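/- **Setting.** Let $\mathcal M$ be a connected smooth 4-manifold with a smooth Lorentzian metric $g$ of signature $(-,+,+,+)$, a volume form $\varepsilon$ of $g$ (an orientation), a smooth real 2-form $H$ and a smooth vector field $T$ such that $\nabla_{[c}H_{ab]}=0$, $\nabla^aH_{ab}=0$, $R_{ab}-\tfrac12Rg_{ab}=2H_{ac}H_b{}^c-\tfrac12g_{ab}H_{cd}H^{cd}$, $\nabla_{(a}T_{b)}=0$, $\mathcal L_TH=0$. The Riemann tensor has the sign for which $R_{abcd}=K(g_{ac}g_{bd}-g_{ad}g_{bc})$ in constant curvature $K$; $C_{abcd}$ is the Weyl tensor. Write $\mathcal X_{ab}=\tfrac12(X_{ab}+\tfrac i2\varepsilon_{abcd}X^{cd})$ for the anti-self-dual part of a real 2-form, $\mathcal H$ and $\mathcal F$ for those of $H$ and of $F_{ab}=\nabla_aT_b-\nabla_bT_a$, $\mathcal C_{abcd}=\tfrac12(C_{abcd}+\tfrac i2\varepsilon_{abef}C^{ef}{}_{cd})$, $\mathcal I_{abcd}=\tfrac14(g_{ac}g_{bd}-g_{ad}g_{bc}+i\varepsilon_{abcd})$, $X\cdot Y=X_{ab}Y^{ab}$,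 $\mathcal H^2=\mathcal H\cdot\mathcal H$, $T^2=g(T,T)$ and $(\mathcal X\tilde\otimes\mathcal Y)_{abcd}=\tfrac12\mathcal X_{ab}\mathcal Y_{cd}+\tfrac12\mathcal Y_{ab}\mathcal X_{cd}-\tfrac13\mathcal I_{abcd}\,\mathcal X\cdot\mathcal Y$. Let $M,q_E,q_B\in\mathbb R$ with $C_1=q_E+iq_B\neq0$, and $C_2=C_3=M/(q_E-iq_B)$ (in the application $M$ is the mass and $q_E,q_B$ are the charges). Let $\Xi,V:\mathcal M\to\mathbb C$ be smooth and $\widehat P:\mathcal M\to\mathbb C$ be a function with $$\nabla_b\Xi=\mathcal H_{ab}T^a,\qquad \nabla_bV=C_1^{-1}\mathcal B_{ab}T^a,\qquad \widehat P^4=-\frac1{C_1^2\mathcal H^2}\ \text{ where }\mathcal H^2\ne0,$$ where $P=\frac1{2\Xi}$ and Wong's tensors are $$C_1^{-1}\mathcal B_{ab}=\mathcal F_{ab}+(2\overline C_3-4\overline\Xi)\mathcal H_{ab},\qquad \mathcal Q_{abcd}=\mathcal C_{abcd}-3\widehat P(\mathcal F\tilde\otimes\mathcal H)_{abcd}.$$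 Assume the normalization at infinity $g(T,T)\to-1$, $\Xi\to0$, $V\to0$ along some proper filter on $\mathcal M$ (for an asymptotically flat end with $T=\partial_t$: $r\to\infty$). Put $$y+iz=C_1P,\qquad U=(y^2+z^2)\nabla^az\nabla_az+z^2,\qquad \kappa=2\overline\Xi-\overline C_3 .$$ **(a)** At every point with $\Xi\neq0$, $\mathcal H^2\ne0$, $\kappa\ne0$ there are real null vectors $\underline l,l$ with $g(\underline l,l)=-1$ and $\mathcal H_{ab}=\frac1{2C_1\widehat P^2}(\underline l_al_b-l_a\underline l_b+i\varepsilon_{abcd}\underline l^cl^d)$, and for every such pair $U$ is differentiable there with $$\nabla_bU=2|C_1P|^2\nabla^az\,\Im E(2)_{ab}+(z\nabla_by-y\nabla_bz)D+E(3)_b+E(4)_b-4z\,\Re(V)\,\nabla_bz ,\qquad(*)$$ where $D=\Im\big((1-\tfrac{P^4}{\widehat P^4})T^2\big)$, $A=\dfrac{C_1P^3\overline P}{\widehat P^2\overline{\widehat P}{}^2}$, $$E(z)_b=\Im\Big[\big(1-\tfrac{P^2}{\widehat P^2}\big)\big((\underline l\cdot T)l_b-(l\cdot T)\underline l_b+i\varepsilon_{abcd}T^a\underline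 l^cl^d\big)\Big],\qquad N_b=(E(z)\cdot\underline l)\,l_b+(E(z)\cdot l)\,\underline l_b,$$ $$E(1)_{ab}=\frac{P^2}{\kappa}T^c\nabla_a\mathcal B_{cb}-\frac{2C_1P^2}{\kappa}\mathcal Q_{dacb}T^cT^d+12C_1P^2(P-\widehat P)(\mathcal H\tilde\otimes\mathcal H)_{dacb}T^cT^d-2C_1P^2\mathcal H_{cb}\Re(C_1^{-1}\mathcal B_a{}^c)-\frac{6P^2\widehat P}{\kappa}(\mathcal B\tilde\otimes\mathcal H)_{dacb}T^cT^d,$$ $$E(2)_{ab}=E(1)_{ab}+\frac{T^2}{C_1}\Big(\frac1P-\frac{P^3}{\widehat P^4}\Big)g_{ab},$$ $$E(3)_b=\Im\Big[\Big(\frac{P^2\overline{\widehat P}{}^2}{\overline P^2\widehat P^2}-1\Big)\frac{AT^2}{\kappa}\nabla_bz+\frac{C_1^2P}{\kappa\overline P}D\,\nabla_bP-\frac{2AT^2}{\kappa}N_b\Big],$$ $$E(4)_b=-\Im\Big[\overline C_1\frac{\overline P}{P}\Big(\frac{P^4}{\widehat P^4}-1\Big)\kappa-C_1\frac{P}{\overline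 P}\Big(\frac{P^2\overline P^2}{\widehat P^2\overline{\widehat P}{}^2}-1\Big)(2\Xi-C_3)\Big]\nabla_bz+\Im\big[2A(2\Xi-C_3)N_b\big].$$ The right-hand side of $(*)$ vanishes at every such point where $\mathcal B=0$, $\nabla\mathcal B=0$, $\mathcal Q=0$, $P=\widehat P$ and $\Re V=0$. **(b)** If $\mathcal B\equiv0$, $\mathcal Q\equiv0$, $\mathcal H^2$ and $\kappa$ have no zeros, $\widehat P$ is smooth and $\frac1{\widehat P}-2\Xi\to0$ at infinity, then $V\equiv0$, $\Xi$ has no zeros, $\widehat P\equiv P$, the right-hand side of $(*)$ is identically zero, and $\nabla U\equiv0$. **(c)** (Kerr–Newman.) Let $q_B=0$, and let a chart with connected range contain a neighbourhood of infinity (an element of the filter) and have coordinates $(t,r,\theta,\phi)$ with $0<\theta<\pi$, $r>M+\sqrt{M^2-\mathfrak a^2-q_E^2}$, where $M>0$, $\mathfrak a^2+q_E^2<M^2$, and with $r\to\infty$ at infinity. If in it $g$ is the Kerr–Newman metric with parameters $(M,\mathfrak a,q_E)$ in Boyer–Lindquist form, $H=d\big(-\tfrac{q_Er}{r^2+\mathfrak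 a^2\cos^2\theta}(dt-\mathfrak a\sin^2\theta\,d\phi)\big)$ and $T=\partial_t$, then $\nabla U$ and the right-hand side of $(*)$ vanish identically in that chart. -/

import Mathlib

open scoped Manifold ContDiff Topology

noncomputable section

/-- The model space of a four dimensional manifold. -/
abbrev E4 : Type := EuclideanSpace ℝ (Fin 4)

/-- The partial derivative `∂_i f` at `u`, for functions of four coordinates. -/
def pd {F : Type*} [NormedAddCommGroup F] [NormedSpace ℝ F]
    (i : Fin 4) (f : E4 → F) (u : E4) : F :=
  fderiv ℝ f u (EuclideanSpace.single i 1)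

/-- The complex conjugate. -/
abbrev cc (z : ℂ) : ℂ := starRingEnd ℂ z

/-! ### Index calculus in one coordinate system -/

/-- The components, in one coordinate system, of a metric `g_ab`, a volume form `ε_abcd`,
a real 2-form `H_ab` and a vector field `T^a`. -/
structure CoordFields where
  g : E4 → Fin 4 → Fin 4 → ℝ
  vol : E4 → Fin 4 → Fin 4 → Fin 4 → Fin 4 → ℝ
  H : E4 → Fin 4 → Fin 4 → ℝ
  T : E4 → Fin 4 → ℝ

namespace CoordFields

/-- The inverse metric `g^ab`. -/
def gu (D : CoordFields) (u : E4) (a b : Fin 4) : ℝ := (Matrix.of (D.g u))⁻¹ a b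

/-- The Christoffel symbols `Γ^c_ab`. -/
def Gamma (D : CoordFields) (u : E4) (c a b : Fin 4) : ℝ :=
  (1 / 2) * ∑ d, D.gu u c d *
    (pd a (fun v => D.g v d b) u + pd b (fun v => D.g v d a) u - pd d (fun v => D.g v a b) u)

/-- The covariant derivative `∇_a X_b` of a 1-form. -/
def covOne (D : CoordFields) (X : E4 → Fin 4 → ℝ) (u : E4) (a b : Fin 4) : ℝ :=
  pd a (fun v => X v b) u - ∑ c, D.Gamma u c a b * X u c

/-- The covariant derivative `∇_c X_ab` of a real or complex tensor of type (0,2). -/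
def covTwo {F : Type*} [NormedAddCommGroup F] [NormedSpace ℝ F]
    (D : CoordFields) (X : E4 → Fin 4 → Fin 4 → F) (u : E4) (c a b : Fin 4) : F :=
  pd c (fun v => X v a b) u
    - ∑ d, D.Gamma u d c a • X u d b - ∑ d, D.Gamma u d c b • X u a d

/-- The Riemann tensor `R_abcd`, with the sign for which `R_abcd = K (g_ac g_bd - g_ad g_bc)`
on a space of constant curvature `K`. -/
def Riem (D : CoordFields) (u : E4) (a b c d : Fin 4) : ℝ :=
  ∑ e, D.g u a e *
    (pd c (fun v => D.Gamma v e d b) u - pd d (fun v => D.Gamma v e c b) u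
      + ∑ f, (D.Gamma u e c f * D.Gamma u f d b - D.Gamma u e d f * D.Gamma u f c b))

/-- The Ricci tensor `R_bd = g^ac R_abcd`. -/
def Ric (D : CoordFields) (u : E4) (b d : Fin 4) : ℝ :=
  ∑ a, ∑ c, D.gu u a c * D.Riem u a b c d

/-- The scalar curvature. -/
def Scal (D : CoordFields) (u : E4) : ℝ := ∑ a, ∑ b, D.gu u a b * D.Ric u a b

/-- The energy-momentum tensor `T_ab = 2 H_ac H_b^c - (1/2) g_ab H_cd H^cd`. -/
def Energy (D : CoordFields) (u : E4) (a b : Fin 4) : ℝ :=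
  2 * ∑ c, ∑ d, D.gu u c d * D.H u a c * D.H u b d
    - (1 / 2) * D.g u a b *
      ∑ c, ∑ d, ∑ e, ∑ f, D.gu u c e * D.gu u d f * D.H u c d * D.H u e f

/-- The 1-form `T_a = g_ab T^b`. -/
def Tlow (D : CoordFields) (u : E4) (a : Fin 4) : ℝ := ∑ b, D.g u a b * D.T u b

/-- `T² = g(T,T)`. -/
def Tsq (D : CoordFields) (u : E4) : ℝ := ∑ a, D.Tlow u a * D.T u a

/-- Einstein's equations, Maxwell's equations, the Killing equation for `T`, and the invariance
of the Maxwell field under `T`, at one point of a coordinate system. -/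
structure FieldEquations (D : CoordFields) (u : E4) : Prop where
  einstein : ∀ a b, D.Ric u a b - (1 / 2) * D.Scal u * D.g u a b = D.Energy u a b
  maxwell_closed : ∀ a b c, D.covTwo D.H u c a b + D.covTwo D.H u a b c + D.covTwo D.H u b c a = 0
  maxwell_div : ∀ b, ∑ c, ∑ a, D.gu u c a * D.covTwo D.H u c a b = 0
  killing : ∀ a b, D.covOne D.Tlow u a b + D.covOne D.Tlow u b a = 0
  lie : ∀ a b, ∑ c, (D.T u c * pd c (fun v => D.H v a b) u
    + D.H u c b * pd a (fun v => D.T v c) u + D.H u a c * pd b (fun v => D.T v c) u) = 0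

/-- The full contraction `X · Y = X_ab Y^ab`. -/
def dot (D : CoordFields) (u : E4) (X Y : Fin 4 → Fin 4 → ℂ) : ℂ :=
  ∑ a, ∑ b, ∑ c, ∑ d, (D.gu u a c : ℂ) * (D.gu u b d : ℂ) * X a b * Y c d

/-- The Hodge dual `*X_ab = (1/2) ε_abcd X^cd`. -/
def hodge (D : CoordFields) (u : E4) (X : Fin 4 → Fin 4 → ℂ) (a b : Fin 4) : ℂ :=
  (1 / 2) * ∑ c, ∑ d, ∑ e, ∑ f,
    (D.vol u a b c d : ℂ) * (D.gu u c e : ℂ) * (D.gu u d f : ℂ) * X e f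

/-- The anti-self-dual form `(1/2) (X + i *X)` of a real 2-form `X`. -/
def asd (D : CoordFields) (X : E4 → Fin 4 → Fin 4 → ℝ) (u : E4) (a b : Fin 4) : ℂ :=
  (1 / 2) * ((X u a b : ℂ) + Complex.I * D.hodge u (fun c d => (X u c d : ℂ)) a b)

/-- The anti-self-dual Maxwell form `𝓗_ab`. -/
def cH (D : CoordFields) (u : E4) (a b : Fin 4) : ℂ := D.asd D.H u a b

/-- `𝓗² = 𝓗_ab 𝓗^ab`. -/
def cHsq (D : CoordFields) (u : E4) : ℂ := D.dot u (D.cH u) (D.cH u)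

/-- The Ernst 2-form `F_ab = ∇_a T_b - ∇_b T_a`. -/
def Ernst (D : CoordFields) (u : E4) (a b : Fin 4) : ℝ :=
  D.covOne D.Tlow u a b - D.covOne D.Tlow u b a

/-- The anti-self-dual Ernst form `𝓕_ab`. -/
def cF (D : CoordFields) (u : E4) (a b : Fin 4) : ℂ := D.asd D.Ernst u a b

/-- `𝓘_abcd = (1/4) (g_ac g_bd - g_ad g_bc + i ε_abcd)`. -/
def cI (D : CoordFields) (u : E4) (a b c d : Fin 4) : ℂ :=
  (1 / 4) * ((D.g u a c * D.g u b d - D.g u a d * D.g u b c : ℝ)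
    + Complex.I * (D.vol u a b c d : ℂ))

/-- The symmetric spinor product of two anti-self-dual 2-forms. -/
def spin (D : CoordFields) (u : E4) (X Y : Fin 4 → Fin 4 → ℂ) (a b c d : Fin 4) : ℂ :=
  (1 / 2) * X a b * Y c d + (1 / 2) * Y a b * X c d - (1 / 3) * D.cI u a b c d * D.dot u X Y

/-- The Kulkarni-Nomizu product. -/
def kulkarni (h k : Fin 4 → Fin 4 → ℝ) (a b c d : Fin 4) : ℝ :=
  h a c * k b d + h b d * k a c - h a d * k b c - h b c * k a d

/-- The Weyl tensor `C_abcd`. -/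
def Weyl (D : CoordFields) (u : E4) (a b c d : Fin 4) : ℝ :=
  D.Riem u a b c d
    - (1 / 2) * kulkarni (D.g u) (fun i j => D.Ric u i j - (1 / 4) * D.Scal u * D.g u i j) a b c d
    - D.Scal u / 24 * kulkarni (D.g u) (D.g u) a b c d

/-- The anti-self-dual Weyl tensor `𝓒_abcd = (1/2) (C_abcd + (i/2) ε_abef C^ef_cd)`. -/
def cC (D : CoordFields) (u : E4) (a b c d : Fin 4) : ℂ :=
  (1 / 2) * ((D.Weyl u a b c d : ℂ)
    + Complex.I * D.hodge u (fun e f => (D.Weyl u e f c d : ℂ)) a b)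

end CoordFields

/-- The constants `M`, `q_E`, `q_B`. -/
structure Consts where
  M : ℝ
  qE : ℝ
  qB : ℝ

/-- `C₁ = q_E + i q_B`. -/
def Consts.C1 (k : Consts) : ℂ := (k.qE : ℂ) + Complex.I * (k.qB : ℂ)

/-- `C₂ = C₃ = M / (q_E - i q_B)`. -/
def Consts.C3 (k : Consts) : ℂ := (k.M : ℂ) / ((k.qE : ℂ) - Complex.I * (k.qB : ℂ))

/-- The fields in one coordinate system, together with the constants, the Maxwell potential `Ξ`,
the potential `V`, and the function `P̂`. -/
structure WongCoord extends CoordFields where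
  k : Consts
  Xi : E4 → ℂ
  V : E4 → ℂ
  Ph : E4 → ℂ

namespace WongCoord

/-- `P = 1 / (2 Ξ)`. -/
def P (D : WongCoord) (u : E4) : ℂ := 1 / (2 * D.Xi u)

/-- `y = Re (C₁ P)`. -/
def y (D : WongCoord) (u : E4) : ℝ := (D.k.C1 * D.P u).re

/-- `z = Im (C₁ P)`. -/
def z (D : WongCoord) (u : E4) : ℝ := (D.k.C1 * D.P u).im

/-- `κ = 2 Ξ̄ - C̄₃`. -/
def kap (D : WongCoord) (u : E4) : ℂ := 2 * cc (D.Xi u) - cc D.k.C3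

/-- Wong's 2-form: `C₁⁻¹ B_ab = 𝓕_ab + (2 C̄₃ - 4 Ξ̄) 𝓗_ab`. -/
def B (D : WongCoord) (u : E4) (a b : Fin 4) : ℂ :=
  D.k.C1 * (D.cF u a b + (2 * cc D.k.C3 - 4 * cc (D.Xi u)) * D.cH u a b)

/-- `∇_c B_ab`. -/
def nablaB (D : WongCoord) (u : E4) (c a b : Fin 4) : ℂ := D.covTwo D.B u c a b

/-- Wong's 4-tensor: `Q_abcd = 𝓒_abcd - 3 P̂ (𝓕 ⊗̃ 𝓗)_abcd`. -/
def Q (D : WongCoord) (u : E4) (a b c d : Fin 4) : ℂ :=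
  D.cC u a b c d - 3 * D.Ph u * D.spin u (D.cF u) (D.cH u) a b c d

/-- `∇^a z`. -/
def zUp (D : WongCoord) (u : E4) (a : Fin 4) : ℝ := ∑ b, D.gu u a b * pd b D.z u

/-- `U = (y² + z²) ∇^a z ∇_a z + z²`. -/
def U (D : WongCoord) (u : E4) : ℝ :=
  (D.y u ^ 2 + D.z u ^ 2) * ∑ a, D.zUp u a * pd a D.z u + D.z u ^ 2

/-- The lowered vector `v_a = g_ab v^b`. -/
def low (D : WongCoord) (u : E4) (v : Fin 4 → ℝ) (a : Fin 4) : ℝ := ∑ b, D.g u a b * v b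

/-- The scalar product `g_ab v^a w^b`. -/
def ip (D : WongCoord) (u : E4) (v w : Fin 4 → ℝ) : ℝ := ∑ a, D.low u v a * w a

/-- `(lb, l)` is the pair of principal null vectors of the Maxwell field, normalized by
`g(lb, l) = -1` and ordered (according to the choice of the square `P̂²`) in such a way that
`𝓗_ab = (lb_a l_b - l_a lb_b + i ε_abcd lb^c l^d) / (2 C₁ P̂²)`. -/
structure IsPrincipalNullPair (D : WongCoord) (u : E4) (lb l : Fin 4 → ℝ) : Prop where
  null_lb : D.ip u lb lb = 0
  null_l : D.ip u l l = 0
  normalized : D.ip u lb l = -1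
  decomposition : ∀ a b, D.cH u a b = 1 / (2 * D.k.C1 * D.Ph u ^ 2) *
    ((D.low u lb a * D.low u l b - D.low u l a * D.low u lb b : ℝ)
      + Complex.I * ∑ c, ∑ d, (D.vol u a b c d * lb c * l d : ℝ))

/-- The error term `E(1)_ab`. -/
def errOne (D : WongCoord) (u : E4) (a b : Fin 4) : ℂ :=
  D.P u ^ 2 / D.kap u * ∑ c, (D.T u c : ℂ) * D.nablaB u a c b
  - 2 * D.k.C1 * D.P u ^ 2 / D.kap u *
      ∑ c, ∑ d, D.Q u d a c b * (D.T u c : ℂ) * (D.T u d : ℂ)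
  + 12 * D.k.C1 * D.P u ^ 2 * (D.P u - D.Ph u) *
      ∑ c, ∑ d, D.spin u (D.cH u) (D.cH u) d a c b * (D.T u c : ℂ) * (D.T u d : ℂ)
  - 2 * D.k.C1 * D.P u ^ 2 *
      ∑ c, D.cH u c b * (((D.k.C1⁻¹ * ∑ e, D.B u a e * (D.gu u e c : ℂ)).re : ℝ) : ℂ)
  - 6 * D.P u ^ 2 * D.Ph u / D.kap u *
      ∑ c, ∑ d, D.spin u (D.B u) (D.cH u) d a c b * (D.T u c : ℂ) * (D.T u d : ℂ)

/-- The error term `E(2)_ab`. -/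
def errTwo (D : WongCoord) (u : E4) (a b : Fin 4) : ℂ :=
  D.errOne u a b
    + (D.Tsq u : ℂ) / D.k.C1 * (1 / D.P u - D.P u ^ 3 / D.Ph u ^ 4) * (D.g u a b : ℂ)

/-- The error term `E_b(z)`. -/
def Ez (D : WongCoord) (u : E4) (lb l : Fin 4 → ℝ) (b : Fin 4) : ℝ :=
  ((1 - D.P u ^ 2 / D.Ph u ^ 2) *
    ((D.ip u lb (D.T u) * D.low u l b - D.ip u l (D.T u) * D.low u lb b : ℝ)
      + Complex.I * ∑ a, ∑ c, ∑ d, (D.vol u a b c d * D.T u a * lb c * l d : ℝ))).im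

/-- `(E(z) · lb) l_b + (E(z) · l) lb_b`. -/
def EzNull (D : WongCoord) (u : E4) (lb l : Fin 4 → ℝ) (b : Fin 4) : ℝ :=
  (∑ a, D.Ez u lb l a * lb a) * D.low u l b + (∑ a, D.Ez u lb l a * l a) * D.low u lb b

/-- `Im ((1 - P⁴ / P̂⁴) T²)`. -/
def ImDefect (D : WongCoord) (u : E4) : ℝ :=
  ((1 - D.P u ^ 4 / D.Ph u ^ 4) * (D.Tsq u : ℂ)).im

/-- The coefficient `C₁ P³ P̄ / (P̂² P̂̄²)`. -/
def coef (D : WongCoord) (u : E4) : ℂ :=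
  D.k.C1 * D.P u ^ 3 * cc (D.P u) / (D.Ph u ^ 2 * cc (D.Ph u) ^ 2)

/-- The error term `E(3)_b`. -/
def errThree (D : WongCoord) (u : E4) (lb l : Fin 4 → ℝ) (b : Fin 4) : ℝ :=
  ((D.P u ^ 2 * cc (D.Ph u) ^ 2 / (cc (D.P u) ^ 2 * D.Ph u ^ 2) - 1) *
      (D.coef u * (D.Tsq u : ℂ) / D.kap u) * ((pd b D.z u : ℝ) : ℂ)
    + D.k.C1 ^ 2 * D.P u / (D.kap u * cc (D.P u)) * (D.ImDefect u : ℂ) * pd b D.P u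
    - 2 * (D.coef u * (D.Tsq u : ℂ) / D.kap u) * (D.EzNull u lb l b : ℂ)).im

/-- The error term `E(4)_b`. -/
def errFour (D : WongCoord) (u : E4) (lb l : Fin 4 → ℝ) (b : Fin 4) : ℝ :=
  - (cc D.k.C1 * (cc (D.P u) / D.P u) * (D.P u ^ 4 / D.Ph u ^ 4 - 1) * D.kap u
      - D.k.C1 * (D.P u / cc (D.P u)) *
        (D.P u ^ 2 * cc (D.P u) ^ 2 / (D.Ph u ^ 2 * cc (D.Ph u) ^ 2) - 1) *
        (2 * D.Xi u - D.k.C3)).im * pd b D.z u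
  + (2 * D.coef u * (2 * D.Xi u - D.k.C3) * (D.EzNull u lb l b : ℂ)).im

/-- The complete algebraic error term. -/
def errorTerm (D : WongCoord) (u : E4) (lb l : Fin 4 → ℝ) (b : Fin 4) : ℝ :=
  2 * ‖D.k.C1 * D.P u‖ ^ 2 * ∑ a, D.zUp u a * (D.errTwo u a b).im
  + (D.z u * pd b D.y u - D.y u * pd b D.z u) * D.ImDefect u
  + D.errThree u lb l b + D.errFour u lb l b
  - 4 * D.z u * (D.V u).re * pd b D.z u

end WongCoord

/-! ### Fields on a manifold -/

section Manifolds

variable {M : Type*} [TopologicalSpace M] [ChartedSpace E4 M]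

/-- The coordinate vector field `∂_i` of a coordinate system `φ`, at the point with
coordinates `u`. -/
def coordFrame (φ : OpenPartialHomeomorph M E4) (u : E4) (i : Fin 4) :
    TangentSpace (𝓡 4) (φ.symm u) :=
  mfderiv (𝓡 4) (𝓡 4) φ.symm u (EuclideanSpace.single i (1 : ℝ) : E4)

/-- The `i`-th component, in the coordinate system `φ`, of a tangent vector at the point with
coordinates `u`. -/
def coordComp (φ : OpenPartialHomeomorph M E4) (u : E4)
    (v : TangentSpace (𝓡 4) (φ.symm u)) (i : Fin 4) : ℝ :=
  let w : E4 := mfderiv (𝓡 4) (𝓡 4) φ (φ.symm u) v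
  w i

/-- A metric, a volume form, a 2-form `H` and a vector field `T` on a 4-manifold (as raw data;
the laws are in `IsStationaryElectrovac`). -/
structure FieldData (M : Type*) [TopologicalSpace M] [ChartedSpace E4 M] where
  metric : ∀ x : M, LinearMap.BilinForm ℝ (TangentSpace (𝓡 4) x)
  vol : ∀ x : M, (TangentSpace (𝓡 4) x) [⋀^Fin 4]→ₗ[ℝ] ℝ
  H : ∀ x : M, LinearMap.BilinForm ℝ (TangentSpace (𝓡 4) x)
  T : ∀ x : M, TangentSpace (𝓡 4) x

/-- The components of the fields in the coordinate system `φ`. -/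
def FieldData.coords (F : FieldData M) (φ : OpenPartialHomeomorph M E4) : CoordFields where
  g u a b := F.metric (φ.symm u) (coordFrame φ u a) (coordFrame φ u b)
  vol u a b c d := F.vol (φ.symm u)
    ![coordFrame φ u a, coordFrame φ u b, coordFrame φ u c, coordFrame φ u d]
  H u a b := F.H (φ.symm u) (coordFrame φ u a) (coordFrame φ u b)
  T u a := coordComp φ u (F.T (φ.symm u)) a

/-- A stationary Einstein-Maxwell space-time: a smooth Lorentzian metric of signature
(-,+,+,+) with its volume form (that is, with an orientation), a smooth Maxwell field `H`, and a
smooth Killing field `T` that preserves `H`, such that the Einstein-Maxwell equations hold. -/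
structure FieldData.IsStationaryElectrovac (F : FieldData M) : Prop where
  metric_symm : ∀ x v w, F.metric x v w = F.metric x w v
  lorentzian : ∀ x, ∃ e : Fin 4 → TangentSpace (𝓡 4) x, ∀ i j,
    F.metric x (e i) (e j) = if i = j then (if i = 0 then -1 else 1) else 0
  vol_sq : ∀ x (v : Fin 4 → TangentSpace (𝓡 4) x),
    F.vol x v ^ 2 = - (Matrix.of fun i j => F.metric x (v i) (v j)).det
  H_alt : ∀ x v w, F.H x v w = - F.H x w v
  metric_smooth : ∀ φ ∈ IsManifold.maximalAtlas (𝓡 4) ∞ M, ∀ a b,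
    ContDiffOn ℝ ∞ (fun u => (F.coords φ).g u a b) φ.target
  vol_smooth : ∀ φ ∈ IsManifold.maximalAtlas (𝓡 4) ∞ M, ∀ a b c d,
    ContDiffOn ℝ ∞ (fun u => (F.coords φ).vol u a b c d) φ.target
  H_smooth : ∀ φ ∈ IsManifold.maximalAtlas (𝓡 4) ∞ M, ∀ a b,
    ContDiffOn ℝ ∞ (fun u => (F.coords φ).H u a b) φ.target
  T_smooth : ∀ φ ∈ IsManifold.maximalAtlas (𝓡 4) ∞ M, ∀ a,
    ContDiffOn ℝ ∞ (fun u => (F.coords φ).T u a) φ.target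
  equations : ∀ φ ∈ IsManifold.maximalAtlas (𝓡 4) ∞ M, ∀ u ∈ φ.target,
    (F.coords φ).FieldEquations u

/-- All fields, constants and functions in the coordinate system `φ`. -/
def FieldData.wong (F : FieldData M) (k : Consts) (Xi V Ph : M → ℂ)
    (φ : OpenPartialHomeomorph M E4) : WongCoord where
  toCoordFields := F.coords φ
  k := k
  Xi := fun u => Xi (φ.symm u)
  V := fun u => V (φ.symm u)
  Ph := fun u => Ph (φ.symm u)

end Manifolds

/-! ### The Kerr-Newman family in Boyer-Lindquist coordinates `(t, r, θ, φ)` -/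

namespace KerrNewman

/-- `Σ = r² + a² cos² θ`. -/
def Sig (a : ℝ) (u : E4) : ℝ := u 1 ^ 2 + a ^ 2 * Real.cos (u 2) ^ 2

/-- `Δ = r² - 2 M r + a² + q²`. -/
def Del (m a q : ℝ) (u : E4) : ℝ := u 1 ^ 2 - 2 * m * u 1 + a ^ 2 + q ^ 2

/-- The Kerr-Newman metric. -/
def metric (m a q : ℝ) (u : E4) : Fin 4 → Fin 4 → ℝ :=
  !![-(Del m a q u - a ^ 2 * Real.sin (u 2) ^ 2) / Sig a u, 0, 0,
      -(a * Real.sin (u 2) ^ 2 * (u 1 ^ 2 + a ^ 2 - Del m a q u)) / Sig a u;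
    0, Sig a u / Del m a q u, 0, 0;
    0, 0, Sig a u, 0;
    -(a * Real.sin (u 2) ^ 2 * (u 1 ^ 2 + a ^ 2 - Del m a q u)) / Sig a u, 0, 0,
      ((u 1 ^ 2 + a ^ 2) ^ 2 - Del m a q u * a ^ 2 * Real.sin (u 2) ^ 2) / Sig a u
        * Real.sin (u 2) ^ 2]

/-- The electromagnetic potential `-(q r / Σ) (dt - a sin² θ dφ)`. -/
def potential (a q : ℝ) (u : E4) : Fin 4 → ℝ :=
  ![-(q * u 1 / Sig a u), 0, 0, q * u 1 / Sig a u * (a * Real.sin (u 2) ^ 2)]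

/-- The coordinate system `φ` is a connected Boyer-Lindquist coordinate system of the exterior
region of the Kerr-Newman black hole with mass `m`, rotation parameter `a` and charge `q`. -/
structure IsChart {M : Type*} [TopologicalSpace M] [ChartedSpace E4 M] (F : FieldData M)
    (φ : OpenPartialHomeomorph M E4) (m a q : ℝ) : Prop where
  connected : IsPreconnected φ.target
  subextremal : 0 < m ∧ q ^ 2 + a ^ 2 < m ^ 2
  exterior : ∀ u ∈ φ.target,
    m + √(m ^ 2 - a ^ 2 - q ^ 2) < u 1 ∧ 0 < u 2 ∧ u 2 < Real.pi
  metric_eq : ∀ u ∈ φ.target, ∀ i j, (F.coords φ).g u i j = metric m a q u i j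
  H_eq : ∀ u ∈ φ.target, ∀ i j, (F.coords φ).H u i j =
    pd i (fun v => potential a q v j) u - pd j (fun v => potential a q v i) u
  T_eq : ∀ u ∈ φ.target, ∀ i, (F.coords φ).T u i = if i = 0 then 1 else 0

end KerrNewman

end

/-!
The proof is a pointwise computation in a chart, followed by a connectedness argument for the
global statements.

*The Hessian of `P`.* A Killing field satisfies `∇_c ∇_a T_b = R_dcab T^d`, so `∇𝓕` is the
anti-self-dual part of a contraction of the curvature with `T` (`covTwo_cF`). The left and the
right Hodge dual of a trace free tensor with the algebraic symmetries of the curvature agree;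
hence the Weyl tensor contributes `2 T^d 𝓒_dacb`, while the Ricci tensor, which equals the energy
tensor of `H`, contributes a term of its own (`covTwo_cF_split`). Since `∇_b Ξ = 𝓗_ab T^a`, the
Hessian of `P = 1 / (2 Ξ)` contains `T^c ∇_a 𝓗_cb`. Writing `∇𝓗` in terms of `∇𝓑` and `∇𝓕`, and
`𝓒` and `𝓕` in terms of `𝓠`, `𝓑` and `𝓗`, one finds that `C₁ ∇_a ∇_b P - E(1)_ab` is algebraic in
the fields (`hessP_sub_errOne`).

*The contraction with `∇z`.* The form `𝓗` is `μ = 1 / (2 C₁ P̂²)` times the bivector of a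
normalized pair of null vectors (`exists_null_pair`), and such a pair extends to an oriented null
frame (`exists_null_frame`). In that frame everything is explicit: the Ricci tensor is `4 |μ|²`
times the reflection in the plane orthogonal to the pair (`frOne_ins_Ric`), and the gradients of
`Ξ`, `P`, `y` and `z` are multiples of the single covector `frW`, or real and imaginary parts of
such multiples. The gradient of `U = |C₁ P|² ∇^a z ∇_a z + z²` involves the Hessian of `z = Im (C₁ P)`
only through `∇^a z ∇_a ∇_b z` (`pd_U`), so the claim becomes a relation of complex numbers
(`gradient_identity`). It needs one more input: the term `2 z ∇_b z` must be expressed by `T²`,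
`V` and `κ`. This is the normalization at infinity. The function `T² + 2 Re V + 4 |Ξ|² - 4 Re (C̄₃ Ξ)`
has vanishing gradient (`pd_normalization`), so on a connected manifold it equals its
limit `-1` (`isNormalizedAt`). Altogether this is `pd_U_eq_errorTerm`, and the error term vanishes
by inspection under the conditions of `errorTerm_eq_zero`.

*Vanishing of Wong's tensors.* If `𝓑` and `𝓠` vanish, then `V` is constant. The contraction of the
formula for `∇𝓕` with `𝓗` reads `∇𝓗² = 8 P̂ 𝓗² ∇Ξ` (`pd_cHsq_of_vanish`), because the Ricci term
cancels against the derivative of the factor `κ` in `𝓕 = 2 κ 𝓗`. Together with `P̂⁴ = -1 / (C₁² 𝓗²)`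
it gives `∇(1 / P̂ - 2 Ξ) = 0` (`pd_inv_Ph_sub`), and the limits at infinity identify the
constants.

*Kerr-Newman.* No curvature is computed. The Maxwell form determines `Ξ` up to a constant, and the
limit at infinity gives `Ξ = q / (2 (r + i σ a cos θ))`, where the sign `σ` is the orientation of
the chart (`KerrNewman.IsChart.Xi_eq`). Then `y + i z = r + i σ a cos θ`, so that `U = a²` is
constant. Moreover `Ξ`, `𝓗²` and `κ` have no zeros in the exterior region, so the error term
equals `∇U`, which is zero.
-/

noncomputable section

/-! ### The permutation symbol and oriented frames -/

/-- The permutation symbol `[abcd]`, with `[0123] = 1`, as a Vandermonde product. -/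
def levi (a b c d : Fin 4) : ℝ :=
  ((b : ℝ) - a) * (c - a) * (d - a) * (c - b) * (d - b) * (d - c) / 12

theorem sum_levi_mul (F : Fin 4 → Fin 4 → Fin 4 → Fin 4 → ℝ) :
    ∑ a, ∑ b, ∑ c, ∑ d, levi a b c d * F a b c d =
      F 0 1 2 3 - F 0 1 3 2 - F 0 2 1 3 + F 0 2 3 1 + F 0 3 1 2 - F 0 3 2 1
      - F 1 0 2 3 + F 1 0 3 2 + F 1 2 0 3 - F 1 2 3 0 - F 1 3 0 2 + F 1 3 2 0
      + F 2 0 1 3 - F 2 0 3 1 - F 2 1 0 3 + F 2 1 3 0 + F 2 3 0 1 - F 2 3 1 0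
      - F 3 0 1 2 + F 3 0 2 1 + F 3 1 0 2 - F 3 1 2 0 - F 3 2 0 1 + F 3 2 1 0 := by
  simp only [Fin.sum_univ_four, levi]
  norm_num
  ring

theorem sum_levi_eq_det (x y z w : Fin 4 → ℝ) :
    ∑ a, ∑ b, ∑ c, ∑ d, levi a b c d * (x a * y b * z c * w d)
      = (Matrix.of ![x, y, z, w]).det := by
  rw [sum_levi_mul]
  simp [Matrix.det_succ_row_zero, Fin.sum_univ_succ, Fin.succAbove]
  ring

theorem det_of_single_eq_levi (i j k l : Fin 4) :
    (Matrix.of ![Pi.single i (1 : ℝ), Pi.single j 1, Pi.single k 1, Pi.single l 1]).det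
      = levi i j k l := by
  rw [← sum_levi_eq_det]
  simp [Pi.single_apply]

theorem det_of_rows_eq_levi_mul_det (n : Fin 4 → Fin 4 → ℝ) (i j k l : Fin 4) :
    (Matrix.of ![n i, n j, n k, n l]).det = levi i j k l * (Matrix.of n).det := by
  rw [← det_of_single_eq_levi, ← Matrix.det_mul]
  congr 1
  ext a b
  fin_cases a <;> simp [Matrix.mul_apply, Pi.single_apply]

/-- The contraction of the permutation symbol with the rows of a matrix. -/
theorem sum_levi_rows (n : Fin 4 → Fin 4 → ℝ) (i j k l : Fin 4) :
    ∑ a, ∑ b, ∑ c, ∑ d, levi a b c d * (n i a * n j b * n k c * n l d)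
      = levi i j k l * (Matrix.of n).det := by
  rw [sum_levi_eq_det, det_of_rows_eq_levi_mul_det]

theorem sum_comm_four {R : Type*} [AddCommMonoid R] (F : Fin 4 → Fin 4 → Fin 4 → Fin 4 → R) :
    ∑ a, ∑ b, ∑ i, ∑ j, F a b i j = ∑ i, ∑ j, ∑ a, ∑ b, F a b i j := by
  calc _ = ∑ a, ∑ i, ∑ b, ∑ j, F a b i j := Finset.sum_congr rfl fun a _ => Finset.sum_comm
    _ = ∑ i, ∑ a, ∑ b, ∑ j, F a b i j := Finset.sum_comm
    _ = ∑ i, ∑ a, ∑ j, ∑ b, F a b i j := Finset.sum_congr rfl fun i _ =>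
        Finset.sum_congr rfl fun a _ => Finset.sum_comm
    _ = _ := Finset.sum_congr rfl fun i _ => Finset.sum_comm

/-- The components of a covector in the frame `n`. -/
def frOne (n : Fin 4 → Fin 4 → ℝ) (X : Fin 4 → ℂ) (i : Fin 4) : ℂ :=
  ∑ a, (n i a : ℂ) * X a

/-- The components of a tensor of type (0,2) in the frame `n`. -/
def frTwo (n : Fin 4 → Fin 4 → ℝ) (X : Fin 4 → Fin 4 → ℂ) (i j : Fin 4) : ℂ :=
  ∑ a, (n i a : ℂ) * ∑ b, (n j b : ℂ) * X a b

namespace CoordFields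

/-- `n` is a frame at `u` in which the metric has the matrix `N`, which is its own inverse, and
in which the volume form is the permutation symbol. -/
structure IsFrame (D : CoordFields) (u : E4) (N : Matrix (Fin 4) (Fin 4) ℝ)
    (n : Fin 4 → Fin 4 → ℝ) : Prop where
  mul_self : N * N = 1
  metric : Matrix.of n * Matrix.of (D.g u) * (Matrix.of n).transpose = N
  vol : ∀ i j k l, ∑ a, ∑ b, ∑ c, ∑ d, D.vol u a b c d * (n i a * n j b * n k c * n l d)
      = levi i j k l

/-- The constant fields with metric `N` and volume form the permutation symbol: in it, the
pointwise operations of index calculus are those on frame components. -/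
def flat (N : Matrix (Fin 4) (Fin 4) ℝ) : CoordFields where
  g _ := N
  vol _ := levi
  H _ _ _ := 0
  T _ _ := 0

theorem flat_gu {N : Matrix (Fin 4) (Fin 4) ℝ} (h : N * N = 1) (u : E4) (a b : Fin 4) :
    (flat N).gu u a b = N a b := by
  have : (Matrix.of N)⁻¹ = N := Matrix.inv_eq_left_inv h
  change (Matrix.of N)⁻¹ a b = _
  rw [this]

namespace IsFrame

variable {D : CoordFields} {u : E4} {N : Matrix (Fin 4) (Fin 4) ℝ} {n : Fin 4 → Fin 4 → ℝ}

theorem isUnit_det (h : D.IsFrame u N n) : IsUnit (Matrix.of n).det := by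
  have h1 := congrArg Matrix.det h.metric
  have h2 := congrArg Matrix.det h.mul_self
  rw [Matrix.det_mul, Matrix.det_mul, Matrix.det_transpose] at h1
  rw [Matrix.det_mul, Matrix.det_one, ← h1] at h2
  refine isUnit_iff_ne_zero.2 fun h0 => ?_
  rw [h0] at h2
  simp at h2

/-- The inverse metric is assembled from the frame vectors: `g⁻¹ = nᵗ N n`. -/
theorem inv_metric (h : D.IsFrame u N n) :
    (Matrix.of (D.g u))⁻¹ = (Matrix.of n).transpose * N * Matrix.of n := by
  apply Matrix.inv_eq_left_inv
  have hu : IsUnit (Matrix.of n).transpose := by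
    rw [Matrix.isUnit_iff_isUnit_det, Matrix.det_transpose]; exact h.isUnit_det
  apply hu.mul_right_cancel
  have := h.metric
  rw [one_mul]
  calc _ = (Matrix.of n).transpose * (N * (Matrix.of n * Matrix.of (D.g u) *
        (Matrix.of n).transpose)) := by simp only [Matrix.mul_assoc]
    _ = _ := by rw [h.metric, h.mul_self, Matrix.mul_one]

theorem metric_mul_inv (h : D.IsFrame u N n) :
    Matrix.of (D.g u) * (Matrix.of (D.g u))⁻¹ = 1 := by
  have h1 : (Matrix.of (D.g u))⁻¹ * Matrix.of (D.g u) = 1 := by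
    rw [h.inv_metric]
    have hu : IsUnit (Matrix.of n).transpose := by
      rw [Matrix.isUnit_iff_isUnit_det, Matrix.det_transpose]; exact h.isUnit_det
    apply hu.mul_right_cancel
    rw [one_mul]
    calc _ = (Matrix.of n).transpose * (N * (Matrix.of n * Matrix.of (D.g u) *
        (Matrix.of n).transpose)) := by simp only [Matrix.mul_assoc]
      _ = _ := by rw [h.metric, h.mul_self, Matrix.mul_one]
  exact mul_eq_one_comm.1 h1

theorem gu_eq (h : D.IsFrame u N n) (a b : Fin 4) :
    D.gu u a b = ∑ i, ∑ j, N i j * n i a * n j b := by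
  rw [gu, h.inv_metric, Matrix.mul_apply]
  simp only [Matrix.mul_apply, Matrix.transpose_apply, Matrix.of_apply, Finset.sum_mul]
  rw [Finset.sum_comm]
  exact Finset.sum_congr rfl fun i _ => Finset.sum_congr rfl fun j _ => by ring

/-- A contraction with the inverse metric is a contraction of frame components with `N`. -/
theorem sum_gu_mul (h : D.IsFrame u N n) (X Y : Fin 4 → ℂ) :
    ∑ a, ∑ b, (D.gu u a b : ℂ) * (X a * Y b)
      = ∑ i, ∑ j, (N i j : ℂ) * (frOne n X i * frOne n Y j) := by
  calc _ = ∑ a, ∑ b, ∑ i, ∑ j, (N i j : ℂ) * ((n i a * X a) * (n j b * Y b)) := by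
        refine Finset.sum_congr rfl fun a _ => Finset.sum_congr rfl fun b _ => ?_
        rw [h.gu_eq]
        push_cast
        simp only [Finset.sum_mul]
        exact Finset.sum_congr rfl fun i _ => Finset.sum_congr rfl fun j _ => by ring
    _ = _ := by
        rw [sum_comm_four]
        refine Finset.sum_congr rfl fun a _ => Finset.sum_congr rfl fun b _ => ?_
        rw [frOne, frOne, Finset.sum_mul_sum, Finset.mul_sum]
        exact Finset.sum_congr rfl fun i _ => by rw [Finset.mul_sum]

/-- A covector is determined by its frame components. -/
theorem frOne_injective (h : D.IsFrame u N n) {X Y : Fin 4 → ℂ}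
    (hXY : ∀ i, frOne n X i = frOne n Y i) (a : Fin 4) : X a = Y a := by
  have h1 : (Matrix.of n).transpose * ((Matrix.of n).transpose)⁻¹ = 1 :=
    Matrix.mul_nonsing_inv _ (by rw [Matrix.det_transpose]; exact h.isUnit_det)
  have key : ∀ Z : Fin 4 → ℂ, Z a = ∑ i, (((Matrix.of n).transpose)⁻¹ i a : ℂ) * frOne n Z i := by
    intro Z
    have h2 : ∀ b, ∑ i, ((n i b : ℂ)) * (((Matrix.of n).transpose)⁻¹ i a : ℂ)
        = if b = a then 1 else 0 := by
      intro b
      have := congrFun (congrFun h1 b) a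
      rw [Matrix.mul_apply, Matrix.one_apply] at this
      have := congrArg (fun x : ℝ => (x : ℂ)) this
      simp only [Matrix.transpose_apply, Matrix.of_apply, Complex.ofReal_sum,
        Complex.ofReal_mul] at this
      rw [this]; split_ifs <;> simp
    simp only [frOne, Finset.mul_sum]
    rw [Finset.sum_comm]
    calc Z a = ∑ b, (if b = a then 1 else 0) * Z b := by simp
      _ = _ := by
        refine Finset.sum_congr rfl fun b _ => ?_
        rw [← h2, Finset.sum_mul]
        exact Finset.sum_congr rfl fun i _ => by ring
  rw [key X, key Y]
  simp only [hXY]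

theorem frTwo_injective (h : D.IsFrame u N n) {X Y : Fin 4 → Fin 4 → ℂ}
    (hXY : ∀ i j, frTwo n X i j = frTwo n Y i j) (a b : Fin 4) : X a b = Y a b := by
  have h1 : ∀ j, frOne n (X a) j = frOne n (Y a) j := fun j =>
    h.frOne_injective (X := fun a => frOne n (X a) j) (Y := fun a => frOne n (Y a) j)
      (fun i => hXY i j) a
  exact h.frOne_injective h1 b

theorem dot_eq (h : D.IsFrame u N n) (X Y : Fin 4 → Fin 4 → ℂ) :
    D.dot u X Y = (flat N).dot u (frTwo n X) (frTwo n Y) := by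
  have h1 : ∀ X Y : Fin 4 → Fin 4 → ℂ, D.dot u X Y = ∑ b, ∑ d, (D.gu u b d : ℂ) *
      ∑ a, ∑ c, (D.gu u a c : ℂ) * (X a b * Y c d) := by
    intro X Y
    rw [dot]
    calc _ = ∑ a, ∑ c, ∑ b, ∑ d, (D.gu u a c : ℂ) * (D.gu u b d : ℂ) * X a b * Y c d :=
          Finset.sum_congr rfl fun a _ => Finset.sum_comm
      _ = _ := by
          rw [sum_comm_four]
          simp only [Finset.mul_sum]
          refine Finset.sum_congr rfl fun a _ => Finset.sum_congr rfl fun b _ =>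
            Finset.sum_congr rfl fun c _ => Finset.sum_congr rfl fun d _ => by ring
  have h2 : ∀ X Y : Fin 4 → Fin 4 → ℂ, (flat N).dot u X Y = ∑ i, ∑ k, ∑ j, ∑ l,
      (N i k : ℂ) * ((N j l : ℂ) * (X i j * Y k l)) := by
    intro X Y
    rw [dot]
    simp only [flat_gu h.mul_self]
    refine Finset.sum_congr rfl fun a _ => ?_
    rw [Finset.sum_comm]
    refine Finset.sum_congr rfl fun b _ =>
            Finset.sum_congr rfl fun c _ => Finset.sum_congr rfl fun d _ => by ring
  rw [h1, h2]
  have h3 : ∀ b d, ∑ a, ∑ c, (D.gu u a c : ℂ) * (X a b * Y c d) = ∑ i, ∑ k, (N i k : ℂ) *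
      (frOne n (fun a => X a b) i * frOne n (fun c => Y c d) k) := fun b d =>
    h.sum_gu_mul (fun a => X a b) (fun c => Y c d)
  simp only [h3, Finset.mul_sum]
  rw [sum_comm_four]
  refine Finset.sum_congr rfl fun i _ => Finset.sum_congr rfl fun k _ => ?_
  have h4 : ∀ (Z : Fin 4 → Fin 4 → ℂ) (i j : Fin 4),
      frTwo n Z i j = frOne n (fun b => frOne n (fun a => Z a b) i) j := by
    intro Z i j
    simp only [frTwo, frOne, Finset.mul_sum]
    rw [Finset.sum_comm]
    refine Finset.sum_congr rfl fun i _ => Finset.sum_congr rfl fun k _ => by ring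
  simp only [← Finset.mul_sum, h4]
  rw [← h.sum_gu_mul, Finset.mul_sum]
  refine Finset.sum_congr rfl fun b _ => ?_
  rw [Finset.mul_sum]
  exact Finset.sum_congr rfl fun d _ => by ring

theorem hodge_eq_dot (D : CoordFields) (u : E4) (X : Fin 4 → Fin 4 → ℂ) (a b : Fin 4) :
    D.hodge u X a b = (1 / 2) * D.dot u (fun c d => (D.vol u a b c d : ℂ)) X := by
  rw [hodge, dot]
  refine congrArg _ (Finset.sum_congr rfl fun _ _ => Finset.sum_congr rfl fun _ _ =>
    Finset.sum_congr rfl fun _ _ => Finset.sum_congr rfl fun _ _ => by ring)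

theorem frTwo_dot (D : CoordFields) (u : E4) (V : Fin 4 → Fin 4 → Fin 4 → Fin 4 → ℂ)
    (X : Fin 4 → Fin 4 → ℂ) (i j : Fin 4) :
    frTwo n (fun a b => D.dot u (V a b) X) i j
      = D.dot u (fun c d => frTwo n (fun a b => V a b c d) i j) X := by
  simp only [frTwo, dot, Finset.mul_sum, Finset.sum_mul]
  rw [sum_comm_four]
  refine Finset.sum_congr rfl fun a _ => Finset.sum_congr rfl fun b _ => ?_
  rw [sum_comm_four]
  refine Finset.sum_congr rfl fun c _ => Finset.sum_congr rfl fun d _ =>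
    Finset.sum_congr rfl fun e _ => Finset.sum_congr rfl fun f _ => by ring

theorem frTwo_vol (h : D.IsFrame u N n) (i j k l : Fin 4) :
    frTwo n (fun c d => frTwo n (fun a b => (D.vol u a b c d : ℂ)) i j) k l
      = (levi i j k l : ℂ) := by
  rw [← h.vol i j k l]
  push_cast
  simp only [frTwo, Finset.mul_sum]
  rw [sum_comm_four]
  refine Finset.sum_congr rfl fun c _ => Finset.sum_congr rfl fun d _ =>
    Finset.sum_congr rfl fun e _ => Finset.sum_congr rfl fun f _ => by ring

theorem frTwo_hodge (h : D.IsFrame u N n) (X : Fin 4 → Fin 4 → ℂ) (i j : Fin 4) :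
    frTwo n (D.hodge u X) i j = (flat N).hodge u (frTwo n X) i j := by
  have h1 : D.hodge u X
      = fun a b => D.dot u (fun c d => (1 / 2) * (D.vol u a b c d : ℂ)) X := by
    funext a b
    rw [hodge_eq_dot, dot, dot]
    simp only [Finset.mul_sum]
    refine Finset.sum_congr rfl fun c _ => Finset.sum_congr rfl fun d _ =>
      Finset.sum_congr rfl fun e _ => Finset.sum_congr rfl fun f _ => by ring
  rw [h1, frTwo_dot, h.dot_eq, hodge_eq_dot, dot, dot]
  have h2 : ∀ k l, frTwo n (fun c d => frTwo n (fun a b => (1 / 2) * (D.vol u a b c d : ℂ)) i j)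
      k l = (1 / 2) * (levi i j k l : ℂ) := by
    intro k l
    rw [← h.frTwo_vol]
    simp only [frTwo, Finset.mul_sum]
    refine Finset.sum_congr rfl fun c _ => Finset.sum_congr rfl fun d _ =>
      Finset.sum_congr rfl fun e _ => Finset.sum_congr rfl fun f _ => by ring
  simp only [h2, Finset.mul_sum]
  refine Finset.sum_congr rfl fun c _ => Finset.sum_congr rfl fun d _ =>
    Finset.sum_congr rfl fun e _ => Finset.sum_congr rfl fun f _ => ?_
  change _ = 1 / 2 * (_ * _ * (levi i j c d : ℂ) * _)
  ring

end IsFrame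
end CoordFields

/-! ### Hodge duality in a null frame -/

/-- The Minkowski metric in a null frame `(lb, l, e₂, e₃)` with `g(lb, l) = -1`. -/
def nullN : Matrix (Fin 4) (Fin 4) ℝ := !![0, -1, 0, 0; -1, 0, 0, 0; 0, 0, 1, 0; 0, 0, 0, 1]

theorem nullN_mul_self : nullN * nullN = 1 := by
  ext i j
  fin_cases i <;> fin_cases j <;> simp [nullN, Matrix.mul_apply, Fin.sum_univ_four]

namespace CoordFields

/-- The complex linear projection `(1/2) (X + i *X)` to anti-self-dual 2-forms. -/
def asdC (D : CoordFields) (u : E4) (X : Fin 4 → Fin 4 → ℂ) (a b : Fin 4) : ℂ :=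
  (1 / 2) * (X a b + Complex.I * D.hodge u X a b)

/-- The contraction `v^a X_ab` of a covector with the first index of a tensor. -/
def ins (D : CoordFields) (u : E4) (v : Fin 4 → ℂ) (X : Fin 4 → Fin 4 → ℂ) (b : Fin 4) : ℂ :=
  ∑ c, ∑ a, (D.gu u c a : ℂ) * (v c * X a b)

/-- The scalar product of two covectors. -/
def dotOne (D : CoordFields) (u : E4) (v w : Fin 4 → ℂ) : ℂ :=
  ∑ c, ∑ a, (D.gu u c a : ℂ) * (v c * w a)

/-- The exterior product of two covectors. -/
def wedge (v w : Fin 4 → ℂ) (a b : Fin 4) : ℂ := v a * w b - v b * w a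

theorem flat_ins_null (u : E4) (v : Fin 4 → ℂ) (X : Fin 4 → Fin 4 → ℂ) (b : Fin 4) :
    (flat nullN).ins u v X b = -(v 0 * X 1 b) - v 1 * X 0 b + v 2 * X 2 b + v 3 * X 3 b := by
  simp only [ins, flat_gu nullN_mul_self, Fin.sum_univ_four]
  simp [nullN]
  ring

theorem flat_dotOne_null (u : E4) (v w : Fin 4 → ℂ) :
    (flat nullN).dotOne u v w = -(v 0 * w 1) - v 1 * w 0 + v 2 * w 2 + v 3 * w 3 := by
  simp only [dotOne, flat_gu nullN_mul_self, Fin.sum_univ_four]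
  simp [nullN]
  ring

/-- The Hodge dual in a null frame `(lb, l, e₂, e₃)`, component by component. -/
theorem flat_hodge_null (u : E4) (X : Fin 4 → Fin 4 → ℂ) (hX : ∀ a b, X a b = - X b a)
    (a b : Fin 4) : (flat nullN).hodge u X a b =
      (!![0, X 2 3, X 0 3, -X 0 2; -X 2 3, 0, -X 1 3, X 1 2;
        -X 0 3, X 1 3, 0, -X 0 1; X 0 2, -X 1 2, X 0 1, 0] : Matrix (Fin 4) (Fin 4) ℂ) a b := by
  have e1 : ∀ e, X 1 0 = - X 0 1 ∧ X 2 0 = - X 0 2 ∧ X 3 0 = - X 0 3 ∧ X 2 1 = - X 1 2 ∧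
    X 3 1 = -X 1 3 ∧ X 3 2 = - X 2 3 ∧ X e e = 0 := fun e => ⟨hX _ _, hX _ _, hX _ _, hX _ _,
      hX _ _, hX _ _, self_eq_neg.1 (hX e e)⟩
  obtain ⟨h1, h2, h3, h4, h5, h6, -⟩ := e1 0
  have h7 := fun e => (e1 e).2.2.2.2.2.2
  simp only [hodge, flat_gu nullN_mul_self, Fin.sum_univ_four]
  fin_cases a <;> fin_cases b <;> simp [nullN, flat, levi, h1, h2, h3, h4, h5, h6, h7] <;>
    norm_num <;> ring

/-- The full contraction of two 2-forms in a null frame. -/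
theorem flat_dot_null (u : E4) (X Y : Fin 4 → Fin 4 → ℂ) (hX : ∀ a b, X a b = - X b a)
    (hY : ∀ a b, Y a b = - Y b a) : (flat nullN).dot u X Y =
      2 * (-(X 0 1 * Y 0 1) + X 2 3 * Y 2 3 - X 0 2 * Y 1 2 - X 0 3 * Y 1 3
        - X 1 2 * Y 0 2 - X 1 3 * Y 0 3) := by
  simp only [dot, flat_gu nullN_mul_self, Fin.sum_univ_four]
  simp [nullN]
  have h7 := fun e => (self_eq_neg.1 (hX e e))
  rw [hX 1 0, hX 2 0, hX 3 0, hX 2 1, hX 3 1, hX 3 2, hY 1 0, hY 2 0, hY 3 0, hY 2 1, hY 3 1,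
    hY 3 2]
  simp only [h7]
  ring

/-- Two 2-forms agree if their six independent components do. -/
theorem antisymm_ext {X Y : Fin 4 → Fin 4 → ℂ} (hX : ∀ a b, X a b = - X b a)
    (hY : ∀ a b, Y a b = - Y b a) (h01 : X 0 1 = Y 0 1) (h02 : X 0 2 = Y 0 2)
    (h03 : X 0 3 = Y 0 3) (h12 : X 1 2 = Y 1 2) (h13 : X 1 3 = Y 1 3) (h23 : X 2 3 = Y 2 3)
    (a b : Fin 4) : X a b = Y a b := by
  have h0 : ∀ a, X a a = Y a a := fun a => by
    rw [self_eq_neg.1 (hX a a), self_eq_neg.1 (hY a a)]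
  have e1 : ∀ a b, X a b = Y a b → X b a = Y b a := fun a b h => by
    rw [hX, hY b a, h]
  fin_cases a <;> fin_cases b <;> first | exact h0 _ | assumption | (apply e1; assumption)

theorem levi_swap (a b c d : Fin 4) : levi a b c d = - levi b a c d := by
  simp only [levi]; ring

theorem flat_hodge_antisymm {N : Matrix (Fin 4) (Fin 4) ℝ} (u : E4) (X : Fin 4 → Fin 4 → ℂ)
    (a b : Fin 4) : (flat N).hodge u X a b = - (flat N).hodge u X b a := by
  simp only [hodge, Finset.mul_sum, ← Finset.sum_neg_distrib]
  refine Finset.sum_congr rfl fun c _ => Finset.sum_congr rfl fun d _ =>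
    Finset.sum_congr rfl fun _ _ => Finset.sum_congr rfl fun _ _ => ?_
  change 1 / 2 * ((levi a b c d : ℂ) * _ * _ * _) = -(1 / 2 * ((levi b a c d : ℂ) * _ * _ * _))
  rw [levi_swap]; push_cast; ring

/-- In a null frame, the left and the right Hodge dual of a trace free tensor with the symmetries
of the curvature agree. -/
theorem flat_hodge_left_eq_right (u : E4) (W : Fin 4 → Fin 4 → Fin 4 → Fin 4 → ℝ)
    (h1 : ∀ a b c d, W a b c d = - W b a c d) (h2 : ∀ a b c d, W a b c d = W c d a b)
    (h3 : ∀ a b c d, W a b c d + W a c d b + W a d b c = 0)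
    (h4 : ∀ b d, -W 0 b 1 d - W 1 b 0 d + W 2 b 2 d + W 3 b 3 d = 0) (a b c d : Fin 4) :
    (flat nullN).hodge u (fun e f => (W e f c d : ℂ)) a b
      = (flat nullN).hodge u (fun e f => (W a b e f : ℂ)) c d := by
  have h1' : ∀ a b c d, W a b c d = - W a b d c := fun a b c d => by
    rw [h2, h1, h2]
  have hl : ∀ c d a b, (flat nullN).hodge u (fun e f => (W e f c d : ℂ)) a b = _ := fun c d =>
    flat_hodge_null u (fun e f => (W e f c d : ℂ)) (fun e f => by rw [h1]; push_cast; rfl)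
  have hr : ∀ a b c d, (flat nullN).hodge u (fun e f => (W a b e f : ℂ)) c d = _ := fun a b =>
    flat_hodge_null u (fun e f => (W a b e f : ℂ)) (fun e f => by rw [h1']; push_cast; rfl)
  have z1 : ∀ a c d, W a a c d = 0 := fun a c d => self_eq_neg.1 (h1 a a c d)
  have z2 : ∀ a c d, W c d a a = 0 := fun a c d => by rw [h2]; exact z1 a c d
  have A : ∀ c d, W 1 0 c d = - W 0 1 c d ∧ W 2 0 c d = - W 0 2 c d ∧ W 3 0 c d = - W 0 3 c d ∧
    W 2 1 c d = - W 1 2 c d ∧ W 3 1 c d = -W 1 3 c d ∧ W 3 2 c d = - W 2 3 c d := fun c d =>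
    ⟨h1 _ _ _ _, h1 _ _ _ _, h1 _ _ _ _, h1 _ _ _ _, h1 _ _ _ _, h1 _ _ _ _⟩
  have A' : ∀ c d, W c d 1 0 = - W c d 0 1 ∧ W c d 2 0 = - W c d 0 2 ∧ W c d 3 0 = - W c d 0 3 ∧
    W c d 2 1 = - W c d 1 2 ∧ W c d 3 1 = -W c d 1 3 ∧ W c d 3 2 = - W c d 2 3 := fun c d =>
    ⟨h1' _ _ _ _, h1' _ _ _ _, h1' _ _ _ _, h1' _ _ _ _, h1' _ _ _ _, h1' _ _ _ _⟩
  have P1 := h2 0 2 0 1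
  have P2 := h2 0 3 0 1
  have P3 := h2 1 2 0 1
  have P4 := h2 1 3 0 1
  have P5 := h2 2 3 0 1
  have P6 := h2 0 3 0 2
  have P7 := h2 1 2 0 2
  have P8 := h2 1 3 0 2
  have P9 := h2 2 3 0 2
  have P10 := h2 1 2 0 3
  have P11 := h2 1 3 0 3
  have P12 := h2 2 3 0 3
  have P13 := h2 1 3 1 2
  have P14 := h2 2 3 1 2
  have P15 := h2 2 3 1 3
  have B1 := h3 0 1 2 3
  have T00 := h4 0 0
  have T01 := h4 0 1
  have T02 := h4 0 2
  have T03 := h4 0 3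
  have T11 := h4 1 1
  have T12 := h4 1 2
  have T13 := h4 1 3
  have T22 := h4 2 2
  have T23 := h4 2 3
  have T33 := h4 3 3
  simp only [A, A', z1, z2] at B1 T00 T01 T02 T03 T11 T12 T13 T22 T23 T33
  have key : ∀ a b, (a, b) ∈ [((0 : Fin 4), (1 : Fin 4)), (0, 2), (0, 3), (1, 2), (1, 3), (2, 3)] →
      ∀ c d, (flat nullN).hodge u (fun e f => (W e f c d : ℂ)) a b
        = (flat nullN).hodge u (fun e f => (W a b e f : ℂ)) c d := by
    intro a b hab
    apply antisymm_ext
    · intro c d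
      simp only [hodge, Finset.mul_sum, ← Finset.sum_neg_distrib]
      refine Finset.sum_congr rfl fun _ _ => Finset.sum_congr rfl fun _ _ =>
        Finset.sum_congr rfl fun _ _ => Finset.sum_congr rfl fun _ _ => ?_
      rw [h1' _ _ c d]; push_cast; ring
    · exact flat_hodge_antisymm u _
    all_goals
      fin_cases hab <;> rw [hl, hr] <;> simp <;> norm_cast <;> linarith
  refine antisymm_ext (X := fun a b => (flat nullN).hodge u (fun e f => (W e f c d : ℂ)) a b)
    (Y := fun a b => (flat nullN).hodge u (fun e f => (W a b e f : ℂ)) c d)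
    (flat_hodge_antisymm u _) ?_ (key _ _ (by simp) _ _) (key _ _ (by simp) _ _)
    (key _ _ (by simp) _ _) (key _ _ (by simp) _ _) (key _ _ (by simp) _ _)
    (key _ _ (by simp) _ _) a b
  intro c d
  simp only [hodge, Finset.mul_sum, ← Finset.sum_neg_distrib]
  refine Finset.sum_congr rfl fun _ _ => Finset.sum_congr rfl fun _ _ =>
    Finset.sum_congr rfl fun _ _ => Finset.sum_congr rfl fun _ _ => ?_
  rw [h1 c d]; push_cast; ring

end CoordFields

/-! ### The bivector of a null pair -/

namespace CoordFields

/-- Frame components of the 2-form `lb_a l_b - l_a lb_b + i ε_abcd lb^c l^d`. -/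
def bivec : Fin 4 → Fin 4 → ℂ :=
  ![![0, -1, 0, 0], ![1, 0, 0, 0], ![0, 0, 0, Complex.I], ![0, 0, -Complex.I, 0]]

/-- The reflection in the plane orthogonal to `lb` and `l`, in frame components. -/
def reflect (v : Fin 4 → ℂ) : Fin 4 → ℂ := ![-v 0, -v 1, v 2, v 3]

/-- Frame components of `(lb · T) l_b - (l · T) lb_b + i ε_abcd T^a lb^c l^d`, where `τ` are the
frame components of `T_b`. -/
def frW (τ : Fin 4 → ℝ) : Fin 4 → ℂ := ![-τ 0, τ 1, -Complex.I * τ 3, Complex.I * τ 2]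

theorem flat_ins_bivec (u : E4) (τ : Fin 4 → ℝ) (b : Fin 4) :
    (flat nullN).ins u (fun i => (τ i : ℂ)) bivec b = frW τ b := by
  rw [flat_ins_null]
  fin_cases b <;> simp [bivec, frW] <;> ring

/-- As an endomorphism, the bivector of a null pair squares to the identity. -/
theorem flat_ins_bivec_bivec (u : E4) (v : Fin 4 → ℂ) (b : Fin 4) :
    (flat nullN).ins u ((flat nullN).ins u v bivec) bivec b = v b := by
  rw [flat_ins_null, flat_ins_null, flat_ins_null, flat_ins_null, flat_ins_null]
  fin_cases b <;> simp [bivec] <;> ring_nf <;> simp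

/-- The bivector of a null pair commutes with its conjugate, and the product is the real reflection
which is `1` on the plane of the pair and `-1` on the orthogonal plane. -/
theorem flat_ins_conj_bivec_bivec (u : E4) (v : Fin 4 → ℂ) (b : Fin 4) :
    (flat nullN).ins u ((flat nullN).ins u v (fun i j => cc (bivec i j))) bivec b
      = - reflect v b := by
  rw [flat_ins_null, flat_ins_null, flat_ins_null, flat_ins_null, flat_ins_null]
  fin_cases b <;> simp [bivec, reflect] <;> ring_nf <;> simp

theorem wedge_antisymm (v w : Fin 4 → ℂ) (a b : Fin 4) : wedge v w a b = - wedge v w b a := by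
  simp only [wedge]; ring

/-- The terms with the factor `1 / κ` in the gradient identity, in a null frame. -/
theorem flat_curvature_terms (u : E4) (τ : Fin 4 → ℝ) (q : ℂ) (z : Fin 4 → ℝ)
    (hz : ∀ i, z i = -(q * frW τ i).im) (n : Fin 4 → ℂ)
    (hn : ∀ i, n i = (![-((1 - q) * frW τ 0).im, -((1 - q) * frW τ 1).im, 0, 0] :
      Fin 4 → ℝ) i) (tsq : ℝ) (ht : tsq = -2 * τ 0 * τ 1 + τ 2 ^ 2 + τ 3 ^ 2) (b : Fin 4) :
    2 * q * cc q * ((flat nullN).dotOne u (fun i => (z i : ℂ)) (fun i => cc (frW τ i)) * frW τ b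
      - (flat nullN).ins u (fun i => (τ i : ℂ)) ((flat nullN).asdC u fun i j =>
          wedge (fun i => (τ i : ℂ)) (reflect fun i => (z i : ℂ)) i j
          + wedge (reflect fun i => (τ i : ℂ)) (fun i => (z i : ℂ)) i j) b)
      = q * (q - cc q) * tsq * z b + ((q ^ 2).im : ℂ) * tsq * q * frW τ b
        - 2 * q * cc q * tsq * n b := by
  obtain ⟨x, y⟩ := q
  have hd := flat_hodge_null u (fun i j =>
          wedge (fun i => (τ i : ℂ)) (reflect fun i => (z i : ℂ)) i j
          + wedge (reflect fun i => (τ i : ℂ)) (fun i => (z i : ℂ)) i j) (fun a b => by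
            rw [wedge_antisymm, wedge_antisymm _ _ b a, wedge_antisymm _ _ b a]; ring)
  simp only [asdC, flat_ins_null, flat_dotOne_null, hd]
  rw [hn, ht]
  have z0 : z 0 = y * τ 0 := by rw [hz]; simp [frW]
  have z1 : z 1 = -(y * τ 1) := by rw [hz]; simp [frW]
  have z2 : z 2 = x * τ 3 := by rw [hz]; simp [frW]
  have z3 : z 3 = -(x * τ 2) := by rw [hz]; simp [frW]
  fin_cases b <;> simp [wedge, reflect, frW, z0, z1, z2, z3] <;>
    apply Complex.ext <;> simp [pow_two] <;> ring

end CoordFields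

/-! ### Lorentzian frames and principal null vectors -/

/-- The Minkowski metric in an orthonormal frame. -/
def minkN : Matrix (Fin 4) (Fin 4) ℝ := !![-1, 0, 0, 0; 0, 1, 0, 0; 0, 0, 1, 0; 0, 0, 0, 1]

theorem minkN_mul_self : minkN * minkN = 1 := by
  ext i j
  fin_cases i <;> fin_cases j <;> simp [minkN, Matrix.mul_apply, Fin.sum_univ_four]

namespace CoordFields

/-- At `u` the components `g` are those of a Lorentzian metric, and `vol` is a volume form of
it. -/
structure IsLorentzAt (D : CoordFields) (u : E4) : Prop where
  symm : ∀ a b, D.g u a b = D.g u b a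
  frame : ∃ e : Fin 4 → Fin 4 → ℝ, Matrix.of e * Matrix.of (D.g u) * (Matrix.of e).transpose = minkN
  vol : ∃ f : ℝ, (∀ a b c d, D.vol u a b c d = f * levi a b c d) ∧
    f ^ 2 = - (Matrix.of (D.g u)).det

variable {D : CoordFields} {u : E4}

/-- The scalar product of two vectors, as a matrix expression. -/
def gip (D : CoordFields) (u : E4) (v w : Fin 4 → ℝ) : ℝ := v ⬝ᵥ (Matrix.of (D.g u)).mulVec w

theorem gip_eq_sum (v w : Fin 4 → ℝ) :
    D.gip u v w = ∑ a, ∑ b, D.g u a b * v a * w b := by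
  simp only [gip, dotProduct, Matrix.mulVec, Finset.mul_sum, Matrix.of_apply]
  refine Finset.sum_congr rfl fun _ _ => Finset.sum_congr rfl fun _ _ => by ring

theorem IsLorentzAt.gip_comm (h : D.IsLorentzAt u) (v w : Fin 4 → ℝ) :
    D.gip u v w = D.gip u w v := by
  rw [gip_eq_sum, gip_eq_sum, Finset.sum_comm]
  refine Finset.sum_congr rfl fun _ _ => Finset.sum_congr rfl fun _ _ => by rw [h.symm]; ring

theorem frame_matrix_apply (n : Fin 4 → Fin 4 → ℝ) (i j : Fin 4) :
    (Matrix.of n * Matrix.of (D.g u) * (Matrix.of n).transpose) i j = D.gip u (n i) (n j) := by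
  rw [Matrix.mul_assoc, Matrix.mul_apply]
  simp only [gip, dotProduct, Matrix.mulVec, Matrix.mul_apply, Matrix.of_apply,
    Matrix.transpose_apply]

theorem gip_neg_left (v w : Fin 4 → ℝ) : D.gip u (-v) w = - D.gip u v w := by
  simp [gip]
theorem gip_neg_right (v w : Fin 4 → ℝ) : D.gip u v (-w) = - D.gip u v w := by
  simp [gip, Matrix.mulVec_neg]
theorem gip_add_left (v w x : Fin 4 → ℝ) : D.gip u (v + w) x = D.gip u v x + D.gip u w x := by
  simp [gip]
theorem gip_add_right (v w x : Fin 4 → ℝ) : D.gip u x (v + w) = D.gip u x v + D.gip u x w := by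
  simp [gip, Matrix.mulVec_add]
theorem gip_smul_left (r : ℝ) (v w : Fin 4 → ℝ) : D.gip u (r • v) w = r * D.gip u v w := by
  simp [gip]
theorem gip_smul_right (r : ℝ) (v w : Fin 4 → ℝ) : D.gip u v (r • w) = r * D.gip u v w := by
  simp [gip, Matrix.mulVec_smul]

/-- A frame with the metric matrix `N` becomes oriented after a change of sign of its last
vector. -/
theorem IsLorentzAt.exists_isFrame (h : D.IsLorentzAt u) {N : Matrix (Fin 4) (Fin 4) ℝ}
    (hN : N * N = 1) (hdet : N.det = -1) (hN3 : ∀ i, i ≠ 3 → N i 3 = 0 ∧ N 3 i = 0)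
    (n : Fin 4 → Fin 4 → ℝ) (hn : ∀ i j, D.gip u (n i) (n j) = N i j) :
    D.IsFrame u N n ∨ D.IsFrame u N ![n 0, n 1, n 2, -n 3] := by
  obtain ⟨f, hf, hf2⟩ := h.vol
  have hvol : ∀ (n : Fin 4 → Fin 4 → ℝ) i j k l,
      ∑ a, ∑ b, ∑ c, ∑ d, D.vol u a b c d * (n i a * n j b * n k c * n l d)
        = f * (Matrix.of n).det * levi i j k l := by
    intro n i j k l
    rw [mul_assoc, mul_comm (Matrix.det _), ← sum_levi_rows]
    simp only [hf, Finset.mul_sum]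
    refine Finset.sum_congr rfl fun _ _ => Finset.sum_congr rfl fun _ _ =>
      Finset.sum_congr rfl fun _ _ => Finset.sum_congr rfl fun _ _ => by ring
  have hmat : Matrix.of n * Matrix.of (D.g u) * (Matrix.of n).transpose = N := by
    ext i j; rw [frame_matrix_apply, hn]
  have hsq : (f * (Matrix.of n).det) ^ 2 = 1 := by
    have := congrArg Matrix.det hmat
    rw [Matrix.det_mul, Matrix.det_mul, Matrix.det_transpose, hdet] at this
    rw [mul_pow, hf2]
    linear_combination -this
  have hd : (Matrix.of ![n 0, n 1, n 2, -n 3]).det = - (Matrix.of n).det := by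
    simp [Matrix.det_succ_row_zero, Fin.sum_univ_succ, Fin.succAbove]
    ring
  rw [pow_two] at hsq
  rcases mul_self_eq_one_iff.1 hsq with h1 | h1
  · left
    exact ⟨hN, hmat, fun i j k l => by rw [hvol, h1, one_mul]⟩
  · right
    refine ⟨hN, ?_, fun i j k l => ?_⟩
    · ext i j
      rw [frame_matrix_apply]
      have a0 := hN3 0 (by decide)
      have a1 := hN3 1 (by decide)
      have a2 := hN3 2 (by decide)
      fin_cases i <;> fin_cases j <;>
        simp [gip_neg_left, gip_neg_right, hn, a0, a1, a2]
    · rw [hvol, hd, mul_neg, h1, neg_neg, one_mul]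

theorem IsLorentzAt.exists_minkowski_frame (h : D.IsLorentzAt u) : ∃ e, D.IsFrame u minkN e := by
  obtain ⟨e, he⟩ := h.frame
  rcases h.exists_isFrame minkN_mul_self (by simp [minkN, Matrix.det_succ_row_zero,
    Fin.sum_univ_succ, Fin.succAbove]) (by
      intro i hi
      fin_cases i <;> simp [minkN] at hi ⊢) e (fun i j => by
        rw [← frame_matrix_apply, he]) with h1 | h1
  exacts [⟨_, h1⟩, ⟨_, h1⟩]

/-- A non-zero vector orthogonal to a timelike vector is spacelike, in Minkowski space. This is the
Cauchy-Schwarz inequality for the spatial parts. -/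
theorem mink_spacelike {t v : Fin 4 → ℝ} (ht : -t 0 ^ 2 + t 1 ^ 2 + t 2 ^ 2 + t 3 ^ 2 < 0)
    (htv : -t 0 * v 0 + t 1 * v 1 + t 2 * v 2 + t 3 * v 3 = 0) (hv : v ≠ 0) :
    0 < -v 0 ^ 2 + v 1 ^ 2 + v 2 ^ 2 + v 3 ^ 2 := by
  have ht0 : 0 < t 0 ^ 2 := by nlinarith [sq_nonneg (t 1), sq_nonneg (t 2), sq_nonneg (t 3)]
  have hV : 0 < v 1 ^ 2 + v 2 ^ 2 + v 3 ^ 2 := by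
    by_contra hcon
    have h1 : v 1 = 0 := by nlinarith [sq_nonneg (v 1), sq_nonneg (v 2), sq_nonneg (v 3)]
    have h2 : v 2 = 0 := by nlinarith [sq_nonneg (v 1), sq_nonneg (v 2), sq_nonneg (v 3)]
    have h3 : v 3 = 0 := by nlinarith [sq_nonneg (v 1), sq_nonneg (v 2), sq_nonneg (v 3)]
    rw [h1, h2, h3] at htv
    have h0 : v 0 = 0 := by
      have : t 0 * v 0 = 0 := by linarith
      rcases mul_eq_zero.1 this with h | h
      · rw [h] at ht0; norm_num at ht0
      · exact h
    apply hv
    ext i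
    fin_cases i <;> simp [h0, h1, h2, h3]
  have hcs : (t 0 * v 0) ^ 2 ≤ (t 1 ^ 2 + t 2 ^ 2 + t 3 ^ 2) * (v 1 ^ 2 + v 2 ^ 2 + v 3 ^ 2) := by
    have : t 0 * v 0 = t 1 * v 1 + t 2 * v 2 + t 3 * v 3 := by linarith
    rw [this]
    nlinarith [sq_nonneg (t 1 * v 2 - t 2 * v 1), sq_nonneg (t 1 * v 3 - t 3 * v 1),
      sq_nonneg (t 2 * v 3 - t 3 * v 2)]
  have h5 : t 0 ^ 2 * v 0 ^ 2 < t 0 ^ 2 * (v 1 ^ 2 + v 2 ^ 2 + v 3 ^ 2) := by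
    rw [← mul_pow]
    refine hcs.trans_lt ?_
    exact mul_lt_mul_of_pos_right (by linarith) hV
  have := lt_of_mul_lt_mul_left h5 ht0.le
  linarith

/-- A non-zero vector orthogonal to a timelike vector is spacelike. -/
theorem IsLorentzAt.gip_self_pos (h : D.IsLorentzAt u) {t v : Fin 4 → ℝ}
    (ht : D.gip u t t < 0) (htv : D.gip u t v = 0) (hv : v ≠ 0) : 0 < D.gip u v v := by
  obtain ⟨e, he⟩ := h.exists_minkowski_frame
  have hu : IsUnit (Matrix.of e).transpose.det := by
    rw [Matrix.det_transpose]; exact he.isUnit_det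
  set c : (Fin 4 → ℝ) → Fin 4 → ℝ := fun v => ((Matrix.of e).transpose⁻¹).mulVec v with hc
  have hce : ∀ v, (Matrix.of e).transpose.mulVec (c v) = v := fun v => by
    rw [hc, Matrix.mulVec_mulVec, Matrix.mul_nonsing_inv _ hu, Matrix.one_mulVec]
  have hg : ∀ v w, D.gip u v w = c v ⬝ᵥ minkN.mulVec (c w) := by
    intro v w
    rw [← he.metric]
    conv_lhs => rw [← hce v, ← hce w]
    rw [gip, Matrix.dotProduct_mulVec, Matrix.dotProduct_mulVec, ← Matrix.mulVec_mulVec,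
      ← Matrix.dotProduct_mulVec, ← Matrix.dotProduct_mulVec, Matrix.mulVec_transpose,
      ← Matrix.dotProduct_mulVec, Matrix.mulVec_mulVec, Matrix.mulVec_mulVec, Matrix.mul_assoc]
  have hg' : ∀ v w, D.gip u v w = -c v 0 * c w 0 + c v 1 * c w 1 + c v 2 * c w 2 + c v 3 * c w 3 := by
    intro v w
    rw [hg]
    simp [minkN, Matrix.mulVec, dotProduct, Fin.sum_univ_four]
  have hcv : c v ≠ 0 := fun h0 => hv (by rw [← hce v, h0, Matrix.mulVec_zero])
  rw [hg'] at ht htv ⊢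
  have := mink_spacelike (t := c t) (v := c v) (by linarith) (by linarith) hcv
  linarith

/-- Three linear conditions on a vector in dimension four have a non-zero solution. -/
theorem exists_orthogonal (D : CoordFields) (u : E4) (x y z : Fin 4 → ℝ) :
    ∃ v : Fin 4 → ℝ, v ≠ 0 ∧ D.gip u x v = 0 ∧ D.gip u y v = 0 ∧ D.gip u z v = 0 := by
  let A : Matrix (Fin 3) (Fin 4) ℝ := Matrix.of ![x, y, z] * Matrix.of (D.g u)
  have hker : LinearMap.ker (Matrix.toLin' A) ≠ ⊥ :=
    LinearMap.ker_ne_bot_of_finrank_lt (by simp)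
  obtain ⟨v, hv, hv0⟩ := (Submodule.ne_bot_iff _).1 hker
  have h1 : A.mulVec v = 0 := by simpa using hv
  refine ⟨v, hv0, ?_⟩
  have h2 : ∀ i, ![x, y, z] i ⬝ᵥ (Matrix.of (D.g u)).mulVec v = 0 := fun i => by
    have := congrFun h1 i
    rw [← Matrix.mulVec_mulVec] at this
    exact this
  exact ⟨h2 0, h2 1, h2 2⟩

/-- A unit vector orthogonal to `x`, `y` and `z`, provided that the plane of `x` and `y` contains a
timelike vector `t`. -/
theorem IsLorentzAt.exists_unit_orthogonal (h : D.IsLorentzAt u) {t : Fin 4 → ℝ}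
    (ht : D.gip u t t < 0) (x y z : Fin 4 → ℝ)
    (hxy : ∀ v, D.gip u x v = 0 → D.gip u y v = 0 → D.gip u t v = 0) :
    ∃ v : Fin 4 → ℝ, D.gip u v v = 1 ∧ D.gip u x v = 0 ∧ D.gip u y v = 0 ∧ D.gip u z v = 0 := by
  obtain ⟨v, hv, hx, hy, hz⟩ := D.exists_orthogonal u x y z
  have hp := h.gip_self_pos ht (hxy v hx hy) hv
  refine ⟨(√(D.gip u v v))⁻¹ • v, ?_, ?_, ?_, ?_⟩
  · rw [gip_smul_left, gip_smul_right, ← mul_assoc, ← mul_inv, Real.mul_self_sqrt hp.le,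
      inv_mul_cancel₀ hp.ne']
  all_goals rw [gip_smul_right]; simp [hx, hy, hz]

/-- A normalized pair of null vectors is part of an oriented null frame. -/
theorem IsLorentzAt.exists_null_frame (h : D.IsLorentzAt u) {lb l : Fin 4 → ℝ}
    (h1 : D.gip u lb lb = 0) (h2 : D.gip u l l = 0) (h3 : D.gip u lb l = -1) :
    ∃ n, D.IsFrame u nullN n ∧ n 0 = lb ∧ n 1 = l := by
  have h3' : D.gip u l lb = -1 := by rw [h.gip_comm, h3]
  have ht : D.gip u (lb + l) (lb + l) < 0 := by
    rw [gip_add_left, gip_add_right, gip_add_right, h1, h2, h3, h3']; norm_num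
  have hxy : ∀ v, D.gip u lb v = 0 → D.gip u l v = 0 → D.gip u (lb + l) v = 0 := by
    intro v hx hy; rw [gip_add_left, hx, hy, add_zero]
  obtain ⟨v, hv, hv1, hv2, -⟩ := h.exists_unit_orthogonal ht lb l l hxy
  obtain ⟨w, hw, hw1, hw2, hw3⟩ := h.exists_unit_orthogonal ht lb l v hxy
  have hv1' := hv1; have hv2' := hv2; have hw1' := hw1; have hw2' := hw2; have hw3' := hw3
  rw [h.gip_comm] at hv1' hv2' hw1' hw2' hw3'
  rcases h.exists_isFrame nullN_mul_self (by simp [nullN, Matrix.det_succ_row_zero,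
    Fin.sum_univ_succ, Fin.succAbove]) (by
      intro i hi
      fin_cases i <;> simp [nullN] at hi ⊢) ![lb, l, v, w] (fun i j => by
        fin_cases i <;> fin_cases j <;> simp [nullN, *]) with h4 | h4
  exacts [⟨_, h4, rfl, rfl⟩, ⟨_, h4, rfl, rfl⟩]

/-- The components of the Hodge dual in an orthonormal frame which determine an anti-self-dual form
from its electric part. -/
theorem flat_hodge_mink (u : E4) (X : Fin 4 → Fin 4 → ℂ) (hX : ∀ a b, X a b = - X b a) :
    (flat minkN).hodge u X 0 1 = X 2 3 ∧ (flat minkN).hodge u X 0 2 = - X 1 3 ∧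
      (flat minkN).hodge u X 0 3 = X 1 2 := by
  simp only [hodge, flat_gu minkN_mul_self, Fin.sum_univ_four]
  simp [minkN, flat, levi, hX 3 2, hX 2 1, hX 3 1]
  norm_num
  ring_nf
  simp

theorem flat_dot_mink (u : E4) (X Y : Fin 4 → Fin 4 → ℂ) (hX : ∀ a b, X a b = - X b a)
    (hY : ∀ a b, Y a b = - Y b a) : (flat minkN).dot u X Y =
      2 * (X 1 2 * Y 1 2 + X 1 3 * Y 1 3 + X 2 3 * Y 2 3 - X 0 1 * Y 0 1 - X 0 2 * Y 0 2
        - X 0 3 * Y 0 3) := by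
  simp only [dot, flat_gu minkN_mul_self, Fin.sum_univ_four]
  simp [minkN]
  have h7 := fun e => (self_eq_neg.1 (hX e e))
  rw [hX 1 0, hX 2 0, hX 3 0, hX 2 1, hX 3 1, hX 3 2, hY 1 0, hY 2 0, hY 3 0, hY 2 1, hY 3 1,
    hY 3 2]
  simp only [h7]
  ring

/-- The 2-form `lb_a l_b - l_a lb_b + i ε_abcd lb^c l^d`. -/
def nullBivec (D : CoordFields) (u : E4) (lb l : Fin 4 → ℝ) (a b : Fin 4) : ℂ :=
  (((∑ b, D.g u a b * lb b) * (∑ a, D.g u b a * l a)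
      - (∑ b, D.g u a b * l b) * (∑ a, D.g u b a * lb a) : ℝ) : ℂ)
    + Complex.I * ∑ c, ∑ d, ((D.vol u a b c d * lb c * l d : ℝ) : ℂ)

/-- The frame components of the covector `x_a` of a vector `x` given by its coefficients. -/
theorem IsFrame.frOne_lower {N : Matrix (Fin 4) (Fin 4) ℝ} {n : Fin 4 → Fin 4 → ℝ}
    (h : D.IsFrame u N n) (x : Fin 4 → ℝ) (i : Fin 4) :
    frOne n (fun a => ((∑ b, D.g u a b * ∑ k, x k * n k b : ℝ) : ℂ)) i
      = ((∑ k, N i k * x k : ℝ) : ℂ) := by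
  have h1 : ∀ k, N i k = ∑ a, ∑ b, D.g u a b * n i a * n k b := fun k => by
    rw [← h.metric, frame_matrix_apply, gip_eq_sum]
  simp only [frOne, h1]
  push_cast
  simp only [Finset.mul_sum, Finset.sum_mul]
  calc _ = ∑ a, ∑ k, ∑ b, (n i a : ℂ) * (D.g u a b * (x k * n k b)) :=
        Finset.sum_congr rfl fun _ _ => Finset.sum_comm
    _ = _ := by
        rw [Finset.sum_comm]
        refine Finset.sum_congr rfl fun _ _ => Finset.sum_congr rfl fun _ _ =>
          Finset.sum_congr rfl fun _ _ => by ring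

theorem IsFrame.frTwo_vol_vec {N : Matrix (Fin 4) (Fin 4) ℝ} {n : Fin 4 → Fin 4 → ℝ}
    (h : D.IsFrame u N n) (x y : Fin 4 → ℝ) (i j : Fin 4) :
    frTwo n (fun a b => ∑ c, ∑ d, ((D.vol u a b c d * (∑ k, x k * n k c) *
      (∑ l, y l * n l d) : ℝ) : ℂ)) i j = ((∑ k, ∑ l, levi i j k l * x k * y l : ℝ) : ℂ) := by
  simp only [frTwo]
  norm_cast
  simp only [← h.vol, Finset.mul_sum, Finset.sum_mul]
  calc _ = ∑ a, ∑ b, ∑ l, ∑ k, ∑ c, ∑ d,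
          n i a * (n j b * (D.vol u a b c d * (x k * n k c) * (y l * n l d))) :=
        Finset.sum_congr rfl fun _ _ => Finset.sum_congr rfl fun _ _ => by rw [sum_comm_four]
    _ = ∑ l, ∑ k, ∑ a, ∑ b, ∑ c, ∑ d,
          n i a * (n j b * (D.vol u a b c d * (x k * n k c) * (y l * n l d))) := sum_comm_four _
    _ = _ := by
        rw [Finset.sum_comm]
        refine Finset.sum_congr rfl fun _ _ => Finset.sum_congr rfl fun _ _ =>
          Finset.sum_congr rfl fun _ _ => Finset.sum_congr rfl fun _ _ =>
          Finset.sum_congr rfl fun _ _ => Finset.sum_congr rfl fun _ _ => by ring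

theorem frTwo_add (n : Fin 4 → Fin 4 → ℝ) (X Y : Fin 4 → Fin 4 → ℂ) (i j : Fin 4) :
    frTwo n (fun a b => X a b + Y a b) i j = frTwo n X i j + frTwo n Y i j := by
  simp only [frTwo, mul_add, Finset.sum_add_distrib]

theorem frTwo_sub (n : Fin 4 → Fin 4 → ℝ) (X Y : Fin 4 → Fin 4 → ℂ) (i j : Fin 4) :
    frTwo n (fun a b => X a b - Y a b) i j = frTwo n X i j - frTwo n Y i j := by
  simp only [frTwo, mul_sub, Finset.sum_sub_distrib]

theorem frTwo_smul (n : Fin 4 → Fin 4 → ℝ) (r : ℂ) (X : Fin 4 → Fin 4 → ℂ) (i j : Fin 4) :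
    frTwo n (fun a b => r * X a b) i j = r * frTwo n X i j := by
  simp only [frTwo, Finset.mul_sum]
  refine Finset.sum_congr rfl fun _ _ => Finset.sum_congr rfl fun _ _ => by ring

theorem frTwo_mul (n : Fin 4 → Fin 4 → ℝ) (x y : Fin 4 → ℂ) (i j : Fin 4) :
    frTwo n (fun a b => x a * y b) i j = frOne n x i * frOne n y j := by
  simp only [frTwo, frOne, Finset.mul_sum, Finset.sum_mul]
  rw [Finset.sum_comm]
  refine Finset.sum_congr rfl fun _ _ => Finset.sum_congr rfl fun _ _ => by ring

theorem frTwo_swap (n : Fin 4 → Fin 4 → ℝ) (X : Fin 4 → Fin 4 → ℂ) (i j : Fin 4) :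
    frTwo n (fun a b => X b a) i j = frTwo n X j i := by
  simp only [frTwo, Finset.mul_sum]
  rw [Finset.sum_comm]
  refine Finset.sum_congr rfl fun _ _ => Finset.sum_congr rfl fun _ _ => by ring

theorem frTwo_antisymm (n : Fin 4 → Fin 4 → ℝ) {X : Fin 4 → Fin 4 → ℂ}
    (hX : ∀ a b, X a b = - X b a) (i j : Fin 4) : frTwo n X i j = - frTwo n X j i := by
  rw [← frTwo_swap n X j i, ← neg_one_mul, ← frTwo_smul]
  congr 1
  funext a b
  rw [hX]; ring

/-- The frame components of the bivector of two vectors given by their coefficients. -/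
theorem IsFrame.frTwo_nullBivec {N : Matrix (Fin 4) (Fin 4) ℝ} {n : Fin 4 → Fin 4 → ℝ}
    (h : D.IsFrame u N n) (x y : Fin 4 → ℝ) (i j : Fin 4) :
    frTwo n (D.nullBivec u (fun b => ∑ k, x k * n k b) (fun b => ∑ k, y k * n k b)) i j
      = (((∑ k, N i k * x k) * (∑ k, N j k * y k) - (∑ k, N i k * y k) * (∑ k, N j k * x k)
        : ℝ) : ℂ) + Complex.I * ((∑ k, ∑ l, levi i j k l * x k * y l : ℝ) : ℂ) := by
  unfold nullBivec
  rw [frTwo_add, frTwo_smul, h.frTwo_vol_vec]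
  simp only [Complex.ofReal_sub]
  rw [frTwo_sub]
  have := h.frOne_lower
  simp only [Complex.ofReal_mul]
  rw [frTwo_mul, frTwo_mul, h.frOne_lower, h.frOne_lower, h.frOne_lower, h.frOne_lower]

theorem nullBivec_antisymm (h : D.IsLorentzAt u) (lb l : Fin 4 → ℝ) (a b : Fin 4) :
    D.nullBivec u lb l a b = - D.nullBivec u lb l b a := by
  obtain ⟨f, hf, -⟩ := h.vol
  have : ∑ c, ∑ d, ((D.vol u a b c d * lb c * l d : ℝ) : ℂ)
      = - ∑ c, ∑ d, ((D.vol u b a c d * lb c * l d : ℝ) : ℂ) := by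
    simp only [← Finset.sum_neg_distrib]
    refine Finset.sum_congr rfl fun c _ => Finset.sum_congr rfl fun d _ => ?_
    rw [hf, hf, levi_swap]; push_cast; ring
  rw [nullBivec, nullBivec, this]
  push_cast
  ring

/-- An anti-self-dual 2-form `X` with `X · X = -4 μ² ≠ 0` is `μ` times the form of a normalized
pair of null vectors. If `p + i q` is its electric part divided by `μ`, these are the multiples
of `(|p|², ± p + q × p)`. -/
theorem IsLorentzAt.exists_null_pair (h : D.IsLorentzAt u) {X : Fin 4 → Fin 4 → ℂ} {μ : ℂ}
    (hX : ∀ a b, X a b = - X b a) (hX2 : ∀ a b, D.hodge u X a b = -Complex.I * X a b)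
    (hμ : μ ≠ 0) (hdot : D.dot u X X = -4 * μ ^ 2) :
    ∃ lb l, D.gip u lb lb = 0 ∧ D.gip u l l = 0 ∧ D.gip u lb l = -1 ∧
      ∀ a b, X a b = μ * D.nullBivec u lb l a b := by
  obtain ⟨e, he⟩ := h.exists_minkowski_frame
  have hA := frTwo_antisymm e hX
  obtain ⟨t1, t2, t3⟩ := flat_hodge_mink u (frTwo e X) hA
  have hh : ∀ i j, (flat minkN).hodge u (frTwo e X) i j = -Complex.I * frTwo e X i j := by
    intro i j
    rw [← he.frTwo_hodge, ← frTwo_smul]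
    congr 1
    funext a b
    exact hX2 a b
  rw [hh] at t1 t2 t3
  rw [he.dot_eq, flat_dot_mink u _ _ hA hA] at hdot
  -- `m = p + i q` is the electric part divided by `μ`, a complex unit vector.
  obtain ⟨m1, hm1⟩ : ∃ m, frTwo e X 0 1 = μ * m := ⟨_, (mul_div_cancel₀ _ hμ).symm⟩
  obtain ⟨m2, hm2⟩ : ∃ m, frTwo e X 0 2 = μ * m := ⟨_, (mul_div_cancel₀ _ hμ).symm⟩
  obtain ⟨m3, hm3⟩ : ∃ m, frTwo e X 0 3 = μ * m := ⟨_, (mul_div_cancel₀ _ hμ).symm⟩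
  have hm : m1 ^ 2 + m2 ^ 2 + m3 ^ 2 = 1 := by
    have hI := Complex.I_sq
    have : frTwo e X 1 3 = Complex.I * frTwo e X 0 2 := by linear_combination t2
    rw [← t1, ← t3, this, hm1, hm2, hm3] at hdot
    have h4 : -4 * μ ^ 2 * (m1 ^ 2 + m2 ^ 2 + m3 ^ 2) = -4 * μ ^ 2 * 1 := by
      linear_combination hdot - 2 * μ ^ 2 * (m1 ^ 2 + m2 ^ 2 + m3 ^ 2) * hI
    exact mul_left_cancel₀ (mul_ne_zero (by norm_num) (pow_ne_zero _ hμ)) h4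
  have t2' : frTwo e X 1 3 = Complex.I * frTwo e X 0 2 := by linear_combination t2
  rw [hm1] at t1
  rw [hm2] at t2'
  rw [hm3] at t3
  obtain ⟨p1, q1⟩ := m1
  obtain ⟨p2, q2⟩ := m2
  obtain ⟨p3, q3⟩ := m3
  have hre := congrArg Complex.re hm
  have him := congrArg Complex.im hm
  simp [pow_two] at hre him
  -- The real and imaginary parts of `m · m = 1`: `p ⟂ q` and `|p|² - |q|² = 1`.
  have hpq : p1 * q1 + p2 * q2 + p3 * q3 = 0 := by linarith
  set s := p1 ^ 2 + p2 ^ 2 + p3 ^ 2 with hs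
  have hq : q1 ^ 2 + q2 ^ 2 + q3 ^ 2 = s - 1 := by rw [hs]; linarith
  have hs0 : s ≠ 0 := by
    have : 0 ≤ q1 ^ 2 + q2 ^ 2 + q3 ^ 2 := by positivity
    intro h0; linarith
  have hpp : p1 ^ 2 + p2 ^ 2 + p3 ^ 2 = s := hs.symm
  -- `r = q × p`
  obtain ⟨r1, hr1⟩ : ∃ r, r = q2 * p3 - q3 * p2 := ⟨_, rfl⟩
  obtain ⟨r2, hr2⟩ : ∃ r, r = q3 * p1 - q1 * p3 := ⟨_, rfl⟩
  obtain ⟨r3, hr3⟩ : ∃ r, r = q1 * p2 - q2 * p1 := ⟨_, rfl⟩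
  have hpr : p1 * r1 + p2 * r2 + p3 * r3 = 0 := by rw [hr1, hr2, hr3]; ring
  have hrr : r1 ^ 2 + r2 ^ 2 + r3 ^ 2 = s * (s - 1) := by
    rw [← hq, hs, hr1, hr2, hr3]
    linear_combination -(p1 * q1 + p2 * q2 + p3 * q3) * hpq
  have hc1 : p2 * r3 - p3 * r2 = s * q1 := by
    rw [hs, hr2, hr3]; linear_combination -p1 * hpq
  have hc2 : p3 * r1 - p1 * r3 = s * q2 := by
    rw [hs, hr1, hr3]; linear_combination -p2 * hpq
  have hc3 : p1 * r2 - p2 * r1 = s * q3 := by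
    rw [hs, hr1, hr2]; linear_combination -p3 * hpq
  clear_value s
  set x : Fin 4 → ℝ := ![1 / 2, (p1 + r1) / (2 * s), (p2 + r2) / (2 * s), (p3 + r3) / (2 * s)]
    with hx
  set y : Fin 4 → ℝ := ![s, -p1 + r1, -p2 + r2, -p3 + r3] with hy
  -- The electric part of `x ∧ y` is `p`, and its magnetic part is `q`.
  have e1 : -x 0 * y 1 + y 0 * x 1 = p1 := by simp [hx, hy]; field_simp; ring
  have e2 : -x 0 * y 2 + y 0 * x 2 = p2 := by simp [hx, hy]; field_simp; ring
  have e3 : -x 0 * y 3 + y 0 * x 3 = p3 := by simp [hx, hy]; field_simp; ring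
  have f1 : x 2 * y 3 - x 3 * y 2 = q1 := by
    simp [hx, hy]; field_simp; linear_combination 2 * hc1
  have f2 : x 3 * y 1 - x 1 * y 3 = q2 := by
    simp [hx, hy]; field_simp; linear_combination 2 * hc2
  have f3 : x 1 * y 2 - x 2 * y 1 = q3 := by
    simp [hx, hy]; field_simp; linear_combination 2 * hc3
  have hgip : ∀ x y : Fin 4 → ℝ, D.gip u (fun b => ∑ k, x k * e k b) (fun b => ∑ k, y k * e k b)
      = -x 0 * y 0 + x 1 * y 1 + x 2 * y 2 + x 3 * y 3 := by
    intro x y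
    have h1 : ∀ x : Fin 4 → ℝ, (fun b => ∑ k, x k * e k b)
        = x 0 • e 0 + (x 1 • e 1 + (x 2 • e 2 + x 3 • e 3)) := by
      intro x; funext b; simp [Fin.sum_univ_four]; ring
    have h2 : ∀ i j, D.gip u (e i) (e j) = minkN i j := fun i j => by
      rw [← frame_matrix_apply, he.metric]
    rw [h1, h1]
    simp only [gip_add_left, gip_add_right, gip_smul_left, gip_smul_right, h2]
    simp [minkN]
    ring
  refine ⟨fun b => ∑ k, x k * e k b, fun b => ∑ k, y k * e k b, ?_, ?_, ?_, ?_⟩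
  · rw [hgip]
    simp [hx]
    field_simp
    linear_combination hpp + 2 * hpr + hrr
  · rw [hgip]
    simp [hy]
    linear_combination hpp - 2 * hpr + hrr
  · rw [hgip]
    simp [hx, hy]
    field_simp
    linear_combination hrr - hpp
  · have hB := nullBivec_antisymm h (fun b => ∑ k, x k * e k b) (fun b => ∑ k, y k * e k b)
    have hXY : ∀ i j, frTwo e X i j = μ * frTwo e (D.nullBivec u (fun b => ∑ k, x k * e k b)
        (fun b => ∑ k, y k * e k b)) i j := by
      refine antisymm_ext hA (fun i j => ?_) ?_ ?_ ?_ ?_ ?_ ?_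
      · rw [frTwo_antisymm e hB i j, mul_neg]
      · rw [hm1, he.frTwo_nullBivec, ← e1, ← f1]
        congr 1
        apply Complex.ext <;> simp [minkN, levi, Fin.sum_univ_four]
        norm_num
        ring
      · rw [hm2, he.frTwo_nullBivec, ← e2, ← f2]
        congr 1
        apply Complex.ext <;> simp [minkN, levi, Fin.sum_univ_four]
        norm_num
        ring
      · rw [hm3, he.frTwo_nullBivec, ← e3, ← f3]
        congr 1
        apply Complex.ext <;> simp [minkN, levi, Fin.sum_univ_four]
        norm_num
        ring
      · rw [← t3, he.frTwo_nullBivec, ← e3, ← f3, mul_left_comm]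
        congr 1
        apply Complex.ext <;> simp [minkN, levi, Fin.sum_univ_four] <;> (norm_num; ring)
      · rw [t2', he.frTwo_nullBivec, ← e2, ← f2, mul_left_comm]
        congr 1
        apply Complex.ext <;> simp [minkN, levi, Fin.sum_univ_four] <;> (norm_num; ring)
      · rw [← t1, he.frTwo_nullBivec, ← e1, ← f1, mul_left_comm]
        congr 1
        apply Complex.ext <;> simp [minkN, levi, Fin.sum_univ_four] <;> (norm_num; ring)
    apply he.frTwo_injective
    intro i j
    rw [frTwo_smul, hXY]

end CoordFields

/-! ### Partial derivatives -/

section Partial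

variable {F : Type*} [NormedAddCommGroup F] [NormedSpace ℝ F] {u : E4}

theorem SmoothAt.differentiableAt {f : E4 → F} (h : ContDiffAt ℝ ∞ f u) :
    DifferentiableAt ℝ f u := h.differentiableAt (by simp)

theorem SmoothAt.pd {f : E4 → F} (h : ContDiffAt ℝ ∞ f u) (i : Fin 4) :
    ContDiffAt ℝ ∞ (pd i f) u :=
  (h.fderiv_right (m := ∞) (by simp)).clm_apply contDiffAt_const

theorem pd_congr {f g : E4 → F} (h : f =ᶠ[𝓝 u] g) (i : Fin 4) : pd i f u = pd i g u := by
  rw [pd, pd, h.fderiv_eq]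

theorem pd_add {f g : E4 → F} (hf : DifferentiableAt ℝ f u) (hg : DifferentiableAt ℝ g u)
    (i : Fin 4) : pd i (fun v => f v + g v) u = pd i f u + pd i g u := by
  simp only [pd]; rw [fderiv_fun_add hf hg]; rfl

theorem pd_sub {f g : E4 → F} (hf : DifferentiableAt ℝ f u) (hg : DifferentiableAt ℝ g u)
    (i : Fin 4) : pd i (fun v => f v - g v) u = pd i f u - pd i g u := by
  simp only [pd]; rw [fderiv_fun_sub hf hg]; rfl

theorem pd_neg (f : E4 → F) (i : Fin 4) : pd i (fun v => - f v) u = - pd i f u := by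
  simp only [pd]; rw [fderiv_fun_neg]; rfl

theorem pd_const (c : F) (i : Fin 4) : pd i (fun _ => c) u = 0 := by
  simp [pd]

theorem pd_sum {ι : Type*} {s : Finset ι} {f : ι → E4 → F}
    (hf : ∀ k ∈ s, DifferentiableAt ℝ (f k) u) (i : Fin 4) :
    pd i (fun v => ∑ k ∈ s, f k v) u = ∑ k ∈ s, pd i (f k) u := by
  simp only [pd]; rw [fderiv_fun_sum hf]; simp

theorem pd_mul {A : Type*} [NormedCommRing A] [NormedAlgebra ℝ A] {f g : E4 → A}
    (hf : DifferentiableAt ℝ f u) (hg : DifferentiableAt ℝ g u) (i : Fin 4) :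
    pd i (fun v => f v * g v) u = pd i f u * g u + f u * pd i g u := by
  simp only [pd]; rw [fderiv_fun_mul hf hg]; simp; ring

theorem pd_const_mul {A : Type*} [NormedCommRing A] [NormedAlgebra ℝ A] {f : E4 → A}
    (c : A) (hf : DifferentiableAt ℝ f u) (i : Fin 4) :
    pd i (fun v => c * f v) u = c * pd i f u := by
  rw [pd_mul (differentiableAt_const c) hf, pd_const]; ring

theorem pd_clm {G : Type*} [NormedAddCommGroup G] [NormedSpace ℝ G] (L : F →L[ℝ] G) {f : E4 → F}
    (hf : DifferentiableAt ℝ f u) (i : Fin 4) :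
    pd i (fun v => L (f v)) u = L (pd i f u) := by
  simp only [pd]
  have := (L.hasFDerivAt.comp u hf.hasFDerivAt).fderiv
  simp only [Function.comp_def] at this
  rw [this]; rfl

theorem pd_ofReal {f : E4 → ℝ} (hf : DifferentiableAt ℝ f u) (i : Fin 4) :
    pd i (fun v => (f v : ℂ)) u = ((pd i f u : ℝ) : ℂ) :=
  pd_clm Complex.ofRealCLM hf i

theorem pd_re {f : E4 → ℂ} (hf : DifferentiableAt ℝ f u) (i : Fin 4) :
    pd i (fun v => (f v).re) u = (pd i f u).re := pd_clm Complex.reCLM hf i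

theorem pd_im {f : E4 → ℂ} (hf : DifferentiableAt ℝ f u) (i : Fin 4) :
    pd i (fun v => (f v).im) u = (pd i f u).im := pd_clm Complex.imCLM hf i

theorem pd_conj {f : E4 → ℂ} (hf : DifferentiableAt ℝ f u) (i : Fin 4) :
    pd i (fun v => cc (f v)) u = cc (pd i f u) := pd_clm Complex.conjCLE.toContinuousLinearMap hf i

theorem pd_comm {f : E4 → F} (h : ContDiffAt ℝ ∞ f u) (i j : Fin 4) :
    pd i (pd j f) u = pd j (pd i f) u := by
  have hs : IsSymmSndFDerivAt ℝ f u := h.isSymmSndFDerivAt (by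
    rw [minSmoothness_of_isRCLikeNormedField]; norm_cast)
  have hd : DifferentiableAt ℝ (fderiv ℝ f) u :=
    (h.fderiv_right (m := 1) (by norm_cast)).differentiableAt (by simp)
  have key : ∀ i j, pd i (pd j f) u = fderiv ℝ (fderiv ℝ f) u (EuclideanSpace.single i 1)
      (EuclideanSpace.single j 1) := by
    intro i j
    have : pd j f = fun v => fderiv ℝ f v (EuclideanSpace.single j 1) := rfl
    rw [this, pd, fderiv_clm_apply hd (by fun_prop)]
    simp
  rw [key, key]
  exact hs _ _

theorem fderiv_eq_zero_of_pd {f : E4 → F} (h : ∀ i, pd i f u = 0) : fderiv ℝ f u = 0 := by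
  ext v
  have hv : v = ∑ i, v i • EuclideanSpace.single i (1 : ℝ) := by
    ext j; simp [Finset.sum_apply, Pi.single_apply]
  rw [hv, map_sum]
  simp only [map_smul]
  simp only [pd] at h
  simp [h]

/-- The Leibniz rule for finite products. -/
theorem pd_prod {s : Finset (Fin 4)} {f : Fin 4 → E4 → ℝ}
    (hf : ∀ k ∈ s, DifferentiableAt ℝ (f k) u) (i : Fin 4) :
    pd i (fun v => ∏ k ∈ s, f k v) u = ∑ k ∈ s, (∏ j ∈ s.erase k, f j u) * pd i (f k) u := by
  simp only [pd]
  rw [fderiv_finsetProd hf]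
  simp

/-- The entrywise partial derivative of a matrix valued function. -/
def pdM (i : Fin 4) (A : E4 → Matrix (Fin 4) (Fin 4) ℝ) (u : E4) : Matrix (Fin 4) (Fin 4) ℝ :=
  Matrix.of fun a b => pd i (fun v => A v a b) u

theorem pdM_mul {A B : E4 → Matrix (Fin 4) (Fin 4) ℝ}
    (hA : ∀ a b, DifferentiableAt ℝ (fun v => A v a b) u)
    (hB : ∀ a b, DifferentiableAt ℝ (fun v => B v a b) u) (i : Fin 4) :
    pdM i (fun v => A v * B v) u = pdM i A u * B u + A u * pdM i B u := by
  ext a b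
  simp only [pdM, Matrix.of_apply, Matrix.mul_apply, Matrix.add_apply]
  rw [pd_sum (fun k _ => (hA a k).fun_mul (hB k b)), ← Finset.sum_add_distrib]
  exact Finset.sum_congr rfl fun k _ => pd_mul (hA a k) (hB k b) i

theorem contDiffAt_det {A : E4 → Matrix (Fin 4) (Fin 4) ℝ}
    (hA : ∀ a b, ContDiffAt ℝ ∞ (fun v => A v a b) u) :
    ContDiffAt ℝ ∞ (fun v => (A v).det) u := by
  simp only [Matrix.det_apply']
  exact ContDiffAt.sum fun σ _ => contDiffAt_const.mul (contDiffAt_prod fun k _ => hA _ _)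

theorem contDiffAt_matrix_inv {A : E4 → Matrix (Fin 4) (Fin 4) ℝ}
    (hA : ∀ a b, ContDiffAt ℝ ∞ (fun v => A v a b) u) (h0 : (A u).det ≠ 0) (a b : Fin 4) :
    ContDiffAt ℝ ∞ (fun v => (A v)⁻¹ a b) u := by
  simp only [Matrix.inv_def, Ring.inverse_eq_inv', Matrix.smul_apply, Matrix.adjugate_apply,
    smul_eq_mul]
  refine ((contDiffAt_det hA).inv h0).mul (contDiffAt_det fun i j => ?_)
  simp only [Matrix.updateRow_apply]
  split_ifs
  · exact contDiffAt_const
  · exact hA _ _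

/-- Jacobi's formula for the derivative of a determinant. -/
theorem pd_det {A : E4 → Matrix (Fin 4) (Fin 4) ℝ}
    (hA : ∀ a b, DifferentiableAt ℝ (fun v => A v a b) u) (i : Fin 4) :
    pd i (fun v => (A v).det) u = ((A u).adjugate * pdM i A u).trace := by
  have hp : ∀ σ : Equiv.Perm (Fin 4),
      DifferentiableAt ℝ (fun v => ∏ k, A v (σ k) k) u := fun σ =>
    (HasFDerivAt.finsetProd (u := Finset.univ) fun k _ => (hA (σ k) k).hasFDerivAt).differentiableAt
  have h1 : pd i (fun v => (A v).det) u
      = ∑ k, ((A u).updateCol k fun r => pdM i A u r k).det := by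
    simp only [Matrix.det_apply']
    rw [pd_sum (fun σ _ => (differentiableAt_const _).fun_mul (hp σ))]
    rw [Finset.sum_comm]
    refine Finset.sum_congr rfl fun σ _ => ?_
    rw [pd_const_mul _ (hp σ),
      pd_prod (fun k _ => hA _ _), Finset.mul_sum]
    refine Finset.sum_congr rfl fun k _ => ?_
    congr 1
    rw [← Finset.prod_erase_mul _ _ (Finset.mem_univ k)]
    congr 1
    · refine Finset.prod_congr rfl fun j hj => ?_
      rw [Matrix.updateCol_ne (Finset.ne_of_mem_erase hj)]
    · rw [Matrix.updateCol_self]; rfl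
  rw [h1, Matrix.trace]
  refine Finset.sum_congr rfl fun k _ => ?_
  rw [← Matrix.cramer_apply, Matrix.cramer_eq_adjugate_mulVec, Matrix.diag_apply, Matrix.mul_apply]
  rfl

end Partial

/-! ### The Levi-Civita connection -/

namespace CoordFields

/-- On the open set `Ω` the components are those of a smooth Lorentzian metric, a smooth volume
form of it, a smooth 2-form and a smooth vector field, subject to the field equations. -/
structure IsElectrovacOn (D : CoordFields) (Ω : Set E4) : Prop where
  isOpen : IsOpen Ω
  lorentz : ∀ u ∈ Ω, D.IsLorentzAt u
  H_alt : ∀ u ∈ Ω, ∀ a b, D.H u a b = - D.H u b a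
  smooth_g : ∀ u ∈ Ω, ∀ a b, ContDiffAt ℝ ∞ (fun v => D.g v a b) u
  smooth_vol : ∀ u ∈ Ω, ∀ a b c d, ContDiffAt ℝ ∞ (fun v => D.vol v a b c d) u
  smooth_H : ∀ u ∈ Ω, ∀ a b, ContDiffAt ℝ ∞ (fun v => D.H v a b) u
  smooth_T : ∀ u ∈ Ω, ∀ a, ContDiffAt ℝ ∞ (fun v => D.T v a) u
  equations : ∀ u ∈ Ω, D.FieldEquations u

variable {D : CoordFields} {Ω : Set E4} {u : E4}

theorem IsLorentzAt.det_ne_zero (h : D.IsLorentzAt u) : (Matrix.of (D.g u)).det ≠ 0 := by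
  obtain ⟨e, he⟩ := h.exists_minkowski_frame
  have := congrArg Matrix.det he.metric_mul_inv
  rw [Matrix.det_mul, Matrix.det_one] at this
  intro h0
  rw [h0, zero_mul] at this
  exact zero_ne_one this

/-- The matrix of the inverse metric. -/
def guM (D : CoordFields) (u : E4) : Matrix (Fin 4) (Fin 4) ℝ := Matrix.of (D.gu u)

/-- The matrix of the metric. -/
def gM (D : CoordFields) (u : E4) : Matrix (Fin 4) (Fin 4) ℝ := Matrix.of (D.g u)

theorem guM_eq (D : CoordFields) (u : E4) : D.guM u = (D.gM u)⁻¹ := rfl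

theorem IsLorentzAt.g_mul_gu (h : D.IsLorentzAt u) : D.gM u * D.guM u = 1 := by
  rw [guM_eq]; exact Matrix.mul_nonsing_inv _ (isUnit_iff_ne_zero.2 h.det_ne_zero)

theorem IsLorentzAt.gu_mul_g (h : D.IsLorentzAt u) : D.guM u * D.gM u = 1 := by
  rw [guM_eq]; exact Matrix.nonsing_inv_mul _ (isUnit_iff_ne_zero.2 h.det_ne_zero)

theorem IsLorentzAt.gM_transpose (h : D.IsLorentzAt u) : (D.gM u).transpose = D.gM u := by
  ext a b; exact h.symm b a

theorem IsLorentzAt.guM_transpose (h : D.IsLorentzAt u) : (D.guM u).transpose = D.guM u := by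
  rw [guM_eq, Matrix.transpose_nonsing_inv, h.gM_transpose]

theorem IsLorentzAt.gu_symm (h : D.IsLorentzAt u) (a b : Fin 4) : D.gu u a b = D.gu u b a :=
  congrFun (congrFun h.guM_transpose b) a

theorem IsLorentzAt.sum_g_gu (h : D.IsLorentzAt u) (a b : Fin 4) :
    ∑ c, D.g u a c * D.gu u c b = if a = b then 1 else 0 := by
  have := congrFun (congrFun h.g_mul_gu a) b
  rw [Matrix.mul_apply, Matrix.one_apply] at this
  exact this

theorem IsLorentzAt.sum_gu_g (h : D.IsLorentzAt u) (a b : Fin 4) :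
    ∑ c, D.gu u a c * D.g u c b = if a = b then 1 else 0 := by
  have := congrFun (congrFun h.gu_mul_g a) b
  rw [Matrix.mul_apply, Matrix.one_apply] at this
  exact this

/-- Lowering and raising an index. -/
theorem IsLorentzAt.sum_g_sum_gu (h : D.IsLorentzAt u) (X : Fin 4 → ℝ) (a : Fin 4) :
    ∑ c, D.g u a c * ∑ b, D.gu u c b * X b = X a := by
  simp only [Finset.mul_sum]
  rw [Finset.sum_comm]
  calc _ = ∑ b, (∑ c, D.g u a c * D.gu u c b) * X b := by
        refine Finset.sum_congr rfl fun b _ => ?_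
        rw [Finset.sum_mul]
        exact Finset.sum_congr rfl fun c _ => by ring
    _ = X a := by simp [h.sum_g_gu]

theorem IsLorentzAt.sum_gu_sum_g (h : D.IsLorentzAt u) (X : Fin 4 → ℝ) (a : Fin 4) :
    ∑ c, D.gu u a c * ∑ b, D.g u c b * X b = X a := by
  simp only [Finset.mul_sum]
  rw [Finset.sum_comm]
  calc _ = ∑ b, (∑ c, D.gu u a c * D.g u c b) * X b := by
        refine Finset.sum_congr rfl fun b _ => ?_
        rw [Finset.sum_mul]
        exact Finset.sum_congr rfl fun c _ => by ring
    _ = X a := by simp [h.sum_gu_g]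

/-- The Christoffel symbols with lowered first index. -/
def GammaLow (D : CoordFields) (u : E4) (c a b : Fin 4) : ℝ :=
  (1 / 2) * (pd a (fun v => D.g v c b) u + pd b (fun v => D.g v c a) u
    - pd c (fun v => D.g v a b) u)

theorem Gamma_eq (D : CoordFields) (u : E4) (c a b : Fin 4) :
    D.Gamma u c a b = ∑ d, D.gu u c d * D.GammaLow u d a b := by
  rw [Gamma, Finset.mul_sum]
  exact Finset.sum_congr rfl fun d _ => by rw [GammaLow]; ring

namespace IsElectrovacOn

theorem mem_nhds (h : D.IsElectrovacOn Ω) (hu : u ∈ Ω) : ∀ᶠ v in 𝓝 u, v ∈ Ω :=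
  h.isOpen.mem_nhds hu

theorem smooth_gu (h : D.IsElectrovacOn Ω) (hu : u ∈ Ω) (a b : Fin 4) :
    ContDiffAt ℝ ∞ (fun v => D.gu v a b) u :=
  contDiffAt_matrix_inv (A := fun v => Matrix.of (D.g v)) (h.smooth_g u hu)
    (h.lorentz u hu).det_ne_zero a b

theorem smooth_GammaLow (h : D.IsElectrovacOn Ω) (hu : u ∈ Ω) (c a b : Fin 4) :
    ContDiffAt ℝ ∞ (fun v => D.GammaLow v c a b) u := by
  have := fun i a b => SmoothAt.pd (h.smooth_g u hu a b) i
  exact contDiffAt_const.mul (((this _ _ _).add (this _ _ _)).sub (this _ _ _))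

theorem smooth_Gamma (h : D.IsElectrovacOn Ω) (hu : u ∈ Ω) (c a b : Fin 4) :
    ContDiffAt ℝ ∞ (fun v => D.Gamma v c a b) u := by
  simp only [Gamma_eq]
  exact ContDiffAt.sum fun d _ => (h.smooth_gu hu _ _).mul (h.smooth_GammaLow hu _ _ _)

theorem pd_g_symm (h : D.IsElectrovacOn Ω) (hu : u ∈ Ω) (c a b : Fin 4) :
    pd c (fun v => D.g v a b) u = pd c (fun v => D.g v b a) u :=
  pd_congr ((h.mem_nhds hu).mono fun v hv => (h.lorentz v hv).symm a b) c

theorem GammaLow_symm (h : D.IsElectrovacOn Ω) (hu : u ∈ Ω) (c a b : Fin 4) :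
    D.GammaLow u c a b = D.GammaLow u c b a := by
  rw [GammaLow, GammaLow, h.pd_g_symm hu c a b]; ring

theorem Gamma_symm (h : D.IsElectrovacOn Ω) (hu : u ∈ Ω) (c a b : Fin 4) :
    D.Gamma u c a b = D.Gamma u c b a := by
  rw [Gamma_eq, Gamma_eq]
  exact Finset.sum_congr rfl fun d _ => by rw [h.GammaLow_symm hu]

theorem sum_g_Gamma (h : D.IsElectrovacOn Ω) (hu : u ∈ Ω) (c a b : Fin 4) :
    ∑ d, D.g u c d * D.Gamma u d a b = D.GammaLow u c a b := by
  simp only [Gamma_eq]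
  exact (h.lorentz u hu).sum_g_sum_gu (fun d => D.GammaLow u d a b) c

/-- The connection is metric: `∇g = 0`. -/
theorem pd_g (h : D.IsElectrovacOn Ω) (hu : u ∈ Ω) (c a b : Fin 4) :
    pd c (fun v => D.g v a b) u = D.GammaLow u a c b + D.GammaLow u b c a := by
  rw [GammaLow, GammaLow, h.pd_g_symm hu c b a, h.pd_g_symm hu b a c, h.pd_g_symm hu a c b]
  ring

/-- The matrix `Γ^a_mb` for fixed `m`. -/
def GamM (D : CoordFields) (u : E4) (m : Fin 4) : Matrix (Fin 4) (Fin 4) ℝ :=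
  Matrix.of fun a b => D.Gamma u a m b

theorem pdM_g (h : D.IsElectrovacOn Ω) (hu : u ∈ Ω) (m : Fin 4) :
    pdM m D.gM u = (GamM D u m).transpose * D.gM u + D.gM u * GamM D u m := by
  ext a b
  have h1 : pdM m D.gM u a b = _ := h.pd_g hu m a b
  rw [h1, ← h.sum_g_Gamma hu, ← h.sum_g_Gamma hu, add_comm]
  simp only [Matrix.add_apply, Matrix.mul_apply, Matrix.transpose_apply, GamM, gM, Matrix.of_apply]
  congr 1
  exact Finset.sum_congr rfl fun d _ => by rw [(h.lorentz u hu).symm]; ring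

theorem pdM_gu (h : D.IsElectrovacOn Ω) (hu : u ∈ Ω) (m : Fin 4) :
    pdM m D.guM u = -(GamM D u m * D.guM u) - D.guM u * (GamM D u m).transpose := by
  have hl := h.lorentz u hu
  have h1 : pdM m (fun v => D.gM v * D.guM v) u = 0 := by
    ext a b
    have : (fun v => (D.gM v * D.guM v) a b) =ᶠ[𝓝 u] fun _ => (1 : Matrix _ _ ℝ) a b :=
      (h.mem_nhds hu).mono fun v hv => by
        change (D.gM v * D.guM v) a b = _; rw [(h.lorentz v hv).g_mul_gu]
    change pd m _ u = 0
    rw [pd_congr this, pd_const]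
  have h2 := pdM_mul (A := D.gM) (B := D.guM) (u := u)
    (fun a b => SmoothAt.differentiableAt (h.smooth_g u hu a b))
    (fun a b => SmoothAt.differentiableAt (h.smooth_gu hu a b)) m
  rw [h1, h.pdM_g hu] at h2
  have h3 := congrArg (fun X => D.guM u * X) h2
  simp only [Matrix.mul_zero, Matrix.mul_add, Matrix.add_mul] at h3
  have e1 : D.guM u * ((GamM D u m).transpose * D.gM u * D.guM u)
      = D.guM u * (GamM D u m).transpose := by
    rw [Matrix.mul_assoc, hl.g_mul_gu, Matrix.mul_one]
  have e2 : D.guM u * (D.gM u * GamM D u m * D.guM u) = GamM D u m * D.guM u := by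
    rw [Matrix.mul_assoc, ← Matrix.mul_assoc, hl.gu_mul_g, Matrix.one_mul]
  have e3 : D.guM u * (D.gM u * pdM m D.guM u) = pdM m D.guM u := by
    rw [← Matrix.mul_assoc, hl.gu_mul_g, Matrix.one_mul]
  rw [e1, e2, e3] at h3
  have h4 : pdM m D.guM u = -(D.guM u * (GamM D u m).transpose + GamM D u m * D.guM u) :=
    (neg_eq_of_add_eq_zero_right h3.symm).symm
  rw [h4]; abel

/-- The inverse metric is parallel. -/
theorem pd_gu (h : D.IsElectrovacOn Ω) (hu : u ∈ Ω) (m a b : Fin 4) :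
    pd m (fun v => D.gu v a b) u
      = -∑ c, D.Gamma u a m c * D.gu u c b - ∑ c, D.Gamma u b m c * D.gu u a c := by
  have := congrFun (congrFun (h.pdM_gu hu m) a) b
  simp only [Matrix.sub_apply, Matrix.neg_apply, Matrix.mul_apply, Matrix.transpose_apply, GamM,
    guM, Matrix.of_apply] at this
  refine Eq.trans this ?_
  congr 1
  exact Finset.sum_congr rfl fun c _ => by ring

/-- `∂_m det g = 2 Γ^c_mc det g`, by Jacobi's formula. -/
theorem pd_det_g (h : D.IsElectrovacOn Ω) (hu : u ∈ Ω) (m : Fin 4) :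
    pd m (fun v => (D.gM v).det) u = 2 * (GamM D u m).trace * (D.gM u).det := by
  rw [pd_det (A := D.gM) (fun a b => SmoothAt.differentiableAt (h.smooth_g u hu a b)),
    h.pdM_g hu, Matrix.mul_add, Matrix.trace_add, ← Matrix.mul_assoc, ← Matrix.mul_assoc,
    Matrix.adjugate_mul, Matrix.trace_mul_comm, ← Matrix.mul_assoc, Matrix.mul_adjugate,
    smul_mul_assoc, one_mul, smul_mul_assoc, one_mul, Matrix.trace_smul, Matrix.trace_smul,
    Matrix.trace_transpose, smul_eq_mul]
  ring

/-- The infinitesimal form of the multiplicativity of the determinant. -/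
theorem trace_mul_levi (G : Fin 4 → Fin 4 → ℝ) (a b c d : Fin 4) :
    (∑ e, G e e) * levi a b c d = ∑ e, (G e a * levi e b c d + G e b * levi a e c d
      + G e c * levi a b e d + G e d * levi a b c e) := by
  set P : Matrix (Fin 4) (Fin 4) ℝ :=
    Matrix.of ![Pi.single a (1 : ℝ), Pi.single b 1, Pi.single c 1, Pi.single d 1] with hP
  have hcol : ∀ k, (P.updateRow k fun e => G e (![a, b, c, d] k)).det
      = (P.transpose.adjugate * (Matrix.of G * P.transpose)) k k := by
    intro k
    rw [← Matrix.det_transpose, ← Matrix.updateCol_transpose, ← Matrix.cramer_apply,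
      Matrix.cramer_eq_adjugate_mulVec, Matrix.mul_apply, Matrix.mulVec, dotProduct]
    refine Finset.sum_congr rfl fun e _ => ?_
    congr 1
    rw [Matrix.mul_apply]
    fin_cases k <;> simp [hP, Pi.single_apply]
  have htr : ∑ k, (P.updateRow k fun e => G e (![a, b, c, d] k)).det
      = (∑ e, G e e) * levi a b c d := by
    simp only [hcol]
    change (P.transpose.adjugate * (Matrix.of G * P.transpose)).trace = _
    rw [Matrix.trace_mul_comm, Matrix.mul_assoc, Matrix.mul_adjugate, Matrix.mul_smul,
      Matrix.mul_one, Matrix.trace_smul, Matrix.det_transpose, hP, det_of_single_eq_levi,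
      smul_eq_mul, mul_comm]
    rfl
  rw [← htr, Fin.sum_univ_four, Finset.sum_add_distrib, Finset.sum_add_distrib,
    Finset.sum_add_distrib]
  have e0 : (P.updateRow 0 fun e => G e a) = Matrix.of ![fun e => G e a, Pi.single b 1,
      Pi.single c 1, Pi.single d 1] := by
    ext i j; fin_cases i <;> simp [hP, Matrix.updateRow_apply]
  have e1 : (P.updateRow 1 fun e => G e b) = Matrix.of ![Pi.single a 1, fun e => G e b,
      Pi.single c 1, Pi.single d 1] := by
    ext i j; fin_cases i <;> simp [hP, Matrix.updateRow_apply]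
  have e2 : (P.updateRow 2 fun e => G e c) = Matrix.of ![Pi.single a 1, Pi.single b 1,
      fun e => G e c, Pi.single d 1] := by
    ext i j; fin_cases i <;> simp [hP, Matrix.updateRow_apply]
  have e3 : (P.updateRow 3 fun e => G e d) = Matrix.of ![Pi.single a 1, Pi.single b 1,
      Pi.single c 1, fun e => G e d] := by
    ext i j; fin_cases i <;> simp [hP, Matrix.updateRow_apply]
  simp only [Matrix.cons_val]
  rw [e0, e1, e2, e3, ← sum_levi_eq_det, ← sum_levi_eq_det, ← sum_levi_eq_det, ← sum_levi_eq_det]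
  simp [Pi.single_apply, mul_comm]

/-- The volume form is parallel. Its components are `f [abcd]` with `f² = -det g`, so that
`∂_m f = Γ^e_me f`. -/
theorem pd_vol (h : D.IsElectrovacOn Ω) (hu : u ∈ Ω) (m a b c d : Fin 4) :
    pd m (fun v => D.vol v a b c d) u = ∑ e, (D.Gamma u e m a * D.vol u e b c d
      + D.Gamma u e m b * D.vol u a e c d + D.Gamma u e m c * D.vol u a b e d
      + D.Gamma u e m d * D.vol u a b c e) := by
  have hl0 : levi 0 1 2 3 = 1 := by norm_num [levi]
  have hf : ∀ v ∈ Ω, (∀ a b c d, D.vol v a b c d = D.vol v 0 1 2 3 * levi a b c d) ∧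
      D.vol v 0 1 2 3 ^ 2 = - (D.gM v).det := by
    intro v hv
    obtain ⟨f, hf, hf2⟩ := (h.lorentz v hv).vol
    have : D.vol v 0 1 2 3 = f := by rw [hf, hl0, mul_one]
    rw [this]
    exact ⟨hf, hf2⟩
  have hd := SmoothAt.differentiableAt (h.smooth_vol u hu 0 1 2 3)
  obtain ⟨h1, h2⟩ := hf u hu
  have h0 : D.vol u 0 1 2 3 ≠ 0 := by
    intro h0
    rw [h0] at h2
    exact (h.lorentz u hu).det_ne_zero (show (D.gM u).det = 0 by simpa using h2.symm)
  have h3 : pd m (fun v => D.vol v 0 1 2 3) u = (GamM D u m).trace * D.vol u 0 1 2 3 := by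
    have e1 : pd m (fun v => D.vol v 0 1 2 3 * D.vol v 0 1 2 3) u
        = - pd m (fun v => (D.gM v).det) u := by
      rw [← pd_neg]
      exact pd_congr ((h.mem_nhds hu).mono fun v hv => by
        rw [← (hf v hv).2]; ring) m
    rw [pd_mul hd hd, h.pd_det_g hu] at e1
    have h4 : 2 * D.vol u 0 1 2 3 * pd m (fun v => D.vol v 0 1 2 3) u
        = 2 * D.vol u 0 1 2 3 * ((GamM D u m).trace * D.vol u 0 1 2 3) := by
      linear_combination e1 - 2 * (GamM D u m).trace * h2
    exact mul_left_cancel₀ (mul_ne_zero two_ne_zero h0) h4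
  have h4 : pd m (fun v => D.vol v a b c d) u = levi a b c d * pd m (fun v => D.vol v 0 1 2 3) u := by
    rw [← pd_const_mul _ hd]
    exact pd_congr ((h.mem_nhds hu).mono fun v hv => by
      rw [(hf v hv).1]; ring) m
  rw [h4, h3]
  have h5 := trace_mul_levi (fun e a => D.Gamma u e m a) a b c d
  have h6 : (GamM D u m).trace = ∑ e, D.Gamma u e m e := rfl
  calc _ = D.vol u 0 1 2 3 * ((∑ e, D.Gamma u e m e) * levi a b c d) := by rw [h6]; ring
    _ = _ := by
      rw [h5, Finset.mul_sum]
      refine Finset.sum_congr rfl fun e _ => ?_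
      rw [h1 e b c d, h1 a e c d, h1 a b e d, h1 a b c e]
      ring

end IsElectrovacOn
end CoordFields

/-! ### Covariant derivatives of 2-forms and their Hodge duals -/

namespace CoordFields

variable {D : CoordFields} {Ω : Set E4} {u : E4}

/-- The matrix of the components `X^ab`. -/
def upM (D : CoordFields) (X : Fin 4 → Fin 4 → ℝ) (u : E4) : Matrix (Fin 4) (Fin 4) ℝ :=
  D.guM u * Matrix.of X * (D.guM u).transpose

/-- The Hodge dual of a real 2-form. -/
def hodgeR (D : CoordFields) (u : E4) (X : Fin 4 → Fin 4 → ℝ) (a b : Fin 4) : ℝ :=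
  (1 / 2) * ∑ c, ∑ d, D.vol u a b c d * D.upM X u c d

theorem hodge_ofReal (D : CoordFields) (u : E4) (X : Fin 4 → Fin 4 → ℝ) (a b : Fin 4) :
    D.hodge u (fun c d => (X c d : ℂ)) a b = (D.hodgeR u X a b : ℂ) := by
  rw [hodge, hodgeR]
  push_cast
  congr 1
  refine Finset.sum_congr rfl fun c _ => Finset.sum_congr rfl fun d _ => ?_
  simp only [upM, guM, Matrix.mul_apply, Matrix.transpose_apply, Matrix.of_apply]
  push_cast
  simp only [Finset.mul_sum, Finset.sum_mul]
  rw [Finset.sum_comm]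
  refine Finset.sum_congr rfl fun c _ => Finset.sum_congr rfl fun d _ => by ring

theorem asd_eq (D : CoordFields) (X : E4 → Fin 4 → Fin 4 → ℝ) (u : E4) (a b : Fin 4) :
    D.asd X u a b = (1 / 2) * ((X u a b : ℂ) + Complex.I * (D.hodgeR u (X u) a b : ℂ)) := by
  rw [asd, hodge_ofReal]

/-- The covariant derivative depends only on the germ of the tensor field. -/
theorem covTwo_congr {F : Type*} [NormedAddCommGroup F] [NormedSpace ℝ F]
    {X Y : E4 → Fin 4 → Fin 4 → F} (h : ∀ᶠ v in 𝓝 u, ∀ a b, X v a b = Y v a b) (c a b : Fin 4) :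
    D.covTwo X u c a b = D.covTwo Y u c a b := by
  simp only [covTwo, h.self_of_nhds]
  rw [pd_congr (h.mono fun v hv => hv a b)]

theorem covTwo_neg_swap {X : E4 → Fin 4 → Fin 4 → ℝ}
    (h : ∀ᶠ v in 𝓝 u, ∀ a b, X v a b = - X v b a) (c a b : Fin 4) :
    D.covTwo X u c a b = - D.covTwo X u c b a := by
  have h1 := pd_congr (h.mono fun v hv => hv a b) c
  rw [pd_neg] at h1
  simp only [covTwo, h1, smul_eq_mul]
  have e1 : ∀ e, ∑ d, D.Gamma u d c e * X u d b = - ∑ d, D.Gamma u d c e * X u b d := fun e => by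
    rw [← Finset.sum_neg_distrib]
    exact Finset.sum_congr rfl fun d _ => by rw [h.self_of_nhds]; ring
  have e2 : ∀ e, ∑ d, D.Gamma u d c e * X u a d = - ∑ d, D.Gamma u d c e * X u d a := fun e => by
    rw [← Finset.sum_neg_distrib]
    exact Finset.sum_congr rfl fun d _ => by rw [h.self_of_nhds]; ring
  rw [e1, e2]
  ring

theorem covTwo_const_mul {A : Type*} [NormedCommRing A] [NormedAlgebra ℝ A] (r : A)
    {X : E4 → Fin 4 → Fin 4 → A} (h : ∀ a b, DifferentiableAt ℝ (fun v => X v a b) u)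
    (c a b : Fin 4) :
    D.covTwo (fun v a b => r * X v a b) u c a b = r * D.covTwo X u c a b := by
  simp only [covTwo]
  rw [pd_const_mul _ (h a b), mul_sub, mul_sub, Finset.mul_sum, Finset.mul_sum]
  simp only [mul_smul_comm]

theorem covTwo_add {F : Type*} [NormedAddCommGroup F] [NormedSpace ℝ F]
    {X Y : E4 → Fin 4 → Fin 4 → F} (hX : ∀ a b, DifferentiableAt ℝ (fun v => X v a b) u)
    (hY : ∀ a b, DifferentiableAt ℝ (fun v => Y v a b) u) (c a b : Fin 4) :
    D.covTwo (fun v a b => X v a b + Y v a b) u c a b = D.covTwo X u c a b + D.covTwo Y u c a b := by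
  simp only [covTwo]
  rw [pd_add (hX a b) (hY a b)]
  simp only [smul_add, Finset.sum_add_distrib]
  abel

theorem covTwo_mul {A : Type*} [NormedCommRing A] [NormedAlgebra ℝ A] {f : E4 → A}
    {X : E4 → Fin 4 → Fin 4 → A} (hf : DifferentiableAt ℝ f u)
    (h : ∀ a b, DifferentiableAt ℝ (fun v => X v a b) u) (c a b : Fin 4) :
    D.covTwo (fun v a b => f v * X v a b) u c a b
      = pd c f u * X u a b + f u * D.covTwo X u c a b := by
  simp only [covTwo]
  rw [pd_mul hf (h a b), mul_sub, mul_sub, Finset.mul_sum, Finset.mul_sum]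
  simp only [mul_smul_comm]
  ring

theorem covTwo_ofReal {X : E4 → Fin 4 → Fin 4 → ℝ}
    (h : ∀ a b, DifferentiableAt ℝ (fun v => X v a b) u) (c a b : Fin 4) :
    D.covTwo (fun v a b => (X v a b : ℂ)) u c a b = ((D.covTwo X u c a b : ℝ) : ℂ) := by
  simp only [covTwo]
  rw [pd_ofReal (h a b)]
  simp

namespace IsElectrovacOn

theorem smooth_upM (h : D.IsElectrovacOn Ω) (hu : u ∈ Ω) {X : E4 → Fin 4 → Fin 4 → ℝ}
    (hX : ∀ a b, ContDiffAt ℝ ∞ (fun v => X v a b) u) (a b : Fin 4) :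
    ContDiffAt ℝ ∞ (fun v => D.upM (X v) v a b) u := by
  simp only [upM, Matrix.mul_apply]
  exact ContDiffAt.sum fun _ _ => (ContDiffAt.sum fun _ _ => (h.smooth_gu hu _ _).mul
    (hX _ _)).mul (h.smooth_gu hu _ _)

theorem smooth_hodgeR (h : D.IsElectrovacOn Ω) (hu : u ∈ Ω) {X : E4 → Fin 4 → Fin 4 → ℝ}
    (hX : ∀ a b, ContDiffAt ℝ ∞ (fun v => X v a b) u) (a b : Fin 4) :
    ContDiffAt ℝ ∞ (fun v => D.hodgeR v (X v) a b) u :=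
  contDiffAt_const.mul (ContDiffAt.sum fun _ _ => ContDiffAt.sum fun _ _ =>
    (h.smooth_vol u hu _ _ _ _).mul (h.smooth_upM hu hX _ _))

theorem smooth_asd (h : D.IsElectrovacOn Ω) (hu : u ∈ Ω) {X : E4 → Fin 4 → Fin 4 → ℝ}
    (hX : ∀ a b, ContDiffAt ℝ ∞ (fun v => X v a b) u) (a b : Fin 4) :
    ContDiffAt ℝ ∞ (fun v => D.asd X v a b) u := by
  simp only [asd_eq]
  have h1 := fun {f : E4 → ℝ} (hf : ContDiffAt ℝ ∞ f u) =>
    Complex.ofRealCLM.contDiff.contDiffAt.comp u hf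
  exact contDiffAt_const.mul ((h1 (hX a b)).add
    (contDiffAt_const.mul (h1 (h.smooth_hodgeR hu hX a b))))

/-- The covariant derivative of `X^ab`. -/
theorem pd_upM (h : D.IsElectrovacOn Ω) (hu : u ∈ Ω) {X : E4 → Fin 4 → Fin 4 → ℝ}
    (hX : ∀ a b, ContDiffAt ℝ ∞ (fun v => X v a b) u) (m c d : Fin 4) :
    pd m (fun v => D.upM (X v) v c d) u = D.upM (D.covTwo X u m) u c d
      - ∑ e, D.Gamma u c m e * D.upM (X u) u e d - ∑ e, D.Gamma u d m e * D.upM (X u) u c e := by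
  have dX : ∀ a b, DifferentiableAt ℝ (fun v => Matrix.of (X v) a b) u := fun a b =>
    SmoothAt.differentiableAt (hX a b)
  have dg : ∀ a b, DifferentiableAt ℝ (fun v => D.guM v a b) u := fun a b =>
    SmoothAt.differentiableAt (h.smooth_gu hu a b)
  have h1 : pdM m (fun v => D.upM (X v) v) u = _ :=
    pdM_mul (A := fun v => D.guM v * Matrix.of (X v)) (B := fun v => (D.guM v).transpose)
      (fun a b => by
        simp only [Matrix.mul_apply]
        exact DifferentiableAt.fun_sum fun k _ => (dg a k).mul (dX k b)) (fun a b => dg b a) m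
  rw [pdM_mul dg dX] at h1
  have h2 : pdM m (fun v => (D.guM v).transpose) u = (pdM m D.guM u).transpose := rfl
  rw [h2, h.pdM_gu hu] at h1
  have h3 : Matrix.of (D.covTwo X u m) = pdM m (fun v => Matrix.of (X v)) u
      - (GamM D u m).transpose * Matrix.of (X u) - Matrix.of (X u) * GamM D u m := by
    ext a b
    simp only [covTwo, Matrix.sub_apply, Matrix.mul_apply, pdM, GamM, Matrix.of_apply,
      Matrix.transpose_apply, smul_eq_mul]
    congr 1
    exact Finset.sum_congr rfl fun e _ => by ring
  have h4 : pdM m (fun v => D.upM (X v) v) u = D.upM (D.covTwo X u m) u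
      - GamM D u m * D.upM (X u) u - D.upM (X u) u * (GamM D u m).transpose := by
    rw [h1, upM, upM, h3]
    simp only [Matrix.transpose_sub, Matrix.transpose_neg, Matrix.transpose_mul,
      Matrix.transpose_transpose]
    noncomm_ring
  have h5 := congrFun (congrFun h4 c) d
  simp only [Matrix.sub_apply, Matrix.mul_apply, GamM, Matrix.of_apply,
      Matrix.transpose_apply] at h5
  refine Eq.trans h5 ?_
  congr 1
  exact Finset.sum_congr rfl fun e _ => by ring

/-- The Hodge dual is parallel. -/
theorem covTwo_hodgeR (h : D.IsElectrovacOn Ω) (hu : u ∈ Ω) {X : E4 → Fin 4 → Fin 4 → ℝ}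
    (hX : ∀ a b, ContDiffAt ℝ ∞ (fun v => X v a b) u) (m a b : Fin 4) :
    D.covTwo (fun v => D.hodgeR v (X v)) u m a b = D.hodgeR u (D.covTwo X u m) a b := by
  have dv := fun a b c d => SmoothAt.differentiableAt (h.smooth_vol u hu a b c d)
  have dX := fun a b => SmoothAt.differentiableAt (h.smooth_upM hu hX a b)
  rw [covTwo]
  simp only [hodgeR, smul_eq_mul]
  rw [pd_const_mul _ (DifferentiableAt.fun_sum fun c _ => DifferentiableAt.fun_sum fun d _ =>
    (dv a b c d).fun_mul (dX c d)), pd_sum (fun c _ => DifferentiableAt.fun_sum fun d _ =>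
    (dv a b c d).fun_mul (dX c d))]
  have h1 : ∀ c, pd m (fun v => ∑ d, D.vol v a b c d * D.upM (X v) v c d) u
      = ∑ d, (pd m (fun v => D.vol v a b c d) u * D.upM (X u) u c d
        + D.vol u a b c d * pd m (fun v => D.upM (X v) v c d) u) := fun c => by
    rw [pd_sum (fun d _ => (dv a b c d).fun_mul (dX c d))]
    exact Finset.sum_congr rfl fun d _ => pd_mul (dv a b c d) (dX c d) m
  simp only [h1, h.pd_vol hu, h.pd_upM hu hX]
  generalize D.upM (D.covTwo X u m) u = Z
  generalize D.upM (X u) u = Y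
  simp only [Fin.sum_univ_four]
  ring

/-- The covariant derivative commutes with the anti-self-dual projection. -/
theorem covTwo_asd (h : D.IsElectrovacOn Ω) (hu : u ∈ Ω) {X : E4 → Fin 4 → Fin 4 → ℝ}
    (hX : ∀ a b, ContDiffAt ℝ ∞ (fun v => X v a b) u) (m a b : Fin 4) :
    D.covTwo (D.asd X) u m a b = D.asdC u (fun a b => ((D.covTwo X u m a b : ℝ) : ℂ)) a b := by
  have d1 := fun a b => SmoothAt.differentiableAt (hX a b)
  have d2 := fun a b => SmoothAt.differentiableAt (h.smooth_hodgeR hu hX a b)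
  have c1 := fun {f : E4 → ℝ} (hf : DifferentiableAt ℝ f u) =>
    Complex.ofRealCLM.differentiableAt.comp u hf
  have e1 : D.asd X = fun v a b =>
      (1 / 2) * ((X v a b : ℂ) + Complex.I * (D.hodgeR v (X v) a b : ℂ)) := by
    funext v a b; rw [asd_eq]
  rw [e1, covTwo_const_mul (X := fun v a b => (X v a b : ℂ) + Complex.I * (D.hodgeR v (X v) a b : ℂ))
    _ (fun a b => (c1 (d1 a b)).add ((c1 (d2 a b)).const_mul _)),
    covTwo_add (X := fun v a b => (X v a b : ℂ)) (Y := fun v a b =>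
      Complex.I * (D.hodgeR v (X v) a b : ℂ)) (fun a b => c1 (d1 a b))
      (fun a b => (c1 (d2 a b)).const_mul _), covTwo_ofReal d1,
    covTwo_const_mul (X := fun v a b => (D.hodgeR v (X v) a b : ℂ)) _ (fun a b => c1 (d2 a b)),
    covTwo_ofReal d2, h.covTwo_hodgeR hu hX, asdC, hodge_ofReal]

end IsElectrovacOn
end CoordFields

/-! ### Curvature and the Killing equation -/

namespace CoordFields

variable {D : CoordFields} {Ω : Set E4} {u : E4}

/-- The curvature `R^a_bcd` of the Christoffel symbols. -/
def RiemUp (D : CoordFields) (u : E4) (e b c d : Fin 4) : ℝ :=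
  pd c (fun v => D.Gamma v e d b) u - pd d (fun v => D.Gamma v e c b) u
      + ∑ f, (D.Gamma u e c f * D.Gamma u f d b - D.Gamma u e d f * D.Gamma u f c b)

theorem Riem_eq (D : CoordFields) (u : E4) (a b c d : Fin 4) :
    D.Riem u a b c d = ∑ e, D.g u a e * D.RiemUp u e b c d := rfl

theorem smooth_Tlow (hg : ∀ a b, ContDiffAt ℝ ∞ (fun v => D.g v a b) u)
    (hT : ∀ a, ContDiffAt ℝ ∞ (fun v => D.T v a) u) (a : Fin 4) :
    ContDiffAt ℝ ∞ (fun v => D.Tlow v a) u :=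
  ContDiffAt.sum fun b _ => (hg a b).mul (hT b)

namespace IsElectrovacOn

/-- The second derivatives of the metric. -/
theorem pd_pd_g (h : D.IsElectrovacOn Ω) (hu : u ∈ Ω) (c d a b : Fin 4) :
    pd c (pd d fun v => D.g v a b) u = pd d (pd c fun v => D.g v a b) u ∧
    pd c (pd d fun v => D.g v a b) u = pd c (pd d fun v => D.g v b a) u :=
  ⟨pd_comm (h.smooth_g u hu a b) c d,
    pd_congr ((h.mem_nhds hu).mono fun _ hv => h.pd_g_symm hv d a b) c⟩

/-- The quadratic terms of the curvature tensor. -/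
def quadGamma (D : CoordFields) (u : E4) (a b c d : Fin 4) : ℝ :=
  ∑ e, D.GammaLow u e a b * D.Gamma u e c d

theorem quadGamma_symm (h : D.IsElectrovacOn Ω) (hu : u ∈ Ω) (a b c d : Fin 4) :
    quadGamma D u a b c d = quadGamma D u b a c d ∧ quadGamma D u a b c d = quadGamma D u c d a b := by
  constructor
  · exact Finset.sum_congr rfl fun e _ => by rw [h.GammaLow_symm hu]
  · simp only [quadGamma, Gamma_eq, Finset.mul_sum]
    rw [Finset.sum_comm]
    exact Finset.sum_congr rfl fun e _ => Finset.sum_congr rfl fun f _ => by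
      rw [(h.lorentz u hu).gu_symm]; ring

/-- The curvature with all indices lowered: second derivatives of the metric and a quadratic
expression in the Christoffel symbols. The symmetries of the curvature can be read off from it. -/
theorem Riem_formula (h : D.IsElectrovacOn Ω) (hu : u ∈ Ω) (a b c d : Fin 4) :
    D.Riem u a b c d = (1 / 2) * (pd c (pd b fun v => D.g v a d) u - pd c (pd a fun v => D.g v d b) u
      - pd d (pd b fun v => D.g v a c) u + pd d (pd a fun v => D.g v c b) u)
      - quadGamma D u c a d b + quadGamma D u d a c b := by
  have dG : ∀ c a b, DifferentiableAt ℝ (fun v => D.Gamma v c a b) u := fun c a b =>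
    SmoothAt.differentiableAt (h.smooth_Gamma hu c a b)
  have dg : ∀ a b, DifferentiableAt ℝ (fun v => D.g v a b) u := fun a b =>
    SmoothAt.differentiableAt (h.smooth_g u hu a b)
  have dp : ∀ i a b, DifferentiableAt ℝ (fun v => pd i (fun w => D.g w a b) v) u := fun i a b =>
    SmoothAt.differentiableAt (SmoothAt.pd (h.smooth_g u hu a b) i)
  have h1 : ∀ c d b, ∑ e, D.g u a e * pd c (fun v => D.Gamma v e d b) u
      = pd c (fun v => D.GammaLow v a d b) u
        - ∑ e, (D.GammaLow u a c e + D.GammaLow u e c a) * D.Gamma u e d b := by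
    intro c d b
    have : pd c (fun v => D.GammaLow v a d b) u
        = pd c (fun v => ∑ e, D.g v a e * D.Gamma v e d b) u :=
      pd_congr ((h.mem_nhds hu).mono fun v hv => (h.sum_g_Gamma hv a d b).symm) c
    rw [this, pd_sum fun e _ => (dg a e).fun_mul (dG e d b), ← Finset.sum_sub_distrib]
    refine Finset.sum_congr rfl fun e _ => ?_
    rw [pd_mul (dg a e) (dG e d b), h.pd_g hu]
    ring
  have h2 : ∀ c d b, ∑ e, D.g u a e * ∑ f, D.Gamma u e c f * D.Gamma u f d b
      = ∑ f, D.GammaLow u a c f * D.Gamma u f d b := by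
    intro c d b
    simp only [Finset.mul_sum]
    rw [Finset.sum_comm]
    refine Finset.sum_congr rfl fun f _ => ?_
    rw [← h.sum_g_Gamma hu, Finset.sum_mul]
    exact Finset.sum_congr rfl fun e _ => by ring
  have h3 : ∀ c d b, pd c (fun v => D.GammaLow v a d b) u = (1 / 2) * (
      pd c (pd d fun v => D.g v a b) u + pd c (pd b fun v => D.g v a d) u
      - pd c (pd a fun v => D.g v d b) u) := by
    intro c d b
    simp only [GammaLow]
    rw [pd_const_mul _ (((dp _ _ _).fun_add (dp _ _ _)).fun_sub (dp _ _ _)),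
      pd_sub ((dp _ _ _).fun_add (dp _ _ _)) (dp _ _ _), pd_add (dp _ _ _) (dp _ _ _)]
  have h4 : D.Riem u a b c d = (∑ e, D.g u a e * pd c (fun v => D.Gamma v e d b) u)
      - (∑ e, D.g u a e * pd d (fun v => D.Gamma v e c b) u)
      + (∑ e, D.g u a e * ∑ f, D.Gamma u e c f * D.Gamma u f d b)
      - ∑ e, D.g u a e * ∑ f, D.Gamma u e d f * D.Gamma u f c b := by
    rw [← Finset.sum_sub_distrib, ← Finset.sum_add_distrib, ← Finset.sum_sub_distrib, Riem]
    refine Finset.sum_congr rfl fun e _ => ?_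
    rw [Finset.sum_sub_distrib]
    ring
  rw [h4, h1, h1, h2, h2, h3, h3, (h.pd_pd_g hu d c a b).1]
  simp only [add_mul, Finset.sum_add_distrib, quadGamma]
  ring

theorem Riem_swap_left (h : D.IsElectrovacOn Ω) (hu : u ∈ Ω) (a b c d : Fin 4) :
    D.Riem u a b c d = - D.Riem u b a c d := by
  have s := fun c d a b => (h.pd_pd_g hu c d a b).2
  have q := h.quadGamma_symm hu
  rw [h.Riem_formula hu, h.Riem_formula hu]
  linarith [s c a b d, s c b d a, s d a b c, s d b c a, (q c b d a).2, (q d b c a).2]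

theorem Riem_pair (h : D.IsElectrovacOn Ω) (hu : u ∈ Ω) (a b c d : Fin 4) :
    D.Riem u a b c d = D.Riem u c d a b := by
  have s := fun c d a b => (h.pd_pd_g hu c d a b).2
  have t := fun c d a b => (h.pd_pd_g hu c d a b).1
  have q := h.quadGamma_symm hu
  rw [h.Riem_formula hu, h.Riem_formula hu]
  linarith [t a d c b, t c b a d, t a c b d, s c a b d, t b d c a, s d b c a, (q a c b d).1,
    (q c a b d).2, (q b d c a).1, (q d b c a).2, (q b c a d).1, (q c b a d).2, (q a d c b).1]

/-- The first Bianchi identity. -/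
theorem Riem_bianchi (h : D.IsElectrovacOn Ω) (hu : u ∈ Ω) (a b c d : Fin 4) :
    D.Riem u a b c d + D.Riem u a c d b + D.Riem u a d b c = 0 := by
  have s := fun c d a b => (h.pd_pd_g hu c d a b).2
  have t := fun c d a b => (h.pd_pd_g hu c d a b).1
  have q := h.quadGamma_symm hu
  rw [h.Riem_formula hu, h.Riem_formula hu, h.Riem_formula hu]
  linarith [t c b a d, t d b a c, t d c a b, s d a c b, s c a d b, s b a d c, (q c a d b).2,
    (q d b c a).1, (q b d c a).2, (q d a c b).2, (q c b d a).1, (q b c d a).2, (q b a d c).2,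
    (q d c b a).1, (q c d b a).2]

/-- The Ricci identity for a 1-form. -/
theorem ricci_identity (h : D.IsElectrovacOn Ω) (hu : u ∈ Ω) {X : E4 → Fin 4 → ℝ}
    (hX : ∀ a, ContDiffAt ℝ ∞ (fun v => X v a) u) (c a b : Fin 4) :
    D.covTwo (D.covOne X) u c a b - D.covTwo (D.covOne X) u a c b
      = - ∑ d, D.RiemUp u d b c a * X u d := by
  have dG : ∀ c a b, DifferentiableAt ℝ (fun v => D.Gamma v c a b) u := fun c a b =>
    SmoothAt.differentiableAt (h.smooth_Gamma hu c a b)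
  have dX := fun a => SmoothAt.differentiableAt (hX a)
  have dp : ∀ i a, DifferentiableAt ℝ (fun v => pd i (fun w => X w a) v) u := fun i a =>
    SmoothAt.differentiableAt (SmoothAt.pd (hX a) i)
  have h1 : ∀ c a b, pd c (fun v => D.covOne X v a b) u = pd c (pd a fun v => X v b) u
      - ∑ d, (pd c (fun v => D.Gamma v d a b) u * X u d + D.Gamma u d a b * pd c (fun v => X v d) u) := by
    intro c a b
    simp only [covOne]
    rw [pd_sub (dp _ _) (DifferentiableAt.fun_sum fun d _ => (dG _ _ _).fun_mul (dX d)),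
      pd_sum fun d _ => (dG _ _ _).fun_mul (dX d)]
    congr 1
    exact Finset.sum_congr rfl fun d _ => pd_mul (dG _ _ _) (dX d) c
  have g1 : ∀ e c a, D.Gamma u e c a = D.Gamma u e a c := fun e c a => h.Gamma_symm hu e c a
  simp only [covTwo, h1, pd_comm (hX b) c a, smul_eq_mul]
  simp only [RiemUp, covOne, g1 _ c a]
  simp only [Fin.sum_univ_four]
  ring

theorem Riem_contract (h : D.IsElectrovacOn Ω) (hu : u ∈ Ω) (b c a : Fin 4) :
    ∑ d, D.RiemUp u d b c a * D.Tlow u d = ∑ d, D.Riem u d b c a * D.T u d := by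
  simp only [Riem_eq, Tlow, Finset.mul_sum, Finset.sum_mul]
  rw [Finset.sum_comm]
  exact Finset.sum_congr rfl fun e _ => Finset.sum_congr rfl fun f _ => by
    rw [(h.lorentz u hu).symm f e]; ring

/-- The second covariant derivative of a Killing field. -/
theorem covTwo_covOne_Tlow (h : D.IsElectrovacOn Ω) (hu : u ∈ Ω) (c a b : Fin 4) :
    D.covTwo (D.covOne D.Tlow) u c a b = ∑ d, D.Riem u d c a b * D.T u d := by
  have hT := fun a => smooth_Tlow (h.smooth_g u hu) (h.smooth_T u hu) a
  have hA : ∀ c a b, D.covTwo (D.covOne D.Tlow) u c a b = - D.covTwo (D.covOne D.Tlow) u c b a :=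
    fun c a b => covTwo_neg_swap ((h.mem_nhds hu).mono fun v hv a b =>
      eq_neg_of_add_eq_zero_left ((h.equations v hv).killing a b)) c a b
  have hR : ∀ c a b, D.covTwo (D.covOne D.Tlow) u c a b - D.covTwo (D.covOne D.Tlow) u a c b
      = - ∑ d, D.Riem u d b c a * D.T u d := fun c a b => by
    rw [h.ricci_identity hu hT, h.Riem_contract hu]
  have hB : (∑ d, D.Riem u d a b c * D.T u d) + (∑ d, D.Riem u d b c a * D.T u d)
      + ∑ d, D.Riem u d c a b * D.T u d = 0 := by
    rw [← Finset.sum_add_distrib, ← Finset.sum_add_distrib]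
    refine Finset.sum_eq_zero fun d _ => ?_
    rw [← add_mul, ← add_mul, h.Riem_bianchi hu, zero_mul]
  linarith [hR c a b, hR a b c, hR b c a, hA c a b, hA a c b, hA a b c, hA b a c, hA b c a, hA c b a]

/-- By the Killing equation `∇_a T_b - ∇_b T_a = 2 ∇_a T_b`. -/
theorem Ernst_eq (h : D.IsElectrovacOn Ω) (hu : u ∈ Ω) (a b : Fin 4) :
    D.Ernst u a b = 2 * D.covOne D.Tlow u a b := by
  rw [Ernst, two_mul, sub_eq_add_neg,
    eq_neg_of_add_eq_zero_left ((h.equations u hu).killing b a), neg_neg]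

theorem smooth_covOne (h : D.IsElectrovacOn Ω) (hu : u ∈ Ω) {X : E4 → Fin 4 → ℝ}
    (hX : ∀ a, ContDiffAt ℝ ∞ (fun v => X v a) u) (a b : Fin 4) :
    ContDiffAt ℝ ∞ (fun v => D.covOne X v a b) u :=
  (SmoothAt.pd (hX b) a).sub (ContDiffAt.sum fun c _ => (h.smooth_Gamma hu _ _ _).mul (hX c))

theorem smooth_Ernst (h : D.IsElectrovacOn Ω) (hu : u ∈ Ω) (a b : Fin 4) :
    ContDiffAt ℝ ∞ (fun v => D.Ernst v a b) u :=
  (h.smooth_covOne hu (smooth_Tlow (h.smooth_g u hu) (h.smooth_T u hu)) a b).sub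
    (h.smooth_covOne hu (smooth_Tlow (h.smooth_g u hu) (h.smooth_T u hu)) b a)

theorem covTwo_Ernst (h : D.IsElectrovacOn Ω) (hu : u ∈ Ω) (c a b : Fin 4) :
    D.covTwo D.Ernst u c a b = 2 * ∑ d, D.Riem u d c a b * D.T u d := by
  rw [covTwo_congr (Y := fun v a b => 2 * D.covOne D.Tlow v a b)
    ((h.mem_nhds hu).mono fun v hv a b => h.Ernst_eq hv a b), covTwo_const_mul _ (fun a b =>
      SmoothAt.differentiableAt (h.smooth_covOne hu
        (smooth_Tlow (h.smooth_g u hu) (h.smooth_T u hu)) a b)), h.covTwo_covOne_Tlow hu]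

theorem Ernst_alt (D : CoordFields) (u : E4) (a b : Fin 4) :
    D.Ernst u a b = - D.Ernst u b a := by
  rw [Ernst, Ernst]; ring

/-- The derivative of the anti-self-dual Ernst form is the anti-self-dual part of `2 R_dcab T^d`. -/
theorem covTwo_cF (h : D.IsElectrovacOn Ω) (hu : u ∈ Ω) (c a b : Fin 4) :
    D.covTwo D.cF u c a b
      = D.asdC u (fun a b => ((2 * ∑ d, D.Riem u d c a b * D.T u d : ℝ) : ℂ)) a b := by
  have := h.covTwo_asd hu (h.smooth_Ernst hu) c a b
  simp only [h.covTwo_Ernst hu] at this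
  exact this

end IsElectrovacOn
end CoordFields

/-! ### Gradients of `T²` and Hessians of potentials -/

namespace CoordFields

variable {D : CoordFields} {Ω : Set E4} {u : E4}

theorem sum_upper_mul (h : D.IsLorentzAt u) (v : Fin 4 → ℝ) (X : Fin 4 → ℂ) :
    ∑ a, ((∑ b, D.gu u a b * v b : ℝ) : ℂ) * X a = D.dotOne u (fun a => (v a : ℂ)) X := by
  rw [dotOne, Finset.sum_comm]
  refine Finset.sum_congr rfl fun a _ => ?_
  push_cast
  rw [Finset.sum_mul]
  exact Finset.sum_congr rfl fun b _ => by rw [h.gu_symm]; ring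

theorem T_eq_sum_gu (h : D.IsLorentzAt u) (a : Fin 4) :
    D.T u a = ∑ b, D.gu u a b * D.Tlow u b := (h.sum_gu_sum_g (D.T u) a).symm

theorem sum_T_mul (h : D.IsLorentzAt u) (X : Fin 4 → ℂ) :
    ∑ a, (D.T u a : ℂ) * X a = D.dotOne u (fun a => (D.Tlow u a : ℂ)) X := by
  rw [← sum_upper_mul h]
  simp only [← T_eq_sum_gu h]

theorem ins_eq_dotOne (D : CoordFields) (u : E4) (v : Fin 4 → ℂ) (X : Fin 4 → Fin 4 → ℂ)
    (b : Fin 4) : D.ins u v X b = D.dotOne u v (fun a => X a b) := rfl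

/-- The scalar square of a covector. -/
def sqOne (D : CoordFields) (u : E4) (v : Fin 4 → ℝ) : ℝ := ∑ a, ∑ b, D.gu u a b * (v a * v b)

theorem Tsq_eq (h : D.IsLorentzAt u) : D.Tsq u = D.sqOne u (D.Tlow u) := by
  rw [Tsq, sqOne]
  refine Finset.sum_congr rfl fun a _ => ?_
  rw [T_eq_sum_gu h, Finset.mul_sum]
  exact Finset.sum_congr rfl fun b _ => by ring

theorem sqOne_ofReal (D : CoordFields) (u : E4) (v : Fin 4 → ℝ) :
    (D.sqOne u v : ℂ) = D.dotOne u (fun a => (v a : ℂ)) (fun a => (v a : ℂ)) := by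
  rw [sqOne, dotOne]
  push_cast
  rfl

namespace IsElectrovacOn

/-- The gradient of the square of a 1-form. -/
theorem pd_sqOne (h : D.IsElectrovacOn Ω) (hu : u ∈ Ω) {X : E4 → Fin 4 → ℝ}
    (hX : ∀ a, DifferentiableAt ℝ (fun v => X v a) u) (c : Fin 4) :
    pd c (fun v => D.sqOne v (X v)) u
      = 2 * ∑ a, ∑ b, D.gu u a b * X u a * D.covOne X u c b := by
  have dg : ∀ a b, DifferentiableAt ℝ (fun v => D.gu v a b) u := fun a b =>
    SmoothAt.differentiableAt (h.smooth_gu hu a b)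
  simp only [sqOne]
  rw [pd_sum fun a _ => DifferentiableAt.fun_sum fun b _ => (dg a b).fun_mul ((hX a).fun_mul (hX b))]
  have h1 : ∀ a, pd c (fun v => ∑ b, D.gu v a b * (X v a * X v b)) u
      = ∑ b, (pd c (fun v => D.gu v a b) u * (X u a * X u b)
        + D.gu u a b * (pd c (fun v => X v a) u * X u b + X u a * pd c (fun v => X v b) u)) := by
    intro a
    rw [pd_sum fun b _ => (dg a b).fun_mul ((hX a).fun_mul (hX b))]
    refine Finset.sum_congr rfl fun b _ => ?_
    rw [pd_mul (dg a b) ((hX a).fun_mul (hX b)), pd_mul (hX a) (hX b)]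
  simp only [h1, h.pd_gu hu, covOne]
  have gs := fun a b => (h.lorentz u hu).gu_symm a b
  simp only [Fin.sum_univ_four, gs 1 0, gs 2 0, gs 3 0, gs 2 1, gs 3 1, gs 3 2]
  ring

/-- The covariant derivative `∇_a T^c` of the Killing field. -/
theorem pd_T (h : D.IsElectrovacOn Ω) (hu : u ∈ Ω) (a c : Fin 4) :
    pd a (fun v => D.T v c) u + ∑ d, D.Gamma u c a d * D.T u d
      = (1 / 2) * ∑ e, D.gu u c e * D.Ernst u a e := by
  have dg : ∀ a b, DifferentiableAt ℝ (fun v => D.gu v a b) u := fun a b =>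
    SmoothAt.differentiableAt (h.smooth_gu hu a b)
  have dT := fun a => SmoothAt.differentiableAt (smooth_Tlow (h.smooth_g u hu) (h.smooth_T u hu) a)
  have h1 : pd a (fun v => D.T v c) u = pd a (fun v => ∑ e, D.gu v c e * D.Tlow v e) u :=
    pd_congr ((h.mem_nhds hu).mono fun v hv => T_eq_sum_gu (h.lorentz v hv) c) a
  rw [h1, pd_sum fun e _ => (dg c e).fun_mul (dT e)]
  simp only [pd_mul (dg c _) (dT _), h.pd_gu hu, h.Ernst_eq hu, covOne,
    T_eq_sum_gu (h.lorentz u hu)]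
  have gs := fun a b => (h.lorentz u hu).gu_symm a b
  simp only [Fin.sum_univ_four, gs 1 0, gs 2 0, gs 3 0, gs 2 1, gs 3 1, gs 3 2]
  ring

/-- `∇_c T² = -F_ac T^a`. -/
theorem pd_Tsq (h : D.IsElectrovacOn Ω) (hu : u ∈ Ω) (c : Fin 4) :
    pd c D.Tsq u = - ∑ a, D.Ernst u a c * D.T u a := by
  have h1 : pd c D.Tsq u = pd c (fun v => D.sqOne v (D.Tlow v)) u :=
    pd_congr ((h.mem_nhds hu).mono fun v hv => Tsq_eq (h.lorentz v hv)) c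
  rw [h1, h.pd_sqOne hu (fun a => SmoothAt.differentiableAt
    (smooth_Tlow (h.smooth_g u hu) (h.smooth_T u hu) a)), Finset.mul_sum, ← Finset.sum_neg_distrib]
  rw [Finset.sum_congr rfl fun a _ => Finset.mul_sum _ _ _, Finset.sum_comm]
  refine Finset.sum_congr rfl fun b _ => ?_
  rw [Ernst_alt, h.Ernst_eq hu, T_eq_sum_gu (h.lorentz u hu), Finset.mul_sum,
    ← Finset.sum_neg_distrib]
  exact Finset.sum_congr rfl fun e _ => by rw [(h.lorentz u hu).gu_symm]; ring

/-- The Hessian of a potential `f` with `∇_b f = 𝓗_ab T^a`. -/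
theorem hess_potential (h : D.IsElectrovacOn Ω) (hu : u ∈ Ω) {f : E4 → ℂ}
    (hf : ∀ v ∈ Ω, ∀ b, pd b f v = ∑ a, D.cH v a b * (D.T v a : ℂ)) (a b : Fin 4) :
    pd a (pd b f) u - ∑ c, (D.Gamma u c a b : ℂ) * pd c f u
      = ∑ c, D.covTwo D.cH u a c b * (D.T u c : ℂ)
        + ∑ c, D.cH u c b * (((1 / 2) * ∑ e, D.gu u c e * D.Ernst u a e : ℝ) : ℂ) := by
  have dH : ∀ a b, DifferentiableAt ℝ (fun v => D.cH v a b) u := fun a b =>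
    SmoothAt.differentiableAt (h.smooth_asd hu (h.smooth_H u hu) a b)
  have dT := fun a => SmoothAt.differentiableAt (h.smooth_T u hu a)
  have dTc : ∀ a, DifferentiableAt ℝ (fun v => (D.T v a : ℂ)) u := fun a =>
    Complex.ofRealCLM.differentiableAt.comp u (dT a)
  have h1 : pd a (pd b f) u = pd a (fun v => ∑ c, D.cH v c b * (D.T v c : ℂ)) u :=
    pd_congr ((h.mem_nhds hu).mono fun v hv => hf v hv b) a
  rw [h1, pd_sum fun c _ => (dH c b).fun_mul (dTc c)]
  have h2 : ∀ c, pd a (fun v => D.cH v c b * (D.T v c : ℂ)) u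
      = pd a (fun v => D.cH v c b) u * (D.T u c : ℂ)
        + D.cH u c b * ((pd a (fun v => D.T v c) u : ℝ) : ℂ) := fun c => by
    rw [pd_mul (dH c b) (dTc c), pd_ofReal (dT c)]
  simp only [h2, ← h.pd_T hu, covTwo, hf u hu, Complex.real_smul]
  push_cast
  simp only [Fin.sum_univ_four]
  ring

end IsElectrovacOn
end CoordFields

/-! ### Weyl and Ricci tensor of an electrovacuum -/

namespace CoordFields

variable {D : CoordFields} {Ω : Set E4} {u : E4}

/-- The components of a real tensor of type (0,4) in the frame `n`. -/
def frFour (n : Fin 4 → Fin 4 → ℝ) (W : Fin 4 → Fin 4 → Fin 4 → Fin 4 → ℝ) (i j k l : Fin 4) : ℝ :=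
  ∑ a, ∑ b, ∑ c, ∑ d, n i a * n j b * n k c * n l d * W a b c d

theorem frTwo_frTwo (n : Fin 4 → Fin 4 → ℝ) (W : Fin 4 → Fin 4 → Fin 4 → Fin 4 → ℝ)
    (i j k l : Fin 4) :
    frTwo n (fun c d => frTwo n (fun a b => (W a b c d : ℂ)) i j) k l = (frFour n W i j k l : ℂ) := by
  simp only [frTwo, frFour]
  norm_cast
  simp only [Finset.mul_sum]
  rw [sum_comm_four]
  refine Finset.sum_congr rfl fun _ _ => Finset.sum_congr rfl fun _ _ =>
    Finset.sum_congr rfl fun _ _ => Finset.sum_congr rfl fun _ _ => by ring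

theorem frTwo_comm (n : Fin 4 → Fin 4 → ℝ) (W : Fin 4 → Fin 4 → Fin 4 → Fin 4 → ℂ)
    (i j k l : Fin 4) :
    frTwo n (fun c d => frTwo n (fun a b => W a b c d) i j) k l
      = frTwo n (fun a b => frTwo n (fun c d => W a b c d) k l) i j := by
  simp only [frTwo, Finset.mul_sum]
  rw [sum_comm_four]
  refine Finset.sum_congr rfl fun _ _ => Finset.sum_congr rfl fun _ _ =>
    Finset.sum_congr rfl fun _ _ => Finset.sum_congr rfl fun _ _ => by ring

theorem frTwo_hodge_param (D : CoordFields) (u : E4) (n : Fin 4 → Fin 4 → ℝ)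
    (X : Fin 4 → Fin 4 → Fin 4 → Fin 4 → ℂ) (a b k l : Fin 4) :
    frTwo n (fun c d => D.hodge u (X c d) a b) k l
      = D.hodge u (fun e f => frTwo n (fun c d => X c d e f) k l) a b := by
  simp only [frTwo, hodge, Finset.mul_sum]
  rw [sum_comm_four]
  refine Finset.sum_congr rfl fun c _ => Finset.sum_congr rfl fun d _ => ?_
  rw [sum_comm_four]
  refine Finset.sum_congr rfl fun c _ => Finset.sum_congr rfl fun d _ =>
    Finset.sum_congr rfl fun e _ => Finset.sum_congr rfl fun f _ => by ring

/-- A trace can be computed in a frame. -/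
theorem IsFrame.sum_gu_mul_two {N : Matrix (Fin 4) (Fin 4) ℝ} {n : Fin 4 → Fin 4 → ℝ}
    (h : D.IsFrame u N n) (X : Fin 4 → Fin 4 → ℝ) :
    ∑ a, ∑ c, D.gu u a c * X a c = ∑ i, ∑ k, N i k * ∑ a, ∑ c, n i a * n k c * X a c := by
  simp only [h.gu_eq, Finset.sum_mul, Finset.mul_sum]
  rw [sum_comm_four]
  refine Finset.sum_congr rfl fun c _ => Finset.sum_congr rfl fun d _ =>
    Finset.sum_congr rfl fun e _ => Finset.sum_congr rfl fun f _ => by ring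

/-- The left and the right Hodge dual of a trace free tensor with the symmetries of the curvature
agree. -/
theorem IsFrame.hodge_left_eq_right {n : Fin 4 → Fin 4 → ℝ} (h : D.IsFrame u nullN n)
    (W : Fin 4 → Fin 4 → Fin 4 → Fin 4 → ℝ)
    (h1 : ∀ a b c d, W a b c d = - W b a c d) (h2 : ∀ a b c d, W a b c d = W c d a b)
    (h3 : ∀ a b c d, W a b c d + W a c d b + W a d b c = 0)
    (h4 : ∀ b d, ∑ a, ∑ c, D.gu u a c * W a b c d = 0) (a b c d : Fin 4) :
    D.hodge u (fun e f => (W e f c d : ℂ)) a b = D.hodge u (fun e f => (W a b e f : ℂ)) c d := by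
  have key : ∀ i j k l,
      frTwo n (fun c d => frTwo n (fun a b => D.hodge u (fun e f => (W e f c d : ℂ)) a b) i j) k l
      = frTwo n (fun c d => frTwo n (fun a b => D.hodge u (fun e f => (W a b e f : ℂ)) c d) i j)
        k l := by
    intro i j k l
    have e1 : ∀ c d, frTwo n (fun a b => D.hodge u (fun e f => (W e f c d : ℂ)) a b) i j = _ :=
      fun c d => h.frTwo_hodge _ i j
    have e2 : ∀ a b, frTwo n (fun c d => D.hodge u (fun e f => (W a b e f : ℂ)) c d) k l = _ :=
      fun a b => h.frTwo_hodge _ k l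
    rw [frTwo_comm n (fun a b c d => D.hodge u (fun e f => (W a b e f : ℂ)) c d)]
    simp only [e1, e2, frTwo_hodge_param]
    have e3 : ∀ p q, frTwo n (fun c d => frTwo n (fun e f => (W e f c d : ℂ)) p q) k l
        = (frFour n W p q k l : ℂ) := fun p q => frTwo_frTwo n W p q k l
    have e4 : ∀ p q, frTwo n (fun a b => frTwo n (fun e f => (W a b e f : ℂ)) p q) i j
        = (frFour n W i j p q : ℂ) := fun p q => by
      rw [← frTwo_frTwo, frTwo_comm n (fun a b c d => (W a b c d : ℂ))]
    simp only [e3]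
    have e5 : (fun e f => frTwo n (fun c d => frTwo n (fun e f => (W c d e f : ℂ)) e f) i j)
        = fun e f => (frFour n W i j e f : ℂ) := by
      funext p q; exact e4 p q
    rw [e5]
    refine flat_hodge_left_eq_right u (frFour n W) ?_ ?_ ?_ ?_ i j k l
    · intro i j k l
      simp only [frFour]
      rw [Finset.sum_comm, ← Finset.sum_neg_distrib]
      refine Finset.sum_congr rfl fun a _ => ?_
      rw [← Finset.sum_neg_distrib]
      refine Finset.sum_congr rfl fun b _ => ?_
      rw [← Finset.sum_neg_distrib]
      refine Finset.sum_congr rfl fun c _ => ?_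
      rw [← Finset.sum_neg_distrib]
      refine Finset.sum_congr rfl fun d _ => ?_
      rw [h1]; ring
    · intro i j k l
      simp only [frFour]
      rw [sum_comm_four]
      refine Finset.sum_congr rfl fun c _ => Finset.sum_congr rfl fun d _ =>
        Finset.sum_congr rfl fun e _ => Finset.sum_congr rfl fun f _ => ?_
      rw [h2]; ring
    · intro i j k l
      have e6 : frFour n W i k l j = ∑ a, ∑ b, ∑ c, ∑ d,
          n i a * n j b * n k c * n l d * W a c d b := by
        refine Finset.sum_congr rfl fun a _ => ?_
        calc _ = ∑ c, ∑ b, ∑ d, n i a * n k c * n l d * n j b * W a c d b :=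
              Finset.sum_congr rfl fun c _ => Finset.sum_comm
          _ = _ := by
              rw [Finset.sum_comm]
              refine Finset.sum_congr rfl fun d _ =>
                Finset.sum_congr rfl fun e _ => Finset.sum_congr rfl fun f _ => by ring
      have e7 : frFour n W i l j k = ∑ a, ∑ b, ∑ c, ∑ d,
          n i a * n j b * n k c * n l d * W a d b c := by
        refine Finset.sum_congr rfl fun a _ => ?_
        rw [Finset.sum_comm]
        refine Finset.sum_congr rfl fun b _ => ?_
        rw [Finset.sum_comm]
        refine Finset.sum_congr rfl fun d _ =>
          Finset.sum_congr rfl fun e _ => by ring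
      rw [e6, e7, frFour, ← Finset.sum_add_distrib, ← Finset.sum_add_distrib]
      refine Finset.sum_eq_zero fun a _ => ?_
      rw [← Finset.sum_add_distrib, ← Finset.sum_add_distrib]
      refine Finset.sum_eq_zero fun b _ => ?_
      rw [← Finset.sum_add_distrib, ← Finset.sum_add_distrib]
      refine Finset.sum_eq_zero fun c _ => ?_
      rw [← Finset.sum_add_distrib, ← Finset.sum_add_distrib]
      refine Finset.sum_eq_zero fun d _ => ?_
      linear_combination (n i a * n j b * n k c * n l d) * h3 a b c d
    · intro j l
      have e8 : ∑ i, ∑ k, nullN i k * frFour n W i j k l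
          = ∑ b, ∑ d, n j b * n l d * ∑ a, ∑ c, D.gu u a c * W a b c d := by
        simp only [h.sum_gu_mul_two, frFour, Finset.mul_sum]
        have r1 : ∀ i k, ∑ a, ∑ b, ∑ c, ∑ d, nullN i k * (n i a * n j b * n k c * n l d * W a b c d)
            = ∑ b, ∑ d, ∑ a, ∑ c, nullN i k * (n i a * n j b * n k c * n l d * W a b c d) := by
          intro i k
          calc _ = ∑ b, ∑ a, ∑ c, ∑ d, nullN i k * (n i a * n j b * n k c * n l d * W a b c d) :=
                Finset.sum_comm
            _ = ∑ b, ∑ a, ∑ d, ∑ c, nullN i k * (n i a * n j b * n k c * n l d * W a b c d) :=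
                Finset.sum_congr rfl fun _ _ => Finset.sum_congr rfl fun _ _ => Finset.sum_comm
            _ = _ := Finset.sum_congr rfl fun _ _ => Finset.sum_comm
        simp only [r1]
        rw [sum_comm_four]
        refine Finset.sum_congr rfl fun _ _ => Finset.sum_congr rfl fun _ _ =>
          Finset.sum_congr rfl fun _ _ => Finset.sum_congr rfl fun _ _ =>
          Finset.sum_congr rfl fun _ _ => Finset.sum_congr rfl fun _ _ => by ring
      simp only [h4, mul_zero, Finset.sum_const_zero] at e8
      simp only [Fin.sum_univ_four] at e8
      simp [nullN] at e8
      linarith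
  have k2 : ∀ i j, frTwo n (fun a b => D.hodge u (fun e f => (W e f c d : ℂ)) a b) i j
      = frTwo n (fun a b => D.hodge u (fun e f => (W a b e f : ℂ)) c d) i j := fun i j =>
    h.frTwo_injective (X := fun c d => frTwo n (fun a b =>
      D.hodge u (fun e f => (W e f c d : ℂ)) a b) i j) (Y := fun c d => frTwo n (fun a b =>
      D.hodge u (fun e f => (W a b e f : ℂ)) c d) i j) (fun k l => key i j k l) c d
  exact h.frTwo_injective (X := fun a b => D.hodge u (fun e f => (W e f c d : ℂ)) a b)
    (Y := fun a b => D.hodge u (fun e f => (W a b e f : ℂ)) c d) k2 a b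

namespace IsElectrovacOn

theorem Ric_symm (h : D.IsElectrovacOn Ω) (hu : u ∈ Ω) (b d : Fin 4) :
    D.Ric u b d = D.Ric u d b := by
  rw [Ric, Ric, Finset.sum_comm]
  refine Finset.sum_congr rfl fun a _ => Finset.sum_congr rfl fun c _ => ?_
  rw [h.Riem_pair hu, (h.lorentz u hu).gu_symm]

/-- The trace of the energy-momentum tensor, hence the scalar curvature, vanishes. -/
theorem Scal_eq_zero (h : D.IsElectrovacOn Ω) (hu : u ∈ Ω) : D.Scal u = 0 := by
  have hl := h.lorentz u hu
  have hE := (h.equations u hu).einstein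
  have tr : ∑ a, ∑ b, D.gu u a b * D.g u a b = 4 := by
    have : ∀ a, ∑ b, D.gu u a b * D.g u a b = 1 := fun a => by
      have := hl.sum_gu_g a a
      rw [if_pos rfl] at this
      rw [← this]
      exact Finset.sum_congr rfl fun b _ => by rw [hl.symm]
    simp [this]
  have h1 : ∑ a, ∑ b, D.gu u a b * D.Energy u a b = 0 := by
    simp only [Energy, mul_sub, Finset.sum_sub_distrib]
    have e2 : ∑ a, ∑ b, D.gu u a b * (1 / 2 * D.g u a b *
        ∑ c, ∑ d, ∑ e, ∑ f, D.gu u c e * D.gu u d f * D.H u c d * D.H u e f)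
        = 2 * ∑ c, ∑ d, ∑ e, ∑ f, D.gu u c e * D.gu u d f * D.H u c d * D.H u e f := by
      have : ∀ S : ℝ, ∑ a, ∑ b, D.gu u a b * (1 / 2 * D.g u a b * S)
          = (1 / 2 * S) * ∑ a, ∑ b, D.gu u a b * D.g u a b := fun S => by
        simp only [Finset.mul_sum]
        exact Finset.sum_congr rfl fun a _ => Finset.sum_congr rfl fun b _ => by ring
      rw [this, tr]; ring
    have e3 : ∑ a, ∑ b, D.gu u a b * (2 * ∑ c, ∑ d, D.gu u c d * D.H u a c * D.H u b d)
        = 2 * ∑ c, ∑ d, ∑ e, ∑ f, D.gu u c e * D.gu u d f * D.H u c d * D.H u e f := by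
      simp only [Finset.mul_sum]
      refine Finset.sum_congr rfl fun a _ => ?_
      rw [Finset.sum_comm]
      refine Finset.sum_congr rfl fun b _ => Finset.sum_congr rfl fun c _ =>
        Finset.sum_congr rfl fun d _ => by ring
    rw [e2, e3, sub_self]
  have h2 : ∑ a, ∑ b, D.gu u a b * (D.Ric u a b - 1 / 2 * D.Scal u * D.g u a b)
      = D.Scal u - 1 / 2 * D.Scal u * ∑ a, ∑ b, D.gu u a b * D.g u a b := by
    rw [Scal]
    simp only [mul_sub, Finset.sum_sub_distrib, Finset.mul_sum]
    congr 1
    exact Finset.sum_congr rfl fun a _ => Finset.sum_congr rfl fun b _ => by ring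
  simp only [hE] at h2
  rw [h1, tr] at h2
  linarith

/-- Einstein's equation in the trace reversed form. -/
theorem Ric_eq_Energy (h : D.IsElectrovacOn Ω) (hu : u ∈ Ω) (a b : Fin 4) :
    D.Ric u a b = D.Energy u a b := by
  rw [← (h.equations u hu).einstein, h.Scal_eq_zero hu]; ring

/-- The Weyl tensor when the scalar curvature vanishes. -/
theorem Weyl_eq (h : D.IsElectrovacOn Ω) (hu : u ∈ Ω) (a b c d : Fin 4) :
    D.Weyl u a b c d = D.Riem u a b c d - (1 / 2) * kulkarni (D.g u) (D.Ric u) a b c d := by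
  rw [Weyl, h.Scal_eq_zero hu]
  simp only [kulkarni]
  ring

/-- The anti-self-dual part of the Weyl tensor may be taken with respect to the second pair of
indices, because the Weyl tensor is trace free. -/
theorem cC_eq (h : D.IsElectrovacOn Ω) (hu : u ∈ Ω) {n : Fin 4 → Fin 4 → ℝ}
    (hn : D.IsFrame u nullN n) (a b c d : Fin 4) :
    D.cC u a b c d = D.asdC u (fun e f => (D.Weyl u a b e f : ℂ)) c d := by
  rw [cC, asdC, hn.hodge_left_eq_right (D.Weyl u)]
  · intro a b c d
    rw [h.Weyl_eq hu, h.Weyl_eq hu, h.Riem_swap_left hu]; simp only [kulkarni]; ring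
  · intro a b c d
    have hs := (h.lorentz u hu).symm
    have hr := h.Ric_symm hu
    rw [h.Weyl_eq hu, h.Weyl_eq hu, h.Riem_pair hu]; simp only [kulkarni]
    rw [hs c a, hs d b, hs c b, hs d a, hr c a, hr d b, hr c b, hr d a]; ring
  · intro a b c d
    have hs := (h.lorentz u hu).symm
    have hr := h.Ric_symm hu
    have hb := h.Riem_bianchi hu a b c d
    rw [h.Weyl_eq hu, h.Weyl_eq hu, h.Weyl_eq hu]; simp only [kulkarni]
    rw [hs d c, hs c b, hs d b, hr d c, hr c b, hr d b]
    linear_combination hb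
  · intro b d
    have hl := h.lorentz u hu
    have tr : ∑ a, ∑ c, D.gu u a c * D.g u a c = 4 := by
      have : ∀ a, ∑ b, D.gu u a b * D.g u a b = 1 := fun a => by
        have := hl.sum_gu_g a a
        rw [if_pos rfl] at this
        rw [← this]
        exact Finset.sum_congr rfl fun b _ => by rw [hl.symm]
      simp [this]
    have t2 : ∑ a, ∑ c, D.gu u a c * (D.g u a d * D.Ric u b c) = D.Ric u b d := by
      rw [Finset.sum_comm]
      calc _ = ∑ c, (∑ a, D.gu u c a * D.g u a d) * D.Ric u b c := by
            refine Finset.sum_congr rfl fun c _ => ?_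
            rw [Finset.sum_mul]
            exact Finset.sum_congr rfl fun a _ => by rw [hl.gu_symm]; ring
        _ = _ := by simp [hl.sum_gu_g]
    have t3 : ∑ a, ∑ c, D.gu u a c * (D.g u b c * D.Ric u a d) = D.Ric u b d := by
      calc _ = ∑ a, (∑ c, D.gu u a c * D.g u c b) * D.Ric u a d := by
            refine Finset.sum_congr rfl fun c _ => ?_
            rw [Finset.sum_mul]
            exact Finset.sum_congr rfl fun a _ => by rw [hl.symm]; ring
        _ = _ := by simp [hl.sum_gu_g]
    have t4 : ∑ a, ∑ c, D.gu u a c * D.Ric u a c = 0 := h.Scal_eq_zero hu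
    have t5 : ∑ a, ∑ c, D.gu u a c * D.Riem u a b c d = D.Ric u b d := rfl
    calc _ = ∑ a, ∑ c, (D.gu u a c * D.Riem u a b c d
          - (1 / 2) * (D.gu u a c * D.g u a c) * D.Ric u b d
          - (1 / 2) * D.g u b d * (D.gu u a c * D.Ric u a c)
          + (1 / 2) * (D.gu u a c * (D.g u a d * D.Ric u b c))
          + (1 / 2) * (D.gu u a c * (D.g u b c * D.Ric u a d))) := by
            refine Finset.sum_congr rfl fun a _ => Finset.sum_congr rfl fun c _ => ?_
            rw [h.Weyl_eq hu]; simp only [kulkarni]; ring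
      _ = 0 := by
        simp only [Finset.sum_add_distrib, Finset.sum_sub_distrib, ← Finset.mul_sum,
          ← Finset.sum_mul]
        rw [t2, t3, t4, t5, tr]; ring

end IsElectrovacOn
end CoordFields

/-! ### Algebra of anti-self-dual 2-forms -/

namespace CoordFields

variable {D : CoordFields} {Ω : Set E4} {u : E4}

theorem frOne_add (n : Fin 4 → Fin 4 → ℝ) (X Y : Fin 4 → ℂ) (i : Fin 4) :
    frOne n (fun a => X a + Y a) i = frOne n X i + frOne n Y i := by
  simp only [frOne, mul_add, Finset.sum_add_distrib]

theorem frOne_sub (n : Fin 4 → Fin 4 → ℝ) (X Y : Fin 4 → ℂ) (i : Fin 4) :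
    frOne n (fun a => X a - Y a) i = frOne n X i - frOne n Y i := by
  simp only [frOne, mul_sub, Finset.sum_sub_distrib]

theorem frOne_smul (n : Fin 4 → Fin 4 → ℝ) (r : ℂ) (X : Fin 4 → ℂ) (i : Fin 4) :
    frOne n (fun a => r * X a) i = r * frOne n X i := by
  simp only [frOne, Finset.mul_sum]
  exact Finset.sum_congr rfl fun _ _ => by ring

theorem frOne_conj (n : Fin 4 → Fin 4 → ℝ) (X : Fin 4 → ℂ) (i : Fin 4) :
    frOne n (fun a => cc (X a)) i = cc (frOne n X i) := by
  simp only [frOne, cc, map_sum, map_mul, Complex.conj_ofReal]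

theorem frTwo_conj (n : Fin 4 → Fin 4 → ℝ) (X : Fin 4 → Fin 4 → ℂ) (i j : Fin 4) :
    frTwo n (fun a b => cc (X a b)) i j = cc (frTwo n X i j) := by
  simp only [frTwo, cc, map_sum, map_mul, Complex.conj_ofReal]

/-- The frame components of a real covector are real. -/
theorem frOne_ofReal (n : Fin 4 → Fin 4 → ℝ) (X : Fin 4 → ℝ) (i : Fin 4) :
    frOne n (fun a => (X a : ℂ)) i = ((∑ a, n i a * X a : ℝ) : ℂ) := by
  simp only [frOne]; push_cast; rfl

namespace IsFrame

variable {N : Matrix (Fin 4) (Fin 4) ℝ} {n : Fin 4 → Fin 4 → ℝ}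

theorem dotOne_eq (h : D.IsFrame u N n) (v w : Fin 4 → ℂ) :
    D.dotOne u v w = (flat N).dotOne u (frOne n v) (frOne n w) := by
  rw [dotOne, h.sum_gu_mul, dotOne]
  simp only [flat_gu h.mul_self]

theorem frOne_ins (h : D.IsFrame u N n) (v : Fin 4 → ℂ) (X : Fin 4 → Fin 4 → ℂ) (i : Fin 4) :
    frOne n (D.ins u v X) i = (flat N).ins u (frOne n v) (frTwo n X) i := by
  have h1 : frOne n (D.ins u v X) i = D.dotOne u v (fun a => ∑ b, (n i b : ℂ) * X a b) := by
    simp only [frOne, ins, dotOne, Finset.mul_sum]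
    rw [Finset.sum_comm]
    refine Finset.sum_congr rfl fun c _ => ?_
    rw [Finset.sum_comm]
    exact Finset.sum_congr rfl fun a _ => Finset.sum_congr rfl fun b _ => by ring
  rw [h1, h.dotOne_eq]
  rfl

/-- The anti-self-dual projection can be computed in a frame. -/
theorem frTwo_asdC (h : D.IsFrame u N n) (X : Fin 4 → Fin 4 → ℂ) (i j : Fin 4) :
    frTwo n (D.asdC u X) i j = (flat N).asdC u (frTwo n X) i j := by
  have e : D.asdC u X = fun a b => (1 / 2) * (X a b + Complex.I * D.hodge u X a b) := rfl
  have e' : frTwo n (fun a b => D.hodge u X a b) i j = _ := h.frTwo_hodge X i j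
  rw [e, frTwo_smul, frTwo_add, frTwo_smul, e']
  rfl

/-- The Hodge dual squares to `-1` on 2-forms, in Lorentzian signature. -/
theorem hodge_hodge (h : D.IsFrame u nullN n) {X : Fin 4 → Fin 4 → ℂ}
    (hX : ∀ a b, X a b = - X b a) (a b : Fin 4) :
    D.hodge u (D.hodge u X) a b = - X a b := by
  have hA := frTwo_antisymm n hX
  have e : (fun i j => frTwo n (D.hodge u X) i j) = (flat nullN).hodge u (frTwo n X) := by
    funext i j; exact h.frTwo_hodge X i j
  have key : ∀ i j, frTwo n (D.hodge u (D.hodge u X)) i j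
      = frTwo n (fun a b => -1 * X a b) i j := by
    intro i j
    have e' : frTwo n (D.hodge u X) = (flat nullN).hodge u (frTwo n X) := e
    rw [h.frTwo_hodge, e', frTwo_smul,
      flat_hodge_null u _ (flat_hodge_antisymm u _)]
    simp only [flat_hodge_null u _ hA]
    have h7 := fun e => (self_eq_neg.1 (hA e e))
    fin_cases i <;> fin_cases j <;> simp [h7]
    all_goals rw [hA]
  have := h.frTwo_injective key a b
  rw [this]; ring

theorem hodge_antisymm (h : D.IsFrame u N n) (X : Fin 4 → Fin 4 → ℂ) (a b : Fin 4) :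
    D.hodge u X a b = - D.hodge u X b a := by
  have e : ∀ i j, frTwo n (fun a b => D.hodge u X a b) i j = _ := h.frTwo_hodge X
  have := h.frTwo_injective (X := D.hodge u X) (Y := fun a b => -1 * D.hodge u X b a)
    (fun i j => by
      rw [frTwo_smul, frTwo_swap n fun a b => D.hodge u X a b, e, h.frTwo_hodge,
        flat_hodge_antisymm]
      ring) a b
  rw [this]; ring

end IsFrame

/-- Some oriented null frame: from `(e₀ + e₁) / 2` and `e₀ - e₁` for an orthonormal frame `e`. -/
theorem IsLorentzAt.exists_frame (h : D.IsLorentzAt u) : ∃ n, D.IsFrame u nullN n := by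
  obtain ⟨e, he⟩ := h.exists_minkowski_frame
  have h2 : ∀ i j, D.gip u (e i) (e j) = minkN i j := fun i j => by
    rw [← frame_matrix_apply, he.metric]
  obtain ⟨n, hn, -⟩ := h.exists_null_frame (lb := (1 / 2 : ℝ) • (e 0 + e 1)) (l := e 0 + -e 1)
    (by simp only [gip_smul_left, gip_smul_right, gip_add_left, gip_add_right, h2]; simp [minkN])
    (by simp only [gip_add_left, gip_add_right, gip_neg_left, gip_neg_right, h2]; simp [minkN])
    (by
      simp only [gip_smul_left, gip_add_left, gip_add_right, gip_neg_right, h2]; simp [minkN]; norm_num)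
  exact ⟨n, hn⟩

theorem hodge_add (D : CoordFields) (u : E4) (X Y : Fin 4 → Fin 4 → ℂ) (a b : Fin 4) :
    D.hodge u (fun c d => X c d + Y c d) a b = D.hodge u X a b + D.hodge u Y a b := by
  simp only [hodge, mul_add, Finset.sum_add_distrib]

theorem hodge_smul (D : CoordFields) (u : E4) (r : ℂ) (X : Fin 4 → Fin 4 → ℂ) (a b : Fin 4) :
    D.hodge u (fun c d => r * X c d) a b = r * D.hodge u X a b := by
  simp only [hodge, Finset.mul_sum]
  exact Finset.sum_congr rfl fun _ _ => Finset.sum_congr rfl fun _ _ =>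
    Finset.sum_congr rfl fun _ _ => Finset.sum_congr rfl fun _ _ => by ring

theorem asdC_add (D : CoordFields) (u : E4) (X Y : Fin 4 → Fin 4 → ℂ) (a b : Fin 4) :
    D.asdC u (fun c d => X c d + Y c d) a b = D.asdC u X a b + D.asdC u Y a b := by
  simp only [asdC, hodge_add]; ring

theorem asdC_smul (D : CoordFields) (u : E4) (r : ℂ) (X : Fin 4 → Fin 4 → ℂ) (a b : Fin 4) :
    D.asdC u (fun c d => r * X c d) a b = r * D.asdC u X a b := by
  simp only [asdC, hodge_smul]; ring

theorem asdC_sum (D : CoordFields) (u : E4) (X : Fin 4 → Fin 4 → Fin 4 → ℂ) (a b : Fin 4) :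
    D.asdC u (fun c d => ∑ k, X k c d) a b = ∑ k, D.asdC u (X k) a b := by
  simp only [Fin.sum_univ_four, asdC_add]

namespace IsLorentzAt

theorem asdC_antisymm (h : D.IsLorentzAt u) {X : Fin 4 → Fin 4 → ℂ}
    (hX : ∀ a b, X a b = - X b a) (a b : Fin 4) : D.asdC u X a b = - D.asdC u X b a := by
  obtain ⟨n, hn⟩ := h.exists_frame
  rw [asdC, asdC, hX, hn.hodge_antisymm]; ring

/-- Anti-self-duality. -/
theorem hodge_asdC (h : D.IsLorentzAt u) {X : Fin 4 → Fin 4 → ℂ}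
    (hX : ∀ a b, X a b = - X b a) (a b : Fin 4) :
    D.hodge u (D.asdC u X) a b = -Complex.I * D.asdC u X a b := by
  obtain ⟨n, hn⟩ := h.exists_frame
  have : D.hodge u (D.asdC u X) a b
      = (1 / 2) * (D.hodge u X a b + Complex.I * D.hodge u (D.hodge u X) a b) := by
    have e : D.asdC u X = fun a b => (1 / 2) * (X a b + Complex.I * D.hodge u X a b) := rfl
    rw [e, hodge_smul, hodge_add, hodge_smul]
  rw [this, hn.hodge_hodge hX, asdC]
  linear_combination ((1 / 2) * D.hodge u X a b) * Complex.I_sq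

end IsLorentzAt

/-- A real 2-form is twice the real part of its anti-self-dual part. -/
theorem two_mul_re_asd (D : CoordFields) (X : E4 → Fin 4 → Fin 4 → ℝ) (u : E4) (a b : Fin 4) :
    2 * (D.asd X u a b).re = X u a b := by
  rw [asd_eq]
  simp

theorem asd_add_conj (D : CoordFields) (X : E4 → Fin 4 → Fin 4 → ℝ) (u : E4) (a b : Fin 4) :
    (X u a b : ℂ) = D.asd X u a b + cc (D.asd X u a b) := by
  rw [cc, Complex.add_conj, two_mul_re_asd]

/-- The Ricci tensor is the product of the anti-self-dual Maxwell form and its conjugate: the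
identity behind this, in a null frame. -/
theorem flat_energy (u : E4) (μ : ℂ) (v : Fin 4 → ℂ) (X : Fin 4 → Fin 4 → ℂ)
    (hX : ∀ i j, X i j = μ * bivec i j + cc (μ * bivec i j)) (b : Fin 4) :
    -2 * (flat nullN).ins u ((flat nullN).ins u v X) X b - (1 / 2) * v b * (flat nullN).dot u X X
      = 4 * (μ * cc μ) * reflect v b := by
  have hA : ∀ i j, X i j = - X j i := by
    intro i j
    rw [hX, hX j i]
    have : bivec i j = - bivec j i := by
      fin_cases i <;> fin_cases j <;> simp [bivec]
    rw [this]; simp [cc]; ring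
  have e01 : X 0 1 = -(μ + cc μ) := by rw [hX]; simp [bivec]; ring
  have e23 : X 2 3 = Complex.I * (μ - cc μ) := by rw [hX]; simp [bivec]; ring
  have e02 : X 0 2 = 0 := by rw [hX]; simp [bivec]
  have e03 : X 0 3 = 0 := by rw [hX]; simp [bivec]
  have e12 : X 1 2 = 0 := by rw [hX]; simp [bivec]
  have e13 : X 1 3 = 0 := by rw [hX]; simp [bivec]
  have h7 := fun e => (self_eq_neg.1 (hA e e))
  have hI := Complex.I_sq
  rw [flat_dot_null u X X hA hA, flat_ins_null, flat_ins_null, flat_ins_null, flat_ins_null,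
    flat_ins_null]
  fin_cases b <;> simp only [Fin.zero_eta, Fin.mk_one, Fin.reduceFinMk, reflect, hA 1 0, hA 2 0,
    hA 3 0, hA 2 1, hA 3 1, hA 3 2, h7, e01, e02, e03, e12, e13, e23, Matrix.cons_val]
  · linear_combination (-v 0 * (μ - cc μ) ^ 2) * hI
  · linear_combination (-v 1 * (μ - cc μ) ^ 2) * hI
  · linear_combination (v 2 * (μ - cc μ) ^ 2) * hI
  · linear_combination (v 3 * (μ - cc μ) ^ 2) * hI

end CoordFields

/-! ### Wong's tensors and the Hessian of `P` -/

namespace WongCoord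

variable {D : WongCoord} {Ω : Set E4} {u : E4}

/-- The local form of the hypotheses on `Ξ` and `V`, on an open set of a coordinate system. -/
structure IsSolutionOn (D : WongCoord) (Ω : Set E4) : Prop where
  electrovac : D.toCoordFields.IsElectrovacOn Ω
  C1_ne : D.k.C1 ≠ 0
  smooth_Xi : ∀ u ∈ Ω, ContDiffAt ℝ ∞ D.Xi u
  smooth_V : ∀ u ∈ Ω, ContDiffAt ℝ ∞ D.V u
  pd_Xi : ∀ u ∈ Ω, ∀ b, pd b D.Xi u = ∑ a, D.cH u a b * (D.T u a : ℂ)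
  pd_V : ∀ u ∈ Ω, ∀ b, pd b D.V u = ∑ a, D.k.C1⁻¹ * D.B u a b * (D.T u a : ℂ)

/-- The definition of `𝓑`, solved for the Ernst form: `𝓕 = C₁⁻¹ 𝓑 + 2 κ 𝓗`. -/
theorem cF_eq (h : D.k.C1 ≠ 0) (u : E4) (a b : Fin 4) :
    D.cF u a b = D.k.C1⁻¹ * D.B u a b + 2 * D.kap u * D.cH u a b := by
  rw [B, kap, inv_mul_cancel_left₀ h]; ring

/-- The part of the curvature term which the Ricci tensor contributes to `∇𝓕`. -/
def ricTerm (D : CoordFields) (u : E4) (a c b : Fin 4) : ℂ :=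
  ((∑ d, D.T u d * CoordFields.kulkarni (D.g u) (D.Ric u) d a c b : ℝ) : ℂ)

/-- The covariant derivative of the Ernst form, split into the Weyl and the Ricci part. -/
theorem _root_.CoordFields.IsElectrovacOn.covTwo_cF_split {D : CoordFields}
    (h : D.IsElectrovacOn Ω) (hu : u ∈ Ω) (a c b : Fin 4) :
    D.covTwo D.cF u a c b = 2 * ∑ d, (D.T u d : ℂ) * D.cC u d a c b
      + D.asdC u (ricTerm D u a) c b := by
  obtain ⟨n, hn⟩ := (h.lorentz u hu).exists_frame
  rw [h.covTwo_cF hu]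
  have e : (fun c b => ((2 * ∑ d, D.Riem u d a c b * D.T u d : ℝ) : ℂ))
      = fun c b => (2 * ∑ d, (D.T u d : ℂ) * (D.Weyl u d a c b : ℂ)) + ricTerm D u a c b := by
    funext c b
    rw [ricTerm]
    simp only [h.Weyl_eq hu]
    push_cast
    simp only [Fin.sum_univ_four]
    ring
  rw [e, CoordFields.asdC_add, CoordFields.asdC_smul, CoordFields.asdC_sum]
  simp only [CoordFields.asdC_smul, h.cC_eq hu hn]

namespace IsSolutionOn

theorem smooth_cH (h : D.IsSolutionOn Ω) (hu : u ∈ Ω) (a b : Fin 4) :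
    ContDiffAt ℝ ∞ (fun v => D.cH v a b) u :=
  h.electrovac.smooth_asd hu (h.electrovac.smooth_H u hu) a b

theorem smooth_cF (h : D.IsSolutionOn Ω) (hu : u ∈ Ω) (a b : Fin 4) :
    ContDiffAt ℝ ∞ (fun v => D.cF v a b) u :=
  h.electrovac.smooth_asd hu (fun a b => h.electrovac.smooth_Ernst hu a b) a b

/-- The product rule for `𝓑`, with `∇κ = 2 ∇Ξ̄`. -/
theorem nablaB_eq (h : D.IsSolutionOn Ω) (hu : u ∈ Ω) (c a b : Fin 4) :
    D.nablaB u c a b = D.k.C1 * (D.covTwo D.cF u c a b - 2 * D.kap u * D.covTwo D.cH u c a b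
      - 4 * cc (pd c D.Xi u) * D.cH u a b) := by
  have dH := fun a b => SmoothAt.differentiableAt (h.smooth_cH hu a b)
  have dF := fun a b => SmoothAt.differentiableAt (h.smooth_cF hu a b)
  have dX := SmoothAt.differentiableAt (h.smooth_Xi u hu)
  have dXc : DifferentiableAt ℝ (fun v => cc (D.Xi v)) u :=
    Complex.conjCLE.toContinuousLinearMap.differentiableAt.comp u dX
  have df : DifferentiableAt ℝ (fun v => 2 * cc D.k.C3 - 4 * cc (D.Xi v)) u :=
    (differentiableAt_const _).fun_sub ((differentiableAt_const (4 : ℂ)).fun_mul dXc)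
  have e : D.B = fun v a b => D.k.C1 * (D.cF v a b
      + (2 * cc D.k.C3 - 4 * cc (D.Xi v)) * D.cH v a b) := rfl
  have e2 : pd c (fun v => 2 * cc D.k.C3 - 4 * cc (D.Xi v)) u = -4 * cc (pd c D.Xi u) := by
    rw [pd_sub (differentiableAt_const _) ((differentiableAt_const (4 : ℂ)).fun_mul dXc), pd_const,
      pd_const_mul _ dXc, pd_conj dX]
    ring
  rw [nablaB, e, CoordFields.covTwo_const_mul _ fun a b =>
      (dF a b).fun_add (df.fun_mul (dH a b)),
    CoordFields.covTwo_add (X := D.cF) dF fun a b => df.fun_mul (dH a b),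
    CoordFields.covTwo_mul (X := D.cH) df dH, e2, kap]
  ring

/-- `∇_b P = -2 P² ∇_b Ξ`. -/
theorem pd_P (h : D.IsSolutionOn Ω) (hu : u ∈ Ω) (h0 : D.Xi u ≠ 0) (b : Fin 4) :
    DifferentiableAt ℝ D.P u ∧ pd b D.P u = -2 * D.P u ^ 2 * pd b D.Xi u := by
  have dX := SmoothAt.differentiableAt (h.smooth_Xi u hu)
  have e : D.P = fun v => (2 * D.Xi v)⁻¹ := by funext v; rw [P, one_div]
  have d2 : DifferentiableAt ℝ (fun v => 2 * D.Xi v) u :=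
    (differentiableAt_const (2 : ℂ)).fun_mul dX
  have h2 : (2 : ℂ) * D.Xi u ≠ 0 := mul_ne_zero two_ne_zero h0
  have dP : DifferentiableAt ℝ D.P u := by rw [e]; exact d2.fun_inv h2
  refine ⟨dP, ?_⟩
  have hP : D.P u * (2 * D.Xi u) = 1 := by rw [P, one_div, inv_mul_cancel₀ h2]
  have e1 : pd b (fun v => D.P v * (2 * D.Xi v)) u = 0 := by
    have : (fun v => D.P v * (2 * D.Xi v)) =ᶠ[𝓝 u] fun _ => 1 := by
      filter_upwards [(dX.continuousAt.eventually_ne h0)] with v hv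
      rw [P, one_div, inv_mul_cancel₀ (mul_ne_zero two_ne_zero hv)]
    rw [pd_congr this, pd_const]
  rw [pd_mul dP d2, pd_const_mul _ dX] at e1
  linear_combination (D.P u) * e1 - pd b D.P u * hP

theorem smooth_P (h : D.IsSolutionOn Ω) (hu : u ∈ Ω) (h0 : D.Xi u ≠ 0) :
    ContDiffAt ℝ ∞ D.P u := by
  have e : D.P = fun v => (2 * D.Xi v)⁻¹ := by funext v; rw [P, one_div]
  rw [e]
  exact (contDiffAt_const.mul (h.smooth_Xi u hu)).inv (mul_ne_zero two_ne_zero h0)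

theorem eventually_ne (h : D.IsSolutionOn Ω) (hu : u ∈ Ω) (h0 : D.Xi u ≠ 0) :
    ∀ᶠ v in 𝓝 u, v ∈ Ω ∧ D.Xi v ≠ 0 :=
  (h.electrovac.mem_nhds hu).and
    ((h.smooth_Xi u hu).continuousAt.eventually_ne h0)

end IsSolutionOn

/-- The Hessian `∇_a ∇_b P`. -/
def hessP (D : WongCoord) (u : E4) (a b : Fin 4) : ℂ :=
  pd a (pd b D.P) u - ∑ c, (D.Gamma u c a b : ℂ) * pd c D.P u

namespace IsSolutionOn

/-- The Hessian of `P = 1 / (2 Ξ)` from the Hessian of the potential `Ξ`. -/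
theorem hessP_eq (h : D.IsSolutionOn Ω) (hu : u ∈ Ω) (h0 : D.Xi u ≠ 0) (a b : Fin 4) :
    D.hessP u a b = 8 * D.P u ^ 3 * pd a D.Xi u * pd b D.Xi u
      - 2 * D.P u ^ 2 * (∑ c, D.covTwo D.cH u a c b * (D.T u c : ℂ)
        + ∑ c, D.cH u c b * (((1 / 2) * ∑ e, D.gu u c e * D.Ernst u a e : ℝ) : ℂ)) := by
  rw [← h.electrovac.hess_potential hu h.pd_Xi]
  have dP := (h.pd_P hu h0 a).1
  have dXb := SmoothAt.differentiableAt (SmoothAt.pd (h.smooth_Xi u hu) b)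
  have e1 : pd a (pd b D.P) u = pd a (fun v => -2 * (D.P v * D.P v) * pd b D.Xi v) u := by
    refine pd_congr ?_ a
    filter_upwards [h.eventually_ne hu h0] with v hv
    rw [(h.pd_P hv.1 hv.2 b).2]; ring
  have d2 : DifferentiableAt ℝ (fun v => -2 * (D.P v * D.P v)) u :=
    (differentiableAt_const (-2 : ℂ)).fun_mul (dP.fun_mul dP)
  rw [hessP, e1, pd_mul d2 dXb, pd_const_mul _ (dP.fun_mul dP), pd_mul dP dP,
    (h.pd_P hu h0 a).2]
  simp only [fun c => (h.pd_P hu h0 c).2, Fin.sum_univ_four]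
  ring

end IsSolutionOn

/-- `(𝓗 ⊗̃ 𝓗)_dacb T^c T^d`. -/
def spinTT (D : WongCoord) (u : E4) (a b : Fin 4) : ℂ :=
  ∑ c, ∑ d, D.spin u (D.cH u) (D.cH u) d a c b * (D.T u c : ℂ) * (D.T u d : ℂ)

namespace IsSolutionOn

/-- The Hessian of `P` differs from the error term `E(1)` only by terms which involve the fields
algebraically. -/
theorem hessP_sub_errOne (h : D.IsSolutionOn Ω) (hu : u ∈ Ω) (h0 : D.Xi u ≠ 0)
    (hk : D.kap u ≠ 0) (a b : Fin 4) :
    D.k.C1 * D.hessP u a b - D.errOne u a b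
      = 8 * D.k.C1 * D.P u ^ 3 * pd a D.Xi u * pd b D.Xi u
        - 12 * D.k.C1 * D.P u ^ 3 * D.spinTT u a b
        - 2 * D.k.C1 * D.P u ^ 2 * ∑ c, D.cH u c b * ∑ e, (D.gu u c e : ℂ) *
          (D.kap u * D.cH u a e + cc (D.kap u) * cc (D.cH u a e))
        - D.k.C1 * D.P u ^ 2 / D.kap u * (∑ c, (D.T u c : ℂ) * D.asdC u
            (ricTerm D.toCoordFields u a) c b - 4 * cc (pd a D.Xi u) * pd b D.Xi u) := by
  have hC := h.C1_ne
  -- The derivative of `𝓑`, with `∇𝓕` expressed by the curvature.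
  have e1 : ∑ c, (D.T u c : ℂ) * D.nablaB u a c b = D.k.C1 *
      (2 * ∑ c, ∑ d, D.cC u d a c b * (D.T u c : ℂ) * (D.T u d : ℂ)
        + ∑ c, (D.T u c : ℂ) * D.asdC u (ricTerm D.toCoordFields u a) c b
        - 2 * D.kap u * ∑ c, D.covTwo D.cH u a c b * (D.T u c : ℂ)
        - 4 * cc (pd a D.Xi u) * pd b D.Xi u) := by
    simp only [h.nablaB_eq hu, h.electrovac.covTwo_cF_split hu, h.pd_Xi u hu b,
      Fin.sum_univ_four]
    ring
  -- The tensor `𝓠`, with `𝓕` expressed by `𝓑` and `𝓗`.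
  have e2 : ∑ c, ∑ d, D.Q u d a c b * (D.T u c : ℂ) * (D.T u d : ℂ)
      = ∑ c, ∑ d, D.cC u d a c b * (D.T u c : ℂ) * (D.T u d : ℂ)
        - 3 * D.Ph u * (D.k.C1⁻¹ * ∑ c, ∑ d,
            D.spin u (D.B u) (D.cH u) d a c b * (D.T u c : ℂ) * (D.T u d : ℂ)
          + 2 * D.kap u * D.spinTT u a b) := by
    have hd : D.dot u (D.cF u) (D.cH u) = D.k.C1⁻¹ * D.dot u (D.B u) (D.cH u)
        + 2 * D.kap u * D.dot u (D.cH u) (D.cH u) := by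
      simp only [CoordFields.dot, cF_eq hC, Finset.mul_sum, ← Finset.sum_add_distrib]
      exact Finset.sum_congr rfl fun _ _ => Finset.sum_congr rfl fun _ _ =>
        Finset.sum_congr rfl fun _ _ => Finset.sum_congr rfl fun _ _ => by ring
    have hs : ∀ c d, D.spin u (D.cF u) (D.cH u) d a c b = D.k.C1⁻¹ *
        D.spin u (D.B u) (D.cH u) d a c b + 2 * D.kap u * D.spin u (D.cH u) (D.cH u) d a c b := by
      intro c d
      simp only [CoordFields.spin, hd, cF_eq hC]
      ring
    simp only [Q, hs, spinTT, Fin.sum_univ_four]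
    ring
  -- The real part of `C₁⁻¹ 𝓑`, which is half of `F` minus the real part of `2 κ 𝓗`.
  have e3 : ∀ c, (((D.k.C1⁻¹ * ∑ e, D.B u a e * (D.gu u e c : ℂ)).re : ℝ) : ℂ)
      = (((1 / 2) * ∑ e, D.gu u c e * D.Ernst u a e : ℝ) : ℂ)
        - ∑ e, (D.gu u c e : ℂ) * (D.kap u * D.cH u a e + cc (D.kap u) * cc (D.cH u a e)) := by
    intro c
    have e4 : ∀ e, (((D.k.C1⁻¹ * D.B u a e).re : ℝ) : ℂ) = (1 / 2) * (D.Ernst u a e : ℂ)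
        - (D.kap u * D.cH u a e + cc (D.kap u) * cc (D.cH u a e)) := by
      intro e
      have h1 : D.k.C1⁻¹ * D.B u a e = D.cF u a e - 2 * (D.kap u * D.cH u a e) := by
        rw [cF_eq hC]; ring
      have h2 := CoordFields.two_mul_re_asd D.toCoordFields D.Ernst u a e
      rw [h1, ← h2, cc, cc, ← map_mul, Complex.add_conj]
      simp [CoordFields.cF]
    have e5 : ((D.k.C1⁻¹ * ∑ e, D.B u a e * (D.gu u e c : ℂ)).re : ℝ)
        = ∑ e, D.gu u c e * (D.k.C1⁻¹ * D.B u a e).re := by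
      rw [Finset.mul_sum, Complex.re_sum]
      refine Finset.sum_congr rfl fun e _ => ?_
      rw [← mul_assoc, mul_comm, Complex.re_ofReal_mul, (h.electrovac.lorentz u hu).gu_symm]
    rw [e5]
    push_cast
    simp only [e4]
    simp only [Fin.sum_univ_four]
    ring
  have e6 : ∑ c, D.cH u c b * (((D.k.C1⁻¹ * ∑ e, D.B u a e * (D.gu u e c : ℂ)).re : ℝ) : ℂ)
      = ∑ c, D.cH u c b * (((1 / 2) * ∑ e, D.gu u c e * D.Ernst u a e : ℝ) : ℂ)
        - ∑ c, D.cH u c b * ∑ e, (D.gu u c e : ℂ) *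
          (D.kap u * D.cH u a e + cc (D.kap u) * cc (D.cH u a e)) := by
    rw [← Finset.sum_sub_distrib]
    exact Finset.sum_congr rfl fun c _ => by rw [e3, mul_sub]
  rw [errOne, e1, e2, e6, h.hessP_eq hu h0]
  change _ = _ - 12 * D.k.C1 * D.P u ^ 3 * D.spinTT u a b - _ - _
  have e7 : ∑ c, ∑ d, D.spin u (D.cH u) (D.cH u) d a c b * (D.T u c : ℂ) * (D.T u d : ℂ)
      = D.spinTT u a b := rfl
  rw [e7]
  field_simp
  ring

end IsSolutionOn
end WongCoord

/-! ### Contraction of the Hessian of `P` with `∇z` -/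

namespace CoordFields

variable {D : CoordFields} {Ω : Set E4} {u : E4}

theorem IsLorentzAt.vol_swap (h : D.IsLorentzAt u) (a b c d : Fin 4) :
    D.vol u a b c d = - D.vol u c b a d := by
  obtain ⟨f, hf, -⟩ := h.vol
  have : levi a b c d = - levi c b a d := by
    simp only [levi]; ring
  rw [hf, hf, this]; ring

theorem IsLorentzAt.Tlow_eq (h : D.IsLorentzAt u) (b : Fin 4) :
    D.Tlow u b = ∑ d, D.g u d b * D.T u d := by
  rw [Tlow]
  exact Finset.sum_congr rfl fun d _ => by rw [h.symm]

theorem dotOne_add_right (D : CoordFields) (u : E4) (v w x : Fin 4 → ℂ) :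
    D.dotOne u v (fun a => w a + x a) = D.dotOne u v w + D.dotOne u v x := by
  simp only [dotOne, mul_add, Finset.sum_add_distrib]

theorem dotOne_smul_right (D : CoordFields) (u : E4) (r : ℂ) (v w : Fin 4 → ℂ) :
    D.dotOne u v (fun a => r * w a) = r * D.dotOne u v w := by
  simp only [dotOne, Finset.mul_sum]
  exact Finset.sum_congr rfl fun _ _ => Finset.sum_congr rfl fun _ _ => by ring

theorem dotOne_sum_right (D : CoordFields) (u : E4) (v : Fin 4 → ℂ) (w : Fin 4 → Fin 4 → ℂ) :
    D.dotOne u v (fun a => ∑ k, w k a) = ∑ k, D.dotOne u v (w k) := by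
  simp only [Fin.sum_univ_four, dotOne_add_right]

/-- Raising and lowering an index: `v^a g_ab = v_b`. -/
theorem IsLorentzAt.dotOne_g (h : D.IsLorentzAt u) (v : Fin 4 → ℂ) (b : Fin 4) :
    D.dotOne u v (fun a => (D.g u a b : ℂ)) = v b := by
  have e : ∀ c, ∑ a, (D.gu u c a : ℂ) * (v c * (D.g u a b : ℂ)) = if c = b then v c else 0 := by
    intro c
    have h1 := h.sum_gu_g c b
    have h2 : ((∑ a, D.gu u c a * D.g u a b : ℝ) : ℂ) = if c = b then 1 else 0 := by
      rw [h1]; split_ifs <;> simp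
    push_cast at h2
    calc _ = v c * ∑ a, (D.gu u c a : ℂ) * (D.g u a b : ℂ) := by
          rw [Finset.mul_sum]; exact Finset.sum_congr rfl fun _ _ => by ring
      _ = _ := by rw [h2]; split_ifs <;> simp
  simp only [dotOne, e]
  simp

end CoordFields

namespace WongCoord

variable {D : WongCoord} {Ω : Set E4} {u : E4}

namespace IsSolutionOn

/-- The double contraction of `𝓗 ⊗̃ 𝓗` with `T`: the first terms of `⊗̃` give `∇Ξ ⊗ ∇Ξ`, and the
volume form in `𝓘` drops out. -/
theorem spinTT_eq (h : D.IsSolutionOn Ω) (hu : u ∈ Ω) (a b : Fin 4) :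
    D.spinTT u a b = pd a D.Xi u * pd b D.Xi u - (1 / 12) * D.cHsq u *
      ((D.Tsq u : ℂ) * (D.g u a b : ℂ) - (D.Tlow u a : ℂ) * (D.Tlow u b : ℂ)) := by
  have hL := h.electrovac.lorentz u hu
  have hv : ∑ c, ∑ d, (D.vol u d a c b : ℂ) * (D.T u c : ℂ) * (D.T u d : ℂ) = 0 := by
    have h1 : ∑ c, ∑ d, (D.vol u d a c b : ℂ) * (D.T u c : ℂ) * (D.T u d : ℂ)
        = - ∑ c, ∑ d, (D.vol u d a c b : ℂ) * (D.T u c : ℂ) * (D.T u d : ℂ) := by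
      conv_lhs => rw [Finset.sum_comm]
      simp only [← Finset.sum_neg_distrib]
      refine Finset.sum_congr rfl fun c _ => Finset.sum_congr rfl fun d _ => ?_
      rw [hL.vol_swap c a d b]
      push_cast
      ring
    exact self_eq_neg.1 h1
  rw [h.pd_Xi u hu, h.pd_Xi u hu, hL.Tlow_eq b, CoordFields.Tlow, CoordFields.Tsq, cHsq_def]
  simp only [spinTT, CoordFields.spin, CoordFields.cI, CoordFields.Tlow]
  push_cast
  simp only [Fin.sum_univ_four] at hv ⊢
  linear_combination (-(1 / 12) * Complex.I * D.dot u (D.cH u) (D.cH u)) * hv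
where
  cHsq_def : D.cHsq u = D.dot u (D.cH u) (D.cH u) := rfl

end IsSolutionOn

/-- The gradient of `z`, as a complex covector. -/
def dz (D : WongCoord) (u : E4) (b : Fin 4) : ℂ := ((pd b D.z u : ℝ) : ℂ)

/-- `T_b`, as a complex covector. -/
def Tc (D : CoordFields) (u : E4) (b : Fin 4) : ℂ := (D.Tlow u b : ℂ)

/-- The Ricci tensor, as a complex tensor. -/
def Rc (D : CoordFields) (u : E4) (a b : Fin 4) : ℂ := (D.Ric u a b : ℂ)

namespace IsSolutionOn

theorem sum_zUp_mul (h : D.IsSolutionOn Ω) (hu : u ∈ Ω) (X : Fin 4 → ℂ) :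
    ∑ a, (D.zUp u a : ℂ) * X a = D.dotOne u (D.dz u) X :=
  CoordFields.sum_upper_mul (h.electrovac.lorentz u hu) (fun b => pd b D.z u) X

/-- The contraction of the Ricci part of `∇𝓕` with a covector. -/
theorem dotOne_asdC_ricTerm (h : D.IsSolutionOn Ω) (hu : u ∈ Ω) (v : Fin 4 → ℂ) (c b : Fin 4) :
    D.dotOne u v (fun a => D.asdC u (ricTerm D.toCoordFields u a) c b)
      = D.asdC u (fun c b =>
          CoordFields.wedge (Tc D.toCoordFields u) (D.ins u v (Rc D.toCoordFields u)) c b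
          + CoordFields.wedge (D.ins u (Tc D.toCoordFields u) (Rc D.toCoordFields u)) v c b) c b := by
  have hL := h.electrovac.lorentz u hu
  have e1 : ∀ c b, D.dotOne u v (fun a => ricTerm D.toCoordFields u a c b)
      = CoordFields.wedge (Tc D.toCoordFields u) (D.ins u v (Rc D.toCoordFields u)) c b
          + CoordFields.wedge (D.ins u (Tc D.toCoordFields u) (Rc D.toCoordFields u)) v c b := by
    intro c b
    have hq : ∀ b, D.ins u (Tc D.toCoordFields u) (Rc D.toCoordFields u) b
        = ∑ d, (D.T u d : ℂ) * (D.Ric u d b : ℂ) := fun b =>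
      (CoordFields.sum_T_mul hL fun d => (D.Ric u d b : ℂ)).symm
    have e2 : ∀ a, ricTerm D.toCoordFields u a c b
        = ((D.Tlow u c : ℂ) * (D.Ric u a b : ℂ) + (-(D.Tlow u b : ℂ)) * (D.Ric u a c : ℂ))
          + ((∑ d, (D.T u d : ℂ) * (D.Ric u d c : ℂ)) * (D.g u a b : ℂ)
            + (-∑ d, (D.T u d : ℂ) * (D.Ric u d b : ℂ)) * (D.g u a c : ℂ)) := by
      intro a
      simp only [ricTerm, CoordFields.kulkarni, hL.Tlow_eq]
      push_cast
      simp only [Fin.sum_univ_four]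
      ring
    simp only [e2]
    rw [CoordFields.dotOne_add_right, CoordFields.dotOne_add_right, CoordFields.dotOne_add_right,
      CoordFields.dotOne_smul_right, CoordFields.dotOne_smul_right, CoordFields.dotOne_smul_right,
      CoordFields.dotOne_smul_right, hL.dotOne_g, hL.dotOne_g, ← hq, ← hq]
    simp only [CoordFields.wedge, CoordFields.ins_eq_dotOne, Tc, Rc]
    ring
  simp only [← e1]
  have e4 : (fun c b => D.dotOne u v (fun a => ricTerm D.toCoordFields u a c b))
      = fun c b => ∑ p, ∑ q, ((D.gu u p q : ℂ) * v p) * ricTerm D.toCoordFields u q c b := by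
    funext c b
    exact Finset.sum_congr rfl fun _ _ => Finset.sum_congr rfl fun _ _ => by ring
  rw [e4, CoordFields.asdC_sum D.toCoordFields u
    (fun p c b => ∑ q, ((D.gu u p q : ℂ) * v p) * ricTerm D.toCoordFields u q c b)]
  refine Finset.sum_congr rfl fun p _ => ?_
  rw [CoordFields.asdC_sum D.toCoordFields u
    (fun q c b => ((D.gu u p q : ℂ) * v p) * ricTerm D.toCoordFields u q c b)]
  refine Finset.sum_congr rfl fun q _ => ?_
  rw [CoordFields.asdC_smul D.toCoordFields u]
  ring

/-- The contraction of the Ricci part of `∇𝓕` with `T` and with a covector. -/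
theorem dotOne_ricTerm (h : D.IsSolutionOn Ω) (hu : u ∈ Ω) (v : Fin 4 → ℂ) (b : Fin 4) :
    D.dotOne u v (fun a => ∑ c, (D.T u c : ℂ) * D.asdC u (ricTerm D.toCoordFields u a) c b)
      = D.ins u (Tc D.toCoordFields u) (D.asdC u fun c b =>
          CoordFields.wedge (Tc D.toCoordFields u) (D.ins u v (Rc D.toCoordFields u)) c b
          + CoordFields.wedge (D.ins u (Tc D.toCoordFields u) (Rc D.toCoordFields u)) v c b) b := by
  rw [CoordFields.ins_eq_dotOne]
  change _ = D.dotOne u (fun a => (D.Tlow u a : ℂ)) _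
  rw [← CoordFields.sum_T_mul (h.electrovac.lorentz u hu)]
  simp only [← h.dotOne_asdC_ricTerm hu]
  have e5 : ∀ A : Fin 4 → Fin 4 → ℂ, D.dotOne u v (fun a => ∑ c, (D.T u c : ℂ) * A a c)
      = ∑ c, (D.T u c : ℂ) * D.dotOne u v (fun a => A a c) := by
    intro A
    simp only [CoordFields.dotOne, Fin.sum_univ_four]
    ring
  exact e5 _

/-- The terms of the Hessian which are quadratic in the Maxwell form, contracted with a covector. -/
theorem dotOne_quad (h : D.IsSolutionOn Ω) (hu : u ∈ Ω) (v : Fin 4 → ℂ) (b : Fin 4) :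
    D.dotOne u v (fun a => ∑ c, D.cH u c b * ∑ e, (D.gu u c e : ℂ) *
          (D.kap u * D.cH u a e + cc (D.kap u) * cc (D.cH u a e)))
      = D.kap u * D.ins u (D.ins u v (D.cH u)) (D.cH u) b
        + cc (D.kap u) * D.ins u (D.ins u v fun a e => cc (D.cH u a e)) (D.cH u) b := by
  have hL := h.electrovac.lorentz u hu
  have e1 : ∀ A : Fin 4 → Fin 4 → ℂ, D.dotOne u v (fun a => ∑ c, D.cH u c b * ∑ e,
      (D.gu u c e : ℂ) * A a e) = D.ins u (D.ins u v A) (D.cH u) b := by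
    intro A
    have e2 : D.dotOne u v (fun a => ∑ c, D.cH u c b * ∑ e, (D.gu u c e : ℂ) * A a e)
        = ∑ c, ∑ e, D.cH u c b * (D.gu u c e : ℂ) * D.dotOne u v (fun a => A a e) := by
      have e3 : ∀ a, ∑ c, D.cH u c b * ∑ e, (D.gu u c e : ℂ) * A a e
          = ∑ c, ∑ e, D.cH u c b * (D.gu u c e : ℂ) * A a e := fun a =>
        Finset.sum_congr rfl fun c _ => by
          rw [Finset.mul_sum]; exact Finset.sum_congr rfl fun e _ => by ring
      simp only [e3, CoordFields.dotOne_sum_right, CoordFields.dotOne_smul_right]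
    rw [e2, CoordFields.ins, Finset.sum_comm]
    refine Finset.sum_congr rfl fun c _ => Finset.sum_congr rfl fun e _ => ?_
    rw [CoordFields.ins_eq_dotOne, hL.gu_symm]
    ring
  have e4 := e1 fun a e => D.kap u * D.cH u a e + cc (D.kap u) * cc (D.cH u a e)
  rw [e4, CoordFields.ins_eq_dotOne, CoordFields.ins_eq_dotOne, CoordFields.ins_eq_dotOne]
  have e5 : D.ins u v (fun a e => D.kap u * D.cH u a e + cc (D.kap u) * cc (D.cH u a e))
      = fun e => D.kap u * D.ins u v (D.cH u) e
        + cc (D.kap u) * D.ins u v (fun a e => cc (D.cH u a e)) e := by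
    funext e
    simp only [CoordFields.ins_eq_dotOne, CoordFields.dotOne_add_right,
      CoordFields.dotOne_smul_right]
  rw [e5]
  simp only [CoordFields.dotOne, Finset.mul_sum, ← Finset.sum_add_distrib]
  exact Finset.sum_congr rfl fun _ _ => Finset.sum_congr rfl fun _ _ => by ring

/-- The contraction of the Hessian of `P` with the gradient of `z`. -/
theorem zUp_hessP (h : D.IsSolutionOn Ω) (hu : u ∈ Ω) (h0 : D.Xi u ≠ 0)
    (hk : D.kap u ≠ 0) (b : Fin 4) :
    ∑ a, (D.zUp u a : ℂ) * (D.k.C1 * D.hessP u a b - D.errOne u a b)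
      = -4 * D.k.C1 * D.P u ^ 3 * D.dotOne u (D.dz u) (fun a => pd a D.Xi u) * pd b D.Xi u
        + D.k.C1 * D.P u ^ 3 * D.cHsq u * ((D.Tsq u : ℂ) * D.dz u b
          - D.dotOne u (D.dz u) (Tc D.toCoordFields u) * Tc D.toCoordFields u b)
        - 2 * D.k.C1 * D.P u ^ 2 *
          (D.kap u * D.ins u (D.ins u (D.dz u) (D.cH u)) (D.cH u) b
          + cc (D.kap u) * D.ins u (D.ins u (D.dz u) fun a e => cc (D.cH u a e)) (D.cH u) b)
        - D.k.C1 * D.P u ^ 2 / D.kap u * (D.ins u (Tc D.toCoordFields u) (D.asdC u fun c b =>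
          CoordFields.wedge (Tc D.toCoordFields u) (D.ins u (D.dz u) (Rc D.toCoordFields u)) c b
          + CoordFields.wedge (D.ins u (Tc D.toCoordFields u) (Rc D.toCoordFields u)) (D.dz u) c b)
            b - 4 * D.dotOne u (D.dz u) (fun a => cc (pd a D.Xi u)) * pd b D.Xi u) := by
  have hL := h.electrovac.lorentz u hu
  rw [← h.dotOne_ricTerm hu, ← h.dotOne_quad hu, h.sum_zUp_mul hu]
  have e : ∀ a, D.k.C1 * D.hessP u a b - D.errOne u a b
      = (-4 * D.k.C1 * D.P u ^ 3 * pd b D.Xi u) * pd a D.Xi u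
      + ((D.k.C1 * D.P u ^ 3 * D.cHsq u * (D.Tsq u : ℂ)) * (D.g u a b : ℂ)
      + ((-D.k.C1 * D.P u ^ 3 * D.cHsq u * (D.Tlow u b : ℂ)) * Tc D.toCoordFields u a
      + ((-2 * D.k.C1 * D.P u ^ 2) * (∑ c, D.cH u c b * ∑ e, (D.gu u c e : ℂ) *
          (D.kap u * D.cH u a e + cc (D.kap u) * cc (D.cH u a e)))
      + ((-D.k.C1 * D.P u ^ 2 / D.kap u) * (∑ c, (D.T u c : ℂ) * D.asdC u
            (ricTerm D.toCoordFields u a) c b)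
      + (4 * D.k.C1 * D.P u ^ 2 / D.kap u * pd b D.Xi u) * cc (pd a D.Xi u))))) := by
    intro a
    rw [h.hessP_sub_errOne hu h0 hk, h.spinTT_eq hu, Tc]
    ring
  simp only [e]
  simp only [CoordFields.dotOne_add_right, CoordFields.dotOne_smul_right, hL.dotOne_g]
  rw [Tc]
  ring

end IsSolutionOn
end WongCoord

/-! ### The gradient identity in a null frame -/

namespace CoordFields

variable {D : CoordFields} {Ω : Set E4} {u : E4}

theorem flat_ins_smul (u : E4) (r : ℂ) (v : Fin 4 → ℂ) (X : Fin 4 → Fin 4 → ℂ) (b : Fin 4) :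
    (flat nullN).ins u v (fun i j => r * X i j) b = r * (flat nullN).ins u v X b := by
  simp only [flat_ins_null]; ring

theorem flat_ins_smul_left (u : E4) (r : ℂ) (v : Fin 4 → ℂ) (X : Fin 4 → Fin 4 → ℂ) (b : Fin 4) :
    (flat nullN).ins u (fun i => r * v i) X b = r * (flat nullN).ins u v X b := by
  simp only [flat_ins_null]; ring

theorem bivec_antisymm (i j : Fin 4) : bivec i j = - bivec j i := by
  fin_cases i <;> fin_cases j <;> simp [bivec]

/-- `∇^a z ∇_a (C₁ P)` in a null frame: its real part is half the defect of `T²`. -/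
theorem flat_dotOne_frW (u : E4) (τ : Fin 4 → ℝ) (q : ℂ) (z : Fin 4 → ℝ)
    (hz : ∀ i, z i = -(q * frW τ i).im) (tsq : ℝ)
    (ht : tsq = -2 * τ 0 * τ 1 + τ 2 ^ 2 + τ 3 ^ 2) :
    q * (flat nullN).dotOne u (fun i => (z i : ℂ)) (frW τ)
      = -((((1 - q ^ 2) * tsq).im / 2 : ℝ)
        + Complex.I * ((-2 * z 0 * z 1 + z 2 ^ 2 + z 3 ^ 2 : ℝ) : ℂ)) := by
  obtain ⟨x, y⟩ := q
  rw [flat_dotOne_null, ht]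
  have z0 : z 0 = y * τ 0 := by rw [hz]; simp [frW]
  have z1 : z 1 = -(y * τ 1) := by rw [hz]; simp [frW]
  have z2 : z 2 = x * τ 3 := by rw [hz]; simp [frW]
  have z3 : z 3 = -(x * τ 2) := by rw [hz]; simp [frW]
  apply Complex.ext <;> simp [pow_two, frW, z0, z1, z2, z3] <;> ring

/-- `T` is orthogonal to the gradient of `z`. -/
theorem flat_dotOne_orthogonal (u : E4) (τ : Fin 4 → ℝ) (q : ℂ) (z : Fin 4 → ℝ)
    (hz : ∀ i, z i = -(q * frW τ i).im) :
    (flat nullN).dotOne u (fun i => (z i : ℂ)) (fun i => (τ i : ℂ)) = 0 := by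
  obtain ⟨x, y⟩ := q
  rw [flat_dotOne_null]
  have z0 : z 0 = y * τ 0 := by rw [hz]; simp [frW]
  have z1 : z 1 = -(y * τ 1) := by rw [hz]; simp [frW]
  have z2 : z 2 = x * τ 3 := by rw [hz]; simp [frW]
  have z3 : z 3 = -(x * τ 2) := by rw [hz]; simp [frW]
  rw [z0, z1, z2, z3]
  push_cast
  ring

/-- The reflection of the gradient of `z` is expressed by the null components of the error. -/
theorem reflect_grad (τ : Fin 4 → ℝ) (q : ℂ) (z : Fin 4 → ℝ)
    (hz : ∀ i, z i = -(q * frW τ i).im) (i : Fin 4) :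
    reflect (fun i => (z i : ℂ)) i = z i + 2 * ((![-((1 - q) * frW τ 0).im,
      -((1 - q) * frW τ 1).im, 0, 0] : Fin 4 → ℝ) i : ℂ) := by
  fin_cases i <;> simp [reflect, hz, frW] <;> ring

/-- The gradient identity, as a relation of the components in a null frame. -/
theorem gradient_identity {C1 P Ph κ : ℂ} (hC : C1 ≠ 0) (hP : P ≠ 0) (hPh : Ph ≠ 0) (hκ : κ ≠ 0)
    (u : E4) (τ : Fin 4 → ℝ) (y z : Fin 4 → ℝ) (tsq v : ℝ)
    (hz : ∀ i, z i = -(P ^ 2 / Ph ^ 2 * frW τ i).im)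
    (hy : ∀ i, y i = -(P ^ 2 / Ph ^ 2 * frW τ i).re)
    (ht : tsq = -2 * τ 0 * τ 1 + τ 2 ^ 2 + τ 3 ^ 2)
    (hnorm : (C1 * P).im * (tsq + 1 + 2 * v) = (cc C1 * (cc P / P) * κ).im)
    (N : Fin 4 → ℝ) (hN : N = ![-((1 - P ^ 2 / Ph ^ 2) * frW τ 0).im,
      -((1 - P ^ 2 / Ph ^ 2) * frW τ 1).im, 0, 0])
    (μ A dd : ℂ) (hμ : μ = 1 / (2 * C1 * Ph ^ 2))
    (hA : A = C1 * P ^ 3 * cc P / (Ph ^ 2 * cc Ph ^ 2))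
    (hdd : dd = (((1 - P ^ 4 / Ph ^ 4) * tsq).im : ℝ))
    (b : Fin 4) (G dP : ℂ) (hdP : C1 * dP = -(P ^ 2 / Ph ^ 2 * frW τ b))
    (hG : G = -4 * C1 * P ^ 3 * μ ^ 2 * (flat nullN).dotOne u (fun i => (z i : ℂ)) (frW τ) * frW τ b
      - 4 * C1 * P ^ 3 * μ ^ 2 * tsq * z b
      - 2 * C1 * P ^ 2 * (κ * μ ^ 2 * z b - cc κ * (μ * cc μ) * reflect (fun i => (z i : ℂ)) b)
      + 4 * C1 * P ^ 2 / κ * (μ * cc μ) * ((flat nullN).dotOne u (fun i => (z i : ℂ))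
          (fun i => cc (frW τ i)) * frW τ b
        - (flat nullN).ins u (fun i => (τ i : ℂ)) ((flat nullN).asdC u fun i j =>
          wedge (fun i => (τ i : ℂ)) (reflect fun i => (z i : ℂ)) i j
          + wedge (reflect fun i => (τ i : ℂ)) (fun i => (z i : ℂ)) i j) b)) :
    (2 * (C1 * P).re * y b + 2 * (C1 * P).im * z b) * (-2 * z 0 * z 1 + z 2 ^ 2 + z 3 ^ 2)
      + 2 * ‖C1 * P‖ ^ 2 * G.im + 2 * (C1 * P).im * z b
      - 2 * ‖C1 * P‖ ^ 2 * ((tsq / C1 * (1 / P - P ^ 3 / Ph ^ 4)).im * z b)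
      - ((C1 * P).im * y b - (C1 * P).re * z b) * dd.re
      - ((P ^ 2 * cc Ph ^ 2 / (cc P ^ 2 * Ph ^ 2) - 1) * (A * tsq / κ) * (z b : ℂ)
        + C1 ^ 2 * P / (κ * cc P) * dd * dP - 2 * (A * tsq / κ) * (N b : ℂ)).im
      - (- (cc C1 * (cc P / P) * (P ^ 4 / Ph ^ 4 - 1) * κ
          - C1 * (P / cc P) * (P ^ 2 * cc P ^ 2 / (Ph ^ 2 * cc Ph ^ 2) - 1) * cc κ).im * z b
        + (2 * A * cc κ * (N b : ℂ)).im)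
      + 4 * (C1 * P).im * v * z b = 0 := by
  have hPc : cc P ≠ 0 := (map_ne_zero _).2 hP
  have hCc : cc C1 ≠ 0 := (map_ne_zero _).2 hC
  have hPhc : cc Ph ≠ 0 := (map_ne_zero _).2 hPh
  -- All coefficients are expressed by `q = P² / P̂²` and `α = C₁ P / P̄`.
  obtain ⟨q, hq⟩ : ∃ q, q = P ^ 2 / Ph ^ 2 := ⟨_, rfl⟩
  have hqc : cc q = cc P ^ 2 / cc Ph ^ 2 := by rw [hq]; simp [cc]
  obtain ⟨α, hα⟩ : ∃ α, α = C1 * (P / cc P) := ⟨_, rfl⟩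
  have hαc : cc α = cc C1 * (cc P / P) := by rw [hα]; simp [cc]
  have hq2 : P ^ 4 / Ph ^ 4 = q ^ 2 := by rw [hq]; field_simp
  have hμq : μ = q / (2 * C1 * P ^ 2) := by rw [hμ, hq]; field_simp
  have hμc : cc μ = cc q / (2 * cc C1 * cc P ^ 2) := by
    rw [hμq]; simp only [cc, map_div₀, map_mul, map_pow, map_ofNat]
  have hAα : A = α * (q * cc q) := by rw [hA, hα, hqc, hq]; field_simp
  have hn : ∀ w : ℂ, 2 * ‖C1 * P‖ ^ 2 * w.im = (2 * (C1 * P) * cc (C1 * P) * w).im := by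
    intro w
    have : 2 * (C1 * P) * cc (C1 * P) * w = ((2 * ‖C1 * P‖ ^ 2 : ℝ) : ℂ) * w := by
      rw [mul_assoc (2 : ℂ), cc, Complex.mul_conj, Complex.normSq_eq_norm_sq]; push_cast; ring
    rw [this, Complex.im_ofReal_mul]
  have hL := flat_curvature_terms u τ q z (fun i => by rw [hz, hq]) (fun i => (N i : ℂ))
    (fun i => by rw [hN, ← hq]) tsq ht b
  have hE := flat_dotOne_frW u τ q z (fun i => by rw [hz, hq]) tsq ht
  have hS := reflect_grad τ q z (fun i => by rw [hz, hq]) b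
  rw [← hq] at hN
  rw [← hN] at hS
  set X := (flat nullN).ins u (fun i => (τ i : ℂ)) ((flat nullN).asdC u fun i j =>
          wedge (fun i => (τ i : ℂ)) (reflect fun i => (z i : ℂ)) i j
          + wedge (reflect fun i => (τ i : ℂ)) (fun i => (z i : ℂ)) i j) b
  set dw := (flat nullN).dotOne u (fun i => (z i : ℂ)) (frW τ)
  set dwc := (flat nullN).dotOne u (fun i => (z i : ℂ)) (fun i => cc (frW τ i))
  have hwb : q * frW τ b = -((y b : ℂ) + Complex.I * (z b : ℂ)) := by
    rw [hy, hz, ← hq]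
    apply Complex.ext <;> simp
  obtain ⟨xx, hxx⟩ : ∃ xx, xx = -2 * z 0 * z 1 + z 2 ^ 2 + z 3 ^ 2 := ⟨_, rfl⟩
  rw [← hxx] at hE ⊢
  rw [hq2] at hdd
  have hdd' : dd = ((((1 - q ^ 2) * tsq).im : ℝ) : ℂ) := hdd
  have hdr : ((1 - q ^ 2) * (tsq : ℂ)).im = dd.re := by rw [hdd', Complex.ofReal_re]
  obtain ⟨d, hd⟩ : ∃ d : ℝ, dd.re = d := ⟨_, rfl⟩
  have hddd : dd = (d : ℂ) := by rw [hdd', hdr, hd]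
  rw [hdr, hd] at hE
  -- The contracted Hessian, with the curvature terms replaced by those of `flat_curvature_terms`.
  have hGG : 2 * (C1 * P) * cc (C1 * P) * G
      = -2 * cc (C1 * P) * (((d / 2 : ℝ) : ℂ) + Complex.I * (xx : ℂ)) *
          ((y b : ℂ) + Complex.I * (z b : ℂ))
        - 2 * cc (C1 * P) * q ^ 2 * tsq * z b - q ^ 2 * cc α * κ * z b
        + q * cc q * α * cc κ * (z b + 2 * (N b : ℂ))
        + α / κ * (q * (q - cc q) * tsq * z b + ((q ^ 2).im : ℂ) * tsq * q * frW τ b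
        - 2 * q * cc q * tsq * (N b : ℂ)) := by
    rw [← hL, ← hS, hαc, hα, hG, hμc, hμq]
    have e1 : cc (C1 * P) = cc C1 * cc P := map_mul _ _ _
    rw [e1]
    have e2 : (q * dw) * (q * frW τ b) = (((d / 2 : ℝ) : ℂ) + Complex.I * (xx : ℂ)) *
          ((y b : ℂ) + Complex.I * (z b : ℂ)) := by rw [hE, hwb]; ring
    rw [mul_assoc (-2 * (cc C1 * cc P)), ← e2]
    field_simp
    ring
  have hT : 2 * (C1 * P) * cc (C1 * P) * (tsq / C1 * (1 / P - P ^ 3 / Ph ^ 4))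
      = 2 * cc (C1 * P) * tsq * (1 - q ^ 2) := by
    rw [hq]; field_simp
  have h3 : (P ^ 2 * cc Ph ^ 2 / (cc P ^ 2 * Ph ^ 2) - 1) * (A * tsq / κ) * (z b : ℂ)
        + C1 ^ 2 * P / (κ * cc P) * dd * dP - 2 * (A * tsq / κ) * (N b : ℂ)
      = α / κ * (q * (q - cc q) * tsq * z b + ((q ^ 2).im : ℂ) * tsq * q * frW τ b
        - 2 * q * cc q * tsq * (N b : ℂ)) := by
    have e1 : P ^ 2 * cc Ph ^ 2 / (cc P ^ 2 * Ph ^ 2) * (q * cc q) = q * q := by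
      rw [hqc, hq]; field_simp
    have e2 : C1 ^ 2 * P / (κ * cc P) * dd * dP = α / κ * dd * (C1 * dP) := by
      rw [hα]; field_simp
    have e3 : dd = - (((q ^ 2).im : ℝ) : ℂ) * (tsq : ℂ) := by
      rw [hdd', Complex.im_mul_ofReal]; simp
    rw [e2, hdP, hAα, e3, ← hq]
    linear_combination (α * tsq / κ * z b) * e1
  have h4 : cc C1 * (cc P / P) * (P ^ 4 / Ph ^ 4 - 1) * κ
          - C1 * (P / cc P) * (P ^ 2 * cc P ^ 2 / (Ph ^ 2 * cc Ph ^ 2) - 1) * cc κ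
      = cc α * (q ^ 2 - 1) * κ - α * (q * cc q - 1) * cc κ := by
    have e1 : P ^ 2 * cc P ^ 2 / (Ph ^ 2 * cc Ph ^ 2) = q * cc q := by
      rw [hqc, hq]; field_simp
    rw [hαc, hα, hq2, e1]
  rw [← hαc] at hnorm
  have hn2 := hn (tsq / C1 * (1 / P - P ^ 3 / Ph ^ 4))
  rw [hT] at hn2
  rw [hn G, hGG, ← mul_assoc, hn2, h3, h4, hd, hAα]
  set E3 := α / κ * (q * (q - cc q) * tsq * z b + ((q ^ 2).im : ℂ) * tsq * q * frW τ b
        - 2 * q * cc q * tsq * (N b : ℂ))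
  have hs : ∀ (w : ℂ) (r : ℝ), (w * r).im = w.im * r := fun w r => Complex.im_mul_ofReal w r
  have hac : (α * cc κ).im = -(cc α * κ).im := by
    rw [← Complex.conj_im]; simp [cc]
  generalize C1 * P = ζ at *
  clear_value E3
  have hr1 : (-2 * cc ζ * (((d / 2 : ℝ) : ℂ) + Complex.I * (xx : ℂ)) *
          ((y b : ℂ) + Complex.I * (z b : ℂ))).im
      = d * (ζ.im * y b - ζ.re * z b) - 2 * xx * (ζ.re * y b + ζ.im * z b) := by
    simp [cc]; ring
  -- Regroup by the terms of the error; the terms `-ᾱ κ z_b` and `α κ̄ z_b` which are left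
  -- over have equal imaginary parts, and `hnorm` replaces them by terms with `T²` and `Re V`.
  have e5 : -2 * cc ζ * (((d / 2 : ℝ) : ℂ) + Complex.I * (xx : ℂ)) *
          ((y b : ℂ) + Complex.I * (z b : ℂ))
        - 2 * cc ζ * q ^ 2 * tsq * z b - q ^ 2 * cc α * κ * z b
        + q * cc q * α * cc κ * (z b + 2 * (N b : ℂ)) + E3
      = -2 * cc ζ * (((d / 2 : ℝ) : ℂ) + Complex.I * (xx : ℂ)) *
          ((y b : ℂ) + Complex.I * (z b : ℂ)) + 2 * cc ζ * tsq * (1 - q ^ 2) * z b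
        - 2 * cc ζ * (tsq * z b : ℝ) - (cc α * (q ^ 2 - 1) * κ - α * (q * cc q - 1) * cc κ) * z b
        - (cc α * κ) * z b + (α * cc κ) * z b + 2 * (α * (q * cc q)) * cc κ * (N b : ℂ) + E3 := by
    push_cast; ring
  rw [e5]
  simp only [Complex.add_im, Complex.sub_im, hr1, hs, hac]
  have e6 : (2 * cc ζ).im = -2 * ζ.im := by simp [cc]
  rw [e6]
  linear_combination (2 * z b) * hnorm

end CoordFields

/-! ### Existence and use of the principal null pair -/

namespace WongCoord

variable {D : WongCoord} {Ω : Set E4} {u : E4}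

theorem ip_eq_gip (hL : D.IsLorentzAt u) (v w : Fin 4 → ℝ) : D.ip u v w = D.gip u v w := by
  rw [hL.gip_comm, CoordFields.gip_eq_sum, ip]
  refine Finset.sum_congr rfl fun a _ => ?_
  rw [low, Finset.sum_mul]
  exact Finset.sum_congr rfl fun b _ => by ring

namespace IsSolutionOn

theorem cH_antisymm (h : D.IsSolutionOn Ω) (hu : u ∈ Ω) (a b : Fin 4) :
    D.cH u a b = - D.cH u b a :=
  (h.electrovac.lorentz u hu).asdC_antisymm (X := fun a b => (D.H u a b : ℂ))
    (fun a b => by rw [h.electrovac.H_alt u hu a b]; push_cast; ring) a b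

/-- Existence of principal null vectors. -/
theorem exists_principal_pair (h : D.IsSolutionOn Ω) (hu : u ∈ Ω) (hH : D.cHsq u ≠ 0)
    (hP : D.Ph u ^ 4 = -1 / (D.k.C1 ^ 2 * D.cHsq u)) : ∃ lb l, D.IsPrincipalNullPair u lb l := by
  have hL := h.electrovac.lorentz u hu
  have hC := h.C1_ne
  have hP0 : D.Ph u ≠ 0 := by
    intro h0
    rw [h0, zero_pow (by norm_num), eq_comm, div_eq_zero_iff] at hP
    rcases hP with hP | hP
    · norm_num at hP
    · exact mul_ne_zero (pow_ne_zero 2 hC) hH hP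
  obtain ⟨lb, l, h1, h2, h3, h4⟩ := hL.exists_null_pair (X := D.cH u)
    (μ := 1 / (2 * D.k.C1 * D.Ph u ^ 2)) (h.cH_antisymm hu)
    (hL.hodge_asdC (X := fun a b => (D.H u a b : ℂ)) fun a b => by
      rw [h.electrovac.H_alt u hu a b]; push_cast; ring)
    (one_div_ne_zero (mul_ne_zero (mul_ne_zero two_ne_zero hC) (pow_ne_zero 2 hP0))) (by
      change D.cHsq u = _
      field_simp at hP ⊢
      linear_combination 4 * hP)
  refine ⟨lb, l, by rw [ip_eq_gip hL, h1], by rw [ip_eq_gip hL, h2], by rw [ip_eq_gip hL, h3],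
    fun a b => ?_⟩
  rw [h4, CoordFields.nullBivec]
  simp only [low]
  push_cast
  rfl

end IsSolutionOn

namespace IsPrincipalNullPair

variable {lb l : Fin 4 → ℝ}

theorem cH_eq (hp : D.IsPrincipalNullPair u lb l) (a b : Fin 4) :
    D.cH u a b = 1 / (2 * D.k.C1 * D.Ph u ^ 2) * D.nullBivec u lb l a b := by
  rw [hp.decomposition, CoordFields.nullBivec]
  simp only [low]
  push_cast
  rfl

theorem exists_frame (hp : D.IsPrincipalNullPair u lb l) (hL : D.IsLorentzAt u) :
    ∃ n, D.IsFrame u nullN n ∧ n 0 = lb ∧ n 1 = l :=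
  hL.exists_null_frame (by rw [← ip_eq_gip hL, hp.null_lb]) (by rw [← ip_eq_gip hL, hp.null_l])
    (by rw [← ip_eq_gip hL, hp.normalized])

end IsPrincipalNullPair

open CoordFields in
/-- The principal bivector in an adapted null frame. -/
theorem frTwo_nullBivec_adapted {D : CoordFields} {n : Fin 4 → Fin 4 → ℝ}
    (hn : D.IsFrame u nullN n) (i j : Fin 4) :
    frTwo n (D.nullBivec u (n 0) (n 1)) i j = bivec i j := by
  have e : ∀ m : Fin 4, n m = fun b => ∑ k, (Pi.single m 1 : Fin 4 → ℝ) k * n k b := by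
    intro m; funext b; simp [Pi.single_apply]
  have h1 := hn.frTwo_nullBivec (Pi.single 0 1) (Pi.single 1 1) i j
  rw [← e 0, ← e 1] at h1
  rw [h1]
  fin_cases i <;> fin_cases j <;> simp [nullN, bivec, levi, Pi.single_apply]
  all_goals norm_num

open CoordFields in
/-- The frame components of a lowered frame vector. -/
theorem frOne_low_adapted {D : WongCoord} {n : Fin 4 → Fin 4 → ℝ}
    (hn : D.IsFrame u nullN n) (m i : Fin 4) :
    ∑ a, n i a * D.low u (n m) a = nullN i m := by
  have e : n m = fun b => ∑ k, (Pi.single m 1 : Fin 4 → ℝ) k * n k b := by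
    funext b; simp [Pi.single_apply]
  have h1 := hn.frOne_lower (Pi.single m 1) i
  have h2 := frOne_ofReal n (D.low u (n m)) i
  rw [show (fun a => ((D.low u (n m) a : ℝ) : ℂ))
    = fun a => ((∑ b, D.g u a b * ∑ k, (Pi.single m 1 : Fin 4 → ℝ) k * n k b : ℝ) : ℂ) by
      conv_lhs => rw [e]
      rfl, h1] at h2
  have h3 := Complex.ofReal_injective h2
  rw [← h3]
  simp [Pi.single_apply]

open CoordFields in
/-- The contraction of the Ricci tensor with a covector, in terms of the Maxwell field. -/
theorem _root_.CoordFields.IsElectrovacOn.ins_Ric {D : CoordFields} (h : D.IsElectrovacOn Ω)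
    (hu : u ∈ Ω) (v : Fin 4 → ℂ) (b : Fin 4) :
    D.ins u v (Rc D u) b = -2 * D.ins u (D.ins u v fun a b => (D.H u a b : ℂ))
        (fun a b => (D.H u a b : ℂ)) b
      - (1 / 2) * v b * D.dot u (fun a b => (D.H u a b : ℂ)) (fun a b => (D.H u a b : ℂ)) := by
  have hL := h.lorentz u hu
  have e : ∀ a, Rc D u a b = 2 * (∑ c, ∑ d, (-(D.gu u c d : ℂ) * (D.H u d b : ℂ)) * (D.H u a c : ℂ))
      + (-(1 / 2) * D.dot u (fun a b => (D.H u a b : ℂ)) (fun a b => (D.H u a b : ℂ)))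
        * (D.g u a b : ℂ) := by
    intro a
    rw [Rc, h.Ric_eq_Energy hu, Energy, CoordFields.dot]
    push_cast
    have e1 : ∀ c d, (D.gu u c d : ℂ) * (D.H u a c : ℂ) * (D.H u b d : ℂ)
        = (-(D.gu u c d : ℂ) * (D.H u d b : ℂ)) * (D.H u a c : ℂ) := by
      intro c d
      rw [h.H_alt u hu b d]; push_cast; ring
    simp only [e1]
    ring
  rw [ins_eq_dotOne]
  simp only [e]
  rw [dotOne_add_right, dotOne_smul_right, dotOne_smul_right, hL.dotOne_g, dotOne_sum_right D u v
    fun c a => ∑ d, (-(D.gu u c d : ℂ) * (D.H u d b : ℂ)) * (D.H u a c : ℂ)]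
  have e2 : ∀ c, D.dotOne u v (fun a => ∑ d, (-(D.gu u c d : ℂ) * (D.H u d b : ℂ)) * (D.H u a c : ℂ))
      = ∑ d, (-(D.gu u c d : ℂ) * (D.H u d b : ℂ)) * D.ins u v (fun a b => (D.H u a b : ℂ)) c := by
    intro c
    rw [dotOne_sum_right D u v
      fun d a => (-(D.gu u c d : ℂ) * (D.H u d b : ℂ)) * (D.H u a c : ℂ)]
    simp only [dotOne_smul_right]
    rfl
  simp only [e2]
  rw [CoordFields.ins]
  have e3 : ∀ c d, (-(D.gu u c d : ℂ) * (D.H u d b : ℂ)) * D.ins u v (fun a b => (D.H u a b : ℂ)) c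
      = -((D.gu u c d : ℂ) * (D.ins u v (fun a b => (D.H u a b : ℂ)) c * (D.H u d b : ℂ))) :=
    fun c d => by ring
  simp only [e3, Finset.sum_neg_distrib]
  ring

open CoordFields in
/-- If `𝓗 = μ (lb ∧ l + i ⋆(lb ∧ l))`, then the Ricci tensor is `4 |μ|²` times the reflection in the
plane orthogonal to `lb` and `l`. -/
theorem _root_.CoordFields.IsElectrovacOn.frOne_ins_Ric {D : CoordFields} (h : D.IsElectrovacOn Ω)
    (hu : u ∈ Ω) {n : Fin 4 → Fin 4 → ℝ} (hn : D.IsFrame u nullN n) {μ : ℂ}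
    (hμ : ∀ i j, frTwo n (D.cH u) i j = μ * bivec i j) (v : Fin 4 → ℂ) (i : Fin 4) :
    frOne n (D.ins u v (Rc D u)) i = 4 * (μ * cc μ) * reflect (frOne n v) i := by
  have hX : ∀ i j, frTwo n (fun a b => (D.H u a b : ℂ)) i j
      = μ * bivec i j + cc (μ * bivec i j) := by
    intro i j
    have : (fun a b => (D.H u a b : ℂ)) = fun a b => D.cH u a b + cc (D.cH u a b) := by
      funext a b
      exact asd_add_conj D D.H u a b
    rw [this, frTwo_add, frTwo_conj, ← hμ]
  rw [← flat_energy u μ (frOne n v) _ hX i, ← hn.dot_eq]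
  have e : frOne n (D.ins u v (Rc D u)) i = frOne n (fun b => -2 * D.ins u (D.ins u v
      fun a b => (D.H u a b : ℂ)) (fun a b => (D.H u a b : ℂ)) b + (-(1 / 2) * D.dot u
        (fun a b => (D.H u a b : ℂ)) (fun a b => (D.H u a b : ℂ))) * v b) i := by
    congr 1
    funext b
    rw [h.ins_Ric hu]
    ring
  rw [e, frOne_add, frOne_smul, frOne_smul]
  have e1 : frOne n (fun b => D.ins u (D.ins u v fun a b => (D.H u a b : ℂ))
      (fun a b => (D.H u a b : ℂ)) b) i
      = (flat nullN).ins u ((flat nullN).ins u (frOne n v) (frTwo n fun a b => (D.H u a b : ℂ)))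
        (frTwo n fun a b => (D.H u a b : ℂ)) i := by
    have := hn.frOne_ins (D.ins u v fun a b => (D.H u a b : ℂ)) (fun a b => (D.H u a b : ℂ)) i
    rw [show frOne n (D.ins u v fun a b => (D.H u a b : ℂ)) = (flat nullN).ins u (frOne n v)
      (frTwo n fun a b => (D.H u a b : ℂ)) from funext fun j => hn.frOne_ins _ _ j] at this
    exact this
  rw [e1]
  ring

end WongCoord

/-! ### The normalization of `T²` and the gradient of `U` -/

namespace WongCoord

variable {D : WongCoord} {Ω : Set E4} {u : E4}

/-- The normalization of `T²` at infinity, propagated to the point `u`. -/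
def IsNormalizedAt (D : WongCoord) (u : E4) : Prop :=
  D.Tsq u + 2 * (D.V u).re + 4 * Complex.normSq (D.Xi u) - 4 * (cc D.k.C3 * D.Xi u).re = -1

theorem C3_eq (k : Consts) : k.C3 = (k.M : ℂ) / cc k.C1 := by
  rw [Consts.C3, Consts.C1]
  simp [sub_eq_add_neg]

/-- The normalization of `T²`, in the form in which it enters the gradient of `U`. -/
theorem IsNormalizedAt.im_eq (h : D.IsNormalizedAt u) (hC : D.k.C1 ≠ 0) (h0 : D.Xi u ≠ 0) :
    (D.k.C1 * D.P u).im * (D.Tsq u + 1 + 2 * (D.V u).re)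
      = (cc D.k.C1 * (cc (D.P u) / D.P u) * D.kap u).im := by
  have hP : D.P u ≠ 0 := one_div_ne_zero (mul_ne_zero two_ne_zero h0)
  have hX : D.Xi u = 1 / (2 * D.P u) := by rw [P]; field_simp
  have hC3 : cc D.k.C3 = (D.k.M : ℂ) / D.k.C1 := by rw [C3_eq]; simp [cc]
  obtain ⟨ζ, hζ⟩ : ∃ ζ, ζ = D.k.C1 * D.P u := ⟨_, rfl⟩
  have hζ0 : ζ ≠ 0 := by rw [hζ]; exact mul_ne_zero hC hP
  have hPc : cc (D.P u) ≠ 0 := (map_ne_zero _).2 hP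
  have hζc0 : cc ζ ≠ 0 := (map_ne_zero _).2 hζ0
  have hcc : cc D.k.C1 * cc (D.P u) = cc ζ := by rw [hζ]; exact (map_mul _ _ _).symm
  have h1 : cc D.k.C1 * (cc (D.P u) / D.P u) * D.kap u
      = cc ζ / (D.P u * cc (D.P u)) - D.k.M * (cc ζ / ζ) := by
    rw [kap, hC3, hX, ← hcc, hζ]
    have : cc (1 / (2 * D.P u)) = 1 / (2 * cc (D.P u)) := by
      simp only [cc, map_div₀, map_mul, map_one, map_ofNat]
    rw [this]
    field_simp
  have hnP : (0 : ℝ) < Complex.normSq (D.P u) := Complex.normSq_pos.2 hP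
  have hnζ : (0 : ℝ) < Complex.normSq ζ := Complex.normSq_pos.2 hζ0
  have h2 : cc ζ / (D.P u * cc (D.P u)) = cc ζ / (Complex.normSq (D.P u) : ℝ) := by
    rw [cc, cc, Complex.mul_conj]
  have h3 : cc ζ / ζ = cc ζ * cc ζ / (Complex.normSq ζ : ℝ) := by
    rw [cc, ← Complex.mul_conj]; field_simp
  have h4 : Complex.normSq (D.Xi u) = 1 / (4 * Complex.normSq (D.P u)) := by
    rw [hX, Complex.normSq_div, Complex.normSq_mul, Complex.normSq_one, Complex.normSq_ofNat]
    norm_num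
  have h5 : (cc D.k.C3 * D.Xi u) = (D.k.M / 2 : ℝ) * (cc ζ / (Complex.normSq ζ : ℝ)) := by
    rw [hC3, hX, cc, ← Complex.mul_conj, hζ] at *
    push_cast
    field_simp
  rw [IsNormalizedAt, h4, h5, Complex.re_ofReal_mul, Complex.div_ofReal_re] at h
  rw [h1, h2, h3, ← hζ, Complex.sub_im, Complex.im_ofReal_mul, Complex.div_ofReal_im,
    Complex.div_ofReal_im]
  have e : D.Tsq u + 1 + 2 * (D.V u).re = 2 * D.k.M * (ζ.re / Complex.normSq ζ)
      - 1 / Complex.normSq (D.P u) := by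
    have : (cc ζ).re = ζ.re := Complex.conj_re ζ
    rw [this] at h
    field_simp at h ⊢
    linarith
  rw [e]
  simp only [Complex.mul_im, Complex.conj_re, Complex.conj_im]
  field_simp
  ring

namespace IsSolutionOn

theorem z_eq (h : D.IsSolutionOn Ω) (hu : u ∈ Ω) (h0 : D.Xi u ≠ 0) (b : Fin 4) :
    pd b D.z u = (D.k.C1 * pd b D.P u).im ∧ pd b D.y u = (D.k.C1 * pd b D.P u).re := by
  have dP := (h.pd_P hu h0 b).1
  have d1 : DifferentiableAt ℝ (fun v => D.k.C1 * D.P v) u := (differentiableAt_const _).fun_mul dP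
  constructor
  · rw [← pd_const_mul _ dP, ← pd_im d1]; rfl
  · rw [← pd_const_mul _ dP, ← pd_re d1]; rfl

theorem smooth_z (h : D.IsSolutionOn Ω) (hu : u ∈ Ω) (h0 : D.Xi u ≠ 0) :
    ContDiffAt ℝ ∞ D.z u ∧ ContDiffAt ℝ ∞ D.y u :=
  ⟨Complex.imCLM.contDiff.contDiffAt.comp u (contDiffAt_const.mul (h.smooth_P hu h0)),
    Complex.reCLM.contDiff.contDiffAt.comp u (contDiffAt_const.mul (h.smooth_P hu h0))⟩

/-- The Hessian of `z` is the imaginary part of `C₁ ∇∇P`. -/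
theorem covOne_dz (h : D.IsSolutionOn Ω) (hu : u ∈ Ω) (h0 : D.Xi u ≠ 0) (a b : Fin 4) :
    D.covOne (fun v b => pd b D.z v) u a b = (D.k.C1 * D.hessP u a b).im := by
  have dPb := SmoothAt.differentiableAt (SmoothAt.pd (h.smooth_P hu h0) b)
  have d1 : DifferentiableAt ℝ (fun v => D.k.C1 * pd b D.P v) u :=
    (differentiableAt_const _).fun_mul dPb
  have e1 : pd a (fun v => pd b D.z v) u = (D.k.C1 * pd a (pd b D.P) u).im := by
    rw [← pd_const_mul _ dPb, ← pd_im d1]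
    refine pd_congr ?_ a
    filter_upwards [h.eventually_ne hu h0] with v hv
    exact (h.z_eq hv.1 hv.2 b).1
  rw [CoordFields.covOne, e1, hessP, mul_sub, Complex.sub_im, Finset.mul_sum, Complex.im_sum]
  congr 1
  refine Finset.sum_congr rfl fun c _ => ?_
  rw [(h.z_eq hu h0 c).1, ← Complex.im_ofReal_mul]
  congr 1
  ring

theorem hessP_symm (h : D.IsSolutionOn Ω) (hu : u ∈ Ω) (h0 : D.Xi u ≠ 0) (a b : Fin 4) :
    D.hessP u a b = D.hessP u b a := by
  rw [hessP, hessP, pd_comm (h.smooth_P hu h0)]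
  simp only [h.electrovac.Gamma_symm hu _ a b]

theorem U_eq (D : WongCoord) : D.U = fun v => (D.y v ^ 2 + D.z v ^ 2) *
    D.sqOne v (fun b => pd b D.z v) + D.z v ^ 2 := by
  funext v
  simp only [U, zUp, CoordFields.sqOne, Finset.sum_mul]
  congr 2
  exact Finset.sum_congr rfl fun _ _ => Finset.sum_congr rfl fun _ _ => by ring

/-- The gradient of `U`, in terms of the Hessian of `P`. -/
theorem pd_U (h : D.IsSolutionOn Ω) (hu : u ∈ Ω) (h0 : D.Xi u ≠ 0) (b : Fin 4) :
    DifferentiableAt ℝ D.U u ∧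
    pd b D.U u = (2 * D.y u * pd b D.y u + 2 * D.z u * pd b D.z u) *
        D.sqOne u (fun b => pd b D.z u)
      + 2 * ‖D.k.C1 * D.P u‖ ^ 2 * ∑ a, D.zUp u a * (D.k.C1 * D.hessP u a b).im
      + 2 * D.z u * pd b D.z u := by
  have dz := SmoothAt.differentiableAt (h.smooth_z hu h0).1
  have dy := SmoothAt.differentiableAt (h.smooth_z hu h0).2
  have dzb := fun b => SmoothAt.differentiableAt (SmoothAt.pd (h.smooth_z hu h0).1 b)
  have dg : ∀ a b, DifferentiableAt ℝ (fun v => D.gu v a b) u := fun a b =>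
    SmoothAt.differentiableAt (h.electrovac.smooth_gu hu a b)
  have ds : DifferentiableAt ℝ (fun v => D.sqOne v (fun b => pd b D.z v)) u :=
    DifferentiableAt.fun_sum fun a _ => DifferentiableAt.fun_sum fun b _ =>
      (dg a b).fun_mul ((dzb a).fun_mul (dzb b))
  have hn : ‖D.k.C1 * D.P u‖ ^ 2 = D.y u ^ 2 + D.z u ^ 2 := by
    rw [← Complex.normSq_eq_norm_sq, Complex.normSq_apply, y, z]; ring
  have dyz : DifferentiableAt ℝ (fun v => D.y v * D.y v + D.z v * D.z v) u :=
    (dy.fun_mul dy).fun_add (dz.fun_mul dz)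
  have e : D.U = fun v => (D.y v * D.y v + D.z v * D.z v) *
      D.sqOne v (fun b => pd b D.z v) + D.z v * D.z v := by
    rw [U_eq]; funext v; ring
  rw [e]
  refine ⟨(dyz.fun_mul ds).fun_add (dz.fun_mul dz), ?_⟩
  rw [pd_add (dyz.fun_mul ds) (dz.fun_mul dz), pd_mul dyz ds, pd_add (dy.fun_mul dy)
    (dz.fun_mul dz), pd_mul dy dy, pd_mul dz dz, h.electrovac.pd_sqOne hu dzb, hn]
  have e1 : ∑ a, ∑ c, D.gu u a c * pd a D.z u * D.covOne (fun v b => pd b D.z v) u b c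
      = ∑ a, D.zUp u a * (D.k.C1 * D.hessP u a b).im := by
    rw [Finset.sum_comm]
    refine Finset.sum_congr rfl fun a _ => ?_
    rw [zUp, Finset.sum_mul]
    refine Finset.sum_congr rfl fun c _ => ?_
    rw [h.covOne_dz hu h0, h.hessP_symm hu h0 b a, (h.electrovac.lorentz u hu).gu_symm]
  rw [e1]
  ring

end IsSolutionOn
end WongCoord

/-! ### Frame components of the gradient of `U` -/

namespace CoordFields

variable {D : CoordFields} {u : E4}

theorem im_frOne (n : Fin 4 → Fin 4 → ℝ) (X : Fin 4 → ℂ) (i : Fin 4) :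
    (frOne n X i).im = ∑ a, n i a * (X a).im := by
  simp [frOne, Complex.im_sum]

theorem frTwo_wedge (n : Fin 4 → Fin 4 → ℝ) (v w : Fin 4 → ℂ) (i j : Fin 4) :
    frTwo n (wedge v w) i j = wedge (frOne n v) (frOne n w) i j := by
  have e : wedge v w = fun a b => v a * w b - w a * v b := by
    funext a b; simp only [wedge]; ring
  rw [e, frTwo_sub, frTwo_mul, frTwo_mul, wedge]
  ring

/-- The square of `𝓗 = μ (lb ∧ l + i ⋆(lb ∧ l))` is `-4 μ²`. -/
theorem IsFrame.cHsq_eq {n : Fin 4 → Fin 4 → ℝ} (hn : D.IsFrame u nullN n) {μ : ℂ}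
    (hμ : ∀ i j, frTwo n (D.cH u) i j = μ * bivec i j) : D.cHsq u = -4 * μ ^ 2 := by
  have hH : frTwo n (D.cH u) = fun i j => μ * bivec i j := funext fun i => funext fun j => hμ i j
  have hA : ∀ i j, μ * bivec i j = -(μ * bivec j i) := fun i j => by
    rw [bivec_antisymm]; ring
  rw [cHsq, hn.dot_eq, hH, flat_dot_null _ _ _ hA hA]
  simp [bivec]
  ring_nf
  simp
  ring

/-- The square of a covector in terms of its components in a null frame. -/
theorem IsFrame.sqOne_eq {n : Fin 4 → Fin 4 → ℝ} (hn : D.IsFrame u nullN n) (v : Fin 4 → ℝ)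
    {x : Fin 4 → ℝ} (hx : ∀ i, ∑ a, n i a * v a = x i) :
    D.sqOne u v = -2 * x 0 * x 1 + x 2 ^ 2 + x 3 ^ 2 := by
  apply Complex.ofReal_injective
  rw [sqOne_ofReal, hn.dotOne_eq, flat_dotOne_null]
  simp only [frOne_ofReal, hx]
  push_cast
  ring

end CoordFields

namespace WongCoord

variable {D : WongCoord} {Ω : Set E4} {u : E4} {lb l : Fin 4 → ℝ} {n : Fin 4 → Fin 4 → ℝ}

open CoordFields

namespace IsPrincipalNullPair

/-- The Maxwell form in the frame adapted to its principal null vectors. -/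
theorem frTwo_cH (hp : D.IsPrincipalNullPair u lb l) (hn : D.IsFrame u nullN n)
    (h0 : n 0 = lb) (h1 : n 1 = l) (i j : Fin 4) :
    frTwo n (D.cH u) i j = 1 / (2 * D.k.C1 * D.Ph u ^ 2) * bivec i j := by
  have e : D.cH u = fun a b => 1 / (2 * D.k.C1 * D.Ph u ^ 2) * D.nullBivec u (n 0) (n 1) a b := by
    funext a b; rw [hp.cH_eq, h0, h1]
  rw [e, frTwo_smul, frTwo_nullBivec_adapted hn]

/-- The null components of `E(z)` in the adapted frame. -/
theorem frOne_EzNull (hL : D.IsLorentzAt u) (hn : D.IsFrame u nullN n)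
    (h0 : n 0 = lb) (h1 : n 1 = l) {τ : Fin 4 → ℝ} (hτ : ∀ i, ∑ a, n i a * D.Tlow u a = τ i)
    (i : Fin 4) :
    ∑ b, n i b * D.EzNull u lb l b = (![-((1 - D.P u ^ 2 / D.Ph u ^ 2) * frW τ 0).im,
      -((1 - D.P u ^ 2 / D.Ph u ^ 2) * frW τ 1).im, 0, 0] : Fin 4 → ℝ) i := by
  have e1 : ∀ b, D.Ez u lb l b = ((1 - D.P u ^ 2 / D.Ph u ^ 2) *
      D.ins u (Tc D.toCoordFields u) (D.nullBivec u lb l) b).im := by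
    intro b
    rw [Ez]
    congr 2
    have : D.ins u (Tc D.toCoordFields u) (D.nullBivec u lb l) b
        = ∑ a, (D.T u a : ℂ) * D.nullBivec u lb l a b :=
      (sum_T_mul hL fun a => D.nullBivec u lb l a b).symm
    rw [this]
    simp only [nullBivec, ip, low]
    push_cast
    simp only [mul_add, Finset.sum_add_distrib, mul_sub, Finset.sum_sub_distrib]
    congr 1
    · congr 1
      · rw [Finset.sum_mul]
        refine Finset.sum_congr rfl fun a _ => ?_
        ring
      · rw [Finset.sum_mul]
        refine Finset.sum_congr rfl fun a _ => ?_
        ring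
    · rw [Finset.mul_sum]
      refine Finset.sum_congr rfl fun a _ => ?_
      simp only [Finset.mul_sum]
      exact Finset.sum_congr rfl fun _ _ => Finset.sum_congr rfl fun _ _ => by ring
  have e2 : ∀ i, ∑ b, n i b * D.Ez u lb l b = ((1 - D.P u ^ 2 / D.Ph u ^ 2) * frW τ i).im := by
    intro i
    have h2 : frOne n (D.ins u (Tc D.toCoordFields u) (D.nullBivec u lb l)) i = frW τ i := by
      rw [hn.frOne_ins, ← flat_ins_bivec u τ i]
      congr 1
      · funext i; rw [← hτ]; exact frOne_ofReal n _ i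
      · funext i j; rw [← h0, ← h1]; exact frTwo_nullBivec_adapted hn i j
    rw [← h2, ← frOne_smul, im_frOne]
    simp only [e1]
  have e3 : ∀ b, D.EzNull u lb l b = ((1 - D.P u ^ 2 / D.Ph u ^ 2) * frW τ 0).im * D.low u (n 1) b
      + ((1 - D.P u ^ 2 / D.Ph u ^ 2) * frW τ 1).im * D.low u (n 0) b := by
    intro b
    rw [EzNull, ← e2, ← e2, h0, h1]
    simp only [mul_comm (lb _), mul_comm (l _)]
  simp only [e3, mul_add, Finset.sum_add_distrib, mul_left_comm (n i _), ← Finset.mul_sum,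
    frOne_low_adapted hn]
  fin_cases i <;> simp [nullN]

end IsPrincipalNullPair

namespace IsSolutionOn

/-- The gradient `∇_b Ξ = 𝓗_ab T^a` in an adapted frame. -/
theorem frOne_pd_Xi (h : D.IsSolutionOn Ω) (hu : u ∈ Ω) (hn : D.IsFrame u nullN n) {μ : ℂ}
    (hμ : ∀ i j, frTwo n (D.cH u) i j = μ * bivec i j) {τ : Fin 4 → ℝ}
    (hτ : ∀ i, frOne n (Tc D.toCoordFields u) i = (τ i : ℂ)) (i : Fin 4) :
    frOne n (fun b => pd b D.Xi u) i = μ * frW τ i := by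
  have e : (fun b => pd b D.Xi u) = D.ins u (Tc D.toCoordFields u) (D.cH u) := by
    funext b
    rw [h.pd_Xi u hu, ins_eq_dotOne]
    change _ = D.dotOne u (fun a => (D.Tlow u a : ℂ)) _
    rw [← sum_T_mul (h.electrovac.lorentz u hu)]
    exact Finset.sum_congr rfl fun _ _ => mul_comm _ _
  rw [e, hn.frOne_ins, funext hτ, show frTwo n (D.cH u) = fun i j => μ * bivec i j from
    funext fun i => funext fun j => hμ i j, flat_ins_smul, flat_ins_bivec]

/-- The Ricci part of `∇𝓕`, contracted with a covector, in a frame adapted to the Maxwell form: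
there the Ricci tensor is a multiple of the reflection in the plane orthogonal to the two principal
null directions. -/
theorem frTwo_asdC_wedge_Rc (h : D.IsSolutionOn Ω) (hu : u ∈ Ω) (hn : D.IsFrame u nullN n) {μ : ℂ}
    (hμ : ∀ i j, frTwo n (D.cH u) i j = μ * bivec i j) {τ : Fin 4 → ℝ}
    (hτ : ∀ i, frOne n (Tc D.toCoordFields u) i = (τ i : ℂ)) (x : Fin 4 → ℂ) :
    frTwo n (D.asdC u fun c b =>
        wedge (Tc D.toCoordFields u) (D.ins u x (Rc D.toCoordFields u)) c b
        + wedge (D.ins u (Tc D.toCoordFields u) (Rc D.toCoordFields u)) x c b)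
      = fun i j => 4 * (μ * cc μ) * (flat nullN).asdC u (fun i j =>
        wedge (fun i => (τ i : ℂ)) (reflect (frOne n x)) i j
        + wedge (reflect fun i => (τ i : ℂ)) (frOne n x) i j) i j := by
  have hT := funext hτ
  have hR := fun v i => h.electrovac.frOne_ins_Ric hu hn hμ v i
  have e2 : frTwo n (fun c b => wedge (Tc D.toCoordFields u) (D.ins u x (Rc D.toCoordFields u)) c b
        + wedge (D.ins u (Tc D.toCoordFields u) (Rc D.toCoordFields u)) x c b)
      = fun i j => 4 * (μ * cc μ) * (wedge (fun i => (τ i : ℂ)) (reflect (frOne n x)) i j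
        + wedge (reflect fun i => (τ i : ℂ)) (frOne n x) i j) := by
    funext i j
    have w1 : ∀ v w : Fin 4 → ℂ, frTwo n (fun a b => wedge v w a b) i j = _ :=
      fun v w => frTwo_wedge n v w i j
    rw [frTwo_add, w1, w1, hT]
    simp only [wedge, hR, hT]
    ring
  funext i j
  rw [hn.frTwo_asdC, e2, asdC_smul]

/-- The frame components of the contraction of the Hessian of `P` with the gradient of `z`. -/
theorem frOne_zUp_hessP (h : D.IsSolutionOn Ω) (hu : u ∈ Ω) (h0 : D.Xi u ≠ 0)
    (hk : D.kap u ≠ 0) (hn : D.IsFrame u nullN n) {μ : ℂ}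
    (hμ : ∀ i j, frTwo n (D.cH u) i j = μ * bivec i j) {τ z : Fin 4 → ℝ}
    (hτ : ∀ i, frOne n (Tc D.toCoordFields u) i = (τ i : ℂ))
    (hz : ∀ i, frOne n (D.dz u) i = (z i : ℂ))
    (horth : (flat nullN).dotOne u (fun i => (z i : ℂ)) (fun i => (τ i : ℂ)) = 0) (b : Fin 4) :
    frOne n (fun b => ∑ a, (D.zUp u a : ℂ) * (D.k.C1 * D.hessP u a b - D.errOne u a b)) b
      = -4 * D.k.C1 * D.P u ^ 3 * μ ^ 2 * (flat nullN).dotOne u (fun i => (z i : ℂ)) (frW τ)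
          * frW τ b
      - 4 * D.k.C1 * D.P u ^ 3 * μ ^ 2 * D.Tsq u * z b
      - 2 * D.k.C1 * D.P u ^ 2 * (D.kap u * μ ^ 2 * z b
        - cc (D.kap u) * (μ * cc μ) * reflect (fun i => (z i : ℂ)) b)
      + 4 * D.k.C1 * D.P u ^ 2 / D.kap u * (μ * cc μ) *
        ((flat nullN).dotOne u (fun i => (z i : ℂ)) (fun i => cc (frW τ i)) * frW τ b
        - (flat nullN).ins u (fun i => (τ i : ℂ)) ((flat nullN).asdC u fun i j =>
          wedge (fun i => (τ i : ℂ)) (reflect fun i => (z i : ℂ)) i j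
          + wedge (reflect fun i => (τ i : ℂ)) (fun i => (z i : ℂ)) i j) b) := by
  have hH : frTwo n (D.cH u) = fun i j => μ * bivec i j := funext fun i => funext fun j => hμ i j
  have hT := funext hτ
  have hZ := funext hz
  have hξ := h.frOne_pd_Xi hu hn hμ hτ
  have hXi := funext hξ
  have d1 : D.dotOne u (D.dz u) (fun a => pd a D.Xi u)
      = μ * (flat nullN).dotOne u (fun i => (z i : ℂ)) (frW τ) := by
    rw [hn.dotOne_eq, hXi, hZ, dotOne_smul_right (flat nullN) u μ _ (frW τ)]
  have d2 : D.dotOne u (D.dz u) (Tc D.toCoordFields u) = 0 := by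
    rw [hn.dotOne_eq, hT, hZ, horth]
  have d3 : D.dotOne u (D.dz u) (fun a => cc (pd a D.Xi u))
      = cc μ * (flat nullN).dotOne u (fun i => (z i : ℂ)) (fun i => cc (frW τ i)) := by
    have : frOne n (fun a => cc (pd a D.Xi u)) = fun i => cc μ * cc (frW τ i) := by
      funext i; rw [frOne_conj, hξ]; exact map_mul _ _ _
    rw [hn.dotOne_eq, this, hZ, dotOne_smul_right]
  have d4 := hn.cHsq_eq hμ
  have f1 : frOne n (fun b => D.ins u (D.ins u (D.dz u) (D.cH u)) (D.cH u) b) b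
      = μ ^ 2 * z b := by
    have e1 : frOne n (D.ins u (D.dz u) (D.cH u))
        = fun i => μ * (flat nullN).ins u (fun i => (z i : ℂ)) bivec i := by
      funext i; rw [hn.frOne_ins, hH, hZ, flat_ins_smul]
    have e2 := hn.frOne_ins (D.ins u (D.dz u) (D.cH u)) (D.cH u) b
    rw [e1, hH, flat_ins_smul, flat_ins_smul_left, flat_ins_bivec_bivec] at e2
    rw [show frOne n (fun b => D.ins u (D.ins u (D.dz u) (D.cH u)) (D.cH u) b) b = _ from e2]
    ring
  have f2 : frOne n (fun b => D.ins u (D.ins u (D.dz u) fun a e => cc (D.cH u a e)) (D.cH u) b) b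
      = -(μ * cc μ) * reflect (fun i => (z i : ℂ)) b := by
    have hHc : frTwo n (fun a e => cc (D.cH u a e)) = fun i j => cc μ * cc (bivec i j) := by
      funext i j; rw [frTwo_conj, hμ]; exact map_mul _ _ _
    have e1 : frOne n (D.ins u (D.dz u) fun a e => cc (D.cH u a e))
        = fun i => cc μ * (flat nullN).ins u (fun i => (z i : ℂ)) (fun i j => cc (bivec i j)) i := by
      funext i; rw [hn.frOne_ins, hHc, hZ, flat_ins_smul]
    have e2 := hn.frOne_ins (D.ins u (D.dz u) fun a e => cc (D.cH u a e)) (D.cH u) b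
    rw [e1, hH, flat_ins_smul, flat_ins_smul_left, flat_ins_conj_bivec_bivec] at e2
    rw [show frOne n (fun b => D.ins u (D.ins u (D.dz u) fun a e => cc (D.cH u a e))
      (D.cH u) b) b = _ from e2]
    ring
  have f3 : frOne n (fun b => D.ins u (Tc D.toCoordFields u) (D.asdC u fun c b =>
          wedge (Tc D.toCoordFields u) (D.ins u (D.dz u) (Rc D.toCoordFields u)) c b
          + wedge (D.ins u (Tc D.toCoordFields u) (Rc D.toCoordFields u)) (D.dz u) c b) b) b
      = 4 * (μ * cc μ) * (flat nullN).ins u (fun i => (τ i : ℂ)) ((flat nullN).asdC u fun i j =>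
          wedge (fun i => (τ i : ℂ)) (reflect fun i => (z i : ℂ)) i j
          + wedge (reflect fun i => (τ i : ℂ)) (fun i => (z i : ℂ)) i j) b := by
    have e1 := hn.frOne_ins (Tc D.toCoordFields u) (D.asdC u fun c b =>
          wedge (Tc D.toCoordFields u) (D.ins u (D.dz u) (Rc D.toCoordFields u)) c b
          + wedge (D.ins u (Tc D.toCoordFields u) (Rc D.toCoordFields u)) (D.dz u) c b) b
    have e3 := h.frTwo_asdC_wedge_Rc hu hn hμ hτ (D.dz u)
    rw [hZ] at e3
    rw [e3, hT, flat_ins_smul] at e1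
    exact e1
  have e : (fun b => ∑ a, (D.zUp u a : ℂ) * (D.k.C1 * D.hessP u a b - D.errOne u a b))
      = fun b => ((-4 * D.k.C1 * D.P u ^ 3 * (μ * (flat nullN).dotOne u (fun i => (z i : ℂ))
            (frW τ)) + D.k.C1 * D.P u ^ 2 / D.kap u * (4 * (cc μ * (flat nullN).dotOne u
              (fun i => (z i : ℂ)) (fun i => cc (frW τ i))))) * pd b D.Xi u
        + (D.k.C1 * D.P u ^ 3 * (-4 * μ ^ 2) * (D.Tsq u : ℂ)) * D.dz u b)
        + ((-2 * D.k.C1 * D.P u ^ 2 * D.kap u) *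
            D.ins u (D.ins u (D.dz u) (D.cH u)) (D.cH u) b
        + (-2 * D.k.C1 * D.P u ^ 2 * cc (D.kap u)) *
            D.ins u (D.ins u (D.dz u) fun a e => cc (D.cH u a e)) (D.cH u) b)
        + (-(D.k.C1 * D.P u ^ 2 / D.kap u)) * D.ins u (Tc D.toCoordFields u) (D.asdC u fun c b =>
          wedge (Tc D.toCoordFields u) (D.ins u (D.dz u) (Rc D.toCoordFields u)) c b
          + wedge (D.ins u (Tc D.toCoordFields u) (Rc D.toCoordFields u)) (D.dz u) c b) b := by
    funext b
    rw [h.zUp_hessP hu h0 hk, d1, d2, d3, d4]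
    ring
  rw [e, frOne_add, frOne_add, frOne_add, frOne_add, frOne_smul, frOne_smul, frOne_smul,
    frOne_smul, frOne_smul, f1, f2, f3, hξ]
  rw [show frOne n (fun b => D.dz u b) b = _ from hz b]
  ring

end IsSolutionOn
end WongCoord

/-! ### The exact gradient of `U` and its vanishing -/

namespace WongCoord

variable {D : WongCoord} {Ω : Set E4} {u : E4} {lb l : Fin 4 → ℝ}

open CoordFields

namespace IsSolutionOn

/-- `E(2)` differs from `E(1)` by a multiple of the metric, which contributes a multiple of `∇z`. -/
theorem sum_zUp_errTwo (h : D.IsSolutionOn Ω) (hu : u ∈ Ω) (b : Fin 4) :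
    ∑ a, D.zUp u a * (D.errTwo u a b).im = ∑ a, D.zUp u a * (D.errOne u a b).im
      + ((D.Tsq u : ℂ) / D.k.C1 * (1 / D.P u - D.P u ^ 3 / D.Ph u ^ 4)).im * pd b D.z u := by
  have hg : ∑ a, D.zUp u a * D.g u a b = pd b D.z u := by
    have h1 := (h.electrovac.lorentz u hu).sum_g_sum_gu (fun c => pd c D.z u) b
    rw [← h1]
    exact Finset.sum_congr rfl fun a _ => by
      rw [zUp, (h.electrovac.lorentz u hu).symm a b, mul_comm]
  rw [← hg, Finset.mul_sum, ← Finset.sum_add_distrib]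
  refine Finset.sum_congr rfl fun a _ => ?_
  rw [errTwo, Complex.add_im, Complex.im_mul_ofReal]
  ring

/-- The gradient of `U` equals the algebraic error term. -/
theorem pd_U_eq_errorTerm (h : D.IsSolutionOn Ω) (hu : u ∈ Ω) (h0 : D.Xi u ≠ 0)
    (hk : D.kap u ≠ 0) (hPh : D.Ph u ≠ 0) (hnorm : D.IsNormalizedAt u)
    (hp : D.IsPrincipalNullPair u lb l) (b : Fin 4) :
    pd b D.U u = D.errorTerm u lb l b := by
  have hL := h.electrovac.lorentz u hu
  have hC := h.C1_ne
  have hP : D.P u ≠ 0 := one_div_ne_zero (mul_ne_zero two_ne_zero h0)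
  obtain ⟨n, hn, hn0, hn1⟩ := hp.exists_frame hL
  obtain ⟨τ, hτ⟩ : ∃ τ : Fin 4 → ℝ, ∀ i, ∑ a, n i a * D.Tlow u a = τ i := ⟨_, fun _ => rfl⟩
  obtain ⟨z, hz⟩ : ∃ z : Fin 4 → ℝ, ∀ i, ∑ a, n i a * pd a D.z u = z i := ⟨_, fun _ => rfl⟩
  obtain ⟨y, hy⟩ : ∃ y : Fin 4 → ℝ, ∀ i, ∑ a, n i a * pd a D.y u = y i := ⟨_, fun _ => rfl⟩
  obtain ⟨N, hN⟩ : ∃ N : Fin 4 → ℝ, ∀ i, ∑ a, n i a * D.EzNull u lb l a = N i := ⟨_, fun _ => rfl⟩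
  obtain ⟨μ, hμ⟩ : ∃ μ, μ = 1 / (2 * D.k.C1 * D.Ph u ^ 2) := ⟨_, rfl⟩
  have hH := hp.frTwo_cH hn hn0 hn1
  rw [← hμ] at hH
  have hτc : ∀ i, frOne n (Tc D.toCoordFields u) i = (τ i : ℂ) := fun i => by
    rw [← hτ]; exact frOne_ofReal n _ i
  have hzc : ∀ i, frOne n (D.dz u) i = (z i : ℂ) := fun i => by
    rw [← hz]; exact frOne_ofReal n _ i
  have hξ := h.frOne_pd_Xi hu hn hH hτc
  have hdP : ∀ i, D.k.C1 * frOne n (fun b => pd b D.P u) i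
      = -(D.P u ^ 2 / D.Ph u ^ 2 * frW τ i) := by
    intro i
    have : (fun b => pd b D.P u) = fun b => -2 * D.P u ^ 2 * pd b D.Xi u := by
      funext b; exact (h.pd_P hu h0 b).2
    rw [this, frOne_smul, hξ, hμ]
    field_simp
  have hz' : ∀ i, z i = -(D.P u ^ 2 / D.Ph u ^ 2 * frW τ i).im := by
    intro i
    rw [← Complex.neg_im, ← hdP, ← frOne_smul, im_frOne, ← hz]
    simp only [(h.z_eq hu h0 _).1]
  have hy' : ∀ i, y i = -(D.P u ^ 2 / D.Ph u ^ 2 * frW τ i).re := by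
    intro i
    rw [← Complex.neg_re, ← hdP, ← frOne_smul, ← hy]
    simp [frOne, Complex.re_sum, (h.z_eq hu h0 _).2]
  have ht : D.Tsq u = -2 * τ 0 * τ 1 + τ 2 ^ 2 + τ 3 ^ 2 := by
    rw [Tsq_eq hL, hn.sqOne_eq _ hτ]
  have hxx := hn.sqOne_eq (fun a => pd a D.z u) hz
  have hN' : N = ![-((1 - D.P u ^ 2 / D.Ph u ^ 2) * frW τ 0).im,
      -((1 - D.P u ^ 2 / D.Ph u ^ 2) * frW τ 1).im, 0, 0] := by
    funext i
    rw [← hN, IsPrincipalNullPair.frOne_EzNull hL hn hn0 hn1 hτ]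
  have horth := flat_dotOne_orthogonal u τ _ z hz'
  have hG := h.frOne_zUp_hessP hu h0 hk hn hH hτc hzc horth
  have hid := fun i => gradient_identity hC hP hPh hk u τ y z (D.Tsq u) (D.V u).re hz' hy' ht
    (hnorm.im_eq hC h0) N hN' μ (D.coef u) (D.ImDefect u) hμ rfl rfl i _ _ (hdP i) (hG i)
  set G : Fin 4 → ℂ := fun b => ∑ a, (D.zUp u a : ℂ) *
    (D.k.C1 * D.hessP u a b - D.errOne u a b) with hGdef
  have hGim : ∀ b, (G b).im = ∑ a, D.zUp u a * (D.k.C1 * D.hessP u a b).im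
      - ∑ a, D.zUp u a * (D.errOne u a b).im := by
    intro b
    rw [hGdef, ← Finset.sum_sub_distrib]
    simp only [Complex.im_sum, Complex.im_ofReal_mul, Complex.sub_im, mul_sub]
  have hcc : cc (D.kap u) = 2 * D.Xi u - D.k.C3 := by
    simp only [kap, cc, map_sub, map_mul, map_ofNat, Complex.conj_conj]
  -- the difference of the two sides, as a covector
  have hr : ∀ b, pd b D.U u - D.errorTerm u lb l b
      = (2 * D.y u * pd b D.y u + 2 * D.z u * pd b D.z u) * D.sqOne u (fun b => pd b D.z u)
        + 2 * ‖D.k.C1 * D.P u‖ ^ 2 * (G b).im + 2 * D.z u * pd b D.z u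
        - 2 * ‖D.k.C1 * D.P u‖ ^ 2 * (((D.Tsq u : ℂ) / D.k.C1 *
          (1 / D.P u - D.P u ^ 3 / D.Ph u ^ 4)).im * pd b D.z u)
        - (D.z u * pd b D.y u - D.y u * pd b D.z u) * D.ImDefect u
        - D.errThree u lb l b - D.errFour u lb l b + 4 * D.z u * (D.V u).re * pd b D.z u := by
    intro b
    rw [(h.pd_U hu h0 b).2, errorTerm, h.sum_zUp_errTwo hu, hGim]
    ring
  have h3 : ∀ i, ∑ b, n i b * D.errThree u lb l b
      = ((D.P u ^ 2 * cc (D.Ph u) ^ 2 / (cc (D.P u) ^ 2 * D.Ph u ^ 2) - 1) *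
          (D.coef u * (D.Tsq u : ℂ) / D.kap u) * (z i : ℂ)
        + D.k.C1 ^ 2 * D.P u / (D.kap u * cc (D.P u)) * (D.ImDefect u : ℂ) *
          frOne n (fun b => pd b D.P u) i
        - 2 * (D.coef u * (D.Tsq u : ℂ) / D.kap u) * (N i : ℂ)).im := by
    intro i
    have e1 : (N i : ℂ) = frOne n (fun b => (D.EzNull u lb l b : ℂ)) i := by
      rw [frOne_ofReal, hN]
    rw [e1, ← hzc, ← frOne_smul, ← frOne_smul, ← frOne_smul, ← frOne_add, ← frOne_sub, im_frOne]
    rfl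
  have h4 : ∀ i, ∑ b, n i b * D.errFour u lb l b
      = - (cc D.k.C1 * (cc (D.P u) / D.P u) * (D.P u ^ 4 / D.Ph u ^ 4 - 1) * D.kap u
          - D.k.C1 * (D.P u / cc (D.P u)) *
            (D.P u ^ 2 * cc (D.P u) ^ 2 / (D.Ph u ^ 2 * cc (D.Ph u) ^ 2) - 1) *
            cc (D.kap u)).im * z i
        + (2 * D.coef u * cc (D.kap u) * (N i : ℂ)).im := by
    intro i
    have e1 : (N i : ℂ) = frOne n (fun b => (D.EzNull u lb l b : ℂ)) i := by
      rw [frOne_ofReal, hN]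
    rw [e1, ← frOne_smul, im_frOne, ← hz, Finset.mul_sum, ← Finset.sum_add_distrib, hcc]
    refine Finset.sum_congr rfl fun b _ => ?_
    rw [errFour]
    ring
  have hGf : ∀ i, (frOne n G i).im = ∑ b, n i b * (G b).im := fun i => im_frOne n G i
  have key : ∀ i, ∑ b, n i b * (pd b D.U u - D.errorTerm u lb l b) = 0 := by
    intro i
    rw [← hid i, ← h3 i, ← h4 i, hGf i, Complex.ofReal_re, ← hz i, ← hy i]
    change _ = (2 * D.y u * _ + 2 * D.z u * _) * _ + _ * _ + 2 * D.z u * _ - _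
      - (D.z u * _ - D.y u * _) * _ - _ - _ + 4 * D.z u * _ * _
    simp only [hr, hxx, Fin.sum_univ_four]
    ring
  have hfin := hn.frOne_injective (X := fun b => ((pd b D.U u - D.errorTerm u lb l b : ℝ) : ℂ))
    (Y := fun _ => 0) (fun i => by
      rw [frOne_ofReal, key]; simp [frOne]) b
  exact sub_eq_zero.1 (Complex.ofReal_eq_zero.1 hfin)

end IsSolutionOn

/-- The error term vanishes if Wong's tensors vanish, `P = P̂` and `Re V = 0`. -/
theorem errorTerm_eq_zero (hPh : D.Ph u ≠ 0)
    (hB : ∀ a b, D.B u a b = 0) (hnB : ∀ c a b, D.nablaB u c a b = 0)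
    (hQ : ∀ a b c d, D.Q u a b c d = 0) (hPP : D.P u = D.Ph u) (hV : (D.V u).re = 0)
    (lb l : Fin 4 → ℝ) (b : Fin 4) : D.errorTerm u lb l b = 0 := by
  have hPc : cc (D.Ph u) ≠ 0 := (map_ne_zero _).2 hPh
  have hs : ∀ a b c d, D.spin u (D.B u) (D.cH u) a b c d = 0 := by
    intro a b c d
    simp [spin, dot, hB]
  have h1 : ∀ a b, D.errOne u a b = 0 := by
    intro a b
    simp [errOne, hB, hnB, hQ, hs, hPP]
  have e1 : D.Ph u ^ 3 / D.Ph u ^ 4 = 1 / D.Ph u := by field_simp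
  have h2 : ∀ a b, D.errTwo u a b = 0 := by
    intro a b
    rw [errTwo, h1, hPP, e1]; simp
  have hd : D.ImDefect u = 0 := by
    rw [ImDefect, hPP, div_self (pow_ne_zero 4 hPh)]; simp
  have hE : ∀ b, D.Ez u lb l b = 0 := by
    intro b
    rw [Ez, hPP, div_self (pow_ne_zero 2 hPh)]; simp
  have hN : ∀ b, D.EzNull u lb l b = 0 := by
    intro b
    simp [EzNull, hE]
  have e2 : D.Ph u ^ 2 * cc (D.Ph u) ^ 2 / (cc (D.Ph u) ^ 2 * D.Ph u ^ 2) = 1 := by field_simp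
  have e3 : D.Ph u ^ 2 * cc (D.Ph u) ^ 2 / (D.Ph u ^ 2 * cc (D.Ph u) ^ 2) = 1 := by field_simp
  have h3 : D.errThree u lb l b = 0 := by
    rw [errThree, hPP, e2, hd, hN]; simp
  have h4 : D.errFour u lb l b = 0 := by
    rw [errFour, hPP, e3, div_self (pow_ne_zero 4 hPh), hN]; simp
  simp [errorTerm, h2, h3, h4, hd, hV]

end WongCoord

/-! ### Passage from the manifold to charts -/

section Charts

variable {M : Type*} [TopologicalSpace M] [ChartedSpace E4 M]
variable {φ : OpenPartialHomeomorph M E4} {u : E4}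

theorem mdifferentiable_of_mem_maximalAtlas (hφ : φ ∈ IsManifold.maximalAtlas (𝓡 4) ∞ M) :
    φ.MDifferentiable (𝓡 4) (𝓡 4) :=
  ⟨(contMDiffOn_of_mem_maximalAtlas hφ).mdifferentiableOn (by simp),
    (contMDiffOn_symm_of_mem_maximalAtlas hφ).mdifferentiableOn (by simp)⟩

theorem map_eq_sum_single {W : Type*} [AddCommGroup W] [Module ℝ W] [TopologicalSpace W]
    (L : E4 →L[ℝ] W) (w : E4) : L w = ∑ i, w i • L (EuclideanSpace.single i (1 : ℝ)) := by
  have h : w = ∑ i, w i • (EuclideanSpace.single i (1 : ℝ) : E4) := by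
    ext j
    simp [Pi.single_apply]
  conv_lhs => rw [h]
  rw [map_sum]
  simp only [map_smul]

/-- Every tangent vector is the combination of the coordinate vector fields with its components. -/
theorem sum_coordComp_smul (hφ : φ ∈ IsManifold.maximalAtlas (𝓡 4) ∞ M) (hu : u ∈ φ.target)
    (v : TangentSpace (𝓡 4) (φ.symm u)) :
    ∑ i, coordComp φ u v i • coordFrame φ u i = v := by
  obtain ⟨(w : E4), rfl⟩ := (mdifferentiable_of_mem_maximalAtlas hφ).symm.mfderiv_surjective hu v
  have h1 : ∀ i, coordComp φ u (mfderiv (𝓡 4) (𝓡 4) φ.symm u w) i = w i := by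
    intro i
    have h2 := DFunLike.congr_fun ((mdifferentiable_of_mem_maximalAtlas hφ).comp_symm_deriv hu) w
    exact congrArg (fun x : E4 => x i) h2
  simp only [h1, coordFrame]
  exact (map_eq_sum_single (W := TangentSpace (𝓡 4) (φ.symm u))
    (mfderiv (𝓡 4) (𝓡 4) φ.symm u) w).symm

/-- The metric in terms of the components in a chart. -/
theorem FieldData.metric_eq_sum (F : FieldData M) (hφ : φ ∈ IsManifold.maximalAtlas (𝓡 4) ∞ M)
    (hu : u ∈ φ.target) (v w : TangentSpace (𝓡 4) (φ.symm u)) :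
    F.metric (φ.symm u) v w
      = ∑ a, ∑ b, (F.coords φ).g u a b * coordComp φ u v a * coordComp φ u w b := by
  conv_lhs => rw [← sum_coordComp_smul hφ hu v, ← sum_coordComp_smul hφ hu w]
  simp only [map_sum, LinearMap.sum_apply, map_smul, LinearMap.smul_apply, smul_eq_mul,
    Finset.mul_sum]
  rw [Finset.sum_comm]
  exact Finset.sum_congr rfl fun a _ => Finset.sum_congr rfl fun b _ => by
    simp only [FieldData.coords]; ring

/-- An alternating form of top degree is determined by one component. -/
theorem FieldData.vol_eq (F : FieldData M) (a b c d : Fin 4) :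
    (F.coords φ).vol u a b c d = (F.coords φ).vol u 0 1 2 3 * levi a b c d := by
  let L : E4 →ₗ[ℝ] TangentSpace (𝓡 4) (φ.symm u) := (mfderiv (𝓡 4) (𝓡 4) φ.symm u).toLinearMap
  let β := (EuclideanSpace.basisFun (Fin 4) ℝ).toBasis
  have h1 : ∀ s : Fin 4 → Fin 4, F.vol (φ.symm u) (fun k => coordFrame φ u (s k))
      = F.vol (φ.symm u) (fun k => coordFrame φ u k) *
        (Matrix.of fun k => (Pi.single (s k) 1 : Fin 4 → ℝ)).det := by
    intro s
    have h2 := ((F.vol (φ.symm u)).compLinearMap L).eq_smul_basis_det β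
    have h3 := DFunLike.congr_fun h2 (fun k => β (s k))
    have h4 : ∀ k, β k = EuclideanSpace.single k (1 : ℝ) := fun k => by simp [β]
    have h5 : β.det (fun k => β (s k))
        = (Matrix.of fun k => (Pi.single (s k) 1 : Fin 4 → ℝ)).det := by
      rw [Module.Basis.det_apply, ← Matrix.det_transpose]
      congr 1
      ext i j
      rw [Matrix.transpose_apply, Module.Basis.toMatrix_apply, Module.Basis.repr_self]
      simp [Finsupp.single_apply, Pi.single_apply, eq_comm]
    rw [AlternatingMap.smul_apply, h5] at h3
    simp only [AlternatingMap.compLinearMap_apply, h4, smul_eq_mul] at h3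
    exact h3
  have h6 : ∀ a b c d : Fin 4, (F.coords φ).vol u a b c d
      = F.vol (φ.symm u) (fun k => coordFrame φ u (![a, b, c, d] k)) := by
    intro a b c d
    change F.vol (φ.symm u) _ = _
    congr 1
    funext k
    fin_cases k <;> rfl
  have h7 : (fun k => coordFrame φ u (![0, 1, 2, 3] k)) = fun k => coordFrame φ u k := by
    funext k; fin_cases k <;> rfl
  rw [h6, h6, h7, h1]
  congr 1
  rw [← det_of_single_eq_levi]
  congr 1
  ext i j
  fin_cases i <;> rfl

variable {F : FieldData M}

/-- The components of the metric and the volume form in a chart satisfy the pointwise conditions. -/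
theorem FieldData.isLorentzAt (hF : F.IsStationaryElectrovac)
    (hφ : φ ∈ IsManifold.maximalAtlas (𝓡 4) ∞ M) (hu : u ∈ φ.target) :
    (F.coords φ).IsLorentzAt u where
  symm _ _ := hF.metric_symm _ _ _
  frame := by
    obtain ⟨e, he⟩ := hF.lorentzian (φ.symm u)
    refine ⟨fun i a => coordComp φ u (e i) a, ?_⟩
    ext i j
    rw [CoordFields.frame_matrix_apply, CoordFields.gip_eq_sum, ← F.metric_eq_sum hφ hu, he]
    fin_cases i <;> fin_cases j <;> simp [minkN]
  vol := by
    refine ⟨(F.coords φ).vol u 0 1 2 3, fun a b c d => F.vol_eq a b c d, ?_⟩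
    have h1 := hF.vol_sq (φ.symm u) (fun k => coordFrame φ u k)
    have h2 : (F.coords φ).vol u 0 1 2 3 = F.vol (φ.symm u) (fun k => coordFrame φ u k) := by
      change F.vol (φ.symm u) _ = _
      congr 1
      funext k; fin_cases k <;> rfl
    rw [h2, h1]
    rfl

/-- The field equations hold in every chart of the maximal atlas. -/
theorem FieldData.isElectrovacOn (hF : F.IsStationaryElectrovac)
    (hφ : φ ∈ IsManifold.maximalAtlas (𝓡 4) ∞ M) : (F.coords φ).IsElectrovacOn φ.target where
  isOpen := φ.open_target
  lorentz _ hu := F.isLorentzAt hF hφ hu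
  H_alt _ _ _ _ := hF.H_alt _ _ _
  smooth_g _ hu a b := (hF.metric_smooth φ hφ a b).contDiffAt (φ.open_target.mem_nhds hu)
  smooth_vol _ hu a b c d := (hF.vol_smooth φ hφ a b c d).contDiffAt (φ.open_target.mem_nhds hu)
  smooth_H _ hu a b := (hF.H_smooth φ hφ a b).contDiffAt (φ.open_target.mem_nhds hu)
  smooth_T _ hu a := (hF.T_smooth φ hφ a).contDiffAt (φ.open_target.mem_nhds hu)
  equations u hu := hF.equations φ hφ u hu

theorem ContMDiff.contDiffAt_comp_symm {f : M → ℂ} (hf : ContMDiff (𝓡 4) 𝓘(ℝ, ℂ) ∞ f)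
    (hφ : φ ∈ IsManifold.maximalAtlas (𝓡 4) ∞ M) (hu : u ∈ φ.target) :
    ContDiffAt ℝ ∞ (fun v => f (φ.symm v)) u := by
  have h1 : ContMDiffOn (𝓡 4) 𝓘(ℝ, ℂ) ∞ (fun v => f (φ.symm v)) φ.target :=
    hf.comp_contMDiffOn (contMDiffOn_symm_of_mem_maximalAtlas hφ)
  exact (contMDiffOn_iff_contDiffOn.1 h1).contDiffAt (φ.open_target.mem_nhds hu)

/-- A function on a connected manifold whose coordinate derivatives vanish is constant. -/
theorem eq_of_pd_eq_zero [IsManifold (𝓡 4) ∞ M] [ConnectedSpace M]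
    {X : Type*} [NormedAddCommGroup X] [NormedSpace ℝ X]
    {f : M → X}
    (hd : ∀ φ ∈ IsManifold.maximalAtlas (𝓡 4) ∞ M, ∀ u ∈ φ.target,
      DifferentiableAt ℝ (fun v => f (φ.symm v)) u)
    (h0 : ∀ φ ∈ IsManifold.maximalAtlas (𝓡 4) ∞ M, ∀ u ∈ φ.target, ∀ i,
      pd i (fun v => f (φ.symm v)) u = 0) (p q : M) : f p = f q := by
  have hloc : IsLocallyConstant f := by
    rw [IsLocallyConstant.iff_eventually_eq]
    intro x
    have hφ := IsManifold.chart_mem_maximalAtlas (I := 𝓡 4) (n := ∞) x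
    set φ := chartAt E4 x
    have hx : x ∈ φ.source := mem_chart_source E4 x
    obtain ⟨ε, hε, hb⟩ := Metric.isOpen_iff.1 φ.open_target (φ x) (φ.map_source hx)
    have hcont := (φ.continuousAt hx).eventually (Metric.ball_mem_nhds (φ x) hε)
    filter_upwards [hcont, φ.open_source.mem_nhds hx] with y hy hys
    have := (convex_ball (φ x) ε).isPreconnected
    -- On a ball in the target of a chart, a function with zero derivative is constant.
    have h1 := Metric.isOpen_ball.is_const_of_fderiv_eq_zero this
      (f := fun v => f (φ.symm v)) (𝕜 := ℝ)
      (fun v hv => (hd φ hφ v (hb hv)).differentiableWithinAt)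
      (fun v hv => fderiv_eq_zero_of_pd (h0 φ hφ v (hb hv))) hy (Metric.mem_ball_self hε)
    simpa [φ.left_inv hys, φ.left_inv hx] using h1
  exact hloc.apply_eq_of_preconnectedSpace p q

end Charts

/-! ### Propagation of the normalization at infinity -/

namespace WongCoord

variable {D : WongCoord} {Ω : Set E4} {u : E4}

/-- The function `T² + 2 Re V + 4 |Ξ|² - 4 Re (C̄₃ Ξ)` has vanishing gradient. -/
theorem IsSolutionOn.pd_normalization (h : D.IsSolutionOn Ω) (hu : u ∈ Ω) (c : Fin 4) :
    DifferentiableAt ℝ (fun v => D.Tsq v + 2 * (D.V v).re + 4 * Complex.normSq (D.Xi v)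
      - 4 * (cc D.k.C3 * D.Xi v).re) u ∧
    pd c (fun v => D.Tsq v + 2 * (D.V v).re + 4 * Complex.normSq (D.Xi v)
      - 4 * (cc D.k.C3 * D.Xi v).re) u = 0 := by
  have dX := SmoothAt.differentiableAt (h.smooth_Xi u hu)
  have dV := SmoothAt.differentiableAt (h.smooth_V u hu)
  have dT : DifferentiableAt ℝ D.Tsq u :=
    DifferentiableAt.fun_sum fun a _ => (SmoothAt.differentiableAt (CoordFields.smooth_Tlow
      (h.electrovac.smooth_g u hu) (h.electrovac.smooth_T u hu) a)).fun_mul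
        (SmoothAt.differentiableAt (h.electrovac.smooth_T u hu a))
  have dVr : DifferentiableAt ℝ (fun v => (D.V v).re) u :=
    Complex.reCLM.differentiableAt.comp u dV
  have dXr : DifferentiableAt ℝ (fun v => (D.Xi v).re) u :=
    Complex.reCLM.differentiableAt.comp u dX
  have dXi : DifferentiableAt ℝ (fun v => (D.Xi v).im) u :=
    Complex.imCLM.differentiableAt.comp u dX
  have dCX : DifferentiableAt ℝ (fun v => cc D.k.C3 * D.Xi v) u :=
    (differentiableAt_const _).fun_mul dX
  have dCr : DifferentiableAt ℝ (fun v => (cc D.k.C3 * D.Xi v).re) u :=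
    Complex.reCLM.differentiableAt.comp u dCX
  have dn : DifferentiableAt ℝ (fun v => Complex.normSq (D.Xi v)) u := by
    simp only [Complex.normSq_apply]
    exact (dXr.fun_mul dXr).fun_add (dXi.fun_mul dXi)
  have en : pd c (fun v => Complex.normSq (D.Xi v)) u = 2 * (cc (D.Xi u) * pd c D.Xi u).re := by
    simp only [Complex.normSq_apply]
    rw [pd_add (dXr.fun_mul dXr) (dXi.fun_mul dXi), pd_mul dXr dXr, pd_mul dXi dXi, pd_re dX,
      pd_im dX]
    simp [cc]
    ring
  have eT : pd c D.Tsq u = -2 * (pd c D.V u).re - 4 * (D.kap u * pd c D.Xi u).re := by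
    rw [h.electrovac.pd_Tsq hu, h.pd_V u hu, h.pd_Xi u hu, Finset.mul_sum, Complex.re_sum,
      Complex.re_sum, Finset.mul_sum, Finset.mul_sum, ← Finset.sum_neg_distrib,
      ← Finset.sum_sub_distrib]
    refine Finset.sum_congr rfl fun a _ => ?_
    have h1 := CoordFields.two_mul_re_asd D.toCoordFields D.Ernst u a c
    have h2 : D.asd D.Ernst u a c = _ := cF_eq h.C1_ne u a c
    rw [← h1, h2, ← mul_assoc, Complex.re_mul_ofReal, Complex.re_mul_ofReal, Complex.add_re,
      mul_assoc 2, mul_assoc, Complex.mul_re 2]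
    simp
    ring
  have d2 := dV
  refine ⟨((dT.fun_add ((differentiableAt_const (2 : ℝ)).fun_mul dVr)).fun_add
    ((differentiableAt_const (4 : ℝ)).fun_mul dn)).fun_sub
      ((differentiableAt_const (4 : ℝ)).fun_mul dCr), ?_⟩
  rw [pd_sub ((dT.fun_add ((differentiableAt_const (2 : ℝ)).fun_mul dVr)).fun_add
    ((differentiableAt_const (4 : ℝ)).fun_mul dn)) ((differentiableAt_const (4 : ℝ)).fun_mul dCr),
    pd_add (dT.fun_add ((differentiableAt_const (2 : ℝ)).fun_mul dVr))
    ((differentiableAt_const (4 : ℝ)).fun_mul dn),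
    pd_add dT ((differentiableAt_const (2 : ℝ)).fun_mul dVr), pd_const_mul _ dVr,
    pd_const_mul _ dn, pd_const_mul _ dCr, pd_re dV, pd_re dCX, pd_const_mul _ dX, en, eT, kap,
    sub_mul, Complex.sub_re, mul_assoc, Complex.mul_re 2]
  simp
  ring

end WongCoord

section Global

variable {M : Type*} [TopologicalSpace M] [ChartedSpace E4 M] {F : FieldData M} {k : Consts}
  {Xi V Ph : M → ℂ}

theorem FieldData.Tsq_eq {φ : OpenPartialHomeomorph M E4} {u : E4}
    (hφ : φ ∈ IsManifold.maximalAtlas (𝓡 4) ∞ M) (hu : u ∈ φ.target) :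
    (F.coords φ).Tsq u = F.metric (φ.symm u) (F.T (φ.symm u)) (F.T (φ.symm u)) := by
  rw [F.metric_eq_sum hφ hu, CoordFields.Tsq]
  simp only [CoordFields.Tlow, Finset.sum_mul]
  refine Finset.sum_congr rfl fun a _ => Finset.sum_congr rfl fun b _ => ?_
  change _ = (F.coords φ).g u a b * (F.coords φ).T u a * (F.coords φ).T u b
  ring

/-- The global hypotheses give the local ones in every coordinate system. -/
theorem FieldData.isSolutionOn (hF : F.IsStationaryElectrovac) (hk : k.C1 ≠ 0)
    (hXi_smooth : ContMDiff (𝓡 4) 𝓘(ℝ, ℂ) ∞ Xi) (hV_smooth : ContMDiff (𝓡 4) 𝓘(ℝ, ℂ) ∞ V)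
    (hXi : ∀ φ ∈ IsManifold.maximalAtlas (𝓡 4) ∞ M, ∀ u ∈ φ.target, ∀ b,
      pd b (F.wong k Xi V Ph φ).Xi u
        = ∑ a, (F.wong k Xi V Ph φ).cH u a b * ((F.wong k Xi V Ph φ).T u a : ℂ))
    (hV : ∀ φ ∈ IsManifold.maximalAtlas (𝓡 4) ∞ M, ∀ u ∈ φ.target, ∀ b,
      pd b (F.wong k Xi V Ph φ).V u
        = ∑ a, k.C1⁻¹ * (F.wong k Xi V Ph φ).B u a b * ((F.wong k Xi V Ph φ).T u a : ℂ))
    {φ : OpenPartialHomeomorph M E4} (hφ : φ ∈ IsManifold.maximalAtlas (𝓡 4) ∞ M) :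
    (F.wong k Xi V Ph φ).IsSolutionOn φ.target where
  electrovac := F.isElectrovacOn hF hφ
  C1_ne := hk
  smooth_Xi _ hu := hXi_smooth.contDiffAt_comp_symm hφ hu
  smooth_V _ hu := hV_smooth.contDiffAt_comp_symm hφ hu
  pd_Xi := hXi φ hφ
  pd_V := hV φ hφ

/-- The normalization at infinity holds everywhere, in the form of a relation of the scalars. -/
theorem FieldData.isNormalizedAt [IsManifold (𝓡 4) ∞ M] [ConnectedSpace M]
    (hsol : ∀ φ ∈ IsManifold.maximalAtlas (𝓡 4) ∞ M,
      (F.wong k Xi V Ph φ).IsSolutionOn φ.target)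
    {infty : Filter M} [infty.NeBot]
    (hT : Filter.Tendsto (fun p => F.metric p (F.T p) (F.T p)) infty (𝓝 (-1)))
    (hXi : Filter.Tendsto Xi infty (𝓝 0)) (hV : Filter.Tendsto V infty (𝓝 0))
    {φ : OpenPartialHomeomorph M E4} (hφ : φ ∈ IsManifold.maximalAtlas (𝓡 4) ∞ M) {u : E4}
    (hu : u ∈ φ.target) : (F.wong k Xi V Ph φ).IsNormalizedAt u := by
  set f : M → ℝ := fun p => F.metric p (F.T p) (F.T p) + 2 * (V p).re + 4 * Complex.normSq (Xi p)
      - 4 * (cc k.C3 * Xi p).re with hf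
  have hcoord : ∀ φ ∈ IsManifold.maximalAtlas (𝓡 4) ∞ M, ∀ u ∈ φ.target,
      f (φ.symm u) = (F.wong k Xi V Ph φ).Tsq u + 2 * ((F.wong k Xi V Ph φ).V u).re
        + 4 * Complex.normSq ((F.wong k Xi V Ph φ).Xi u)
        - 4 * (cc (F.wong k Xi V Ph φ).k.C3 * (F.wong k Xi V Ph φ).Xi u).re := by
    intro φ hφ u hu
    have := F.Tsq_eq hφ hu
    change _ = (F.coords φ).Tsq u + _ + _ - _
    rw [this]
    rfl
  have hev : ∀ φ ∈ IsManifold.maximalAtlas (𝓡 4) ∞ M, ∀ u ∈ φ.target,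
      (fun v => f (φ.symm v)) =ᶠ[𝓝 u] fun u => (F.wong k Xi V Ph φ).Tsq u
        + 2 * ((F.wong k Xi V Ph φ).V u).re + 4 * Complex.normSq ((F.wong k Xi V Ph φ).Xi u)
        - 4 * (cc (F.wong k Xi V Ph φ).k.C3 * (F.wong k Xi V Ph φ).Xi u).re := by
    intro φ hφ u hu
    filter_upwards [φ.open_target.mem_nhds hu] with v hv
    exact hcoord φ hφ v hv
  have hconst : ∀ p q, f p = f q := eq_of_pd_eq_zero
    (fun φ hφ u hu => (hev φ hφ u hu).differentiableAt_iff.2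
      ((hsol φ hφ).pd_normalization hu 0).1)
    (fun φ hφ u hu i => by
      rw [pd_congr (hev φ hφ u hu), ((hsol φ hφ).pd_normalization hu i).2])
  have hlim : Filter.Tendsto f infty (𝓝 (-1 + 2 * (0 : ℂ).re + 4 * Complex.normSq 0
      - 4 * (cc k.C3 * 0).re)) :=
    ((hT.add (((Complex.continuous_re.tendsto _).comp hV).const_mul 2)).add
      (((Complex.continuous_normSq.tendsto _).comp hXi).const_mul 4)).sub
      (((Complex.continuous_re.tendsto _).comp (hXi.const_mul (cc k.C3))).const_mul 4)
  have hlim' : Filter.Tendsto (fun _ : M => f (φ.symm u)) infty (𝓝 (-1)) := by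
    have : (fun _ : M => f (φ.symm u)) = f := funext fun q => hconst _ q
    rw [this]
    simpa using hlim
  rw [WongCoord.IsNormalizedAt, ← hcoord φ hφ u hu]
  exact tendsto_nhds_unique tendsto_const_nhds hlim'

end Global

/-! ### Derivatives of full contractions -/

namespace CoordFields

variable {D : CoordFields} {Ω : Set E4} {u : E4}

/-- The full contraction of two real tensors of type (0,2). -/
def dotR (D : CoordFields) (u : E4) (X Y : Fin 4 → Fin 4 → ℝ) : ℝ :=
  ∑ a, ∑ b, X a b * D.upM Y u a b

theorem dot_ofReal (D : CoordFields) (u : E4) (X Y : Fin 4 → Fin 4 → ℝ) :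
    D.dot u (fun a b => (X a b : ℂ)) (fun a b => (Y a b : ℂ)) = (D.dotR u X Y : ℂ) := by
  rw [dot, dotR]
  push_cast
  refine Finset.sum_congr rfl fun a _ => Finset.sum_congr rfl fun b _ => ?_
  simp only [upM, guM, Matrix.mul_apply, Matrix.transpose_apply, Matrix.of_apply]
  push_cast
  simp only [Finset.mul_sum, Finset.sum_mul]
  rw [Finset.sum_comm]
  refine Finset.sum_congr rfl fun c _ => Finset.sum_congr rfl fun d _ => by ring

theorem dot_comm (h : D.IsLorentzAt u) (X Y : Fin 4 → Fin 4 → ℂ) :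
    D.dot u X Y = D.dot u Y X := by
  rw [dot, sum_comm_four]
  refine Finset.sum_congr rfl fun a _ => Finset.sum_congr rfl fun b _ =>
    Finset.sum_congr rfl fun c _ => Finset.sum_congr rfl fun d _ => ?_
  rw [h.gu_symm c a, h.gu_symm d b]
  ring

theorem dot_add_left (D : CoordFields) (u : E4) (X Y Z : Fin 4 → Fin 4 → ℂ) :
    D.dot u (fun a b => X a b + Y a b) Z = D.dot u X Z + D.dot u Y Z := by
  simp only [dot, ← Finset.sum_add_distrib, mul_add, add_mul]

theorem dot_smul_left (D : CoordFields) (u : E4) (r : ℂ) (X Z : Fin 4 → Fin 4 → ℂ) :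
    D.dot u (fun a b => r * X a b) Z = r * D.dot u X Z := by
  simp only [dot, Finset.mul_sum]
  refine Finset.sum_congr rfl fun a _ => Finset.sum_congr rfl fun b _ =>
    Finset.sum_congr rfl fun c _ => Finset.sum_congr rfl fun d _ => by ring

theorem dot_sum_left (D : CoordFields) (u : E4) (X : Fin 4 → Fin 4 → Fin 4 → ℂ)
    (Z : Fin 4 → Fin 4 → ℂ) :
    D.dot u (fun a b => ∑ k, X k a b) Z = ∑ k, D.dot u (X k) Z := by
  simp only [Fin.sum_univ_four (f := fun k => X k _ _), Fin.sum_univ_four (f := fun k => D.dot u (X k) Z), dot_add_left]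

/-- The full contraction is compatible with the covariant derivative. -/
theorem IsElectrovacOn.pd_dotR (h : D.IsElectrovacOn Ω) (hu : u ∈ Ω) {X Y : E4 → Fin 4 → Fin 4 → ℝ}
    (hX : ∀ a b, ContDiffAt ℝ ∞ (fun v => X v a b) u)
    (hY : ∀ a b, ContDiffAt ℝ ∞ (fun v => Y v a b) u) (m : Fin 4) :
    DifferentiableAt ℝ (fun v => D.dotR v (X v) (Y v)) u ∧
    pd m (fun v => D.dotR v (X v) (Y v)) u
      = D.dotR u (D.covTwo X u m) (Y u) + D.dotR u (X u) (D.covTwo Y u m) := by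
  have dX := fun a b => SmoothAt.differentiableAt (hX a b)
  have dY := fun a b => SmoothAt.differentiableAt (h.smooth_upM hu hY a b)
  refine ⟨DifferentiableAt.fun_sum fun a _ => DifferentiableAt.fun_sum fun b _ =>
    (dX a b).fun_mul (dY a b), ?_⟩
  simp only [dotR]
  rw [pd_sum fun a _ => DifferentiableAt.fun_sum fun b _ => (dX a b).fun_mul (dY a b)]
  have e : ∀ a, pd m (fun v => ∑ b, X v a b * D.upM (Y v) v a b) u
      = ∑ b, (D.covTwo X u m a b * D.upM (Y u) u a b + X u a b * D.upM (D.covTwo Y u m) u a b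
        + ((∑ d, D.Gamma u d m a * X u d b) * D.upM (Y u) u a b
          - X u a b * ∑ e, D.Gamma u a m e * D.upM (Y u) u e b)
        + ((∑ d, D.Gamma u d m b * X u a d) * D.upM (Y u) u a b
          - X u a b * ∑ e, D.Gamma u b m e * D.upM (Y u) u a e)) := by
    intro a
    rw [pd_sum fun b _ => (dX a b).fun_mul (dY a b)]
    refine Finset.sum_congr rfl fun b _ => ?_
    rw [pd_mul (dX a b) (dY a b), h.pd_upM hu hY, covTwo]
    simp only [smul_eq_mul]
    ring
  have e1 : ∑ a, ∑ b, ((∑ d, D.Gamma u d m a * X u d b) * D.upM (Y u) u a b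
      - X u a b * ∑ e, D.Gamma u a m e * D.upM (Y u) u e b) = 0 := by
    simp only [Finset.sum_sub_distrib, Finset.sum_mul, Finset.mul_sum]
    rw [sub_eq_zero, Finset.sum_comm, Finset.sum_comm (s := Finset.univ) (t := Finset.univ)
      (f := fun a b => ∑ e, X u a b * (D.Gamma u a m e * D.upM (Y u) u e b))]
    refine Finset.sum_congr rfl fun b _ => ?_
    rw [Finset.sum_comm]
    refine Finset.sum_congr rfl fun a _ => Finset.sum_congr rfl fun d _ => by ring
  have e2 : ∑ a, ∑ b, ((∑ d, D.Gamma u d m b * X u a d) * D.upM (Y u) u a b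
      - X u a b * ∑ e, D.Gamma u b m e * D.upM (Y u) u a e) = 0 := by
    simp only [Finset.sum_sub_distrib, Finset.sum_mul, Finset.mul_sum]
    rw [sub_eq_zero]
    refine Finset.sum_congr rfl fun a _ => ?_
    rw [Finset.sum_comm]
    refine Finset.sum_congr rfl fun b _ => Finset.sum_congr rfl fun d _ => by ring
  simp only [e, Finset.sum_add_distrib] at *
  rw [e1, e2]
  ring

/-- The contraction of the anti-self-dual parts of two real 2-forms, in real terms. -/
theorem dot_half_add (h : D.IsLorentzAt u) (X Y X' Y' : Fin 4 → Fin 4 → ℝ) :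
    D.dot u (fun a b => (1 / 2) * ((X a b : ℂ) + Complex.I * (Y a b : ℂ)))
        (fun a b => (1 / 2) * ((X' a b : ℂ) + Complex.I * (Y' a b : ℂ)))
      = (1 / 4) * ((D.dotR u X X' - D.dotR u Y Y' : ℝ)
        + Complex.I * ((D.dotR u X Y' + D.dotR u Y X' : ℝ) : ℂ)) := by
  have r : ∀ (Z : Fin 4 → Fin 4 → ℂ) (A B : Fin 4 → Fin 4 → ℝ),
      D.dot u (fun a b => (1 / 2) * ((A a b : ℂ) + Complex.I * (B a b : ℂ))) Z
      = (1 / 2) * (D.dot u (fun a b => (A a b : ℂ)) Z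
        + Complex.I * D.dot u (fun a b => (B a b : ℂ)) Z) := fun Z A B => by
    rw [dot_smul_left, dot_add_left, dot_smul_left]
  rw [r, dot_comm h, r, dot_comm h (fun a b => (Y a b : ℂ)), r]
  simp only [dot_ofReal]
  have c : ∀ A B : Fin 4 → Fin 4 → ℝ, (D.dotR u A B : ℂ) = D.dotR u B A := fun A B => by
    rw [← dot_ofReal, dot_comm h, dot_ofReal]
  rw [c X' X, c Y' X, c X' Y, c Y' Y]
  push_cast
  linear_combination (1 / 4 * (D.dotR u Y Y' : ℂ)) * Complex.I_sq

/-- The gradient of the square `𝓗²` of an anti-self-dual form. -/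
theorem IsElectrovacOn.pd_dot_asd (h : D.IsElectrovacOn Ω) (hu : u ∈ Ω) {X : E4 → Fin 4 → Fin 4 → ℝ}
    (hX : ∀ v ∈ Ω, ∀ a b, ContDiffAt ℝ ∞ (fun v => X v a b) v) (m : Fin 4) :
    DifferentiableAt ℝ (fun v => D.dot v (D.asd X v) (D.asd X v)) u ∧
    pd m (fun v => D.dot v (D.asd X v) (D.asd X v)) u
      = 2 * D.dot u (D.covTwo (D.asd X) u m) (D.asd X u) := by
  have hL := h.lorentz u hu
  have hX' := hX u hu
  set S : E4 → Fin 4 → Fin 4 → ℝ := fun v => D.hodgeR v (X v) with hS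
  have hSs : ∀ a b, ContDiffAt ℝ ∞ (fun v => S v a b) u := fun a b => h.smooth_hodgeR hu hX' a b
  obtain ⟨d1, e1⟩ := h.pd_dotR hu hX' hX' m
  obtain ⟨d2, e2⟩ := h.pd_dotR hu hSs hSs m
  obtain ⟨d3, e3⟩ := h.pd_dotR hu hX' hSs m
  obtain ⟨d4, e4⟩ := h.pd_dotR hu hSs hX' m
  have ea : ∀ v, D.asd X v
      = fun a b => (1 / 2) * ((X v a b : ℂ) + Complex.I * (S v a b : ℂ)) := fun v => by
    funext a b; rw [asd_eq]
  have e0 : (fun v => D.dot v (D.asd X v) (D.asd X v)) =ᶠ[𝓝 u] fun v => (1 / 4) *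
      ((D.dotR v (X v) (X v) - D.dotR v (S v) (S v) : ℝ)
        + Complex.I * ((D.dotR v (X v) (S v) + D.dotR v (S v) (X v) : ℝ) : ℂ)) := by
    filter_upwards [h.mem_nhds hu] with v hv
    rw [ea, dot_half_add (h.lorentz v hv)]
  have dr : ∀ {f : E4 → ℝ}, DifferentiableAt ℝ f u → DifferentiableAt ℝ (fun v => (f v : ℂ)) u :=
    fun hf => Complex.ofRealCLM.differentiableAt.comp u hf
  have k1 := dr (d1.fun_sub d2)
  have k2 := (dr (d3.fun_add d4)).const_mul Complex.I
  have ec : D.covTwo (D.asd X) u m = fun a b => (1 / 2) *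
      (((D.covTwo X u m a b : ℝ) : ℂ) + Complex.I * ((D.covTwo S u m a b : ℝ) : ℂ)) := by
    funext a b
    rw [h.covTwo_asd hu hX', asdC, hodge_ofReal, hS, h.covTwo_hodgeR hu hX']
  refine ⟨((k1.fun_add k2).const_mul (1 / 4)).congr_of_eventuallyEq e0, ?_⟩
  rw [pd_congr e0, pd_const_mul _ (k1.fun_add k2), pd_add k1 k2,
    pd_const_mul _ (dr (d3.fun_add d4)), pd_ofReal (d1.fun_sub d2), pd_ofReal (d3.fun_add d4),
    pd_sub d1 d2, pd_add d3 d4, e1, e2, e3, e4, ec, ea, dot_half_add hL]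
  have c : ∀ A B : Fin 4 → Fin 4 → ℝ, (D.dotR u A B : ℂ) = D.dotR u B A := fun A B => by
    rw [← dot_ofReal, dot_comm hL, dot_ofReal]
  push_cast
  rw [c (X u), c (S u) (D.covTwo S u m), c (X u), c (S u) (D.covTwo X u m)]
  ring

end CoordFields

/-! ### Contractions with an anti-self-dual 2-form -/

namespace CoordFields

variable {D : CoordFields} {Ω : Set E4} {u : E4}

theorem dotOne_comm (h : D.IsLorentzAt u) (v w : Fin 4 → ℂ) : D.dotOne u v w = D.dotOne u w v := by
  rw [dotOne, Finset.sum_comm]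
  refine Finset.sum_congr rfl fun c _ => Finset.sum_congr rfl fun d _ => ?_
  rw [h.gu_symm]
  ring

theorem dot_tmul (D : CoordFields) (u : E4) (v w : Fin 4 → ℂ) (X : Fin 4 → Fin 4 → ℂ) :
    D.dot u (fun a b => v a * w b) X = D.dotOne u v fun c => D.dotOne u w (X c) := by
  simp only [dot, dotOne, Finset.mul_sum]
  refine Finset.sum_congr rfl fun a _ => ?_
  rw [Finset.sum_comm]
  refine Finset.sum_congr rfl fun b _ => Finset.sum_congr rfl fun c _ =>
    Finset.sum_congr rfl fun d _ => by ring

theorem dot_dotOne_left (D : CoordFields) (u : E4) (x : Fin 4 → ℂ) (Y : Fin 4 → Fin 4 → Fin 4 → ℂ)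
    (Z : Fin 4 → Fin 4 → ℂ) :
    D.dotOne u x (fun a => D.dot u (Y a) Z) = D.dot u (fun c b => D.dotOne u x fun a => Y a c b) Z := by
  simp only [dotOne]
  rw [dot_sum_left]
  refine Finset.sum_congr rfl fun k _ => ?_
  rw [dot_sum_left]
  refine Finset.sum_congr rfl fun l _ => ?_
  rw [dot_smul_left, dot_smul_left]

/-- The tensor `𝓘` acts as the identity on anti-self-dual 2-forms. -/
theorem dot_cI (h : D.IsLorentzAt u) {X : Fin 4 → Fin 4 → ℂ} (hX : ∀ a b, X a b = - X b a)
    (hd : ∀ a b, D.hodge u X a b = -Complex.I * X a b) (a b : Fin 4) :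
    D.dot u (D.cI u a b) X = X a b := by
  have hg : ∀ p (w : Fin 4 → ℂ), D.dotOne u (fun c => (D.g u p c : ℂ)) w = w p := fun p w => by
    rw [dotOne_comm h]
    simp only [h.symm p]
    exact h.dotOne_g w p
  have e : D.cI u a b = fun c d => (1 / 4) * (((D.g u a c : ℂ) * (D.g u b d : ℂ)
      + (-1) * ((D.g u b c : ℂ) * (D.g u a d : ℂ))) + Complex.I * (D.vol u a b c d : ℂ)) := by
    funext c d
    rw [cI]
    push_cast
    ring
  have hv : D.dot u (fun c d => (D.vol u a b c d : ℂ)) X = 2 * D.hodge u X a b := by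
    rw [IsFrame.hodge_eq_dot]; ring
  rw [e, dot_smul_left, dot_add_left, dot_add_left, dot_smul_left, dot_smul_left, dot_tmul,
    dot_tmul, hg, hg, hg, hg, hv, hd, hX b a]
  linear_combination (-(1 / 2) * X a b) * Complex.I_sq

/-- The tensor `X ⊗̃ X` has the anti-self-dual form `X` as an eigenvector. -/
theorem dot_spin_self (h : D.IsLorentzAt u) {X : Fin 4 → Fin 4 → ℂ} (hX : ∀ a b, X a b = - X b a)
    (hd : ∀ a b, D.hodge u X a b = -Complex.I * X a b) (a b : Fin 4) :
    D.dot u (D.spin u X X a b) X = (2 / 3) * D.dot u X X * X a b := by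
  have e : D.spin u X X a b = fun c d => X a b * X c d
      + (-(1 / 3) * D.dot u X X) * D.cI u a b c d := by
    funext c d
    rw [spin]
    ring
  rw [e, dot_add_left, dot_smul_left, dot_smul_left, dot_cI h hX hd]
  ring

theorem dot_smul_right (D : CoordFields) (u : E4) (r : ℂ) (X Z : Fin 4 → Fin 4 → ℂ) :
    D.dot u X (fun a b => r * Z a b) = r * D.dot u X Z := by
  simp only [dot, Finset.mul_sum]
  refine Finset.sum_congr rfl fun a _ => Finset.sum_congr rfl fun b _ =>
    Finset.sum_congr rfl fun c _ => Finset.sum_congr rfl fun d _ => by ring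

/-- The Ricci part of `∇𝓕`, contracted with the bivector of an adapted null frame. The projection
to the anti-self-dual part may be dropped, and what remains is `T` contracted with the conjugate
bivector. -/
theorem flat_dot_ric (u : E4) (τ : Fin 4 → ℝ) (x : Fin 4 → ℂ) :
    (flat nullN).dot u ((flat nullN).asdC u fun i j =>
        wedge (fun i => (τ i : ℂ)) (reflect x) i j + wedge (reflect fun i => (τ i : ℂ)) x i j) bivec
      = -4 * (flat nullN).dotOne u x (fun i => cc (frW τ i)) := by
  have hA : ∀ i j, (flat nullN).asdC u (fun i j =>
        wedge (fun i => (τ i : ℂ)) (reflect x) i j + wedge (reflect fun i => (τ i : ℂ)) x i j) i j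
      = - (flat nullN).asdC u (fun i j =>
        wedge (fun i => (τ i : ℂ)) (reflect x) i j + wedge (reflect fun i => (τ i : ℂ)) x i j) j i := by
    intro i j
    simp only [asdC]
    rw [flat_hodge_antisymm]
    simp only [wedge]
    ring
  rw [flat_dot_null _ _ _ hA bivec_antisymm, flat_dotOne_null]
  simp only [asdC]
  have hw : ∀ i j, (wedge (fun i => (τ i : ℂ)) (reflect x) i j
      + wedge (reflect fun i => (τ i : ℂ)) x i j)
      = - (wedge (fun i => (τ i : ℂ)) (reflect x) j i
      + wedge (reflect fun i => (τ i : ℂ)) x j i) := fun i j => by simp only [wedge]; ring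
  simp only [flat_hodge_null u _ hw]
  simp [bivec, frW, reflect, wedge, cc]
  ring_nf
  simp only [Complex.I_sq]
  ring

end CoordFields

/-! ### The gradients of `𝓗²` and `P̂` when Wong's tensors vanish -/

namespace WongCoord

variable {D : WongCoord} {Ω : Set E4} {u : E4} {lb l : Fin 4 → ℝ} {n : Fin 4 → Fin 4 → ℝ}

open CoordFields

namespace IsSolutionOn

/-- The Ricci part of `∇𝓕`, contracted with the Maxwell form. -/
theorem dot_ricTerm (h : D.IsSolutionOn Ω) (hu : u ∈ Ω) (hn : D.IsFrame u nullN n) {μ : ℂ}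
    (hμ : ∀ i j, frTwo n (D.cH u) i j = μ * bivec i j) (a : Fin 4) :
    D.dot u (D.asdC u (ricTerm D.toCoordFields u a)) (D.cH u)
      = 4 * D.cHsq u * cc (pd a D.Xi u) := by
  have hL := h.electrovac.lorentz u hu
  have key : ∀ x, D.dotOne u x (fun a => D.dot u (D.asdC u (ricTerm D.toCoordFields u a)) (D.cH u))
      = D.dotOne u x fun a => 4 * D.cHsq u * cc (pd a D.Xi u) := by
    intro x
    have hτ : ∀ i, frOne n (Tc D.toCoordFields u) i = ((∑ a, n i a * D.Tlow u a : ℝ) : ℂ) :=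
      fun i => frOne_ofReal n (D.Tlow u) i
    set τ : Fin 4 → ℝ := fun i => ∑ a, n i a * D.Tlow u a
    have hξ := h.frOne_pd_Xi hu hn hμ hτ
    have hH : frTwo n (D.cH u) = fun i j => μ * bivec i j :=
      funext fun i => funext fun j => hμ i j
    have e3 := h.frTwo_asdC_wedge_Rc hu hn hμ hτ x
    have e4 : frOne n (fun a => cc (pd a D.Xi u)) = fun i => cc μ * cc (frW τ i) := by
      funext i; rw [frOne_conj, hξ]; exact map_mul _ _ _
    have e5 := funext fun c => funext fun b => h.dotOne_asdC_ricTerm hu x c b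
    rw [dot_dotOne_left, e5, dotOne_smul_right, hn.dotOne_eq, e4, dotOne_smul_right]
    change D.dot u (D.asdC u fun c b =>
          wedge (Tc D.toCoordFields u) (D.ins u x (Rc D.toCoordFields u)) c b
          + wedge (D.ins u (Tc D.toCoordFields u) (Rc D.toCoordFields u)) x c b) _ = _
    rw [hn.dot_eq, e3, hH, dot_smul_left, dot_smul_right, flat_dot_ric, hn.cHsq_eq hμ]
    ring
  have := key fun b => (D.g u b a : ℂ)
  rwa [dotOne_comm hL, hL.dotOne_g, dotOne_comm hL, hL.dotOne_g] at this

theorem Ph_ne_zero (h : D.IsSolutionOn Ω) (hH : D.cHsq u ≠ 0)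
    (hPh : D.Ph u ^ 4 = -1 / (D.k.C1 ^ 2 * D.cHsq u)) : D.Ph u ≠ 0 := by
  intro h0
  rw [h0, zero_pow four_ne_zero] at hPh
  exact div_ne_zero (neg_ne_zero.2 one_ne_zero)
    (mul_ne_zero (pow_ne_zero _ h.C1_ne) hH) hPh.symm

theorem pd_cHsq (h : D.IsSolutionOn Ω) (hu : u ∈ Ω) (c : Fin 4) :
    DifferentiableAt ℝ D.cHsq u ∧
    pd c D.cHsq u = 2 * D.dot u (D.covTwo D.cH u c) (D.cH u) :=
  h.electrovac.pd_dot_asd hu (fun _ hv => h.electrovac.smooth_H _ hv) c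

/-- If Wong's tensors vanish, `𝓗²` has the gradient `8 P̂ 𝓗² ∇Ξ`: this is the contraction with the
Maxwell form of the formula for `∇𝓕`. -/
theorem pd_cHsq_of_vanish (h : D.IsSolutionOn Ω) (hu : u ∈ Ω) (hk : D.kap u ≠ 0)
    (hn : D.IsFrame u nullN n) {μ : ℂ}
    (hμ : ∀ i j, frTwo n (D.cH u) i j = μ * bivec i j)
    (hB : ∀ a b, D.B u a b = 0) (hnB : ∀ c a b, D.nablaB u c a b = 0)
    (hQ : ∀ a b c d, D.Q u a b c d = 0) (a : Fin 4) :
    pd a D.cHsq u = 8 * D.Ph u * D.cHsq u * pd a D.Xi u := by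
  have hL := h.electrovac.lorentz u hu
  have hA := h.cH_antisymm hu
  have hF : D.cF u = fun a b => 2 * D.kap u * D.cH u a b := by
    funext a b
    rw [cF_eq h.C1_ne, hB]
    ring
  have hHd : ∀ a b, D.hodge u (D.cH u) a b = -Complex.I * D.cH u a b := fun a b =>
    hL.hodge_asdC (fun a b => by rw [h.electrovac.H_alt u hu]; push_cast; ring) a b
  -- `𝓕 = 2 κ 𝓗`, differentiated.
  have e1 : D.covTwo D.cF u a = fun c b => 2 * D.kap u * D.covTwo D.cH u a c b
      + 4 * cc (pd a D.Xi u) * D.cH u c b := by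
    funext c b
    have := h.nablaB_eq hu a c b
    rw [hnB] at this
    have := (mul_eq_zero.1 this.symm).resolve_left h.C1_ne
    linear_combination this
  have e2 : D.dot u (D.covTwo D.cF u a) (D.cH u)
      = D.kap u * pd a D.cHsq u + 4 * cc (pd a D.Xi u) * D.cHsq u := by
    rw [e1, dot_add_left, dot_smul_left, dot_smul_left, (h.pd_cHsq hu a).2, cHsq]
    ring
  have hs : ∀ d, D.cC u d a = fun c b => 6 * D.Ph u * D.kap u * D.spin u (D.cH u) (D.cH u) d a c b := by
    intro d
    funext c b
    have := hQ d a c b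
    rw [Q, hF] at this
    simp only [spin, dot_smul_left] at this ⊢
    linear_combination this
  -- The same derivative, expressed by the curvature.
  have e3 : D.covTwo D.cF u a = fun c b => 2 * (∑ d, (D.T u d : ℂ) * D.cC u d a c b)
      + D.asdC u (ricTerm D.toCoordFields u a) c b := by
    funext c b
    exact h.electrovac.covTwo_cF_split hu a c b
  -- The Ricci term is the term with the derivative of `κ` in `e2`, and the two cancel.
  have e4 : D.dot u (D.covTwo D.cF u a) (D.cH u)
      = 8 * D.Ph u * D.kap u * D.cHsq u * pd a D.Xi u + 4 * D.cHsq u * cc (pd a D.Xi u) := by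
    rw [e3, dot_add_left, h.dot_ricTerm hu hn hμ, dot_smul_left, dot_sum_left, h.pd_Xi u hu]
    simp only [dot_smul_left, hs, dot_spin_self hL hA hHd]
    rw [cHsq, Finset.mul_sum, Finset.mul_sum]
    congr 1
    refine Finset.sum_congr rfl fun d _ => ?_
    rw [hA d a, hA a d]
    ring
  have := e2.symm.trans e4
  refine mul_left_cancel₀ hk ?_
  linear_combination this

theorem nablaB_of_vanish (h : D.IsSolutionOn Ω) (hu : u ∈ Ω) (hB : ∀ v ∈ Ω, ∀ a b, D.B v a b = 0)
    (c a b : Fin 4) : D.nablaB u c a b = 0 := by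
  have : D.nablaB u c a b = D.covTwo (fun _ _ _ => (0 : ℂ)) u c a b :=
    covTwo_congr ((h.electrovac.mem_nhds hu).mono fun v hv => hB v hv) c a b
  rw [this, covTwo, pd_const]
  simp

/-- If Wong's tensors vanish, the function `1 / P̂ - 2 Ξ` has vanishing gradient. -/
theorem pd_inv_Ph_sub (h : D.IsSolutionOn Ω) (hu : u ∈ Ω)
    (hB : ∀ v ∈ Ω, ∀ a b, D.B v a b = 0) (hQ : ∀ v ∈ Ω, ∀ a b c d, D.Q v a b c d = 0)
    (hk : D.kap u ≠ 0) (hH : ∀ v ∈ Ω, D.cHsq v ≠ 0)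
    (hPh : ∀ v ∈ Ω, D.Ph v ^ 4 = -1 / (D.k.C1 ^ 2 * D.cHsq v))
    (hd : DifferentiableAt ℝ D.Ph u) (a : Fin 4) :
    DifferentiableAt ℝ (fun v => 1 / D.Ph v - 2 * D.Xi v) u ∧
    pd a (fun v => 1 / D.Ph v - 2 * D.Xi v) u = 0 := by
  obtain ⟨lb, l, hp⟩ := h.exists_principal_pair hu (hH u hu) (hPh u hu)
  obtain ⟨n, hn, h0, h1⟩ := hp.exists_frame (h.electrovac.lorentz u hu)
  have hμ := hp.frTwo_cH hn h0 h1
  have hP0 := h.Ph_ne_zero (hH u hu) (hPh u hu)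
  have dX := SmoothAt.differentiableAt (h.smooth_Xi u hu)
  have e1 := h.pd_cHsq_of_vanish hu hk hn hμ (hB u hu) (h.nablaB_of_vanish hu hB) (hQ u hu) a
  have dH := (h.pd_cHsq hu a).1
  -- differentiate the relation `P̂⁴ C₁² 𝓗² = -1`
  have e2 : (fun v => D.Ph v * D.Ph v * (D.Ph v * D.Ph v) * D.cHsq v) =ᶠ[𝓝 u]
      fun _ => -1 / D.k.C1 ^ 2 := by
    filter_upwards [h.electrovac.mem_nhds hu] with v hv
    have h2 := hH v hv
    have h3 := h.C1_ne
    have := hPh v hv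
    rw [show D.Ph v * D.Ph v * (D.Ph v * D.Ph v) = D.Ph v ^ 4 by ring, this]
    field_simp
  have e3 := pd_congr e2 a
  have d2 := hd.fun_mul hd
  rw [pd_const, pd_mul (d2.fun_mul d2) dH, pd_mul d2 d2, pd_mul hd hd, e1] at e3
  have e4 : pd a D.Ph u = -2 * D.Ph u ^ 2 * pd a D.Xi u := by
    have : 4 * D.Ph u ^ 3 * D.cHsq u ≠ 0 :=
      mul_ne_zero (mul_ne_zero (by norm_num) (pow_ne_zero _ hP0)) (hH u hu)
    refine mul_left_cancel₀ this ?_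
    linear_combination e3
  have di : DifferentiableAt ℝ (fun v => 1 / D.Ph v) u := by
    simpa only [one_div] using hd.fun_inv hP0
  refine ⟨di.fun_sub (dX.const_mul 2), ?_⟩
  rw [pd_sub di (dX.const_mul 2), pd_const_mul _ dX]
  have e5 : (fun v => D.Ph v * (1 / D.Ph v)) =ᶠ[𝓝 u] fun _ => 1 := by
    filter_upwards [hd.continuousAt.eventually_ne hP0] with v hv
    rw [mul_one_div_cancel hv]
  have e6 := pd_congr e5 a
  rw [pd_const, pd_mul hd di, e4] at e6
  refine mul_left_cancel₀ hP0 ?_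
  rw [mul_zero]
  field_simp at e6
  linear_combination e6

end IsSolutionOn
end WongCoord

/-! ### The potentials when Wong's tensors vanish -/

section

variable {M : Type*} [TopologicalSpace M] [ChartedSpace E4 M] {F : FieldData M} {k : Consts}
  {Xi V Ph : M → ℂ}

theorem eq_of_const_of_tendsto {X : Type*} [TopologicalSpace X] [T2Space X] {α : Type*} {f : α → X}
    {c : X} {l : Filter α} [l.NeBot] (hf : ∀ p q, f p = f q) (h : Filter.Tendsto f l (𝓝 c))
    (p : α) : f p = c :=
  tendsto_nhds_unique (tendsto_const_nhds.congr fun q => hf p q) h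

/-- If Wong's tensors vanish identically, then `V = 0`, `Ξ` has no zeros and `P̂ = P`. -/
theorem FieldData.potentials_of_vanish [IsManifold (𝓡 4) ∞ M] [ConnectedSpace M]
    (hsol : ∀ φ ∈ IsManifold.maximalAtlas (𝓡 4) ∞ M,
      (F.wong k Xi V Ph φ).IsSolutionOn φ.target)
    (hPh : ∀ φ ∈ IsManifold.maximalAtlas (𝓡 4) ∞ M, ∀ u ∈ φ.target,
      (F.wong k Xi V Ph φ).cHsq u ≠ 0 →
        (F.wong k Xi V Ph φ).Ph u ^ 4 = -1 / (k.C1 ^ 2 * (F.wong k Xi V Ph φ).cHsq u))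
    {infty : Filter M} [infty.NeBot]
    (hV_infty : Filter.Tendsto V infty (𝓝 0))
    (hPh_smooth : ContMDiff (𝓡 4) 𝓘(ℝ, ℂ) ∞ Ph)
    (hPh_infty : Filter.Tendsto (fun p => 1 / Ph p - 2 * Xi p) infty (𝓝 0))
    (hvan : ∀ φ ∈ IsManifold.maximalAtlas (𝓡 4) ∞ M, ∀ u ∈ φ.target,
        (F.wong k Xi V Ph φ).cHsq u ≠ 0 ∧ (F.wong k Xi V Ph φ).kap u ≠ 0 ∧
        (∀ a b, (F.wong k Xi V Ph φ).B u a b = 0) ∧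
        (∀ a b c d, (F.wong k Xi V Ph φ).Q u a b c d = 0)) (p : M) :
    V p = 0 ∧ Xi p ≠ 0 ∧ Ph p = 1 / (2 * Xi p) := by
  have hV : ∀ p q, V p = V q := by
    refine eq_of_pd_eq_zero
      (fun φ hφ u hu => SmoothAt.differentiableAt ((hsol φ hφ).smooth_V u hu)) fun φ hφ u hu i => ?_
    have := (hsol φ hφ).pd_V u hu i
    simp only [(hvan φ hφ u hu).2.2.1, mul_zero, zero_mul, Finset.sum_const_zero] at this
    exact this
  have hP := fun φ hφ u hu i => (hsol φ hφ).pd_inv_Ph_sub hu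
    (fun v hv => (hvan φ hφ v hv).2.2.1) (fun v hv => (hvan φ hφ v hv).2.2.2)
    (hvan φ hφ u hu).2.1 (fun v hv => (hvan φ hφ v hv).1)
    (fun v hv => hPh φ hφ v hv (hvan φ hφ v hv).1)
    (SmoothAt.differentiableAt (hPh_smooth.contDiffAt_comp_symm hφ hu)) i
  have hc : ∀ p q, 1 / Ph p - 2 * Xi p = 1 / Ph q - 2 * Xi q :=
    eq_of_pd_eq_zero (fun φ hφ u hu => (hP φ hφ u hu 0).1) fun φ hφ u hu i => (hP φ hφ u hu i).2
  have h1 := eq_of_const_of_tendsto hc hPh_infty p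
  have hp0 : Ph p ≠ 0 := by
    have hφ := IsManifold.chart_mem_maximalAtlas (I := 𝓡 4) (n := ∞) p
    have hu := mem_chart_target E4 p
    have := (hsol _ hφ).Ph_ne_zero (hvan _ hφ _ hu).1 (hPh _ hφ _ hu (hvan _ hφ _ hu).1)
    change Ph ((chartAt E4 p).symm (chartAt E4 p p)) ≠ 0 at this
    rwa [(chartAt E4 p).left_inv (mem_chart_source E4 p)] at this
  have h2 : 2 * Xi p = 1 / Ph p := (sub_eq_zero.1 h1).symm
  refine ⟨eq_of_const_of_tendsto hV hV_infty p, fun h0 => ?_, ?_⟩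
  · rw [h0, mul_zero] at h2
    exact one_div_ne_zero hp0 h2.symm
  · rw [h2, one_div_one_div]

end

/-! ### The Kerr-Newman metric -/

namespace KerrNewman

variable {m a q : ℝ} {u : E4}

/-- The point with coordinates `u` lies in the exterior region, off the axis. -/
structure IsExterior (m a q : ℝ) (u : E4) : Prop where
  r_pos : 0 < u 1
  sin_pos : 0 < Real.sin (u 2)
  Del_pos : 0 < Del m a q u

theorem IsExterior.Sig_pos (h : IsExterior m a q u) : 0 < Sig a u := by
  have := h.r_pos
  unfold Sig
  positivity

theorem Sig_eq (a : ℝ) (u : E4) :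
    Sig a u = u 1 ^ 2 + a ^ 2 - a ^ 2 * Real.sin (u 2) ^ 2 := by
  rw [Sig, Real.cos_sq']
  ring

/-- The inverse of the Kerr-Newman metric. -/
def invMetric (m a q : ℝ) (u : E4) : Matrix (Fin 4) (Fin 4) ℝ :=
  !![-((u 1 ^ 2 + a ^ 2) ^ 2 - Del m a q u * a ^ 2 * Real.sin (u 2) ^ 2)
        / (Del m a q u * Sig a u), 0, 0,
      -(a * (u 1 ^ 2 + a ^ 2 - Del m a q u)) / (Del m a q u * Sig a u);
    0, Del m a q u / Sig a u, 0, 0;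
    0, 0, 1 / Sig a u, 0;
    -(a * (u 1 ^ 2 + a ^ 2 - Del m a q u)) / (Del m a q u * Sig a u), 0, 0,
      (Del m a q u - a ^ 2 * Real.sin (u 2) ^ 2)
        / (Del m a q u * Sig a u * Real.sin (u 2) ^ 2)]

theorem of_metric (m a q : ℝ) (u : E4) : Matrix.of (metric m a q u) =
    !![-(Del m a q u - a ^ 2 * Real.sin (u 2) ^ 2) / Sig a u, 0, 0,
      -(a * Real.sin (u 2) ^ 2 * (u 1 ^ 2 + a ^ 2 - Del m a q u)) / Sig a u;
    0, Sig a u / Del m a q u, 0, 0;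
    0, 0, Sig a u, 0;
    -(a * Real.sin (u 2) ^ 2 * (u 1 ^ 2 + a ^ 2 - Del m a q u)) / Sig a u, 0, 0,
      ((u 1 ^ 2 + a ^ 2) ^ 2 - Del m a q u * a ^ 2 * Real.sin (u 2) ^ 2) / Sig a u
        * Real.sin (u 2) ^ 2] := rfl

theorem IsExterior.metric_mul_invMetric (h : IsExterior m a q u) :
    Matrix.of (metric m a q u) * invMetric m a q u = 1 := by
  have h1 := h.Sig_pos.ne'
  have h2 := h.Del_pos.ne'
  have h3 := h.sin_pos.ne'
  have h4 := Sig_eq a u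
  ext i j
  fin_cases i <;> fin_cases j <;>
    simp [of_metric, invMetric, Matrix.mul_apply, Fin.sum_univ_four]
  all_goals
    generalize Sig a u = S at *
    generalize Real.sin (u 2) = s at *
    generalize Del m a q u = Δ at *
    generalize u 1 = r at *
    field_simp
    try rw [h4]
    try ring

/-- The determinant is `-Σ² sin² θ`, so the volume form is `± Σ sin θ dt ∧ dr ∧ dθ ∧ dφ`. -/
theorem IsExterior.det_metric (h : IsExterior m a q u) :
    (Matrix.of (metric m a q u)).det = -(Sig a u * Real.sin (u 2)) ^ 2 := by
  have h1 := h.Sig_pos.ne'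
  have h2 := h.Del_pos.ne'
  have h4 := Sig_eq a u
  rw [of_metric, Matrix.det_succ_row_zero]
  simp [Matrix.det_fin_three, Fin.sum_univ_four, Fin.succAbove, Matrix.submatrix]
  generalize Sig a u = S at *
  generalize Real.sin (u 2) = s at *
  generalize Del m a q u = Δ at *
  generalize u 1 = r at *
  field_simp
  rw [h4]
  ring

theorem hasFDerivAt_coord (u : E4) (i : Fin 4) :
    HasFDerivAt (fun v : E4 => v i) (EuclideanSpace.proj i : E4 →L[ℝ] ℝ) u :=
  (EuclideanSpace.proj i : E4 →L[ℝ] ℝ).hasFDerivAt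

theorem pd_eq_of_hasFDerivAt {X : Type*} [NormedAddCommGroup X] [NormedSpace ℝ X] {f : E4 → X}
    {L : E4 →L[ℝ] X} (h : HasFDerivAt f L u) (i : Fin 4) :
    pd i f u = L (EuclideanSpace.single i 1) := by
  rw [pd, h.fderiv]

theorem pd_coord (u : E4) (i j : Fin 4) :
    pd i (fun v : E4 => v j) u = if j = i then 1 else 0 := by
  rw [pd_eq_of_hasFDerivAt (hasFDerivAt_coord u j)]
  simp

/-- The partial derivatives of a function of the coordinates `r` and `θ` only. -/
theorem pd_comp_coord {f : ℝ → ℝ} {f' : ℝ} (j : Fin 4) (hf : HasDerivAt f f' (u j)) (i : Fin 4) :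
    DifferentiableAt ℝ (fun v : E4 => f (v j)) u ∧
    pd i (fun v : E4 => f (v j)) u = if j = i then f' else 0 := by
  have := hf.comp_hasFDerivAt u (hasFDerivAt_coord u j)
  refine ⟨this.differentiableAt, ?_⟩
  rw [show (fun v : E4 => f (v j)) = f ∘ fun v : E4 => v j from rfl, pd_eq_of_hasFDerivAt this]
  simp

end KerrNewman

/-! ### The Kerr-Newman Maxwell field -/

namespace KerrNewman

variable {m a q : ℝ} {u : E4}

theorem pd_Sig (a : ℝ) (u : E4) (i : Fin 4) : DifferentiableAt ℝ (Sig a) u ∧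
    pd i (Sig a) u = (if 1 = i then 2 * u 1 else 0)
      - (if 2 = i then 2 * a ^ 2 * Real.cos (u 2) * Real.sin (u 2) else 0) := by
  obtain ⟨d1, e1⟩ := pd_comp_coord (u := u) 1 (hasDerivAt_pow 2 (u 1)) i
  have h2 : HasDerivAt (fun x : ℝ => a ^ 2 * Real.cos x ^ 2)
      (-(2 * a ^ 2 * Real.cos (u 2) * Real.sin (u 2))) (u 2) := by
    exact (((Real.hasDerivAt_cos (u 2)).pow 2).const_mul (a ^ 2)).congr_deriv (by push_cast; ring)
  obtain ⟨d2, e2⟩ := pd_comp_coord (u := u) 2 h2 i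
  have e : Sig a = fun v => v 1 ^ 2 + a ^ 2 * Real.cos (v 2) ^ 2 := rfl
  refine ⟨d1.fun_add d2, ?_⟩
  rw [e, pd_add d1 d2, e1, e2]
  split_ifs <;> simp [sub_eq_add_neg]

/-- The derivatives of the function `q r / Σ`. -/
theorem IsExterior.pd_pot (h : IsExterior m a q u) (i : Fin 4) :
    DifferentiableAt ℝ (fun v => q * v 1 / Sig a v) u ∧
    pd i (fun v => q * v 1 / Sig a v) u
      = (if 1 = i then -(q * (u 1 ^ 2 - a ^ 2 * Real.cos (u 2) ^ 2)) / Sig a u ^ 2 else 0)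
        + (if 2 = i then 2 * q * u 1 * a ^ 2 * Real.cos (u 2) * Real.sin (u 2) / Sig a u ^ 2
            else 0) := by
  have h0 := h.Sig_pos.ne'
  obtain ⟨dS, eS⟩ := pd_Sig a u i
  have d1 : DifferentiableAt ℝ (fun v : E4 => v 1) u := (hasFDerivAt_coord u 1).differentiableAt
  have df : DifferentiableAt ℝ (fun v => q * v 1 / Sig a v) u := by
    simpa only [div_eq_mul_inv] using (d1.const_mul q).fun_mul (dS.fun_inv h0)
  refine ⟨df, ?_⟩
  have e1 : (fun v => q * v 1 / Sig a v * Sig a v) =ᶠ[𝓝 u] fun v => q * v 1 := by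
    filter_upwards [dS.continuousAt.eventually_ne h0] with v hv
    exact div_mul_cancel₀ _ hv
  have e2 := pd_congr e1 i
  rw [pd_mul df dS, pd_const_mul _ d1, pd_coord, eS] at e2
  refine mul_right_cancel₀ h0 ?_
  rw [eq_sub_of_add_eq e2]
  have h4 : Sig a u = u 1 ^ 2 + a ^ 2 * Real.cos (u 2) ^ 2 := rfl
  fin_cases i <;> simp
  · generalize Sig a u = S at *
    field_simp
    rw [h4]
    ring
  · field_simp

/-- The Maxwell field of the Kerr-Newman solution. -/
def maxwell (a q : ℝ) (u : E4) : Matrix (Fin 4) (Fin 4) ℝ :=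
  !![0, -(q * (u 1 ^ 2 - a ^ 2 * Real.cos (u 2) ^ 2)) / Sig a u ^ 2,
      2 * q * u 1 * a ^ 2 * Real.cos (u 2) * Real.sin (u 2) / Sig a u ^ 2, 0;
    q * (u 1 ^ 2 - a ^ 2 * Real.cos (u 2) ^ 2) / Sig a u ^ 2, 0, 0,
      -(q * a * Real.sin (u 2) ^ 2 * (u 1 ^ 2 - a ^ 2 * Real.cos (u 2) ^ 2)) / Sig a u ^ 2;
    -(2 * q * u 1 * a ^ 2 * Real.cos (u 2) * Real.sin (u 2)) / Sig a u ^ 2, 0, 0,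
      2 * q * u 1 * a * Real.cos (u 2) * Real.sin (u 2) * (u 1 ^ 2 + a ^ 2) / Sig a u ^ 2;
    0, q * a * Real.sin (u 2) ^ 2 * (u 1 ^ 2 - a ^ 2 * Real.cos (u 2) ^ 2) / Sig a u ^ 2,
      -(2 * q * u 1 * a * Real.cos (u 2) * Real.sin (u 2) * (u 1 ^ 2 + a ^ 2)) / Sig a u ^ 2, 0]

/-- The exterior derivative of the Boyer-Lindquist potential. -/
theorem IsExterior.maxwell_eq (h : IsExterior m a q u) (i j : Fin 4) :
    pd i (fun v => potential a q v j) u - pd j (fun v => potential a q v i) u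
      = maxwell a q u i j := by
  have h0 := h.Sig_pos.ne'
  have h4 := Sig_eq a u
  have hs : HasDerivAt (fun x : ℝ => a * Real.sin x ^ 2)
      (2 * a * Real.cos (u 2) * Real.sin (u 2)) (u 2) := by
    exact (((Real.hasDerivAt_sin (u 2)).pow 2).const_mul a).congr_deriv (by push_cast; ring)
  have p0 : ∀ i, pd i (fun v => potential a q v 0) u = - pd i (fun v => q * v 1 / Sig a v) u :=
    fun i => pd_neg _ i
  have p1 : ∀ i, pd i (fun v => potential a q v 1) u = 0 := fun i => pd_const 0 i
  have p2 : ∀ i, pd i (fun v => potential a q v 2) u = 0 := fun i => pd_const 0 i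
  have p3 : ∀ i, pd i (fun v => potential a q v 3) u = _ := fun i =>
    (pd_mul (h.pd_pot i).1 (pd_comp_coord (u := u) 2 hs i).1 i)
  fin_cases i <;> fin_cases j <;>
    simp [p0, p1, p2, p3, (h.pd_pot _).2, (pd_comp_coord (u := u) 2 hs _).2, maxwell]
  all_goals
    generalize Sig a u = S at *
    generalize Real.sin (u 2) = s at *
    generalize u 1 = r at *
    field_simp
    try rw [h4]
    try ring

end KerrNewman

/-! ### The Hodge dual of the Kerr-Newman Maxwell field -/

namespace KerrNewman

variable {m a q σ : ℝ} {u : E4}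

/-- The fields `g`, `ε`, `H` at one point of the Kerr-Newman exterior; the sign `σ` is the
orientation of the Boyer-Lindquist coordinates. -/
structure IsFieldAt (D : CoordFields) (m a q σ : ℝ) (u : E4) : Prop where
  exterior : IsExterior m a q u
  g_eq : ∀ i j, D.g u i j = metric m a q u i j
  H_eq : ∀ i j, D.H u i j = maxwell a q u i j
  vol_eq : ∀ i j k l, D.vol u i j k l = σ * (Sig a u * Real.sin (u 2)) * levi i j k l
  sign_sq : σ ^ 2 = 1

variable {D : CoordFields}

theorem IsFieldAt.guM_eq (h : IsFieldAt D m a q σ u) : D.guM u = invMetric m a q u := by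
  rw [CoordFields.guM_eq, CoordFields.gM, show D.g u = metric m a q u from
    funext fun i => funext fun j => h.g_eq i j]
  exact Matrix.inv_eq_right_inv h.exterior.metric_mul_invMetric

theorem levi_values : levi 0 1 2 3 = 1 ∧ levi 0 1 3 2 = -1 ∧ levi 0 2 1 3 = -1 ∧ levi 0 2 3 1 = 1 ∧
    levi 0 3 1 2 = 1 ∧ levi 0 3 2 1 = -1 ∧ levi 3 1 0 2 = 1 ∧ levi 3 1 2 0 = -1 ∧
    levi 3 2 0 1 = -1 ∧ levi 3 2 1 0 = 1 ∧ levi 1 2 0 3 = 1 ∧ levi 1 2 3 0 = -1 := by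
  norm_num [levi]

/-- The components of the Hodge dual of the Kerr-Newman Maxwell field. -/
theorem IsFieldAt.hodgeR_eq (h : IsFieldAt D m a q σ u) :
    D.hodgeR u (D.H u) 0 1
      = σ * (2 * q * u 1 * a * Real.cos (u 2) / Sig a u ^ 2) ∧
    D.hodgeR u (D.H u) 0 2
      = σ * (q * a * Real.sin (u 2) * (u 1 ^ 2 - a ^ 2 * Real.cos (u 2) ^ 2) / Sig a u ^ 2) ∧
    D.hodgeR u (D.H u) 0 3 = 0 ∧
    D.hodgeR u (D.H u) 3 1
      = -σ * (2 * q * u 1 * a ^ 2 * Real.sin (u 2) ^ 2 * Real.cos (u 2) / Sig a u ^ 2) ∧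
    D.hodgeR u (D.H u) 3 2
      = -σ * (q * Real.sin (u 2) * (u 1 ^ 2 + a ^ 2) * (u 1 ^ 2 - a ^ 2 * Real.cos (u 2) ^ 2)
          / Sig a u ^ 2) ∧
    D.hodgeR u (D.H u) 1 2 = 0 := by
  have hS := h.exterior.Sig_pos.ne'
  have hD := h.exterior.Del_pos.ne'
  have hs := h.exterior.sin_pos.ne'
  have h4 := Sig_eq a u
  obtain ⟨l1, l2, l3, l4, l5, l6, l7, l8, l9, l10, l11, l12⟩ := levi_values
  have hz : ∀ i j k l, (i = j ∨ i = k ∨ i = l ∨ j = k ∨ j = l ∨ k = l) → levi i j k l = 0 := by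
    rintro i j k l (h | h | h | h | h | h) <;> simp [levi, h]
  have hH : Matrix.of (D.H u) = maxwell a q u := by
    ext i j; exact h.H_eq i j
  have hU : ∀ c d, D.upM (D.H u) u c d
      = (invMetric m a q u * maxwell a q u * (invMetric m a q u).transpose) c d := fun c d => by
    rw [CoordFields.upM, h.guM_eq, hH]
  simp only [CoordFields.hodgeR, h.vol_eq, hU, Fin.sum_univ_four]
  refine ⟨?_, ?_, ?_, ?_, ?_, ?_⟩
  all_goals
    simp [l1, l2, l3, l4, l5, l6, l7, l8, l9, l10, l11, l12, hz, Matrix.mul_apply,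
      Fin.sum_univ_four, invMetric, maxwell]
    try
      generalize Sig a u = S at *
      generalize Real.sin (u 2) = s at *
      generalize Del m a q u = Δ at *
      generalize u 1 = r at *
      field_simp
      rw [h4]
      ring

end KerrNewman

/-! ### The anti-self-dual Kerr-Newman Maxwell form -/

namespace KerrNewman

variable {m a q σ : ℝ} {u : E4}

/-- The complex radius `r + i σ a cos θ`. -/
def rho (a σ : ℝ) (u : E4) : ℂ := ⟨u 1, σ * a * Real.cos (u 2)⟩

/-- `Σ = |r + i σ a cos θ|²`. -/
theorem normSq_rho (hσ : σ ^ 2 = 1) : Complex.normSq (rho a σ u) = Sig a u := by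
  rw [Complex.normSq_apply, rho, Sig]
  linear_combination (a ^ 2 * Real.cos (u 2) ^ 2) * hσ

theorem rho_ne_zero (h : IsExterior m a q u) : rho a σ u ≠ 0 := fun h0 =>
  h.r_pos.ne' (congrArg Complex.re h0)

/-- Real and imaginary part of `1 / ρ²`: up to the sign `σ` these are the functions in the Maxwell
field and in its Hodge dual. -/
theorem one_div_rho_sq (h : IsExterior m a q u) (hσ : σ ^ 2 = 1) : 1 / rho a σ u ^ 2
    = (((u 1 ^ 2 - a ^ 2 * Real.cos (u 2) ^ 2) / Sig a u ^ 2 : ℝ) : ℂ)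
      - Complex.I * ((σ * (2 * u 1 * a * Real.cos (u 2) / Sig a u ^ 2) : ℝ) : ℂ) := by
  have h0 := rho_ne_zero (σ := σ) h
  have hS : ((Sig a u : ℝ) : ℂ) = cc (rho a σ u) * rho a σ u := by
    rw [← normSq_rho hσ, Complex.normSq_eq_conj_mul_self]
  have hc : cc (rho a σ u) ≠ 0 := (map_ne_zero _).2 h0
  have h2 : cc (rho a σ u) ^ 2 = ((u 1 ^ 2 - a ^ 2 * Real.cos (u 2) ^ 2 : ℝ) : ℂ)
      - Complex.I * ((σ * (2 * u 1 * a * Real.cos (u 2)) : ℝ) : ℂ) := by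
    apply Complex.ext
    · simp [rho, pow_two, -Complex.ofReal_cos]
      linear_combination (a ^ 2 * Real.cos (u 2) ^ 2) * hσ
    · simp [rho, pow_two, -Complex.ofReal_cos]
      ring
  have : 1 / rho a σ u ^ 2 = cc (rho a σ u) ^ 2 / ((Sig a u : ℝ) : ℂ) ^ 2 := by
    rw [hS]
    field_simp
  rw [this, h2]
  push_cast
  ring

variable {D : CoordFields}

/-- The anti-self-dual Maxwell form of the Kerr-Newman solution. -/
theorem IsFieldAt.cH_eq (h : IsFieldAt D m a q σ u) :
    D.cH u 0 1 = -(q / 2) * (1 / rho a σ u ^ 2) ∧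
    D.cH u 0 2 = Complex.I * (σ * a * Real.sin (u 2) * (q / 2)) * (1 / rho a σ u ^ 2) ∧
    D.cH u 0 3 = 0 ∧
    D.cH u 3 1 = a * Real.sin (u 2) ^ 2 * (q / 2) * (1 / rho a σ u ^ 2) ∧
    D.cH u 3 2 = -Complex.I * (σ * Real.sin (u 2) * (u 1 ^ 2 + a ^ 2) * (q / 2))
        * (1 / rho a σ u ^ 2) ∧
    D.cH u 1 2 = 0 := by
  obtain ⟨h1, h2, h3, h4, h5, h6⟩ := h.hodgeR_eq
  have hσ : (σ : ℂ) ^ 2 = 1 := by exact_mod_cast h.sign_sq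
  have hI := Complex.I_sq
  rw [one_div_rho_sq h.exterior h.sign_sq]
  simp only [CoordFields.cH, CoordFields.asd_eq, h1, h2, h3, h4, h5, h6, h.H_eq]
  refine ⟨?_, ?_, ?_, ?_, ?_, ?_⟩ <;> simp [maxwell, -Complex.ofReal_cos, -Complex.ofReal_sin]
  · ring
  · linear_combination (Complex.I ^ 2 * (a * Real.sin (u 2) * q * u 1 * a * Real.cos (u 2)
      / Sig a u ^ 2 : ℂ)) * hσ + (a * Real.sin (u 2) * q * u 1 * a * Real.cos (u 2)
      / Sig a u ^ 2 : ℂ) * hI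
  · ring
  · linear_combination (-Complex.I ^ 2 * (Real.sin (u 2) * q * u 1 * a * Real.cos (u 2)
      * (u 1 ^ 2 + a ^ 2) / Sig a u ^ 2 : ℂ)) * hσ - (Real.sin (u 2) * q * u 1 * a *
      Real.cos (u 2) * (u 1 ^ 2 + a ^ 2) / Sig a u ^ 2 : ℂ) * hI

theorem IsFieldAt.gu_eq (h : IsFieldAt D m a q σ u) (i j : Fin 4) :
    D.gu u i j = invMetric m a q u i j := congrFun (congrFun h.guM_eq i) j

/-- `𝓗² = -q² / ρ⁴`. -/
theorem IsFieldAt.cHsq_eq (h : IsFieldAt D m a q σ u) (hA : ∀ i j, D.cH u i j = - D.cH u j i) :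
    D.cHsq u = -(q : ℂ) ^ 2 / rho a σ u ^ 4 := by
  obtain ⟨h1, h2, h3, h4, h5, h6⟩ := h.cH_eq
  have hd : ∀ i, D.cH u i i = 0 := fun i => self_eq_neg.1 (hA i i)
  have e : D.cHsq u = 2 * (D.gu u 1 1 * (D.gu u 0 0 * D.cH u 0 1 ^ 2
      + 2 * D.gu u 0 3 * D.cH u 0 1 * D.cH u 3 1 + D.gu u 3 3 * D.cH u 3 1 ^ 2)
      + D.gu u 2 2 * (D.gu u 0 0 * D.cH u 0 2 ^ 2
      + 2 * D.gu u 0 3 * D.cH u 0 2 * D.cH u 3 2 + D.gu u 3 3 * D.cH u 3 2 ^ 2)) := by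
    simp only [CoordFields.cHsq, CoordFields.dot, Fin.sum_univ_four, hd, hA 1 0, hA 2 0, hA 3 0,
      hA 2 1, hA 1 3, hA 2 3, h3, h6]
    simp [h.gu_eq, invMetric]
    ring
  have hS : (Sig a u : ℂ) ≠ 0 := by exact_mod_cast h.exterior.Sig_pos.ne'
  have hD : (Del m a q u : ℂ) ≠ 0 := by exact_mod_cast h.exterior.Del_pos.ne'
  have hs : (Real.sin (u 2) : ℂ) ≠ 0 := by exact_mod_cast h.exterior.sin_pos.ne'
  have hSe : (Sig a u : ℂ) = (u 1 : ℂ) ^ 2 + a ^ 2 - a ^ 2 * (Real.sin (u 2) : ℂ) ^ 2 := by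
    exact_mod_cast Sig_eq a u
  have hσ : (σ : ℂ) ^ 2 = 1 := by exact_mod_cast h.sign_sq
  have h0 := rho_ne_zero (σ := σ) h.exterior
  rw [e, h1, h2, h4, h5]
  have g00 := h.gu_eq 0 0
  have g03 := h.gu_eq 0 3
  have g33 := h.gu_eq 3 3
  have g11 := h.gu_eq 1 1
  have g22 := h.gu_eq 2 2
  simp [invMetric] at g00 g03 g33 g11 g22
  rw [g00, g03, g33, g11, g22]
  push_cast
  simp only [← Complex.ofReal_sin] at *
  generalize (Sig a u : ℂ) = S at *
  generalize (Del m a q u : ℂ) = Δ at *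
  generalize rho a σ u = ρ at *
  generalize ((Real.sin (u 2) : ℝ) : ℂ) = s at *
  generalize (u 1 : ℂ) = r at *
  field_simp
  simp only [Complex.I_sq, hσ]
  rw [hSe]
  ring

end KerrNewman

/-! ### The Kerr-Newman potential -/

namespace KerrNewman

section

variable {m a q σ : ℝ} {u : E4}

theorem rho_eq (a σ : ℝ) (v : E4) :
    rho a σ v = (v 1 : ℂ) + ((σ * a * Real.cos (v 2) : ℝ) : ℂ) * Complex.I := Complex.mk_eq_add_mul_I _ _

theorem pd_z (a σ : ℝ) (u : E4) (i : Fin 4) :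
    DifferentiableAt ℝ (fun v : E4 => σ * a * Real.cos (v 2)) u ∧
    pd i (fun v : E4 => σ * a * Real.cos (v 2)) u
      = if 2 = i then -(σ * a * Real.sin (u 2)) else 0 :=
  pd_comp_coord (f := fun x => σ * a * Real.cos x) 2
    (((Real.hasDerivAt_cos (u 2)).const_mul (σ * a)).congr_deriv (by ring)) i

theorem pd_rho (a σ : ℝ) (u : E4) (i : Fin 4) : DifferentiableAt ℝ (rho a σ) u ∧
    pd i (rho a σ) u = (if 1 = i then 1 else 0)
      + (if 2 = i then -(Complex.I * (σ * a * Real.sin (u 2))) else 0) := by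
  obtain ⟨d2, e2⟩ := pd_z a σ u i
  have d1 : DifferentiableAt ℝ (fun v : E4 => v 1) u := (hasFDerivAt_coord u 1).differentiableAt
  have dr : ∀ {f : E4 → ℝ}, DifferentiableAt ℝ f u → DifferentiableAt ℝ (fun v => (f v : ℂ)) u :=
    fun hf => Complex.ofRealCLM.differentiableAt.comp u hf
  have k2 := (dr d2).fun_mul (differentiableAt_const Complex.I)
  rw [funext (rho_eq a σ)]
  refine ⟨(dr d1).fun_add k2, ?_⟩
  rw [pd_add (dr d1) k2, pd_mul (dr d2) (differentiableAt_const _), pd_const, pd_ofReal d1,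
    pd_ofReal d2, pd_coord, e2]
  split_ifs <;> simp [-Complex.ofReal_sin, mul_comm]

/-- The gradient of the potential `q / (2 (r + i σ a cos θ))`. -/
theorem pd_potential (h : IsExterior m a q u) (i : Fin 4) :
    DifferentiableAt ℝ (fun v => (q : ℂ) / 2 * (1 / rho a σ v)) u ∧
    pd i (fun v => (q : ℂ) / 2 * (1 / rho a σ v)) u
      = -(q / 2) * (1 / rho a σ u ^ 2) * pd i (rho a σ) u := by
  have h0 := rho_ne_zero (σ := σ) h
  obtain ⟨d, -⟩ := pd_rho a σ u i
  have di : DifferentiableAt ℝ (fun v => 1 / rho a σ v) u := by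
    simpa only [one_div] using d.fun_inv h0
  refine ⟨di.const_mul _, ?_⟩
  rw [pd_const_mul _ di]
  have e5 : (fun v => rho a σ v * (1 / rho a σ v)) =ᶠ[𝓝 u] fun _ => 1 := by
    filter_upwards [d.continuousAt.eventually_ne h0] with v hv
    rw [mul_one_div_cancel hv]
  have e6 := pd_congr e5 i
  rw [pd_const, pd_mul d di] at e6
  have : pd i (fun v => 1 / rho a σ v) u = -(1 / rho a σ u ^ 2) * pd i (rho a σ) u := by
    refine mul_left_cancel₀ h0 ?_
    field_simp at e6 ⊢
    linear_combination e6
  rw [this]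
  ring

end

variable {M : Type*} [TopologicalSpace M] [ChartedSpace E4 M] {F : FieldData M} {k : Consts}
  {Xi V Ph : M → ℂ} {φ : OpenPartialHomeomorph M E4} {m rot q : ℝ}

/-- Outside the outer horizon `r > M + √(M² - a² - q²)` the function `Δ` is positive. -/
theorem IsChart.isExterior (K : IsChart F φ m rot q) {u : E4} (hu : u ∈ φ.target) :
    IsExterior m rot q u := by
  obtain ⟨h1, h2, h3⟩ := K.exterior u hu
  obtain ⟨h4, h5⟩ := K.subextremal
  have h6 := Real.sqrt_nonneg (m ^ 2 - rot ^ 2 - q ^ 2)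
  have h7 := Real.sq_sqrt (show 0 ≤ m ^ 2 - rot ^ 2 - q ^ 2 by linarith)
  refine ⟨by linarith, Real.sin_pos_of_pos_of_lt_pi h2 h3, ?_⟩
  have h8 : √(m ^ 2 - rot ^ 2 - q ^ 2) ^ 2 < (u 1 - m) ^ 2 :=
    pow_lt_pow_left₀ (by linarith) h6 two_ne_zero
  rw [Del]
  nlinarith

/-- The orientation has a constant sign with respect to a connected Boyer-Lindquist chart. -/
theorem IsChart.exists_isFieldAt (K : IsChart F φ m rot q) (hF : F.IsStationaryElectrovac)
    [IsManifold (𝓡 4) ∞ M] (hφ : φ ∈ IsManifold.maximalAtlas (𝓡 4) ∞ M) :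
    ∃ σ : ℝ, ∀ u ∈ φ.target, IsFieldAt (F.coords φ) m rot q σ u := by
  have hl : levi 0 1 2 3 = 1 := levi_values.1
  have hsq : Set.EqOn ((fun u => (F.coords φ).vol u 0 1 2 3) ^ 2)
      ((fun u => Sig rot u * Real.sin (u 2)) ^ 2) φ.target := by
    intro u hu
    obtain ⟨f, h1, h2⟩ := (F.isLorentzAt hF hφ hu).vol
    have h3 := h1 0 1 2 3
    rw [hl, mul_one] at h3
    rw [show (F.coords φ).g u = metric m rot q u from
      funext fun i => funext fun j => K.metric_eq u hu i j, (K.isExterior hu).det_metric] at h2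
    change (F.coords φ).vol u 0 1 2 3 ^ 2 = (Sig rot u * Real.sin (u 2)) ^ 2
    rw [h3, h2, neg_neg]
  have hc : ContinuousOn (fun u => Sig rot u * Real.sin (u 2)) φ.target := fun u _ =>
    ((pd_Sig rot u 0).1.continuousAt.mul (Real.continuous_sin.continuousAt.comp
      (hasFDerivAt_coord u 2).continuousAt)).continuousWithinAt
  have key : ∀ σ : ℝ, σ ^ 2 = 1 → (∀ u ∈ φ.target, (F.coords φ).vol u 0 1 2 3
      = σ * (Sig rot u * Real.sin (u 2))) →
      ∀ u ∈ φ.target, IsFieldAt (F.coords φ) m rot q σ u := fun σ hσ hv u hu =>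
    { exterior := K.isExterior hu
      g_eq := K.metric_eq u hu
      H_eq := fun i j => (K.H_eq u hu i j).trans ((K.isExterior hu).maxwell_eq i j)
      vol_eq := fun i j k l => by rw [F.vol_eq, hv u hu]
      sign_sq := hσ }
  -- The component `ε_0123` is a square root of `(Σ sin θ)²` without zeros, on a connected set.
  rcases K.connected.eq_or_eq_neg_of_sq_eq (hF.vol_smooth φ hφ 0 1 2 3).continuousOn hc hsq
    (fun {u} hu => mul_ne_zero (K.isExterior hu).Sig_pos.ne' (K.isExterior hu).sin_pos.ne')
    with h | h
  · exact ⟨1, key 1 (by norm_num) fun u hu => by rw [one_mul]; exact h hu⟩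
  · exact ⟨-1, key (-1) (by norm_num) fun u hu => by rw [neg_one_mul]; exact h hu⟩

/-- The Maxwell potential of the Kerr-Newman solution, normalized at infinity. -/
theorem IsChart.Xi_eq (K : IsChart F φ m rot q)
    (hsol : (F.wong k Xi V Ph φ).IsSolutionOn φ.target) {σ : ℝ}
    (hf : ∀ u ∈ φ.target, IsFieldAt (F.coords φ) m rot q σ u)
    {infty : Filter M} [infty.NeBot] (hXi_infty : Filter.Tendsto Xi infty (𝓝 0))
    (hsource : ∀ᶠ p in infty, p ∈ φ.source)
    (hr : Filter.Tendsto (fun p => φ p 1) infty Filter.atTop) {u : E4} (hu : u ∈ φ.target) :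
    Xi (φ.symm u) = (q : ℂ) / 2 * (1 / rho rot σ u) := by
  set D := F.wong k Xi V Ph φ with hD
  have hpd : ∀ u ∈ φ.target, ∀ b, pd b D.Xi u
      = pd b (fun v => (q : ℂ) / 2 * (1 / rho rot σ v)) u := by
    intro u hu b
    obtain ⟨h1, h2, h3, -⟩ := (hf u hu).cH_eq
    have h0 : D.cH u 0 0 = 0 := self_eq_neg.1 (hsol.cH_antisymm hu 0 0)
    have hT : ∀ a, D.T u a = if a = 0 then 1 else 0 := K.T_eq u hu
    rw [hsol.pd_Xi u hu, (pd_potential (K.isExterior hu) b).2, (pd_rho rot σ u b).2]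
    simp only [hT, Fin.sum_univ_four]
    change D.cH u 0 1 = _ at h1
    change D.cH u 0 2 = _ at h2
    change D.cH u 0 3 = _ at h3
    fin_cases b <;> simp [h0, h1, h2, h3, -Complex.ofReal_sin]
    ring
  have dX : ∀ u ∈ φ.target, DifferentiableAt ℝ
      (fun v => D.Xi v - (q : ℂ) / 2 * (1 / rho rot σ v)) u := fun u hu =>
    (SmoothAt.differentiableAt (hsol.smooth_Xi u hu)).fun_sub
      (pd_potential (K.isExterior hu) 0).1
  obtain ⟨d, hd⟩ := φ.open_target.exists_is_const_of_fderiv_eq_zero K.connected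
    (fun u hu => (dX u hu).differentiableWithinAt) (fun u hu => fderiv_eq_zero_of_pd fun i => by
      rw [pd_sub (SmoothAt.differentiableAt (hsol.smooth_Xi u hu))
        (pd_potential (K.isExterior hu) 0).1, hpd u hu, sub_self])
  -- `Ξ - q / (2 ρ)` is a constant `d`; both terms tend to zero at infinity.
  have hρ : Filter.Tendsto (fun p => (q : ℂ) / 2 * (1 / rho rot σ (φ p))) infty (𝓝 0) := by
    have h1 : Filter.Tendsto (fun p => ‖rho rot σ (φ p)‖) infty Filter.atTop :=
      Filter.tendsto_atTop_mono (fun p => (le_abs_self _).trans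
        (Complex.abs_re_le_norm (rho rot σ (φ p)))) hr
    have h2 : Filter.Tendsto (fun p => 1 / rho rot σ (φ p)) infty (𝓝 0) := by
      rw [tendsto_zero_iff_norm_tendsto_zero]
      simp only [one_div, norm_inv]
      exact h1.inv_tendsto_atTop
    simpa using h2.const_mul ((q : ℂ) / 2)
  have hlim : Filter.Tendsto (fun _ : M => d) infty (𝓝 0) := by
    have := hXi_infty.sub hρ
    rw [sub_zero] at this
    refine this.congr' ?_
    filter_upwards [hsource] with p hp
    have := hd (φ p) (φ.map_source hp)
    change Xi (φ.symm (φ p)) - _ = d at this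
    rwa [φ.left_inv hp] at this
  have hd0 := tendsto_nhds_unique hlim tendsto_const_nhds
  have := hd u hu
  rw [← hd0, sub_eq_zero] at this
  exact this

end KerrNewman

/-! ### Vanishing of the error term on the Kerr-Newman exterior -/

namespace KerrNewman

variable {M : Type*} [TopologicalSpace M] [ChartedSpace E4 M] {F : FieldData M} {k : Consts}
  {Xi V Ph : M → ℂ} {φ : OpenPartialHomeomorph M E4} {m rot : ℝ}

theorem C1_eq (hB : k.qB = 0) : k.C1 = k.qE := by
  simp [Consts.C1, hB]

/-- On the Kerr-Newman exterior `C₁ P = r + i σ a cos θ`, so that `z = σ a cos θ` and `U = a²`. -/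
theorem IsChart.U_eq (K : IsChart F φ m rot k.qE) (hB : k.qB = 0) (hk : k.C1 ≠ 0) {σ : ℝ}
    (hf : ∀ u ∈ φ.target, IsFieldAt (F.coords φ) m rot k.qE σ u)
    (hX : ∀ u ∈ φ.target, Xi (φ.symm u) = (k.qE : ℂ) / 2 * (1 / rho rot σ u)) {u : E4}
    (hu : u ∈ φ.target) : (F.wong k Xi V Ph φ).U u = rot ^ 2 := by
  set D := F.wong k Xi V Ph φ with hD
  have hq : (k.qE : ℂ) ≠ 0 := C1_eq hB ▸ hk
  have hP : ∀ v ∈ φ.target, D.k.C1 * D.P v = rho rot σ v := by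
    intro v hv
    have h0 := rho_ne_zero (σ := σ) (K.isExterior hv)
    change k.C1 * (1 / (2 * Xi (φ.symm v))) = _
    rw [hX v hv, C1_eq hB]
    field_simp
  have hz : ∀ v ∈ φ.target, D.z v = σ * rot * Real.cos (v 2) := fun v hv => by
    rw [WongCoord.z, hP v hv, rho]
  have hy : D.y u = u 1 := by
    rw [WongCoord.y, hP u hu, rho]
  have hpz : ∀ b, pd b D.z u = if 2 = b then -(σ * rot * Real.sin (u 2)) else 0 := fun b => by
    rw [pd_congr (g := fun v : E4 => σ * rot * Real.cos (v 2)) ?_ b]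
    · exact (pd_z rot σ u b).2
    · filter_upwards [φ.open_target.mem_nhds hu] with v hv using hz v hv
  have hg : D.gu u 2 2 = 1 / Sig rot u := by
    rw [show D.gu u 2 2 = _ from (hf u hu).gu_eq 2 2]
    simp [invMetric]
  have hσ := (hf u hu).sign_sq
  have hS := (K.isExterior hu).Sig_pos.ne'
  have hSe : Sig rot u = u 1 ^ 2 + rot ^ 2 * Real.cos (u 2) ^ 2 := rfl
  have e : u 1 ^ 2 + (σ * rot * Real.cos (u 2)) ^ 2 = Sig rot u := by
    rw [hSe]
    linear_combination (rot ^ 2 * Real.cos (u 2) ^ 2) * hσ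
  rw [WongCoord.U, hy, hz u hu, e]
  simp only [WongCoord.zUp, hpz, Fin.sum_univ_four]
  simp [hg]
  field_simp
  linear_combination (rot ^ 2 * (Real.sin (u 2) ^ 2 + Real.cos (u 2) ^ 2)) * hσ
    + rot ^ 2 * Real.sin_sq_add_cos_sq (u 2)

/-- A zero of `κ` would mean `q² = M ρ`, hence `q² = M r`, while `q² < M²` and `M < r`. -/
theorem IsChart.kap_ne_zero (K : IsChart F φ k.M rot k.qE) (hB : k.qB = 0) (hk : k.C1 ≠ 0) {σ : ℝ}
    {u : E4} (hu : u ∈ φ.target)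
    (hX : Xi (φ.symm u) = (k.qE : ℂ) / 2 * (1 / rho rot σ u)) :
    (F.wong k Xi V Ph φ).kap u ≠ 0 := by
  intro h0
  have hq : (k.qE : ℂ) ≠ 0 := C1_eq hB ▸ hk
  have hρ := rho_ne_zero (σ := σ) (K.isExterior hu)
  have h1 : 2 * cc (Xi (φ.symm u)) - cc k.C3 = 0 := h0
  have h2 : 2 * Xi (φ.symm u) - k.C3 = 0 := by
    have := congrArg cc h1
    simpa [cc, Complex.conj_ofNat] using this
  have h3 : k.C3 = (k.M : ℂ) / k.qE := by simp [Consts.C3, hB]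
  rw [hX, h3] at h2
  have h4 : (k.qE : ℂ) ^ 2 = k.M * rho rot σ u := by
    field_simp at h2
    linear_combination h2
  have h5 := congrArg Complex.re h4
  have h6 : k.qE ^ 2 = k.M * u 1 := by
    simpa [rho, pow_two] using h5
  -- this contradicts `q² < M²` and `M < r`
  obtain ⟨h7, h8⟩ := K.subextremal
  have h9 := (K.exterior u hu).1
  have h10 := Real.sqrt_nonneg (k.M ^ 2 - rot ^ 2 - k.qE ^ 2)
  nlinarith [sq_nonneg rot]

end KerrNewman

section

variable {M : Type*} [TopologicalSpace M] [ChartedSpace E4 M] {F : FieldData M} {k : Consts}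
  {Xi V Ph : M → ℂ} {φ : OpenPartialHomeomorph M E4}

/-- The gradient of `U` and the error term vanish on the Kerr-Newman exterior. -/
theorem KerrNewman.IsChart.vanish {rot : ℝ} (K : KerrNewman.IsChart F φ k.M rot k.qE)
    [IsManifold (𝓡 4) ∞ M] (hF : F.IsStationaryElectrovac)
    (hφ : φ ∈ IsManifold.maximalAtlas (𝓡 4) ∞ M)
    (hB : k.qB = 0) (hk : k.C1 ≠ 0) (hsol : (F.wong k Xi V Ph φ).IsSolutionOn φ.target)
    (hnorm : ∀ u ∈ φ.target, (F.wong k Xi V Ph φ).IsNormalizedAt u)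
    (hPh : ∀ u ∈ φ.target, (F.wong k Xi V Ph φ).cHsq u ≠ 0 →
        (F.wong k Xi V Ph φ).Ph u ^ 4 = -1 / (k.C1 ^ 2 * (F.wong k Xi V Ph φ).cHsq u))
    {infty : Filter M} [infty.NeBot] (hXi_infty : Filter.Tendsto Xi infty (𝓝 0))
    (hsource : ∀ᶠ p in infty, p ∈ φ.source)
    (hr : Filter.Tendsto (fun p => φ p 1) infty Filter.atTop) {u : E4} (hu : u ∈ φ.target)
    (b : Fin 4) :
    pd b (F.wong k Xi V Ph φ).U u = 0 ∧
    ∀ lb l, (F.wong k Xi V Ph φ).IsPrincipalNullPair u lb l →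
      (F.wong k Xi V Ph φ).errorTerm u lb l b = 0 := by
  obtain ⟨σ, hf⟩ := K.exists_isFieldAt hF hφ
  have hX := fun u hu => K.Xi_eq hsol hf hXi_infty hsource hr (u := u) hu
  have hU : pd b (F.wong k Xi V Ph φ).U u = 0 := by
    rw [pd_congr (g := fun _ => rot ^ 2) ?_ b, pd_const]
    filter_upwards [φ.open_target.mem_nhds hu] with v hv using K.U_eq hB hk hf hX hv
  refine ⟨hU, fun lb l hp => ?_⟩
  have hq : (k.qE : ℂ) ≠ 0 := KerrNewman.C1_eq hB ▸ hk
  have hρ := KerrNewman.rho_ne_zero (σ := σ) (K.isExterior hu)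
  have h0 : (F.wong k Xi V Ph φ).Xi u ≠ 0 := by
    change Xi (φ.symm u) ≠ 0
    rw [hX u hu]
    exact mul_ne_zero (div_ne_zero hq two_ne_zero) (one_div_ne_zero hρ)
  have hH : (F.wong k Xi V Ph φ).cHsq u ≠ 0 := by
    rw [show (F.wong k Xi V Ph φ).cHsq u = _ from (hf u hu).cHsq_eq (hsol.cH_antisymm hu)]
    exact div_ne_zero (neg_ne_zero.2 (pow_ne_zero _ hq)) (pow_ne_zero _ hρ)
  rw [← hsol.pd_U_eq_errorTerm hu h0 (K.kap_ne_zero hB hk hu (hX u hu))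
    (hsol.Ph_ne_zero hH (hPh u hu hH)) (hnorm u hu) hp, hU]

end

end

theorem mainTheorem5 {M : Type*} [TopologicalSpace M] [ChartedSpace E4 M]
    [IsManifold (𝓡 4) ∞ M] [ConnectedSpace M]
    (F : FieldData M) (hF : F.IsStationaryElectrovac)
    (k : Consts) (hk : k.C1 ≠ 0)
    (Xi V Ph : M → ℂ)
    (hXi_smooth : ContMDiff (𝓡 4) 𝓘(ℝ, ℂ) ∞ Xi)
    (hV_smooth : ContMDiff (𝓡 4) 𝓘(ℝ, ℂ) ∞ V)
    (hXi : ∀ φ ∈ IsManifold.maximalAtlas (𝓡 4) ∞ M, ∀ u ∈ φ.target, ∀ b,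
      pd b (F.wong k Xi V Ph φ).Xi u
        = ∑ a, (F.wong k Xi V Ph φ).cH u a b * ((F.wong k Xi V Ph φ).T u a : ℂ))
    (hV : ∀ φ ∈ IsManifold.maximalAtlas (𝓡 4) ∞ M, ∀ u ∈ φ.target, ∀ b,
      pd b (F.wong k Xi V Ph φ).V u
        = ∑ a, k.C1⁻¹ * (F.wong k Xi V Ph φ).B u a b * ((F.wong k Xi V Ph φ).T u a : ℂ))
    (hPh : ∀ φ ∈ IsManifold.maximalAtlas (𝓡 4) ∞ M, ∀ u ∈ φ.target,
      (F.wong k Xi V Ph φ).cHsq u ≠ 0 →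
        (F.wong k Xi V Ph φ).Ph u ^ 4 = -1 / (k.C1 ^ 2 * (F.wong k Xi V Ph φ).cHsq u))
    (infty : Filter M) [infty.NeBot]
    (hT_infty : Filter.Tendsto (fun p => F.metric p (F.T p) (F.T p)) infty (𝓝 (-1)))
    (hXi_infty : Filter.Tendsto Xi infty (𝓝 0))
    (hV_infty : Filter.Tendsto V infty (𝓝 0)) :
    -- the exact expression of the gradient of `U`, and its algebraic vanishing
    (∀ φ ∈ IsManifold.maximalAtlas (𝓡 4) ∞ M, ∀ u ∈ φ.target,
      (F.wong k Xi V Ph φ).Xi u ≠ 0 →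
      (F.wong k Xi V Ph φ).cHsq u ≠ 0 →
      (F.wong k Xi V Ph φ).kap u ≠ 0 →
        (∃ lb l, (F.wong k Xi V Ph φ).IsPrincipalNullPair u lb l) ∧
        ∀ lb l, (F.wong k Xi V Ph φ).IsPrincipalNullPair u lb l →
          DifferentiableAt ℝ (F.wong k Xi V Ph φ).U u ∧
          (∀ b, pd b (F.wong k Xi V Ph φ).U u
            = (F.wong k Xi V Ph φ).errorTerm u lb l b) ∧
          ((∀ a b, (F.wong k Xi V Ph φ).B u a b = 0) →
            (∀ c a b, (F.wong k Xi V Ph φ).nablaB u c a b = 0) →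
            (∀ a b c d, (F.wong k Xi V Ph φ).Q u a b c d = 0) →
            (F.wong k Xi V Ph φ).P u = (F.wong k Xi V Ph φ).Ph u →
            ((F.wong k Xi V Ph φ).V u).re = 0 →
            ∀ b, (F.wong k Xi V Ph φ).errorTerm u lb l b = 0)) ∧
    -- identical vanishing of all the error quantities if Wong's tensors vanish identically
    (ContMDiff (𝓡 4) 𝓘(ℝ, ℂ) ∞ Ph →
      Filter.Tendsto (fun p => 1 / Ph p - 2 * Xi p) infty (𝓝 0) →
      (∀ φ ∈ IsManifold.maximalAtlas (𝓡 4) ∞ M, ∀ u ∈ φ.target,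
        (F.wong k Xi V Ph φ).cHsq u ≠ 0 ∧ (F.wong k Xi V Ph φ).kap u ≠ 0 ∧
        (∀ a b, (F.wong k Xi V Ph φ).B u a b = 0) ∧
        (∀ a b c d, (F.wong k Xi V Ph φ).Q u a b c d = 0)) →
      (∀ p, V p = 0 ∧ Xi p ≠ 0 ∧ Ph p = 1 / (2 * Xi p)) ∧
      (∀ φ ∈ IsManifold.maximalAtlas (𝓡 4) ∞ M, ∀ u ∈ φ.target, ∀ b,
        pd b (F.wong k Xi V Ph φ).U u = 0 ∧
        ∀ lb l, (F.wong k Xi V Ph φ).IsPrincipalNullPair u lb l →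
          (F.wong k Xi V Ph φ).errorTerm u lb l b = 0)) ∧
    -- identical vanishing on the Kerr-Newman exterior
    (∀ φ ∈ IsManifold.maximalAtlas (𝓡 4) ∞ M, ∀ rot : ℝ,
      k.qB = 0 → KerrNewman.IsChart F φ k.M rot k.qE →
      (∀ᶠ p in infty, p ∈ φ.source) →
      Filter.Tendsto (fun p => φ p 1) infty Filter.atTop →
      ∀ u ∈ φ.target, ∀ b,
        pd b (F.wong k Xi V Ph φ).U u = 0 ∧
        ∀ lb l, (F.wong k Xi V Ph φ).IsPrincipalNullPair u lb l →
          (F.wong k Xi V Ph φ).errorTerm u lb l b = 0) := by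
  have hsol : ∀ φ ∈ IsManifold.maximalAtlas (𝓡 4) ∞ M,
      (F.wong k Xi V Ph φ).IsSolutionOn φ.target := fun φ hφ =>
    FieldData.isSolutionOn hF hk hXi_smooth hV_smooth hXi hV hφ
  have hnorm : ∀ φ ∈ IsManifold.maximalAtlas (𝓡 4) ∞ M, ∀ u ∈ φ.target,
      (F.wong k Xi V Ph φ).IsNormalizedAt u := fun φ hφ u hu =>
    FieldData.isNormalizedAt hsol hT_infty hXi_infty hV_infty hφ hu
  refine ⟨fun φ hφ u hu h0 hH hκ => ?_, fun hPh_smooth hPh_infty hvan => ?_,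
    fun φ hφ rot hB K hsource hr u hu b => K.vanish hF hφ hB hk (hsol φ hφ) (hnorm φ hφ)
      (hPh φ hφ) hXi_infty hsource hr hu b⟩
  · have hP := hPh φ hφ u hu hH
    have hP0 := (hsol φ hφ).Ph_ne_zero hH hP
    exact ⟨(hsol φ hφ).exists_principal_pair hu hH hP, fun lb l hp =>
      ⟨((hsol φ hφ).pd_U hu h0 0).1,
        (hsol φ hφ).pd_U_eq_errorTerm hu h0 hκ hP0 (hnorm φ hφ u hu) hp,
        fun hB hnB hQ hPP hV0 b =>
          WongCoord.errorTerm_eq_zero hP0 hB hnB hQ hPP hV0 lb l b⟩⟩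
  · have hpot := FieldData.potentials_of_vanish hsol hPh hV_infty hPh_smooth hPh_infty hvan
    refine ⟨hpot, fun φ hφ u hu b => ?_⟩
    obtain ⟨hH, hκ, hB, hQ⟩ := hvan φ hφ u hu
    obtain ⟨hV0, h0, hPP⟩ := hpot (φ.symm u)
    have hP := hPh φ hφ u hu hH
    have hP0 := (hsol φ hφ).Ph_ne_zero hH hP
    have hE : ∀ lb l, (F.wong k Xi V Ph φ).errorTerm u lb l b = 0 := fun lb l =>
      WongCoord.errorTerm_eq_zero hP0 hB
        ((hsol φ hφ).nablaB_of_vanish hu fun v hv => (hvan φ hφ v hv).2.2.1) hQ hPP.symm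
        (congrArg Complex.re hV0) lb l b
    obtain ⟨lb, l, hp⟩ := (hsol φ hφ).exists_principal_pair hu hH hP
    exact ⟨((hsol φ hφ).pd_U_eq_errorTerm hu h0 hκ hP0 (hnorm φ hφ u hu) hp b).trans (hE lb l),
      fun lb l _ => hE lb l⟩
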